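/- **Setting.** Let $m\ge 1$, $r\ge 2$, $\tau>0$. $\mathcal T^{rm,q}_\tau$ is the class of operators $T:\mathcal C([-\tau,\infty)\to\mathbb R^{rm})\to \mathcal L^\infty_{\rm loc}(\mathbb R_{\ge0}\to\mathbb R^q)$ that (a) map bounded functions to bounded functions, with a bound depending only on the bound of the argument; (b) are causal: $\zeta=\xi$ on $[-\tau,t)$ implies $T(\zeta)=T(\xi)$ a.e. on $[0,t)$; (c) are locally Lipschitz: for all $t\ge0$, $\xi\in\mathcal C([-\tau,t]\to\mathbb R^{rm})$ there are $\Delta,\delta,c>0$ such that for all continuous extensions $\zeta_1,\zeta_2$ of $\xi$ that stay $\delta$-close to $\xi(t)$ on $[t,t+\Delta]$ one has $\operatorname{ess\,sup}_{[t,t+\Delta]}\|T(\zeta_1)-T(\zeta_2)\|\le c\sup_{[t,t+\Delta]}\|\zeta_1-\zeta_2\|$. $(d,f,T,\Gamma)\in\mathcal N^{m,r}$ means: $d\in\mathcal L^\infty(\mathbb R_{\ge 0}\to\mathbb R^l)$, $f\in\mathcal C(\mathbb R^l\times\mathbb R^q\to\mathbb R^m)$, $T\in\mathcal T^{rm,q}_\tau$,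 and $\Gamma\in\mathbb R^{m\times m}$ is symmetric and sign definite; $(d,f,T,\Gamma)\in\mathcal N^{m,r}_1$ means that in addition for every $c_1>0$ there is $c_2>0$ such that $\sup_{[-\tau,\infty)}\|\xi_1\|\le c_1$ implies $\|T(\xi_1,\dots,\xi_r)\|\le c_2$ a.e. on $[0,\infty)$. With matrices $R_1,\dots,R_r\in\mathbb R^{m\times m}$ the system is $$y^{(r)}=\sum_{i=1}^r R_iy^{(i-1)}+f\big(d,T(y,\dot y,\dots,y^{(r-1)})\big)+\Gamma u,\qquad y|_{[-\tau,0]}=y^0\in\mathcal W^{r-1,\infty}([-\tau,0]\to\mathbb R^m);\tag{1}$$ a solution on $[-\tau,\omega)$, $\omega\in(0,\infty]$, is a $\mathcal C^{r-1}$ function $y$ on $[-\tau,\omega)$ with this initial trajectory for which $y^{(r-1)}$ is weakly differentiable on $[0,\omega)$ and (1) holds a.e. on $[0,\omega)$. **Cascade.** With $z_{0,1}:=y$, $\varphi_i:=\varphi$ for $i\ge2$, and $z_{i,r+1}:=\tilde\Gamma u$, the cascade of $r-1$ funnel pre-compensators is, for $i=1,\dots,r-1$, $j=1,\dots,r$,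 $$\dot z_{i,j}=(a_j+p_jh_i)(z_{i-1,1}-z_{i,1})+z_{i,j+1},\quad z_{i,j}(0)=z_{i,j}^0,\quad h_i=\frac1{1-\varphi_i^2\|z_{i-1,1}-z_{i,1}\|^2}.\tag{2}$$ Its parameters satisfy $(a,p,\varphi,\varphi_1,\rho,\tilde\Gamma)\in\Sigma$: $\varphi,\varphi_1\in\mathcal C^r(\mathbb R_{\ge0}\to\mathbb R)$ are bounded together with their derivatives up to order $r$, positive on $(0,\infty)$, and have positive limes inferior at $\infty$; and (A.1) $a_1,\dots,a_r>0$, the matrix $A\in\mathbb R^{r\times r}$ with first column $-(a_1,\dots,a_r)^\top$, ones on the superdiagonal and zeros elsewhere is Hurwitz, and $p=P^{-1}(P_1-P_2P_4^{-1}P_2^\top,0,\dots,0)^\top$ for a matrix $P=\begin{bmatrix}P_1&P_2\\P_2^\top&P_4\end{bmatrix}=P^\top>0$, $P_1\in\mathbb R$, with $A^\top P+PA+Q=0$ for some $Q=Q^\top>0$; (A.2) $\rho>1$ and $\varphi=\rho\varphi_1$; (A.3) $\tilde\Gamma$ is symmetric and sign definite, and $\Gamma\tilde\Gamma^{-1}$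 is symmetric and positive definite; (A.4) $G:=I_m-\Gamma\tilde\Gamma^{-1}$ satisfies $\|G\|<\min\big\{\frac{\rho-1}{r-2},\frac{\rho}{4\rho^2(\rho+1)^{r-2}-1}\big\}$ in the spectral norm (the first bound is void for $r=2$). **Theorem.** Let $(d,f,T,\Gamma)\in\mathcal N^{m,r}_1$, where $f$ is moreover locally Lipschitz in its second argument (locally uniformly in the first one), let $y^0\in\mathcal W^{r-1,\infty}([-\tau,0]\to\mathbb R^m)$, $(a,p,\varphi,\varphi_1,\rho,\tilde\Gamma)\in\Sigma$, and let $$\varphi_1(0)\|y^0(0)-z^0_{1,1}\|<1,\qquad \varphi(0)\|z^0_{i-1,1}-z^0_{i,1}\|<1,\quad i=2,\dots,r-1.$$ Then, with $\bar q=rm(r-1)+r$, there are $\tilde d\in\mathcal L^\infty(\mathbb R_{\ge0}\to\mathbb R^r)$, $\tilde F\in\mathcal C(\mathbb R^r\times\mathbb R^{\bar q}\to\mathbb R^m)$ and $\tilde T:\mathcal C([-\tau,\infty)\to\mathbb R^{rm})\to\mathcal L^\infty_{\rm loc}(\mathbb R_{\ge0}\to\mathbb R^{\bar q})$ with $(\tilde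 d,\tilde F,\tilde T,\tilde\Gamma)\in\mathcal N^{m,r}$, and an initial trajectory $\zeta^0\in\mathcal W^{r-1,\infty}([-\tau,0]\to\mathbb R^m)$, such that the interconnection of (1) and (2) with input $u$ and output $z=z_{r-1,1}$ is equivalent to $$z^{(r)}=\tilde F\big(\tilde d,\tilde T(z,\dot z,\dots,z^{(r-1)})\big)+\tilde\Gamma u,\qquad z|_{[-\tau,0]}=\zeta^0 .\tag{3}$$ That is, for all $u\in\mathcal L^\infty_{\rm loc}(\mathbb R_{\ge0}\to\mathbb R^m)$, $\omega\in(0,\infty]$ and $z:[0,\omega)\to\mathbb R^m$: $z$ is the output $z_{r-1,1}$ of a solution $(y,(z_{i,j}))$ of (1), (2) up to time $\omega$ if and only if $z$, extended by $\zeta^0$ to $[-\tau,0)$, is a solution of (3) on $[-\tau,\omega)$. So the interconnection is again minimum phase with relative degree $r$, for every $r\ge2$. -/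

import Mathlib

open MeasureTheory Set

noncomputable section

/-- `ℝⁿ` with the Euclidean norm. -/
abbrev Vec (n : ℕ) : Type := EuclideanSpace ℝ (Fin n)

/-- The linear map `x ↦ M x` on `ℝⁿ`; its operator norm is the spectral norm of `M`. -/
abbrev mulV {n : ℕ} (M : Matrix (Fin n) (Fin n) ℝ) : Vec n →L[ℝ] Vec n :=
  Matrix.toEuclideanCLM (𝕜 := ℝ) M

/-- The operators defined on `C([-σ,∞) → ℝ^{rm})`, where a point of `ℝ^{rm}` is written as the
tuple `(ξ₁,…,ξ_r)` of vectors of `ℝᵐ`. A value is a function considered on `[0,∞)` only and up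
to equality almost everywhere. -/
abbrev Op (σ : ℝ) (r m q : ℕ) : Type := C(Ici (-σ), Fin r → Vec m) → ℝ → Vec q

/-- `L^∞([0,∞))`. -/
def MemLinf {F : Type*} [NormedAddCommGroup F] (g : ℝ → F) : Prop :=
  MemLp g ⊤ (volume.restrict (Ici 0))

/-- `L^∞_loc([0,∞))`: essentially bounded on every compact part of `[0,∞)`. -/
def MemLinfLoc {F : Type*} [NormedAddCommGroup F] (g : ℝ → F) : Prop :=
  ∀ b : ℝ, MemLp g ⊤ (volume.restrict (Icc 0 b))

/-- `W^{k,∞}([a,b])`: `g` (as its continuous representative if `k ≥ 1`) has weak derivatives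
`G 1, …, G k`, and `g, G 1, …, G k` are essentially bounded. -/
def MemWInf {F : Type*} [NormedAddCommGroup F] [NormedSpace ℝ F]
    (k : ℕ) (a b : ℝ) (g : ℝ → F) : Prop :=
  ∃ G : ℕ → ℝ → F, EqOn (G 0) g (Icc a b) ∧
    (∀ j < k, ∀ t ∈ Icc a b, G j t = G j a + ∫ s in a..t, G (j + 1) s) ∧
    ∀ j ≤ k, MemLp (G j) ⊤ (volume.restrict (Icc a b))

/-- The operator class `𝒯_σ^{rm,q}`. (The maximum norm of the tuples `(ξ₁,…,ξ_r)` is equivalent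
to the Euclidean one, and every constant below is existentially quantified.) -/
structure OpClass {r m q : ℕ} (σ : ℝ) (T : Op σ r m q) : Prop where
  pos : 0 < σ
  /-- `T` maps into `L^∞_loc`. -/
  loc : ∀ ξ, MemLinfLoc (T ξ)
  /-- (a) bounded trajectories are mapped to bounded trajectories -/
  bibo : ∀ c₁ > 0, ∃ c₂ > 0, ∀ ξ : C(Ici (-σ), Fin r → Vec m), (∀ t, ‖ξ t‖ ≤ c₁) →
    ∀ᵐ t ∂(volume.restrict (Ici (0 : ℝ))), ‖T ξ t‖ ≤ c₂
  /-- (b) causality -/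
  causal : ∀ t : ℝ, 0 ≤ t → ∀ ζ ξ : C(Ici (-σ), Fin r → Vec m),
    (∀ s : Ici (-σ), (s : ℝ) < t → ζ s = ξ s) →
    ∀ᵐ s ∂(volume.restrict (Ico 0 t)), T ζ s = T ξ s
  /-- (c) local Lipschitz continuity; `M` runs through the upper bounds of `‖ζ₁ - ζ₂‖` -/
  lip : ∀ t : ℝ, ∀ ht : -σ ≤ t, 0 ≤ t → ∀ ξ : C(Ici (-σ), Fin r → Vec m),
    ∃ Δ > 0, ∃ δ > 0, ∃ c > 0, ∀ ζ₁ ζ₂ : C(Ici (-σ), Fin r → Vec m),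
      (∀ s : Ici (-σ), (s : ℝ) ≤ t → ζ₁ s = ξ s ∧ ζ₂ s = ξ s) →
      (∀ s : Ici (-σ), (s : ℝ) ∈ Icc t (t + Δ) →
        ‖ζ₁ s - ξ ⟨t, ht⟩‖ < δ ∧ ‖ζ₂ s - ξ ⟨t, ht⟩‖ < δ) →
      ∀ M : ℝ, (∀ s : Ici (-σ), (s : ℝ) ∈ Icc t (t + Δ) → ‖ζ₁ s - ζ₂ s‖ ≤ M) →
        ∀ᵐ s ∂(volume.restrict (Icc t (t + Δ))), ‖T ζ₁ s - T ζ₂ s‖ ≤ c * M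

/-- Condition `(a'_k)`: `T(ξ₁,…,ξ_r)` is bounded whenever `(ξ₁,…,ξ_k)` is. -/
def BoundedByFirst {r m q : ℕ} (σ : ℝ) (k : ℕ) (T : Op σ r m q) : Prop :=
  ∀ c₁ > 0, ∃ c₂ > 0, ∀ ξ : C(Ici (-σ), Fin r → Vec m),
    (∀ t, ∀ i : Fin r, (i : ℕ) < k → ‖ξ t i‖ ≤ c₁) →
    ∀ᵐ t ∂(volume.restrict (Ici (0 : ℝ))), ‖T ξ t‖ ≤ c₂

/-- Symmetric and sign definite. -/
def SignDefinite {m : ℕ} (Γ : Matrix (Fin m) (Fin m) ℝ) : Prop := Γ.PosDef ∨ (-Γ).PosDef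

/-- `(d, f, T, Γ) ∈ 𝒩^{m,r}` (with memory `τ`). -/
structure MemN {m r l q : ℕ} (τ : ℝ) (d : ℝ → Vec l) (f : Vec l × Vec q → Vec m)
    (T : Op τ r m q) (Γ : Matrix (Fin m) (Fin m) ℝ) : Prop where
  d_bdd : MemLinf d
  f_cont : Continuous f
  op : OpClass τ T
  gain : SignDefinite Γ

/-- `(d, f, T, Γ) ∈ 𝒩^{m,r}_k`. -/
structure MemNk {m r l q : ℕ} (k : ℕ) (τ : ℝ) (d : ℝ → Vec l) (f : Vec l × Vec q → Vec m)
    (T : Op τ r m q) (Γ : Matrix (Fin m) (Fin m) ℝ) : Prop extends MemN τ d f T Γ where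
  first : BoundedByFirst τ k T

/-- `f(δ, η)` is locally Lipschitz in `η`, locally uniformly in `δ`. -/
def LocLipSnd {l q m : ℕ} (f : Vec l × Vec q → Vec m) : Prop :=
  ∀ M : ℝ, ∃ L : ℝ, ∀ δ η η', ‖δ‖ ≤ M → ‖η‖ ≤ M → ‖η'‖ ≤ M →
    ‖f (δ, η) - f (δ, η')‖ ≤ L * ‖η - η'‖

/-- The interval `[-τ, ω)`, `ω ∈ (0, ∞]`. -/
def dom (τ : ℝ) (ω : EReal) : Set ℝ := {t | -τ ≤ t ∧ (t : EReal) < ω}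

/-- `g` is weakly differentiable (locally absolutely continuous) on `[0, ω)`, with weak
derivative `g'`. -/
def HasWeakDerivOn {F : Type*} [NormedAddCommGroup F] [NormedSpace ℝ F]
    (g g' : ℝ → F) (ω : EReal) : Prop :=
  ∀ t : ℝ, 0 ≤ t → (t : EReal) < ω →
    IntervalIntegrable g' volume 0 t ∧ g t = g 0 + ∫ s in (0 : ℝ)..t, g' s

/-- `y` is a solution on `[-τ, ω)` of
`y^{(r)} = ∑ᵢ Rᵢ y^{(i-1)} + f(d, T(y,…,y^{(r-1)})) + Γ u`, `y|_{[-τ,0]} = y⁰`. The indices of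
`R` start at `0`. As `T` acts on functions on all of `[-τ,∞)`, its value on `[0,s)`, `s < ω`, is
taken along the continuous functions `Ξ` that coincide with `(y,…,y^{(r-1)})` on `[-τ,s)`;
by causality the choice of `Ξ` does not matter. -/
structure IsSolution {m r l q : ℕ} (τ : ℝ) (R : Fin r → Matrix (Fin m) (Fin m) ℝ)
    (d : ℝ → Vec l) (f : Vec l × Vec q → Vec m) (T : Op τ r m q)
    (Γ : Matrix (Fin m) (Fin m) ℝ) (y₀ : ℝ → Vec m) (u : ℝ → Vec m) (ω : EReal)
    (y : ℝ → Vec m) : Prop where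
  contDiff : ContDiffOn ℝ ((r - 1 : ℕ) : WithTop ℕ∞) y (dom τ ω)
  init : EqOn y y₀ (Icc (-τ) 0)
  eqn : ∃ yr : ℝ → Vec m,
    HasWeakDerivOn (iteratedDerivWithin (r - 1) y (dom τ ω)) yr ω ∧
    ∀ s : ℝ, 0 < s → (s : EReal) < ω → ∀ Ξ : C(Ici (-τ), Fin r → Vec m),
      (∀ t : Ici (-τ), (t : ℝ) < s → ∀ i, Ξ t i = iteratedDerivWithin i y (dom τ ω) t) →
      ∀ᵐ t ∂(volume.restrict (Ico 0 s)),
        yr t = ∑ i : Fin r, mulV (R i) (iteratedDerivWithin i y (dom τ ω) t)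
          + f (d t, T Ξ t) + mulV Γ (u t)

/-- The funnel functions `Φ_r`. -/
structure IsFunnel (r : ℕ) (φ : ℝ → ℝ) : Prop where
  contDiff : ContDiffOn ℝ (r : WithTop ℕ∞) φ (Ici 0)
  bdd : ∀ k ≤ r, ∃ C, ∀ t ∈ Ici (0 : ℝ), |iteratedDerivWithin k φ (Ici 0) t| ≤ C
  pos : ∀ s > 0, 0 < φ s
  liminf_pos : ∃ ε > 0, ∀ᶠ s in Filter.atTop, ε ≤ φ s

/-- The matrix with first column `-a` and ones on the superdiagonal. -/
def companion {r : ℕ} (a : Fin r → ℝ) : Matrix (Fin r) (Fin r) ℝ :=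
  fun i j => (if (j : ℕ) = 0 then -a i else 0) + (if (j : ℕ) = i + 1 then 1 else 0)

/-- All eigenvalues have negative real part. -/
def IsHurwitz {r : ℕ} (A : Matrix (Fin r) (Fin r) ℝ) : Prop :=
  ∀ μ ∈ spectrum ℂ (A.map (algebraMap ℝ ℂ)), μ.re < 0

/-- The vector `P⁻¹ (P₁ - P₂ P₄⁻¹ P₂ᵀ, 0, …, 0)ᵀ` for the block partition
`P = [P₁, P₂; P₂ᵀ, P₄]` with `P₁ ∈ ℝ`; here `i₀` is the first index. -/
def schurGain {r : ℕ} (P : Matrix (Fin r) (Fin r) ℝ) (i₀ : Fin r) : Fin r → ℝ :=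
  let P₂ : {i : Fin r // i ≠ i₀} → ℝ := fun j => P i₀ j
  let P₄ : Matrix {i : Fin r // i ≠ i₀} {i : Fin r // i ≠ i₀} ℝ := fun i j => P i j
  P⁻¹.mulVec (Pi.single i₀ (P i₀ i₀ - dotProduct P₂ (P₄⁻¹.mulVec P₂)))

/-- `(a, p, φ, φ₁, ρ, Γ̃) ∈ Σ`, for a system with high-gain matrix `Γ`. -/
structure MemSigma {m r : ℕ} (hr : 2 ≤ r) (Γ : Matrix (Fin m) (Fin m) ℝ)
    (a p : Fin r → ℝ) (φ φ₁ : ℝ → ℝ) (ρ : ℝ) (Γt : Matrix (Fin m) (Fin m) ℝ) : Prop where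
  funnel : IsFunnel r φ
  funnel₁ : IsFunnel r φ₁
  /-- (A.1) -/
  a_pos : ∀ i, 0 < a i
  hurwitz : IsHurwitz (companion a)
  lyapunov : ∃ P Q : Matrix (Fin r) (Fin r) ℝ, P.PosDef ∧ Q.PosDef ∧
    (companion a).transpose * P + P * companion a + Q = 0 ∧ p = schurGain P ⟨0, by omega⟩
  /-- (A.2) -/
  rho : 1 < ρ
  funnel_eq : ∀ t, 0 ≤ t → φ t = ρ * φ₁ t
  /-- (A.3) -/
  gain : SignDefinite Γt
  product : (Γ * Γt⁻¹).PosDef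
  /-- (A.4), `‖G‖ < (ρ-1)/(r-2)`, which is no restriction for `r = 2` -/
  small₁ : ((r : ℝ) - 2) * ‖mulV (1 - Γ * Γt⁻¹)‖ < ρ - 1
  /-- (A.4), `‖G‖ < ρ/(4ρ²(ρ+1)^{r-2} - 1)` -/
  small₂ : ‖mulV (1 - Γ * Γt⁻¹)‖ < ρ / (4 * ρ ^ 2 * (ρ + 1) ^ (r - 2) - 1)

section Cascade

variable {m r : ℕ}

/-- The error `z_{i-1,1} - z_{i,1}` (where `z_{0,1} = y`) of the compensator `i`; indices start
at `0`, so that the first compensator has the index `0` and receives `y`. -/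
def cascErr (y : ℝ → Vec m) (z : Fin (r - 1) → Fin r → ℝ → Vec m) (i : Fin (r - 1)) (t : ℝ) :
    Vec m :=
  (if (i : ℕ) = 0 then y t else z ⟨i - 1, by have := i.isLt; omega⟩ ⟨0, by have := i.isLt; omega⟩ t)
    - z i ⟨0, by have := i.isLt; omega⟩ t

/-- The funnel function of the compensator `i`: `φ₁` for the first one, `φ` for all others. -/
def cascFunnel (φ φ₁ : ℝ → ℝ) (i : Fin (r - 1)) : ℝ → ℝ := if (i : ℕ) = 0 then φ₁ else φ

/-- `1 - φᵢ² ‖z_{i-1,1} - z_{i,1}‖²`, the denominator of the gain `hᵢ`. -/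
def cascDenom (φ φ₁ : ℝ → ℝ) (y : ℝ → Vec m) (z : Fin (r - 1) → Fin r → ℝ → Vec m)
    (i : Fin (r - 1)) (t : ℝ) : ℝ :=
  1 - cascFunnel φ φ₁ i t ^ 2 * ‖cascErr y z i t‖ ^ 2

/-- The right-hand side
`(aⱼ + pⱼ hᵢ)(z_{i-1,1} - z_{i,1}) + z_{i,j+1}`, with `Γ̃ u` in place of `z_{i,r+1}`. -/
def cascRhs (a p : Fin r → ℝ) (φ φ₁ : ℝ → ℝ) (Γt : Matrix (Fin m) (Fin m) ℝ)
    (u y : ℝ → Vec m) (z : Fin (r - 1) → Fin r → ℝ → Vec m)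
    (i : Fin (r - 1)) (j : Fin r) (t : ℝ) : Vec m :=
  (a j + p j * (1 / cascDenom φ φ₁ y z i t)) • cascErr y z i t
    + if h : (j : ℕ) + 1 < r then z i ⟨j + 1, h⟩ t else mulV Γt (u t)

/-- `z` is a solution on `[0, ω)` of the cascade of `r - 1` funnel pre-compensators with inputs
`u` and `y` and initial values `z⁰`. The gains have to be defined along a solution. -/
structure IsCascade (a p : Fin r → ℝ) (φ φ₁ : ℝ → ℝ) (Γt : Matrix (Fin m) (Fin m) ℝ)
    (z₀ : Fin (r - 1) → Fin r → Vec m) (u y : ℝ → Vec m) (ω : EReal)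
    (z : Fin (r - 1) → Fin r → ℝ → Vec m) : Prop where
  defined : ∀ i, ∀ t : ℝ, 0 ≤ t → (t : EReal) < ω → cascDenom φ φ₁ y z i t ≠ 0
  init : ∀ i j, z i j 0 = z₀ i j
  eqn : ∀ i j, HasWeakDerivOn (z i j) (cascRhs a p φ φ₁ Γt u y z i j) ω

end Cascade

/-- The function that is `ζ` on `(-∞,0)` and `z` on `[0,∞)`. -/
def glue {m : ℕ} (ζ z : ℝ → Vec m) (t : ℝ) : Vec m := if t < 0 then ζ t else z t

end

/-! Write r = n + 2, number the compensators from 0 to n and their states Z_{i,j} from j = 0 to n +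
1, and put z_i = Z_{i,0}, K = ΓΓ̃⁻¹, G = I − K. The errors are e_0 = y − z_0 and e_i = z_{i−1} −
z_i, the output is z = z_n, and w_{i,j} = (a_j + p_j h_i) e_i. Repeated differentiation of (2) gives
z_i^{(j)} = Z_{i,j} + ∑_{k<j} (d/dt)^{j−1−k} w_{i,k}; the sum is `Coeff.lead`. For i = n and j = r
this reads z^{(r)} = lead + Γ̃u. So T̃ has to produce this lead from ξ = (z, …, z^{(r−1)}); F̃
merely reads it off, and d̃ = 0.

The lead depends on internal states that must be chosen so that u disappears from their dynamics.
These are X_{i,j} = Z_{i−1,j} − Z_{i,j} for i ≥ 1 and X_{0,j} = y^{(j)} − ∑_{k<j} R y^{(k)} − K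
Z_{0,j} − G z^{(j)} (with the appropriate R's, and without the last term for j = r − 1). The control
cancels because all compensators receive the same Γ̃u and KΓ̃ = Γ. From the derivatives of φ, from ξ
and from X, all derivatives of the errors and of y below order r are found recursively, and smoothly
as long as all gains are positive (`Coeff.err`, `Coeff.out`). Thus X solves a causal functional
differential equation driven by ξ (`Coeff.field`, `Sys.IsInternal`), and T̃ is a smooth function of
(φ, ξ, X) (`Sys.innerOp`). The change of variables `Coeff.confOf`, with inverse given by `Coeff.out`
and `Coeff.cascState`, then yields both directions of the equivalence:
`Sys.isSolution_of_interconnection` and `Sys.interconnection_of_isSolution`.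

It remains to see that T̃ belongs to the operator class (`Sys.opClass_innerOp`). For every
continuous ξ the equation for X must have a global solution, with state and gains bounded in terms
of a bound of ξ. This a priori estimate, `Sys.apriori`, is the heart of the proof and has three
stages. (1) As φ(0) may vanish, a short initial interval is treated separately: there the velocity
is bounded, so X stays close to its initial value. (2) Afterwards φ ≥ μ > 0, so the errors are at
most ρ/μ. Then y = z + ∑ e_i is bounded, and by the extra condition of the class 𝒩_1 so is f(d, T(y,
…)), although the higher derivatives of y are not yet controlled. The energy built from P, with a
factor M such that MᵀM = K⁻¹ on the first block, dissipates quadratically by the Lyapunov equation.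
Since P p = (κ, 0, …, 0), the gains act on first components only, where h_i multiplies ⟨e_{i+1},
e_i⟩ − ‖e_i‖². This product is bounded above however large h_i is, because e_{i+1} is no longer than
the funnel radius of e_i. For i = 0 there is an additional term G ∑ e_i, which fits because the
first funnel is wider by the factor ρ and 1 + n‖G‖ < ρ. (3) The errors satisfy e_i' = w_{i−1,0} −
w_{i,0} + bounded and, thanks to K + G = I, e_0' = G w_{n,0} − w_{0,0} + bounded. A gain that
exceeds its predecessor in this loop by a certain constant decreases, and the loop is closed with
the factor ‖G‖ < 1; hence all gains are bounded.

Existence, uniqueness and Lipschitz dependence come from saturating the arguments of the equation: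
the saturated right-hand side is bounded, causal and locally Lipschitz (`Sys.causalLip_satOp`), so
global solutions exist (`CausalLip.exists_sol`), and the a priori estimate shows that a suitable
saturation never acts. -/

noncomputable section

/-! ### Functional differential equations with bounded, causal, locally Lipschitz right-hand side -/

/-- A bounded causal locally Lipschitz operator on the continuous functions on `[0,∞)`. -/
structure CausalLip {W E : Type*} [NormedAddCommGroup W] [NormedAddCommGroup E]
    (N : (ℝ → W) → ℝ → E) : Prop where
  meas : ∀ w, Continuous w → ∀ b, AEStronglyMeasurable (N w) (volume.restrict (Ico 0 b))
  bdd : ∃ B, 0 < B ∧ ∀ w, Continuous w → ∀ b, ∀ᵐ s ∂volume.restrict (Ico 0 b), ‖N w s‖ ≤ B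
  causal : ∀ t, 0 ≤ t → ∀ w w', Continuous w → Continuous w' →
    (∀ s, 0 ≤ s → s < t → w s = w' s) → ∀ᵐ s ∂volume.restrict (Ico 0 t), N w s = N w' s
  lip : ∀ t, 0 ≤ t → ∀ w, Continuous w → ∃ Δ > 0, ∃ δ > 0, ∃ L > 0, ∀ w₁ w₂, Continuous w₁ →
    Continuous w₂ → (∀ s, 0 ≤ s → s ≤ t → w₁ s = w s ∧ w₂ s = w s) →
    (∀ s ∈ Icc t (t + Δ), ‖w₁ s - w t‖ < δ ∧ ‖w₂ s - w t‖ < δ) →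
    ∀ M, (∀ s ∈ Icc t (t + Δ), ‖w₁ s - w₂ s‖ ≤ M) →
      ∀ᵐ s ∂volume.restrict (Ico t (t + Δ)), ‖N w₁ s - N w₂ s‖ ≤ L * M

/-- `X' = N X`, `X 0 = x₀` on `[0,b]`. -/
structure SolOn {E : Type*} [NormedAddCommGroup E] [NormedSpace ℝ E]
    (N : (ℝ → E) → ℝ → E) (x₀ : E) (b : ℝ) (X : ℝ → E) : Prop where
  cont : Continuous X
  eqn : ∀ t ∈ Icc 0 b, X t = x₀ + ∫ s in (0 : ℝ)..t, N X s

lemma ae_restrict_Ioc_iff_Ico {a b : ℝ} {p : ℝ → Prop} :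
    (∀ᵐ s ∂volume.restrict (Ioc a b), p s) ↔ ∀ᵐ s ∂volume.restrict (Ico a b), p s := by
  rw [Measure.restrict_congr_set (Ico_ae_eq_Ioc (μ := volume) (a := a) (b := b))]

lemma ae_restrict_Icc_iff_Ico {a b : ℝ} {p : ℝ → Prop} :
    (∀ᵐ s ∂volume.restrict (Icc a b), p s) ↔ ∀ᵐ s ∂volume.restrict (Ico a b), p s := by
  rw [Measure.restrict_congr_set (Ico_ae_eq_Icc (μ := volume) (a := a) (b := b))]

lemma intervalIntegral_congr_ae_Ico {E : Type*} [NormedAddCommGroup E] [NormedSpace ℝ E]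
    {f g : ℝ → E} {a b : ℝ} (hab : a ≤ b)
    (h : ∀ᵐ s ∂volume.restrict (Ico a b), f s = g s) :
    ∫ s in a..b, f s = ∫ s in a..b, g s := by
  apply intervalIntegral.integral_congr_ae
  rw [uIoc_of_le hab]
  exact (ae_restrict_iff' measurableSet_Ioc).1 (ae_restrict_Ioc_iff_Ico.2 h)

lemma norm_intervalIntegral_le_of_ae_Ico {E : Type*} [NormedAddCommGroup E] [NormedSpace ℝ E]
    {f : ℝ → E} {a b C : ℝ} (hab : a ≤ b)
    (h : ∀ᵐ s ∂volume.restrict (Ico a b), ‖f s‖ ≤ C) :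
    ‖∫ s in a..b, f s‖ ≤ C * (b - a) := by
  have := intervalIntegral.norm_integral_le_of_norm_le_const_ae (a := a) (b := b) (f := f) (C := C) (by
    rw [uIoc_of_le hab]
    exact (ae_restrict_iff' measurableSet_Ioc).1 (ae_restrict_Ioc_iff_Ico.2 h))
  rwa [abs_of_nonneg (sub_nonneg.2 hab)] at this

lemma intervalIntegrable_of_ae_bound {E : Type*} [NormedAddCommGroup E] {f : ℝ → E} {a b C : ℝ}
    (hab : a ≤ b) (hm : AEStronglyMeasurable f (volume.restrict (Ico a b)))
    (h : ∀ᵐ s ∂volume.restrict (Ico a b), ‖f s‖ ≤ C) : IntervalIntegrable f volume a b := by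
  rw [intervalIntegrable_iff_integrableOn_Ico_of_le hab]
  exact IntegrableOn.of_bound (by simp) hm C h

lemma ae_restrict_Ico_mono {a b a' b' : ℝ} (ha : a' ≤ a) (hb : b ≤ b') {p : ℝ → Prop}
    (h : ∀ᵐ s ∂volume.restrict (Ico a' b'), p s) : ∀ᵐ s ∂volume.restrict (Ico a b), p s :=
  ae_restrict_of_ae_restrict_of_subset (Ico_subset_Ico ha hb) h

namespace CausalLip

variable {W E : Type*} [NormedAddCommGroup W] [NormedAddCommGroup E]
  {N : (ℝ → W) → ℝ → E}

lemma intervalIntegrable (hN : CausalLip N) {w : ℝ → W} (hw : Continuous w) {s t : ℝ}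
    (hs : 0 ≤ s) (ht : 0 ≤ t) : IntervalIntegrable (N w) volume s t := by
  obtain ⟨B, -, hB⟩ := hN.bdd
  have key : ∀ t, 0 ≤ t → IntervalIntegrable (N w) volume 0 t := fun t ht =>
    intervalIntegrable_of_ae_bound ht (hN.meas w hw t) (hB w hw t)
  exact (key s hs).symm.trans (key t ht)

/-- Freezing both functions after t + h turns a comparison on [t, t + h] into one on [t, t + Δ];
causality removes the freezing again on [t, t + h). -/
lemma lip_of_le (hN : CausalLip N) {t : ℝ} (ht : 0 ≤ t) {w : ℝ → W} (hw : Continuous w) :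
    ∃ Δ > 0, ∃ δ > 0, ∃ L > 0, ∀ h, 0 ≤ h → h ≤ Δ → ∀ w₁ w₂, Continuous w₁ →
    Continuous w₂ → (∀ s, 0 ≤ s → s ≤ t → w₁ s = w s ∧ w₂ s = w s) →
    (∀ s ∈ Icc t (t + h), ‖w₁ s - w t‖ < δ ∧ ‖w₂ s - w t‖ < δ) →
    ∀ M, (∀ s ∈ Icc t (t + h), ‖w₁ s - w₂ s‖ ≤ M) →
      ∀ᵐ s ∂volume.restrict (Ico t (t + h)), ‖N w₁ s - N w₂ s‖ ≤ L * M := by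
  obtain ⟨Δ, hΔ, δ, hδ, L, hL, H⟩ := hN.lip t ht w hw
  refine ⟨Δ, hΔ, δ, hδ, L, hL, fun h h0 hh w₁ w₂ hw₁ hw₂ heq hcl M hM => ?_⟩
  have hc : ∀ v : ℝ → W, Continuous v → Continuous (fun s => v (min s (t + h))) :=
    fun v hv => hv.comp (continuous_id.min continuous_const)
  have hmem : ∀ s ∈ Icc t (t + Δ), min s (t + h) ∈ Icc t (t + h) := fun s hs =>
    ⟨le_min hs.1 (by linarith), min_le_right _ _⟩
  have key := H (fun s => w₁ (min s (t + h))) (fun s => w₂ (min s (t + h))) (hc _ hw₁) (hc _ hw₂)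
    (fun s hs hst => by
      have : min s (t + h) = s := min_eq_left (by linarith)
      simp only [this]; exact heq s hs hst)
    (fun s hs => hcl _ (hmem s hs)) M (fun s hs => hM _ (hmem s hs))
  have e : ∀ v : ℝ → W, Continuous v →
      ∀ᵐ s ∂volume.restrict (Ico t (t + h)), N (fun s => v (min s (t + h))) s = N v s := fun v hv =>
    ae_restrict_Ico_mono ht le_rfl (hN.causal (t + h) (by linarith) _ _ (hc v hv) hv
      (fun s _ hs => by simp only [min_eq_left hs.le]))
  filter_upwards [ae_restrict_Ico_mono le_rfl (by linarith) key, e w₁ hw₁, e w₂ hw₂] with s h1 h2 h3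
  rwa [h2, h3] at h1

variable [NormedSpace ℝ E]

/-- Solutions of `X' = N (ξ, X)` depend locally Lipschitz continuously on `ξ`. -/
lemma dependence {U : Type*} [NormedAddCommGroup U] {N : (ℝ → U × E) → ℝ → E}
    (hN : CausalLip N) {t : ℝ} (ht : 0 ≤ t) {ξ : ℝ → U} (hξ : Continuous ξ) {X : ℝ → E}
    (hX : Continuous X) :
    ∃ Δ > 0, ∃ δ > 0, ∀ h, 0 ≤ h → h ≤ Δ → ∀ ξ₁ ξ₂ X₁ X₂ x₀, Continuous ξ₁ → Continuous ξ₂ →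
      (∀ s, 0 ≤ s → s ≤ t → ξ₁ s = ξ s ∧ ξ₂ s = ξ s) →
      (∀ s, 0 ≤ s → s ≤ t → X₁ s = X s ∧ X₂ s = X s) →
      (∀ s ∈ Icc t (t + h), ‖ξ₁ s - ξ t‖ < δ ∧ ‖ξ₂ s - ξ t‖ < δ) →
      SolOn (fun Y => N fun s => (ξ₁ s, Y s)) x₀ (t + h) X₁ →
      SolOn (fun Y => N fun s => (ξ₂ s, Y s)) x₀ (t + h) X₂ →
      ∀ M, (∀ s ∈ Icc t (t + h), ‖ξ₁ s - ξ₂ s‖ ≤ M) →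
        ∀ s ∈ Icc t (t + h), ‖X₁ s - X₂ s‖ ≤ M := by
  obtain ⟨Δ, hΔ, δ, hδ, L, hL, H⟩ := hN.lip_of_le ht (w := fun s => (ξ s, X s)) (hξ.prodMk hX)
  obtain ⟨B, hB0, hB⟩ := hN.bdd
  -- In time h a solution moves by at most h B < δ, so it stays where the Lipschitz estimate
  -- applies; L h ≤ 1/2 allows the difference of the solutions to be absorbed.
  refine ⟨min Δ (min (δ / (2 * B)) (1 / (2 * L))), by positivity, δ, hδ, ?_⟩
  intro h h0 hh ξ₁ ξ₂ X₁ X₂ x₀ hξ₁ hξ₂ hξe hXe hcl s₁ s₂ M hM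
  have hhΔ : h ≤ Δ := hh.trans (min_le_left _ _)
  have hhB : h * B < δ := by
    have : h ≤ δ / (2 * B) := hh.trans ((min_le_right _ _).trans (min_le_left _ _))
    rw [le_div_iff₀ (by positivity)] at this
    nlinarith
  have hhL : L * h ≤ 1 / 2 := by
    have : h ≤ 1 / (2 * L) := hh.trans ((min_le_right _ _).trans (min_le_right _ _))
    rw [le_div_iff₀ (by positivity)] at this
    linarith
  have inc : ∀ (η : ℝ → U) (Y : ℝ → E), Continuous η →
      SolOn (fun Y => N fun s => (η s, Y s)) x₀ (t + h) Y → ∀ s ∈ Icc t (t + h),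
      Y s = Y t + ∫ x in t..s, N (fun s => (η s, Y s)) x := by
    intro η Y hη hY s hs
    have hi := fun a b ha hb => hN.intervalIntegrable (hη.prodMk hY.cont) (s := a) (t := b) ha hb
    rw [hY.eqn s ⟨ht.trans hs.1, hs.2⟩, hY.eqn t ⟨ht, by linarith⟩, add_assoc,
      intervalIntegral.integral_add_adjacent_intervals (hi _ _ le_rfl ht)
        (hi _ _ ht (ht.trans hs.1))]
  have close : ∀ (η : ℝ → U) (Y : ℝ → E), Continuous η → Y t = X t →
      SolOn (fun Y => N fun s => (η s, Y s)) x₀ (t + h) Y → ∀ s ∈ Icc t (t + h),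
      ‖Y s - X t‖ < δ := by
    intro η Y hη hYt hY s hs
    rw [inc η Y hη hY s hs, hYt, add_sub_cancel_left]
    refine (norm_intervalIntegral_le_of_ae_Ico hs.1
      (ae_restrict_Ico_mono ht le_rfl (hB _ (hη.prodMk hY.cont) s))).trans_lt ?_
    nlinarith [hs.2]
  obtain ⟨s', hs', hmax⟩ := isCompact_Icc.exists_isMaxOn (nonempty_Icc.2 (by linarith : t ≤ t + h))
    (f := fun s => ‖X₁ s - X₂ s‖) (s₁.cont.sub s₂.cont).norm.continuousOn
  have hD : ∀ s ∈ Icc t (t + h), ‖X₁ s - X₂ s‖ ≤ ‖X₁ s' - X₂ s'‖ := fun s hs => hmax hs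
  set D := ‖X₁ s' - X₂ s'‖
  have hM0 : 0 ≤ M := (norm_nonneg _).trans (hM t ⟨le_rfl, by linarith⟩)
  have hX₁t := (hXe t ht le_rfl).1
  have hX₂t := (hXe t ht le_rfl).2
  have hae := H h h0 hhΔ _ _ (hξ₁.prodMk s₁.cont) (hξ₂.prodMk s₂.cont)
    (fun s hs hst => ⟨by rw [(hξe s hs hst).1, (hXe s hs hst).1],
      by rw [(hξe s hs hst).2, (hXe s hs hst).2]⟩)
    (fun s hs => ⟨by
      rw [Prod.mk_sub_mk, Prod.norm_mk]
      exact max_lt (hcl s hs).1 (close _ _ hξ₁ hX₁t s₁ s hs), by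
      rw [Prod.mk_sub_mk, Prod.norm_mk]
      exact max_lt (hcl s hs).2 (close _ _ hξ₂ hX₂t s₂ s hs)⟩) (M + D)
    (fun s hs => by
      rw [Prod.mk_sub_mk, Prod.norm_mk]
      exact max_le (by linarith [hM s hs, norm_nonneg (X₁ s' - X₂ s')]) (by linarith [hD s hs]))
  -- The pairs (signal, solution) differ by at most M + D. With L h ≤ 1/2 this gives D ≤ (M + D)/2,
  -- that is, D ≤ M.
  have est : D ≤ L * (M + D) * h := by
    have e : X₁ s' - X₂ s' = ∫ x in t..s', (N (fun s => (ξ₁ s, X₁ s)) x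
        - N (fun s => (ξ₂ s, X₂ s)) x) := by
      rw [intervalIntegral.integral_sub
        (hN.intervalIntegrable (hξ₁.prodMk s₁.cont) ht (ht.trans hs'.1))
        (hN.intervalIntegrable (hξ₂.prodMk s₂.cont) ht (ht.trans hs'.1)),
        inc _ _ hξ₁ s₁ s' hs', inc _ _ hξ₂ s₂ s' hs', hX₁t, hX₂t]
      abel
    have := norm_intervalIntegral_le_of_ae_Ico hs'.1 (ae_restrict_Ico_mono le_rfl hs'.2 hae)
    rw [← e] at this
    refine this.trans ?_
    have : 0 ≤ D := norm_nonneg _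
    have : s' - t ≤ h := by linarith [hs'.2]
    gcongr
  intro s hs
  have := hD s hs
  nlinarith [norm_nonneg (X₁ s' - X₂ s')]

omit [NormedSpace ℝ E] in
-- The Lipschitz estimate concerns pairs (ξ, Y), so Δ is shortened until the fixed signal ξ itself
-- stays δ-close to ξ(t).
lemma fix {U : Type*} [NormedAddCommGroup U] {N : (ℝ → U × E) → ℝ → E}
    (hN : CausalLip N) {ξ : ℝ → U} (hξ : Continuous ξ) :
    CausalLip (fun Y => N fun s => (ξ s, Y s)) where
  meas w hw b := hN.meas _ (hξ.prodMk hw) b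
  bdd := by
    obtain ⟨B, hB0, hB⟩ := hN.bdd
    exact ⟨B, hB0, fun w hw b => hB _ (hξ.prodMk hw) b⟩
  causal t ht w w' hw hw' h := hN.causal t ht _ _ (hξ.prodMk hw) (hξ.prodMk hw')
    (fun s hs hst => by simp only [h s hs hst])
  lip t ht w hw := by
    obtain ⟨Δ, hΔ, δ, hδ, L, hL, H⟩ := hN.lip_of_le ht (hξ.prodMk hw)
    obtain ⟨h', hh', hc⟩ := Metric.continuousAt_iff.1 (hξ.continuousAt (x := t)) δ hδ
    refine ⟨min Δ (h' / 2), by positivity, δ, hδ, L, hL,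
      fun w₁ w₂ hw₁ hw₂ heq hcl M hM => H _ (by positivity) (min_le_left _ _) _ _
        (hξ.prodMk hw₁) (hξ.prodMk hw₂) (fun s hs hst => ?_) (fun s hs => ?_) M (fun s hs => ?_)⟩
    · simp only [(heq s hs hst).1, (heq s hs hst).2, and_self]
    · have : ‖ξ s - ξ t‖ < δ := by
        rw [← dist_eq_norm]
        apply hc
        rw [Real.dist_eq, abs_of_nonneg (by linarith [hs.1])]
        have := hs.2
        have := min_le_right Δ (h' / 2)
        linarith
      rw [Prod.mk_sub_mk, Prod.norm_mk, Prod.mk_sub_mk, Prod.norm_mk]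
      exact ⟨max_lt this (hcl s hs).1, max_lt this (hcl s hs).2⟩
    · have := hM s hs
      rw [Prod.mk_sub_mk, Prod.norm_mk, sub_self, norm_zero]
      exact max_le ((norm_nonneg _).trans this) this

end CausalLip

section Existence

variable {E : Type*} [NormedAddCommGroup E] [NormedSpace ℝ E] {N : (ℝ → E) → ℝ → E} {x₀ : E}

lemma SolOn.mono {b b' : ℝ} {X : ℝ → E} (h : SolOn N x₀ b X) (hb : b' ≤ b) : SolOn N x₀ b' X :=
  ⟨h.cont, fun t ht => h.eqn t ⟨ht.1, ht.2.trans hb⟩⟩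

/-- An equation without signal is one with a signal in the one-point space. `dependence` with M = 0
then pushes agreement of two solutions a little further to the right, and the times up to which they
agree form a closed set. -/
lemma CausalLip.unique (hN : CausalLip N) {b : ℝ} {X₁ X₂ : ℝ → E}
    (h₁ : SolOn N x₀ b X₁) (h₂ : SolOn N x₀ b X₂) : ∀ t ∈ Icc 0 b, X₁ t = X₂ t := by
  rcases lt_or_ge b 0 with hb | hb
  · intro t ht; linarith [ht.1, ht.2]
  have hN' : CausalLip (fun w : ℝ → Unit × E => N fun s => (w s).2) := by
    refine ⟨fun w hw => hN.meas _ hw.snd, ?_, fun t ht w w' hw hw' h => hN.causal t ht _ _ hw.snd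
      hw'.snd fun s hs hst => by rw [h s hs hst], fun t ht w hw => ?_⟩
    · obtain ⟨B, hB0, hB⟩ := hN.bdd
      exact ⟨B, hB0, fun w hw b => hB _ hw.snd b⟩
    · obtain ⟨Δ, hΔ, δ, hδ, L, hL, H⟩ := hN.lip t ht _ hw.snd
      refine ⟨Δ, hΔ, δ, hδ, L, hL, fun w₁ w₂ hw₁ hw₂ heq hcl M hM => H _ _ hw₁.snd hw₂.snd
        (fun s hs hst => ?_) (fun s hs => ?_) M fun s hs => ?_⟩
      · exact ⟨by rw [(heq s hs hst).1], by rw [(heq s hs hst).2]⟩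
      · exact ⟨(norm_snd_le (w₁ s - w t)).trans_lt (hcl s hs).1,
          (norm_snd_le (w₂ s - w t)).trans_lt (hcl s hs).2⟩
      · exact (norm_snd_le (w₁ s - w₂ s)).trans (hM s hs)
  have key : Icc 0 b ⊆ {t | ∀ s, 0 ≤ s → s ≤ t → X₁ s = X₂ s} := by
    apply IsClosed.Icc_subset_of_forall_exists_gt
    · rw [show {t | ∀ s, 0 ≤ s → s ≤ t → X₁ s = X₂ s} ∩ Icc 0 b
        = (⋂ x ≥ (0 : ℝ), {t | X₁ (min t x) = X₂ (min t x)}) ∩ Icc 0 b by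
        ext t
        simp only [mem_inter_iff, mem_ofPred_eq, mem_iInter, and_congr_left_iff]
        intro ht
        refine ⟨fun h x hx => h _ (le_min ht.1 hx) (min_le_left _ _), fun h s hs hst => ?_⟩
        simpa [min_eq_right hst] using h s hs]
      refine IsClosed.inter (isClosed_biInter fun x _ => isClosed_eq ?_ ?_) isClosed_Icc
      · exact h₁.cont.comp (continuous_id.min continuous_const)
      · exact h₂.cont.comp (continuous_id.min continuous_const)
    · intro s hs hs'
      rw [le_antisymm hs' hs, h₁.eqn 0 ⟨le_rfl, hb⟩, h₂.eqn 0 ⟨le_rfl, hb⟩]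
      simp
    · rintro t ⟨ht, ht0, htb⟩ y hy
      obtain ⟨Δ, hΔ, δ, hδ, H⟩ := hN'.dependence ht0 (ξ := fun _ => ()) continuous_const h₁.cont
      have hy' : t < y := hy
      refine ⟨t + min Δ (min (y - t) (b - t)), ?_, ?_, ?_⟩
      · intro s hs hst
        rcases le_total s t with h | h
        · exact ht s hs h
        have hle : t + min Δ (min (y - t) (b - t)) ≤ b := by
          linarith [min_le_right Δ (min (y - t) (b - t)), min_le_right (y - t) (b - t)]
        have := H (min Δ (min (y - t) (b - t))) (le_min hΔ.le (le_min (by linarith) (by linarith)))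
          (min_le_left _ _) (fun _ => ()) (fun _ => ()) X₁ X₂ x₀ continuous_const continuous_const
          (fun _ _ _ => ⟨rfl, rfl⟩) (fun s hs hst => ⟨rfl, (ht s hs hst).symm⟩)
          (fun _ _ => by simpa using hδ) (h₁.mono hle) (h₂.mono hle) 0 (fun _ _ => by simp) s ⟨h, hst⟩
        simpa [sub_eq_zero] using this
      · have : 0 < min Δ (min (y - t) (b - t)) := lt_min hΔ (lt_min (by linarith) (by linarith))
        linarith
      · linarith [min_le_right Δ (min (y - t) (b - t)), min_le_left (y - t) (b - t)]
  exact fun t ht => key ht t ht.1 le_rfl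

/-- Contraction principle for the Picard map on the bounded continuous functions that continue X and
stay near X t. Boundedness of N makes the map preserve this set, and L h ≤ 1/2 makes it a
contraction. -/
lemma CausalLip.exists_extension [CompleteSpace E] (hN : CausalLip N) {t : ℝ} (ht : 0 ≤ t)
    {X : ℝ → E} (hX : SolOn N x₀ t X) : ∃ h > 0, ∃ X', SolOn N x₀ (t + h) X' := by
  obtain ⟨Δ, hΔ, δ, hδ, L, hL, H⟩ := hN.lip t ht X hX.cont
  obtain ⟨B, hB0, hB⟩ := hN.bdd
  set h := min Δ (min (δ / (2 * B)) (1 / (2 * L))) with hh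
  have h0 : 0 < h := by positivity
  have hhΔ : h ≤ Δ := min_le_left _ _
  have hhB : h * B ≤ δ / 2 := by
    have : h ≤ δ / (2 * B) := ((min_le_right _ _).trans (min_le_left _ _))
    rw [le_div_iff₀ (by positivity)] at this
    linarith
  have hhL : L * h ≤ 1 / 2 := by
    have : h ≤ 1 / (2 * L) := ((min_le_right _ _).trans (min_le_right _ _))
    rw [le_div_iff₀ (by positivity)] at this
    linarith
  clear_value h
  have hcl : Continuous fun s : ℝ => max t (min s (t + h)) := by fun_prop
  have hcX : Continuous fun s : ℝ => X (max 0 (min s t)) := hX.cont.comp (by fun_prop)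
  have hclmem : ∀ s : ℝ, t ≤ max t (min s (t + h)) ∧ max t (min s (t + h)) ≤ t + h := fun s =>
    ⟨le_max_left _ _, max_le (by linarith) (min_le_right _ _)⟩
  have hXb : ∃ C, ∀ s : ℝ, ‖X (max 0 (min s t))‖ ≤ C := by
    obtain ⟨C, hC⟩ := (isCompact_Icc (a := (0 : ℝ)) (b := t)).exists_bound_of_continuousOn
      hX.cont.continuousOn
    exact ⟨C, fun s => hC _ ⟨le_max_left _ _, max_le ht (min_le_right _ _)⟩⟩
  obtain ⟨C, hC⟩ := hXb
  have hint : ∀ Z : BoundedContinuousFunction ℝ E, ∀ s, t ≤ s →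
      ‖∫ x in t..s, N Z x‖ ≤ B * (s - t) := fun Z s hs =>
    norm_intervalIntegral_le_of_ae_Ico hs (ae_restrict_Ico_mono ht le_rfl (hB Z Z.continuous s))
  have hcint : ∀ Z : BoundedContinuousFunction ℝ E,
      Continuous fun s : ℝ => ∫ x in t..max t (min s (t + h)), N Z x := by
    intro Z
    have h1 : ContinuousOn (fun s : ℝ => ∫ x in t..s, N Z x) (Icc t (t + h)) := by
      have := intervalIntegral.continuousOn_primitive_interval' (μ := volume)
        (hN.intervalIntegrable Z.continuous ht (by linarith : 0 ≤ t + h))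
        (left_mem_uIcc (a := t) (b := t + h))
      rwa [uIcc_of_le (by linarith)] at this
    exact h1.comp_continuous hcl fun s => ⟨(hclmem s).1, (hclmem s).2⟩
  let P : BoundedContinuousFunction ℝ E → BoundedContinuousFunction ℝ E := fun Z =>
    BoundedContinuousFunction.ofNormedAddCommGroup
      (fun s : ℝ => X (max 0 (min s t)) + ∫ x in t..max t (min s (t + h)), N Z x)
      (hcX.add (hcint Z)) (C + B * h) (fun s => (norm_add_le _ _).trans (add_le_add (hC s)
        ((hint Z _ (hclmem s).1).trans (by
          have := (hclmem s).2
          gcongr; linarith))))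
  have hP : ∀ Z s, P Z s = X (max 0 (min s t)) + ∫ x in t..max t (min s (t + h)), N Z x :=
    fun _ _ => rfl
  -- Closeness is imposed at all times after t, not only up to t + h, because the Lipschitz
  -- condition compares on all of [t, t + Δ]. The Picard map freezes its values after t + h, so this
  -- costs nothing.
  let S : Set (BoundedContinuousFunction ℝ E) :=
    {Z | (∀ s ∈ Icc 0 t, Z s = X s) ∧ ∀ s, t ≤ s → ‖Z s - X t‖ ≤ δ / 2}
  have hev : ∀ s : ℝ, Continuous fun Z : BoundedContinuousFunction ℝ E => Z s := fun s =>
    (BoundedContinuousFunction.lipschitz_eval_const s).continuous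
  have hSc : IsClosed S := by
    have : S = (⋂ s ∈ Icc 0 t, {Z : BoundedContinuousFunction ℝ E | Z s = X s}) ∩
        ⋂ s ≥ t, {Z : BoundedContinuousFunction ℝ E | ‖Z s - X t‖ ≤ δ / 2} := by
      ext Z
      simp only [S, mem_ofPred_eq, mem_inter_iff, mem_iInter, ge_iff_le]
    rw [this]
    exact (isClosed_biInter fun s _ => isClosed_eq (hev s) continuous_const).inter
      (isClosed_biInter fun s _ => isClosed_le ((hev s).sub continuous_const).norm
          continuous_const)
  have hPS : ∀ Z, P Z ∈ S := by
    refine fun Z => ⟨fun s hs => ?_, fun s hs => ?_⟩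
    · rw [hP, min_eq_left hs.2, max_eq_right hs.1, max_eq_left ((min_le_left _ _).trans hs.2)]
      simp
    · rw [hP, min_eq_right hs, max_eq_right ht, add_sub_cancel_left]
      refine (hint Z _ (hclmem s).1).trans ?_
      have := (hclmem s).2
      nlinarith
  have hcontr : ∀ Z₁ ∈ S, ∀ Z₂ ∈ S, dist (P Z₁) (P Z₂) ≤ 1 / 2 * dist Z₁ Z₂ := by
    intro Z₁ h₁ Z₂ h₂
    refine (BoundedContinuousFunction.dist_le (by positivity)).2 fun s => ?_
    have hae := H Z₁ Z₂ Z₁.continuous Z₂.continuous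
      (fun s hs hst => ⟨h₁.1 s ⟨hs, hst⟩, h₂.1 s ⟨hs, hst⟩⟩)
      (fun s hs => ⟨(h₁.2 s hs.1).trans_lt (by linarith), (h₂.2 s hs.1).trans_lt (by linarith)⟩)
      (dist Z₁ Z₂) (fun s _ => by
        rw [← dist_eq_norm]; exact BoundedContinuousFunction.dist_coe_le_dist s)
    have hs := hclmem s
    rw [hP, hP, dist_add_left, dist_eq_norm, ← intervalIntegral.integral_sub
        (hN.intervalIntegrable Z₁.continuous ht (ht.trans hs.1))
        (hN.intervalIntegrable Z₂.continuous ht (ht.trans hs.1))]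
    refine (norm_intervalIntegral_le_of_ae_Ico hs.1
      (ae_restrict_Ico_mono le_rfl (by linarith) hae)).trans ?_
    have hd : 0 ≤ dist Z₁ Z₂ := dist_nonneg
    calc L * dist Z₁ Z₂ * (max t (min s (t + h)) - t) ≤ L * dist Z₁ Z₂ * h := by
          gcongr; linarith
      _ = (L * h) * dist Z₁ Z₂ := by ring
      _ ≤ _ := by gcongr
  have hmaps : MapsTo P S S := fun Z _ => hPS Z
  have hcw : ContractingWith (1 / 2) (hmaps.restrict P S S) := by
    refine ⟨by norm_num, LipschitzWith.of_dist_le_mul fun Z₁ Z₂ => ?_⟩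
    rw [Subtype.dist_eq, Subtype.dist_eq]
    simpa using hcontr Z₁ Z₁.2 Z₂ Z₂.2
  obtain ⟨Z, -, hZ, -⟩ := hcw.exists_fixedPoint' hSc.isComplete hmaps (hPS 0) (edist_ne_top _ _)
  refine ⟨h, h0, Z, Z.continuous, fun s hs => ?_⟩
  have hZs : ∀ s, Z s = X (max 0 (min s t)) + ∫ x in t..max t (min s (t + h)), N Z x :=
    fun s => by rw [← hP, hZ]
  have hZS : Z ∈ S := by rw [← hZ]; exact hPS Z
  -- Up to time t the fixed point coincides with X, so by causality N Z may replace N X there.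
  have hpre : ∀ s ∈ Icc 0 t, X s = x₀ + ∫ x in (0 : ℝ)..s, N Z x := fun s hs => by
    rw [hX.eqn s hs]
    congr 1
    exact intervalIntegral_congr_ae_Ico hs.1 (hN.causal s hs.1 _ _ hX.cont Z.continuous
      fun x hx hxs => (hZS.1 x ⟨hx, hxs.le.trans hs.2⟩).symm)
  rcases le_total s t with h' | h'
  · rw [hZS.1 s ⟨hs.1, h'⟩, hpre s ⟨hs.1, h'⟩]
  · rw [hZs, min_eq_right h', max_eq_right ht, min_eq_left hs.2, max_eq_right h',
      hpre t ⟨ht, le_rfl⟩, add_assoc, intervalIntegral.integral_add_adjacent_intervals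
        (hN.intervalIntegrable Z.continuous le_rfl ht)
        (hN.intervalIntegrable Z.continuous ht (ht.trans h'))]

lemma SolOn.norm_sub_le (hN : CausalLip N) {B : ℝ}
    (hB : ∀ w, Continuous w → ∀ b, ∀ᵐ s ∂volume.restrict (Ico 0 b), ‖N w s‖ ≤ B) {b : ℝ}
    {X : ℝ → E} (hX : SolOn N x₀ b X) {s t : ℝ} (hs : 0 ≤ s) (hst : s ≤ t) (htb : t ≤ b) :
    ‖X t - X s‖ ≤ B * (t - s) := by
  rw [hX.eqn t ⟨hs.trans hst, htb⟩, hX.eqn s ⟨hs, hst.trans htb⟩, add_sub_add_left_eq_sub,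
    intervalIntegral.integral_interval_sub_left
      (hN.intervalIntegrable hX.cont le_rfl (hs.trans hst))
      (hN.intervalIntegrable hX.cont le_rfl hs)]
  exact norm_intervalIntegral_le_of_ae_Ico hst (ae_restrict_Ico_mono hs le_rfl (hB _ hX.cont t))

/-- By uniqueness the solutions on [0,t], t < b, fit together to one function on [0,b). It is
Lipschitz with the bound of N as constant, hence extends to the closed interval, where the equation
holds by continuity. -/
lemma CausalLip.exists_sol_of_lt [FiniteDimensional ℝ E] (hN : CausalLip N) {b : ℝ} (hb : 0 < b)
    (h : ∀ t, 0 ≤ t → t < b → ∃ X, SolOn N x₀ t X) : ∃ X, SolOn N x₀ b X := by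
  obtain ⟨B, hB0, hB⟩ := hN.bdd
  choose! Y hY using h
  have hYeq : ∀ s t, 0 ≤ s → s ≤ t → t < b → Y t s = Y s s := fun s t hs hst htb =>
    hN.unique ((hY t (hs.trans hst) htb).mono hst) (hY s hs (hst.trans_lt htb)) s ⟨hs, le_rfl⟩
  have hlip : LipschitzOnWith (Real.toNNReal B) (fun t => Y t t) (Ico 0 b) := by
    refine LipschitzOnWith.of_dist_le_mul ?_
    rw [Real.coe_toNNReal B hB0.le]
    have key : ∀ s ∈ Ico 0 b, ∀ t ∈ Ico 0 b, s ≤ t → dist (Y s s) (Y t t) ≤ B * dist s t := by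
      intro s hs t ht hst
      rw [dist_comm, dist_eq_norm, ← hYeq s t hs.1 hst ht.2, dist_comm s t, Real.dist_eq,
        abs_of_nonneg (by linarith)]
      exact (hY t ht.1 ht.2).norm_sub_le hN hB hs.1 hst le_rfl
    intro s hs t ht
    rcases le_total s t with h | h
    · exact key s hs t ht h
    · rw [dist_comm, dist_comm s t]; exact key t ht s hs h
  obtain ⟨g, hg, hgeq⟩ := hlip.extend_finite_dimension
  have hgc := hg.continuous
  have hgY : ∀ s t, 0 ≤ s → s ≤ t → t < b → g s = Y t s := fun s t hs hst htb => by
    rw [hYeq s t hs hst htb]; exact (hgeq ⟨hs, hst.trans_lt htb⟩).symm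
  have hlt : ∀ t ∈ Ico 0 b, g t = x₀ + ∫ s in (0 : ℝ)..t, N g s := fun t ht => by
    rw [hgY t t ht.1 le_rfl ht.2, (hY t ht.1 ht.2).eqn t ⟨ht.1, le_rfl⟩]
    congr 1
    exact intervalIntegral_congr_ae_Ico ht.1 (hN.causal t ht.1 _ _ (hY t ht.1 ht.2).cont hgc
      fun x hx hxt => (hgY x t hx hxt.le ht.2).symm)
  refine ⟨g, hgc, fun t ht => ?_⟩
  have hI : ContinuousOn (fun t => x₀ + ∫ s in (0 : ℝ)..t, N g s) (Icc 0 b) := by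
    have := intervalIntegral.continuousOn_primitive_interval' (μ := volume)
        (hN.intervalIntegrable hgc le_rfl hb.le) (left_mem_uIcc (a := 0) (b := b))
    rw [uIcc_of_le hb.le] at this
    exact continuousOn_const.add this
  have hcl : closure (Ico 0 b) = Icc 0 b := closure_Ico hb.ne
  have : EqOn g (fun t => x₀ + ∫ s in (0 : ℝ)..t, N g s) (Icc 0 b) :=
    EqOn.of_subset_closure (s := Ico 0 b) hlt hgc.continuousOn hI Ico_subset_Icc_self hcl.ge
  exact this ht

/-- Bounded velocity excludes blow-up: the supremum of the existence times is attained, and a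
solution can be continued beyond every time at which it exists. -/
theorem CausalLip.exists_sol [FiniteDimensional ℝ E] (hN : CausalLip N) (b : ℝ) :
    ∃ X, SolOn N x₀ b X := by
  have := FiniteDimensional.complete ℝ E
  have h00 : SolOn N x₀ 0 (fun _ => x₀) :=
    ⟨continuous_const, fun t ht => by simp [le_antisymm ht.2 ht.1]⟩
  by_contra hcon
  let S : Set ℝ := {t | 0 ≤ t ∧ ∃ X, SolOn N x₀ t X}
  have hSb : ∀ t ∈ S, t ≤ b := fun t ⟨_, X, hX⟩ => by
    by_contra h
    exact hcon ⟨X, hX.mono (le_of_not_ge h)⟩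
  have hS0 : (0 : ℝ) ∈ S := ⟨le_rfl, _, h00⟩
  have hbdd : BddAbove S := ⟨b, hSb⟩
  set c := sSup S
  have hc0 : 0 ≤ c := le_csSup hbdd hS0
  have hlt : ∀ t, 0 ≤ t → t < c → ∃ X, SolOn N x₀ t X := fun t _ htc => by
    obtain ⟨t', ⟨-, X, hX⟩, htt'⟩ := exists_lt_of_lt_csSup ⟨0, hS0⟩ htc
    exact ⟨X, hX.mono htt'.le⟩
  have hc : ∃ X, SolOn N x₀ c X := by
    rcases hc0.eq_or_lt with h | h
    · rw [← h]; exact ⟨_, h00⟩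
    · exact hN.exists_sol_of_lt h hlt
  obtain ⟨X, hX⟩ := hc
  obtain ⟨h, hh, X', hX'⟩ := hN.exists_extension hc0 hX
  have : c + h ≤ c := le_csSup hbdd ⟨by linarith, X', hX'⟩
  linarith

end Existence
end

/-! ### Derivatives of the errors as functions of funnel, output and internal state -/

noncomputable section

/-- The entry `j` of a finite sequence, and `0` beyond its end. -/
def nth {α : Type*} [Zero α] {k : ℕ} (x : Fin k → α) (j : ℕ) : α := if h : j < k then x ⟨j, h⟩ else 0

lemma nth_of_lt {α : Type*} [Zero α] {k : ℕ} (x : Fin k → α) {j : ℕ} (h : j < k) :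
    nth x j = x ⟨j, h⟩ := dif_pos h

lemma nth_of_ge {α : Type*} [Zero α] {k : ℕ} (x : Fin k → α) {j : ℕ} (h : k ≤ j) :
    nth x j = 0 := dif_neg (by omega)

@[simp] lemma nth_val {α : Type*} [Zero α] {k : ℕ} (x : Fin k → α) (j : Fin k) :
    nth x j = x j := dif_pos j.2

lemma contDiff_nth {𝓕 V : Type*} [NormedAddCommGroup 𝓕] [NormedSpace ℝ 𝓕] [NormedAddCommGroup V]
    [NormedSpace ℝ V] {k : ℕ} {x : 𝓕 → Fin k → V} {N : WithTop ℕ∞} (hx : ContDiff ℝ N x) (j : ℕ) :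
    ContDiff ℝ N fun v => nth (x v) j := by
  by_cases h : j < k
  · simp only [nth_of_lt _ h]
    exact (contDiff_pi.1 hx) _
  · simp only [nth_of_ge _ (not_lt.1 h)]
    exact contDiff_const

/-- The sequence in which every entry is a given function of the previous ones. -/
def recSeq {α : Type*} (next : (j : ℕ) → (Fin j → α) → α) : ℕ → α
  | j => next j fun k => recSeq next k
  decreasing_by exact k.2

lemma recSeq_eq {α : Type*} (next : (j : ℕ) → (Fin j → α) → α) (j : ℕ) :
    recSeq next j = next j fun k => recSeq next k := by rw [recSeq]

section JetSum

variable {V F : Type*} [NormedAddCommGroup V] [NormedSpace ℝ V] [NormedAddCommGroup F]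
  [NormedSpace ℝ F]

/-- Along a curve with derivatives `x 0, x 1, …`, this is `∑_{k < j} (d/dt)^{j-1-k} w k (x 0)`. -/
def jetSum (w : ℕ → V → F) : (j : ℕ) → (Fin j → V) → F
  | 0 => fun _ => 0
  | j + 1 => fun x => fderiv ℝ (jetSum w j) (fun k => x k.castSucc) (fun k => x k.succ) + w j (x 0)

/-- The jets whose base point lies in `Ω`. -/
def jetDom (Ω : Set V) (j : ℕ) : Set (Fin j → V) := {x | ∀ k : Fin j, (k : ℕ) = 0 → x k ∈ Ω}

omit [NormedSpace ℝ V] in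
lemma isOpen_jetDom {Ω : Set V} (hΩ : IsOpen Ω) (j : ℕ) : IsOpen (jetDom Ω j) := by
  have : jetDom Ω j = ⋂ k : Fin j, {x | (k : ℕ) = 0 → x k ∈ Ω} := by
    ext x; simp [jetDom]
  rw [this]
  refine isOpen_iInter_of_finite fun k => ?_
  by_cases h : (k : ℕ) = 0
  · simp only [h, true_imp_iff]
    exact hΩ.preimage (continuous_apply k)
  · simp [h]

lemma contDiffOn_jetSum {w : ℕ → V → F} {Ω : Set V} (hΩ : IsOpen Ω)
    (hw : ∀ j, ContDiffOn ℝ (⊤ : ℕ∞) (w j) Ω) (j : ℕ) :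
    ContDiffOn ℝ (⊤ : ℕ∞) (jetSum w j) (jetDom Ω j) := by
  induction j with
  | zero => exact contDiffOn_const
  | succ j ih =>
    have h1 : ContDiffOn ℝ (⊤ : ℕ∞) (fderiv ℝ (jetSum w j)) (jetDom Ω j) :=
      ih.fderiv_of_isOpen (isOpen_jetDom hΩ j) (by simp)
    have hc : ContDiff ℝ (⊤ : ℕ∞) (fun (x : Fin (j + 1) → V) (k : Fin j) => x k.castSucc) :=
      contDiff_pi.2 fun k => contDiff_apply _ _ _
    have hs : ContDiff ℝ (⊤ : ℕ∞) (fun (x : Fin (j + 1) → V) (k : Fin j) => x k.succ) :=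
      contDiff_pi.2 fun k => contDiff_apply _ _ _
    refine ContDiffOn.add ?_ ?_
    · exact (h1.comp hc.contDiffOn fun x (hx : x ∈ jetDom Ω (j + 1)) k hk => hx k.castSucc hk).clm_apply hs.contDiffOn
    · exact (hw j).comp (contDiff_apply _ _ _).contDiffOn fun x (hx : x ∈ jetDom Ω (j + 1)) => hx 0 rfl

/-- Passing from order j to j + 1 differentiates along the curve and adds w j; subtracting w j
leaves the derivative alone. -/
lemma hasDerivWithinAt_jetSum {w : ℕ → V → F} {Ω : Set V} (hΩ : IsOpen Ω)
    (hw : ∀ j, ContDiffOn ℝ (⊤ : ℕ∞) (w j) Ω) {j : ℕ} {c : ℕ → ℝ → V} {s : Set ℝ} {t : ℝ}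
    (hc : ∀ k < j, HasDerivWithinAt (c k) (c (k + 1) t) s t) (h0 : c 0 t ∈ Ω) :
    HasDerivWithinAt (fun x => jetSum w j fun k => c k x)
      (jetSum w (j + 1) (fun k => c k t) - w j (c 0 t)) s t := by
  have hmem : (fun k : Fin j => c k t) ∈ jetDom Ω j := fun k hk => by simpa [hk] using h0
  have hd : HasFDerivAt (jetSum w j) (fderiv ℝ (jetSum w j) (fun k : Fin j => c k t))
      (fun k : Fin j => c k t) :=
    (((contDiffOn_jetSum hΩ hw j).contDiffAt ((isOpen_jetDom hΩ j).mem_nhds hmem)).differentiableAt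
      (by simp)).hasFDerivAt
  have hcd : HasDerivWithinAt (fun x => fun k : Fin j => c k x) (fun k : Fin j => c (k + 1) t) s t :=
    hasDerivWithinAt_pi.2 fun k => hc k k.2
  have := hd.comp_hasDerivWithinAt t hcd
  convert! this using 1
  simp [jetSum]

end JetSum

/-- `(α + β h) e` with `h = 1 / (1 - (c φ)² ‖e‖²)`. -/
def gainTerm {m : ℕ} (c α β : ℝ) (v : ℝ × Vec m) : Vec m :=
  (α + β * (1 / (1 - (c * v.1) ^ 2 * ‖v.2‖ ^ 2))) • v.2

/-- The region of positive denominators. The cascade only demands that denominators do not vanish;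
positivity is recovered later by continuity from the initial time. -/
def gainDom (m : ℕ) (c : ℝ) : Set (ℝ × Vec m) := {v | (c * v.1) ^ 2 * ‖v.2‖ ^ 2 < 1}

lemma isOpen_gainDom (m : ℕ) (c : ℝ) : IsOpen (gainDom m c) :=
  isOpen_lt (by fun_prop) continuous_const

lemma contDiffOn_gainTerm {m : ℕ} (c α β : ℝ) :
    ContDiffOn ℝ (⊤ : ℕ∞) (gainTerm (m := m) c α β) (gainDom m c) := by
  have h2 : ContDiff ℝ (⊤ : ℕ∞) fun v : ℝ × Vec m => ‖v.2‖ ^ 2 := contDiff_snd.norm_sq ℝ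
  have h1 : ContDiff ℝ (⊤ : ℕ∞) fun v : ℝ × Vec m => 1 - (c * v.1) ^ 2 * ‖v.2‖ ^ 2 :=
    contDiff_const.sub (((contDiff_const.mul contDiff_fst).pow 2).mul h2)
  refine ContDiffOn.smul (contDiffOn_const.add (contDiffOn_const.mul
    (contDiffOn_const.div h1.contDiffOn fun v hv => ?_))) contDiff_snd.contDiffOn
  have : (c * v.1) ^ 2 * ‖v.2‖ ^ 2 < 1 := hv
  exact (sub_pos.2 this).ne'

/-- The coefficients of the interconnection, with `n + 1` compensators of order `n + 2`. -/
structure Coeff (m n : ℕ) where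
  a : ℕ → ℝ
  p : ℕ → ℝ
  c : Fin (n + 1) → ℝ
  G : Vec m →L[ℝ] Vec m
  K : Vec m →L[ℝ] Vec m
  R : ℕ → Vec m →L[ℝ] Vec m

abbrev Sig (m n : ℕ) : Type := Fin (n + 2) → Vec m

/-- The internal states of the interconnection. -/
abbrev InnerState (m n : ℕ) : Type := Fin (n + 1) → Fin (n + 2) → Vec m

/-- The derivatives of the funnel function, of the output, and the internal state. -/
abbrev Conf (m n : ℕ) : Type := (Fin (n + 2) → ℝ) × Sig m n × InnerState m n

namespace Coeff

variable {m n : ℕ} (C : Coeff m n)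

def w (i : Fin (n + 1)) (j : ℕ) : ℝ × Vec m → Vec m := gainTerm (C.c i) (C.a j) (C.p j)

lemma contDiffOn_w (i : Fin (n + 1)) (j : ℕ) :
    ContDiffOn ℝ (⊤ : ℕ∞) (C.w i j) (gainDom m (C.c i)) := contDiffOn_gainTerm _ _ _

/-- The derivatives of order `j` of the errors, from those of lower order. -/
def nextErr (θ : Conf m n) (j : ℕ) (prev : Fin j → Fin (n + 1) → Vec m) : Fin (n + 1) → Vec m :=
  let S : Fin (n + 1) → Vec m := fun i => jetSum (C.w i) j fun k => (nth θ.1 k, prev k i)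
  let o : Fin n → Vec m := fun i => nth (θ.2.2 i.succ) j + S i.castSucc - S i.succ
  Fin.cons (nth (θ.2.2 0) j - (if j = n + 1 then C.G (nth θ.2.1 j) else 0) - C.G (∑ i, o i)
    + ∑ k : Fin j, C.R (n + 2 - j + k) (nth θ.2.1 k + ∑ i, prev k i) - C.K (S 0)) o

/-- The derivatives of the errors `z_{i-1,1} - z_{i,1}`. -/
def err (θ : Conf m n) : ℕ → Fin (n + 1) → Vec m := recSeq (C.nextErr θ)

def jet (θ : Conf m n) (i : Fin (n + 1)) (k : ℕ) : ℝ × Vec m := (nth θ.1 k, C.err θ k i)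

/-- The derivatives of `y`. -/
def out (θ : Conf m n) (k : ℕ) : Vec m := nth θ.2.1 k + ∑ i, C.err θ k i

/-- The difference between the derivative of order `j` of `z_{i,1}` and `z_{i,j+1}`. -/
def lead (θ : Conf m n) (i : Fin (n + 1)) (j : ℕ) : Vec m := jetSum (C.w i) j fun k => C.jet θ i k

/-- The internal state with index i + 1 is the difference of the states of neighbouring
compensators; adding their leads turns states into derivatives of outputs. -/
lemma err_succ (θ : Conf m n) (j : ℕ) (i : Fin n) :
    C.err θ j i.succ = nth (θ.2.2 i.succ) j + C.lead θ i.castSucc j - C.lead θ i.succ j := by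
  rw [err, recSeq_eq]; rfl

/-- Solves X_{0,j} = y^{(j)} − ∑ R y^{(k)} − K Z_{0,j} − G z^{(j)} for e_0^{(j)}: write z_0^{(j)} =
K z_0^{(j)} + G z_0^{(j)}, replace the first term by K (Z_{0,j} + lead) and the second by G z^{(j)}
plus G applied to the later errors. For j = n + 1 the term G z^{(j)} is not part of X_{0,j} and has
to be subtracted here. -/
lemma err_zero (θ : Conf m n) (j : ℕ) :
    C.err θ j 0 = nth (θ.2.2 0) j - (if j = n + 1 then C.G (nth θ.2.1 j) else 0)
      - C.G (∑ i : Fin n, C.err θ j i.succ) + ∑ k : Fin j, C.R (n + 2 - j + k) (C.out θ k)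
      - C.K (C.lead θ 0 j) := by
  simp only [err_succ]
  rw [err, recSeq_eq]; rfl

lemma lead_zero (θ : Conf m n) (i : Fin (n + 1)) : C.lead θ i 0 = 0 := rfl

lemma err_succ_zero (θ : Conf m n) (i : Fin n) : C.err θ 0 i.succ = θ.2.2 i.succ 0 := by
  rw [err_succ, lead_zero, lead_zero, nth_of_lt _ (by omega)]; simp

lemma err_zero_zero (θ : Conf m n) :
    C.err θ 0 0 = θ.2.2 0 0 - C.G (∑ i : Fin n, θ.2.2 i.succ 0) := by
  rw [err_zero, lead_zero, nth_of_lt _ (by omega)]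
  simp [err_succ_zero]

/-- The configurations at which all gains are positive. -/
def confDom : Set (Conf m n) := {θ | ∀ i, C.jet θ i 0 ∈ gainDom m (C.c i)}

lemma contDiff_err_zero (i : Fin (n + 1)) :
    ContDiff ℝ (⊤ : ℕ∞) fun θ : Conf m n => C.err θ 0 i := by
  have h : ∀ (i : Fin (n + 1)) (j : Fin (n + 2)),
      ContDiff ℝ (⊤ : ℕ∞) fun θ : Conf m n => θ.2.2 i j := fun i j =>
    contDiff_pi.1 (contDiff_pi.1 (contDiff_snd.comp contDiff_snd) i) j
  refine Fin.cases ?_ (fun i => ?_) i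
  · simp only [err_zero_zero]
    exact (h 0 0).sub (C.G.contDiff.comp (ContDiff.sum fun i _ => h _ _))
  · simp only [err_succ_zero]
    exact h _ _

lemma contDiff_nth_fst (k : ℕ) : ContDiff ℝ (⊤ : ℕ∞) fun θ : Conf m n => nth θ.1 k :=
  contDiff_nth contDiff_fst k

lemma isOpen_confDom : IsOpen C.confDom := by
  have : C.confDom = ⋂ i, (fun θ => C.jet θ i 0) ⁻¹' gainDom m (C.c i) := by
    ext; simp [confDom]
  rw [this]
  exact isOpen_iInter_of_finite fun i => (isOpen_gainDom m (C.c i)).preimage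
    ((contDiff_nth_fst 0).continuous.prodMk (C.contDiff_err_zero i).continuous)

lemma contDiffOn_lead_of {i : Fin (n + 1)} {j : ℕ}
    (h : ∀ k < j, ContDiffOn ℝ (⊤ : ℕ∞) (fun θ => C.err θ k i) C.confDom) :
    ContDiffOn ℝ (⊤ : ℕ∞) (fun θ => C.lead θ i j) C.confDom := by
  have h1 : ContDiffOn ℝ (⊤ : ℕ∞) (fun (θ : Conf m n) (k : Fin j) => C.jet θ i k) C.confDom :=
    contDiffOn_pi.2 fun k => (contDiff_nth_fst k).contDiffOn.prodMk (h k k.2)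
  refine (contDiffOn_jetSum (isOpen_gainDom m (C.c i)) (C.contDiffOn_w i) j).comp h1 ?_
  intro θ hθ k hk
  simpa [hk] using hθ i

/-- Strong induction on the order: a lead of order j involves only errors of order below j, and is
smooth where the gains are positive. -/
lemma contDiffOn_err (j : ℕ) (i : Fin (n + 1)) :
    ContDiffOn ℝ (⊤ : ℕ∞) (fun θ => C.err θ j i) C.confDom := by
  induction j using Nat.strong_induction_on generalizing i with
  | _ j ih =>
  have hX : ∀ i : Fin (n + 1), ContDiffOn ℝ (⊤ : ℕ∞) (fun θ : Conf m n => nth (θ.2.2 i) j)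
      C.confDom := fun i =>
    (contDiff_nth (contDiff_pi.1 (contDiff_snd.comp contDiff_snd) i) j).contDiffOn
  have hξ : ∀ k : ℕ, ContDiffOn ℝ (⊤ : ℕ∞) (fun θ : Conf m n => nth θ.2.1 k) C.confDom := fun k =>
    (contDiff_nth (contDiff_fst.comp contDiff_snd) k).contDiffOn
  have hl : ∀ i, ContDiffOn ℝ (⊤ : ℕ∞) (fun θ => C.lead θ i j) C.confDom := fun i =>
    C.contDiffOn_lead_of fun k hk => ih k hk i
  have hs : ∀ i : Fin n, ContDiffOn ℝ (⊤ : ℕ∞) (fun θ => C.err θ j i.succ) C.confDom := fun i => by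
    simp only [err_succ]
    exact ((hX _).add (hl _)).sub (hl _)
  refine Fin.cases ?_ (fun i => hs i) i
  simp only [err_zero]
  refine ContDiffOn.sub (ContDiffOn.add (ContDiffOn.sub (ContDiffOn.sub (hX 0) ?_) ?_) ?_) ?_
  · split_ifs
    · exact C.G.contDiff.comp_contDiffOn (hξ j)
    · exact contDiffOn_const
  · exact C.G.contDiff.comp_contDiffOn (ContDiffOn.sum fun i _ => hs i)
  · exact ContDiffOn.sum fun k _ => (C.R _).contDiff.comp_contDiffOn
      ((hξ k).add (ContDiffOn.sum fun i _ => ih k k.2 i))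
  · exact C.K.contDiff.comp_contDiffOn (hl 0)

lemma contDiffOn_lead (j : ℕ) (i : Fin (n + 1)) :
    ContDiffOn ℝ (⊤ : ℕ∞) (fun θ => C.lead θ i j) C.confDom :=
  C.contDiffOn_lead_of fun k _ => C.contDiffOn_err k i

lemma contDiffOn_out (j : ℕ) : ContDiffOn ℝ (⊤ : ℕ∞) (fun θ => C.out θ j) C.confDom :=
  (contDiff_nth (contDiff_fst.comp contDiff_snd) j).contDiffOn.add
    (ContDiffOn.sum fun i _ => C.contDiffOn_err j i)

/-- The right-hand side of the internal dynamics; `v` is the value of `f(d, T(y,…))`. -/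
def field (θ : Conf m n) (v : Vec m) : InnerState m n :=
  -- The term R y is what remains when the sum ∑ R y^{(k)} is differentiated and its indices are
  -- shifted. The term −G z^{(n+1)} for j = n appears because X_{0,n+1} is defined without it. The
  -- value f(d, T(y,…)) enters the last component only, and u enters none.
  Fin.cons (fun j => nth (θ.2.2 0) (j + 1) + C.R (n + 1 - j) (C.out θ 0)
      - C.K (C.w 0 j (C.jet θ 0 0)) - (if (j : ℕ) = n then C.G (nth θ.2.1 (n + 1)) else 0)
      + if (j : ℕ) = n + 1 then v else 0)
    (fun i j => C.w i.castSucc j (C.jet θ i.castSucc 0) - C.w i.succ j (C.jet θ i.succ 0)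
      + nth (θ.2.2 i.succ) (j + 1))

/-- Along a trajectory, the entries of `err` are successive derivatives. -/
lemma hasDerivWithinAt_err {θ : ℝ → Conf m n} {s : Set ℝ} {t : ℝ} {v : Vec m}
    (hθ : θ t ∈ C.confDom)
    (hJ : ∀ k < n + 1, HasDerivWithinAt (fun x => nth (θ x).1 k) (nth (θ t).1 (k + 1)) s t)
    (hξ : ∀ k < n + 1, HasDerivWithinAt (fun x => nth (θ x).2.1 k) (nth (θ t).2.1 (k + 1)) s t)
    (hX : ∀ i, ∀ k < n + 1,
      HasDerivWithinAt (fun x => nth ((θ x).2.2 i) k) (nth (C.field (θ t) v i) k) s t)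
    (k : ℕ) (hk : k < n + 1) (i : Fin (n + 1)) :
    HasDerivWithinAt (fun x => C.err (θ x) k i) (C.err (θ t) (k + 1) i) s t := by
  induction k using Nat.strong_induction_on generalizing i with
  | _ k ih =>
  have hl : ∀ i, HasDerivWithinAt (fun x => C.lead (θ x) i k)
      (C.lead (θ t) i (k + 1) - C.w i k (C.jet (θ t) i 0)) s t := fun i =>
    hasDerivWithinAt_jetSum (isOpen_gainDom m (C.c i)) (C.contDiffOn_w i)
      (c := fun k x => C.jet (θ x) i k)
      (fun l hl => (hJ l (hl.trans hk)).prodMk (ih l hl (hl.trans hk) i)) (hθ i)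
  have hs : ∀ i : Fin n, HasDerivWithinAt (fun x => C.err (θ x) k i.succ)
      (C.err (θ t) (k + 1) i.succ) s t := fun i => by
    simp only [err_succ]
    have := ((hX i.succ k hk).add (hl i.castSucc)).sub (hl i.succ)
    refine this.congr_deriv ?_
    rw [nth_of_lt _ (by omega)]
    simp only [field, Fin.cons_succ]
    abel
  refine Fin.cases ?_ hs i
  have hkn : k ≠ n + 1 := hk.ne
  simp only [err_zero]
  have hout : ∀ l : Fin k, HasDerivWithinAt (fun x => C.out (θ x) l) (C.out (θ t) (l + 1)) s t :=
    fun l => (hξ l (l.2.trans hk)).add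
      (HasDerivWithinAt.fun_sum fun i _ => ih l l.2 (l.2.trans hk) i)
  have h1 := (((hX 0 k hk).sub (C.G.hasFDerivAt.comp_hasDerivWithinAt t
    (HasDerivWithinAt.fun_sum fun i (_ : i ∈ Finset.univ) => hs i))).add
    (HasDerivWithinAt.fun_sum fun (l : Fin k) (_ : l ∈ Finset.univ) =>
      (C.R (n + 2 - k + l)).hasFDerivAt.comp_hasDerivWithinAt t (hout l))).sub
    (C.K.hasFDerivAt.comp_hasDerivWithinAt t (hl 0))
  simp only [hkn, if_false, sub_zero]
  refine h1.congr_deriv ?_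
  rw [nth_of_lt _ (by omega), Fin.sum_univ_succ]
  simp only [field, Fin.cons_zero, hkn, if_false, Fin.val_zero, Fin.val_succ, map_sub, add_zero]
  have e1 : n + 2 - (k + 1) = n + 1 - k := by omega
  have e2 : ∀ l : Fin k, n + 1 - k + (l + 1 : ℕ) = n + 2 - k + l := fun l => by omega
  have e3 : (k + 1 = n + 1) = (k = n) := by simp
  simp only [e1, e2, e3]
  by_cases h : k = n
  · subst h; simp only [if_true]; abel
  · simp only [h, if_false]; abel

end Coeff
end

/-! ### Compact sets of configurations and saturation -/

noncomputable section

/-- The radial projection onto the ball of radius `ρ`. -/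
def projBall {F : Type*} [NormedAddCommGroup F] [NormedSpace ℝ F] (ρ : ℝ) (x : F) : F :=
  (ρ / max ρ ‖x‖) • x

section ProjBall

variable {F : Type*} [NormedAddCommGroup F] [NormedSpace ℝ F] {ρ : ℝ}

lemma projBall_of_le (hρ : 0 < ρ) {x : F} (hx : ‖x‖ ≤ ρ) : projBall ρ x = x := by
  rw [projBall, max_eq_left hx, div_self hρ.ne', one_smul]

lemma norm_projBall_le (hρ : 0 < ρ) (x : F) : ‖projBall ρ x‖ ≤ ρ := by
  have h : 0 < max ρ ‖x‖ := lt_max_of_lt_left hρ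
  rw [projBall, norm_smul, Real.norm_of_nonneg (by positivity), div_mul_eq_mul_div,
    div_le_iff₀ h]
  exact mul_le_mul_of_nonneg_left (le_max_right _ _) hρ.le

/-- One summand 1 comes from the displacement of the point, the other from the change of the scaling
factor. The constant 2 does not depend on the radius, which will vary in time with the funnel. -/
lemma norm_projBall_sub_le (hρ : 0 < ρ) (x y : F) :
    ‖projBall ρ x - projBall ρ y‖ ≤ 2 * ‖x - y‖ := by
  have hx : 0 < max ρ ‖x‖ := lt_max_of_lt_left hρ
  have hy : 0 < max ρ ‖y‖ := lt_max_of_lt_left hρ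
  have e : projBall ρ x - projBall ρ y = (ρ / max ρ ‖x‖) • (x - y)
      + (ρ * (max ρ ‖y‖ - max ρ ‖x‖) / (max ρ ‖x‖ * max ρ ‖y‖)) • y := by
    have : ρ * (max ρ ‖y‖ - max ρ ‖x‖) / (max ρ ‖x‖ * max ρ ‖y‖)
        = ρ / max ρ ‖x‖ - ρ / max ρ ‖y‖ := by field_simp
    rw [this, projBall, projBall, smul_sub, sub_smul]
    abel
  have h1 : ‖(ρ / max ρ ‖x‖) • (x - y)‖ ≤ ‖x - y‖ := by
    rw [norm_smul, Real.norm_of_nonneg (by positivity)]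
    exact mul_le_of_le_one_left (norm_nonneg _) ((div_le_one hx).2 (le_max_left _ _))
  have h2 : ‖(ρ * (max ρ ‖y‖ - max ρ ‖x‖) / (max ρ ‖x‖ * max ρ ‖y‖)) • y‖ ≤ ‖x - y‖ := by
    have h3 : |max ρ ‖y‖ - max ρ ‖x‖| ≤ ‖x - y‖ := by
      have := abs_max_sub_max_le_abs ‖y‖ ‖x‖ ρ
      rw [max_comm ρ, max_comm ρ]
      refine this.trans ?_
      rw [norm_sub_rev]
      exact abs_norm_sub_norm_le y x
    rw [norm_smul, norm_div, norm_mul, norm_mul, Real.norm_eq_abs, Real.norm_eq_abs,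
      Real.norm_eq_abs, Real.norm_eq_abs, abs_of_pos hρ, abs_of_pos hx, abs_of_pos hy,
      div_mul_eq_mul_div, div_le_iff₀ (by positivity)]
    calc ρ * |max ρ ‖y‖ - max ρ ‖x‖| * ‖y‖ ≤ max ρ ‖x‖ * ‖x - y‖ * max ρ ‖y‖ := by
          gcongr
          · exact le_max_left _ _
          · exact le_max_right _ _
      _ = _ := by ring
  rw [e]
  exact (norm_add_le _ _).trans (by linarith)

lemma Continuous.projBall {α : Type*} [TopologicalSpace α] {ρ : α → ℝ} {x : α → F}
    (hρ : Continuous ρ) (hx : Continuous x) (h0 : ∀ s, 0 < ρ s) :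
    Continuous fun s => projBall (ρ s) (x s) :=
  (hρ.div (hρ.max hx.norm) fun s => (lt_max_of_lt_left (h0 s)).ne').smul hx

end ProjBall

namespace Coeff

variable {m n : ℕ} (C : Coeff m n)

/-- The errors `z_{i-1,1} - z_{i,1}` as a linear function of the internal state. -/
def errs : InnerState m n →ₗ[ℝ] Fin (n + 1) → Vec m where
  toFun X := Fin.cons (X 0 0 - C.G (∑ i : Fin n, X i.succ 0)) fun i => X i.succ 0
  map_add' X Y := by
    ext i : 1
    refine Fin.cases ?_ (fun i => ?_) i
    · simp only [Fin.cons_zero, Pi.add_apply, Finset.sum_add_distrib, map_add]; abel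
    · simp only [Fin.cons_succ, Pi.add_apply]
  map_smul' r X := by
    ext i : 1
    refine Fin.cases ?_ (fun i => ?_) i
    · simp only [Fin.cons_zero, Pi.smul_apply, ← Finset.smul_sum, map_smul, smul_sub,
        RingHom.id_apply]
    · simp only [Fin.cons_succ, Pi.smul_apply, RingHom.id_apply]

lemma errs_zero (X : InnerState m n) : C.errs X 0 = X 0 0 - C.G (∑ i : Fin n, X i.succ 0) := rfl
lemma errs_succ (X : InnerState m n) (i : Fin n) : C.errs X i.succ = X i.succ 0 := rfl

lemma err_eq_errs (θ : Conf m n) (i : Fin (n + 1)) : C.err θ 0 i = C.errs θ.2.2 i := by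
  refine Fin.cases ?_ (fun i => ?_) i
  · rw [err_zero_zero, errs_zero]
  · rw [err_succ_zero, errs_succ]

/-- The internal state with errors `v.1` and the other entries taken from `v.2`. -/
def ofErrs : (Fin (n + 1) → Vec m) × InnerState m n →ₗ[ℝ] InnerState m n where
  toFun v := Fin.cons (Fin.cons (v.1 0 + C.G (∑ i : Fin n, v.1 i.succ)) fun j => v.2 0 j.succ)
    fun i => Fin.cons (v.1 i.succ) fun j => v.2 i.succ j.succ
  map_add' X Y := by
    ext i j : 2
    refine Fin.cases (Fin.cases ?_ (fun j => ?_) j) (fun i => Fin.cases ?_ (fun j => ?_) j) i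
    · simp only [Fin.cons_zero, Pi.add_apply, Prod.fst_add, Finset.sum_add_distrib, map_add]; abel
    all_goals simp
  map_smul' r X := by
    ext i j : 2
    refine Fin.cases (Fin.cases ?_ (fun j => ?_) j) (fun i => Fin.cases ?_ (fun j => ?_) j) i
    · simp only [Fin.cons_zero, Pi.smul_apply, Prod.smul_fst, ← Finset.smul_sum, map_smul,
        smul_add, RingHom.id_apply]
    all_goals simp

lemma ofErrs_zero_zero (v : (Fin (n + 1) → Vec m) × InnerState m n) :
    C.ofErrs v 0 0 = v.1 0 + C.G (∑ i : Fin n, v.1 i.succ) := rfl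
lemma ofErrs_succ_zero (v : (Fin (n + 1) → Vec m) × InnerState m n) (i : Fin n) :
    C.ofErrs v i.succ 0 = v.1 i.succ := rfl
lemma ofErrs_succ (v : (Fin (n + 1) → Vec m) × InnerState m n) (i : Fin (n + 1))
    (j : Fin (n + 1)) : C.ofErrs v i j.succ = v.2 i j.succ := by
  refine Fin.cases ?_ (fun i => ?_) i <;> rfl

lemma errs_ofErrs (v : (Fin (n + 1) → Vec m) × InnerState m n) : C.errs (C.ofErrs v) = v.1 := by
  ext i : 1
  refine Fin.cases ?_ (fun i => ?_) i
  · rw [errs_zero, ofErrs_zero_zero]; simp only [ofErrs_succ_zero]; abel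
  · rw [errs_succ, ofErrs_succ_zero]

lemma ofErrs_errs (X : InnerState m n) : C.ofErrs (C.errs X, X) = X := by
  ext i j : 2
  refine Fin.cases ?_ (fun j => C.ofErrs_succ _ i j) j
  refine Fin.cases ?_ (fun i => ?_) i
  · rw [ofErrs_zero_zero]; simp only [errs_zero, errs_succ]; abel
  · rw [ofErrs_succ_zero]; rfl

lemma mem_confDom {θ : Conf m n} :
    θ ∈ C.confDom ↔ ∀ i, (C.c i * θ.1 0) ^ 2 * ‖C.errs θ.2.2 i‖ ^ 2 < 1 := by
  refine forall_congr' fun i => ?_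
  rw [gainDom, mem_ofPred_eq, jet, err_eq_errs, nth_of_lt _ (by omega)]; rfl

/-- A compact set of configurations at which the gains are bounded. -/
def core (b ε R k : ℝ) : Set (Conf m n) :=
  {θ | ‖θ.1‖ ≤ b ∧ ‖θ.2.1‖ ≤ k ∧ (∀ i, ‖C.errs θ.2.2 i‖ ≤ R ∧
    |C.c i * θ.1 0| * ‖C.errs θ.2.2 i‖ ≤ 1 - ε) ∧ ∀ i (j : Fin (n + 1)), ‖θ.2.2 i j.succ‖ ≤ R}

lemma core_subset {b ε R k : ℝ} (hε : 0 < ε) : C.core b ε R k ⊆ C.confDom := by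
  intro θ hθ
  rw [mem_confDom]
  intro i
  rw [← mul_pow, ← sq_abs, abs_mul, abs_norm]
  have h := (hθ.2.2.1 i).2
  have h0 : 0 ≤ |C.c i * θ.1 0| * ‖C.errs θ.2.2 i‖ := by positivity
  nlinarith

lemma continuous_errs : Continuous C.errs := C.errs.continuous_of_finiteDimensional
lemma continuous_ofErrs : Continuous C.ofErrs := C.ofErrs.continuous_of_finiteDimensional

lemma isCompact_core (b ε R k : ℝ) : IsCompact (C.core b ε R k) := by
  refine Metric.isCompact_of_isClosed_isBounded ?_ ?_
  · have he : ∀ i, Continuous fun θ : Conf m n => C.errs θ.2.2 i := fun i =>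
      (continuous_apply i).comp (C.continuous_errs.comp (continuous_snd.comp continuous_snd))
    have hX : ∀ i j, Continuous fun θ : Conf m n => θ.2.2 i j := fun i j =>
      (continuous_apply j).comp ((continuous_apply i).comp (continuous_snd.comp continuous_snd))
    have hJ : Continuous fun θ : Conf m n => θ.1 0 := (continuous_apply 0).comp continuous_fst
    have : C.core b ε R k = {θ | ‖θ.1‖ ≤ b} ∩ ({θ | ‖θ.2.1‖ ≤ k} ∩
        ((⋂ i, ({θ | ‖C.errs θ.2.2 i‖ ≤ R} ∩ {θ | |C.c i * θ.1 0| * ‖C.errs θ.2.2 i‖ ≤ 1 - ε})) ∩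
        ⋂ i, ⋂ j : Fin (n + 1), {θ | ‖θ.2.2 i j.succ‖ ≤ R})) := by
      ext θ; simp [core]
    rw [this]
    refine (isClosed_le (by fun_prop) (by fun_prop)).inter
      ((isClosed_le (by fun_prop) (by fun_prop)).inter
      ((isClosed_iInter fun i => (isClosed_le (he i).norm continuous_const).inter
        (isClosed_le ((continuous_const.mul hJ).abs.mul (he i).norm) continuous_const)).inter
      (isClosed_iInter fun i => isClosed_iInter fun j =>
        isClosed_le (hX _ _).norm continuous_const)))
  · obtain ⟨L, hL0, hL⟩ : ∃ L, 0 ≤ L ∧ ∀ v, ‖C.ofErrs v‖ ≤ L * ‖v‖ :=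
      ⟨‖LinearMap.toContinuousLinearMap C.ofErrs‖, norm_nonneg _, fun v =>
        (LinearMap.toContinuousLinearMap C.ofErrs).le_opNorm v⟩
    refine isBounded_iff_forall_norm_le.2 ⟨max b (max k (L * max R 0)), fun θ hθ => ?_⟩
    obtain ⟨h1, h2, h3, h4⟩ := hθ
    rw [Prod.norm_def, Prod.norm_def]
    refine max_le_max h1 (max_le_max h2 ?_)
    -- The entries of order zero are not bounded directly. They are linear functions of the errors,
    -- so they can be discarded and restored by `ofErrs`.
    set X' : InnerState m n := fun i => Fin.cons 0 fun j => θ.2.2 i j.succ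
    have hX' : C.ofErrs (C.errs θ.2.2, X') = θ.2.2 := by
      conv_rhs => rw [← C.ofErrs_errs θ.2.2]
      ext i j : 2
      refine Fin.cases ?_ (fun j => ?_) j
      · refine Fin.cases ?_ (fun i => ?_) i <;> rfl
      · rw [ofErrs_succ, ofErrs_succ]; rfl
    rw [← hX']
    refine (hL _).trans (mul_le_mul_of_nonneg_left ?_ hL0)
    rw [Prod.norm_def]
    refine max_le ((pi_norm_le_iff_of_nonneg (le_max_right _ _)).2 fun i =>
      (h3 i).1.trans (le_max_left _ _)) ((pi_norm_le_iff_of_nonneg (le_max_right _ _)).2 fun i =>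
      (pi_norm_le_iff_of_nonneg (le_max_right _ _)).2 fun j => ?_)
    refine Fin.cases ?_ (fun j => ?_) j
    · simp [X']
    · exact (h4 i j).trans (le_max_left _ _)

/-- For a fixed value of the funnel function all conditions bound norms of linear functions of (ξ,
X). The products of |φ| with the errors are the reason for fixing the funnel entry. -/
lemma segment_subset_core {b ε R k : ℝ} {θ θ' : Conf m n} (h : θ ∈ C.core b ε R k)
    (h' : θ' ∈ C.core b ε R k) (hJ : θ.1 = θ'.1) : segment ℝ θ θ' ⊆ C.core b ε R k := by
  rintro _ ⟨s, t, hs, ht, hst, rfl⟩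
  have key : ∀ {V : Type} [NormedAddCommGroup V] [NormedSpace ℝ V] (x y : V) (r : ℝ),
      ‖x‖ ≤ r → ‖y‖ ≤ r → ‖s • x + t • y‖ ≤ r := by
    intro V _ _ x y r hx hy
    calc ‖s • x + t • y‖ ≤ s * ‖x‖ + t * ‖y‖ := by
          refine (norm_add_le _ _).trans ?_
          rw [norm_smul, norm_smul, Real.norm_of_nonneg hs, Real.norm_of_nonneg ht]
      _ ≤ s * r + t * r := by gcongr
      _ = r := by rw [← add_mul, hst, one_mul]
  have hJ' : (s • θ + t • θ').1 = θ.1 := by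
    simp only [Prod.fst_add, Prod.smul_fst, ← hJ, ← add_smul, hst, one_smul]
  refine ⟨by rw [hJ']; exact h.1, key _ _ _ h.2.1 h'.2.1, fun i => ?_, fun i j =>
    key _ _ _ (h.2.2.2 i j) (h'.2.2.2 i j)⟩
  have e : C.errs (s • θ + t • θ').2.2 i = s • C.errs θ.2.2 i + t • C.errs θ'.2.2 i := by
    simp [map_add, map_smul]
  rw [e, hJ']
  refine ⟨key _ _ _ (h.2.2.1 i).1 (h'.2.2.1 i).1, ?_⟩
  have h1 := (h.2.2.1 i).2
  have h2 := (h'.2.2.1 i).2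
  rw [← hJ] at h2
  have h3 : ‖s • C.errs θ.2.2 i + t • C.errs θ'.2.2 i‖
      ≤ s * ‖C.errs θ.2.2 i‖ + t * ‖C.errs θ'.2.2 i‖ := by
    refine (norm_add_le _ _).trans ?_
    rw [norm_smul, norm_smul, Real.norm_of_nonneg hs, Real.norm_of_nonneg ht]
  calc _ ≤ |C.c i * θ.1 0| * (s * ‖C.errs θ.2.2 i‖ + t * ‖C.errs θ'.2.2 i‖) := by gcongr
    _ = s * (|C.c i * θ.1 0| * ‖C.errs θ.2.2 i‖) + t * (|C.c i * θ.1 0| * ‖C.errs θ'.2.2 i‖) := by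
        ring
    _ ≤ s * (1 - ε) + t * (1 - ε) := by gcongr
    _ = 1 - ε := by rw [← add_mul, hst, one_mul]

/-- Smooth functions of the configuration are bounded and Lipschitz on the compact sets `core`. -/
lemma exists_lipschitz_core {F : Type*} [NormedAddCommGroup F] [NormedSpace ℝ F]
    {g : Conf m n → F} (hg : ContDiffOn ℝ (⊤ : ℕ∞) g C.confDom) (b : ℝ) {ε : ℝ} (hε : 0 < ε)
    (R k : ℝ) : ∃ L, 0 ≤ L ∧ (∀ θ ∈ C.core b ε R k, ‖g θ‖ ≤ L) ∧
      ∀ θ ∈ C.core b ε R k, ∀ θ' ∈ C.core b ε R k, θ.1 = θ'.1 → ‖g θ - g θ'‖ ≤ L * ‖θ - θ'‖ := by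
  have hsub := C.core_subset (b := b) (R := R) (k := k) hε
  obtain ⟨L₁, h1⟩ := (C.isCompact_core b ε R k).exists_bound_of_continuousOn
    (hg.continuousOn.mono hsub)
  have hc : ContinuousOn (fderiv ℝ g) (C.core b ε R k) :=
    (hg.continuousOn_fderiv_of_isOpen C.isOpen_confDom (by simp)).mono hsub
  obtain ⟨L₂, h2⟩ := (C.isCompact_core b ε R k).exists_bound_of_continuousOn hc
  refine ⟨max 0 (max L₁ L₂), le_max_left _ _, fun θ hθ => (h1 θ hθ).trans
    ((le_max_left _ _).trans (le_max_right _ _)), fun θ hθ θ' hθ' hJ => ?_⟩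
  have hseg := C.segment_subset_core hθ' hθ hJ.symm
  refine (convex_segment θ' θ).norm_image_sub_le_of_norm_fderiv_le (𝕜 := ℝ) (f := g)
    (fun x hx => ?_) (fun x hx => (h2 x (hseg hx)).trans
      ((le_max_right _ _).trans (le_max_right _ _))) (left_mem_segment ℝ θ' θ)
    (right_mem_segment ℝ θ' θ)
  exact (hg.contDiffAt (C.isOpen_confDom.mem_nhds (hsub (hseg hx)))).differentiableAt (by simp)

/-- The radius of the ball onto which the error `i` is projected. -/
def satRadius (ε R : ℝ) (i : Fin (n + 1)) (φ : ℝ) : ℝ := (1 - ε) / max |C.c i * φ| ((1 - ε) / R)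

lemma satRadius_pos {ε R : ℝ} (hε : ε < 1) (hR : 0 < R) (i : Fin (n + 1)) (φ : ℝ) :
    0 < C.satRadius ε R i φ := by
  have : 0 < (1 - ε) / R := div_pos (by linarith) hR
  exact div_pos (by linarith) (lt_max_of_lt_right this)

lemma satRadius_le {ε R : ℝ} (hε : ε < 1) (hR : 0 < R) (i : Fin (n + 1)) (φ : ℝ) :
    C.satRadius ε R i φ ≤ R := by
  have h : 0 < (1 - ε) / R := div_pos (by linarith) hR
  rw [satRadius, div_le_iff₀ (lt_max_of_lt_right h)]
  calc 1 - ε = R * ((1 - ε) / R) := by field_simp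
    _ ≤ _ := mul_le_mul_of_nonneg_left (le_max_right _ _) hR.le

lemma mul_satRadius_le {ε R : ℝ} (hε : ε < 1) (hR : 0 < R) (i : Fin (n + 1)) (φ : ℝ) :
    |C.c i * φ| * C.satRadius ε R i φ ≤ 1 - ε := by
  have h : 0 < (1 - ε) / R := div_pos (by linarith) hR
  rw [satRadius, mul_div_assoc', div_le_iff₀ (lt_max_of_lt_right h), mul_comm]
  exact mul_le_mul_of_nonneg_left (le_max_left _ _) (by linarith)

lemma le_satRadius {ε R : ℝ} (hε : ε < 1) (hR : 0 < R) {i : Fin (n + 1)} {φ x : ℝ} (hx0 : 0 ≤ x)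
    (hx : x ≤ R) (hx' : |C.c i * φ| * x ≤ 1 - ε) : x ≤ C.satRadius ε R i φ := by
  have h : 0 < (1 - ε) / R := div_pos (by linarith) hR
  rw [satRadius, le_div_iff₀ (lt_max_of_lt_right h), mul_max_of_nonneg _ _ hx0]
  refine max_le (by linarith) ?_
  rw [mul_div_assoc', div_le_iff₀ hR]
  nlinarith

/-- The minimum of R and (1 − ε)/|c_i φ| is written as one quotient with positive denominator; so it
is continuous even where φ vanishes, as it may at the initial time. -/
lemma continuous_satRadius {ε R : ℝ} (hε : ε < 1) (hR : 0 < R) (i : Fin (n + 1)) :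
    Continuous (C.satRadius ε R i) := by
  have h : 0 < (1 - ε) / R := div_pos (by linarith) hR
  exact continuous_const.div (by fun_prop) fun φ => (lt_max_of_lt_right h).ne'

/-- The configuration with the saturated signal and internal state. -/
def satConf (ε R k : ℝ) (J : Fin (n + 2) → ℝ) (w : Sig m n × InnerState m n) : Conf m n :=
  (J, fun j => projBall k (w.1 j),
    C.ofErrs (fun i => projBall (C.satRadius ε R i (J 0)) (C.errs w.2 i),
      fun i j => projBall R (w.2 i j)))

variable {C} {ε R k : ℝ}

lemma satConf_mem (hε : ε < 1) (hR : 0 < R) (hk : 0 < k) {b : ℝ}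
    {J : Fin (n + 2) → ℝ} (hJ : ‖J‖ ≤ b) (w : Sig m n × InnerState m n) :
    C.satConf ε R k J w ∈ C.core b ε R k := by
  refine ⟨hJ, (pi_norm_le_iff_of_nonneg hk.le).2 fun j => norm_projBall_le hk _, fun i => ?_,
    fun i j => ?_⟩
  · have e : C.errs (C.satConf ε R k J w).2.2 i
        = projBall (C.satRadius ε R i (J 0)) (C.errs w.2 i) := by
      rw [satConf, errs_ofErrs]
    have h := norm_projBall_le (C.satRadius_pos hε hR i (J 0)) (C.errs w.2 i)
    rw [e]
    exact ⟨h.trans (C.satRadius_le hε hR i _),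
      (mul_le_mul_of_nonneg_left h (abs_nonneg _)).trans (C.mul_satRadius_le hε hR i _)⟩
  · simp only [satConf, ofErrs_succ]
    exact norm_projBall_le hR _

lemma satConf_of_mem (hε : ε < 1) (hR : 0 < R) (hk : 0 < k) {b : ℝ}
    {J : Fin (n + 2) → ℝ} {w : Sig m n × InnerState m n} (h : (J, w) ∈ C.core b ε R k) :
    C.satConf ε R k J w = (J, w) := by
  obtain ⟨-, h2, h3, h4⟩ := h
  have e1 : (fun j => projBall k (w.1 j)) = w.1 := funext fun j =>
    projBall_of_le hk ((norm_le_pi_norm _ j).trans h2)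
  have e2 : (fun i => projBall (C.satRadius ε R i (J 0)) (C.errs w.2 i)) = C.errs w.2 :=
    funext fun i => projBall_of_le (C.satRadius_pos hε hR i _)
      (C.le_satRadius hε hR (norm_nonneg _) (h3 i).1 (h3 i).2)
  rw [satConf, e1, e2]
  refine Prod.ext rfl (Prod.ext rfl ?_)
  conv_rhs => rw [← C.ofErrs_errs w.2]
  ext i j : 2
  refine Fin.cases ?_ (fun j => ?_) j
  · refine Fin.cases ?_ (fun i => ?_) i <;> rfl
  · rw [ofErrs_succ]
    exact (C.ofErrs_succ _ i j).trans (projBall_of_le hR (h4 i j))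

lemma continuous_satConf (hε : ε < 1) (hR : 0 < R) (hk : 0 < k) :
    Continuous fun v : (Fin (n + 2) → ℝ) × (Sig m n × InnerState m n) =>
      C.satConf ε R k v.1 v.2 := by
  refine continuous_fst.prodMk (Continuous.prodMk ?_ (C.continuous_ofErrs.comp
    (Continuous.prodMk ?_ ?_)))
  · exact continuous_pi fun j => Continuous.projBall continuous_const (by fun_prop) fun _ => hk
  · refine continuous_pi fun i => Continuous.projBall
      ((C.continuous_satRadius hε hR i).comp (by fun_prop)) ?_ fun _ => C.satRadius_pos hε hR i _
    exact (continuous_apply i).comp (C.continuous_errs.comp (by fun_prop))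
  · exact continuous_pi fun i => continuous_pi fun j =>
      Continuous.projBall continuous_const (by fun_prop) fun _ => hR

lemma exists_lipschitz_satConf (hε : ε < 1) (hR : 0 < R) (hk : 0 < k) :
    ∃ L, 0 ≤ L ∧ ∀ J w w', ‖C.satConf ε R k J w - C.satConf ε R k J w'‖ ≤ L * ‖w - w'‖ := by
  obtain ⟨L₁, h10, h1⟩ : ∃ L, 0 ≤ L ∧ ∀ v, ‖C.ofErrs v‖ ≤ L * ‖v‖ :=
    ⟨‖LinearMap.toContinuousLinearMap C.ofErrs‖, norm_nonneg _, fun v =>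
      (LinearMap.toContinuousLinearMap C.ofErrs).le_opNorm v⟩
  obtain ⟨L₂, h20, h2⟩ : ∃ L, 0 ≤ L ∧ ∀ v, ‖C.errs v‖ ≤ L * ‖v‖ :=
    ⟨‖LinearMap.toContinuousLinearMap C.errs‖, norm_nonneg _, fun v =>
      (LinearMap.toContinuousLinearMap C.errs).le_opNorm v⟩
  refine ⟨2 + L₁ * (2 * L₂ + 2), by positivity, fun J w w' => ?_⟩
  have hw1 : ‖w.1 - w'.1‖ ≤ ‖w - w'‖ := norm_fst_le (w - w')
  have hw2 : ‖w.2 - w'.2‖ ≤ ‖w - w'‖ := norm_snd_le (w - w')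
  have h0 : 0 ≤ ‖w - w'‖ := norm_nonneg _
  have hL : 0 ≤ L₁ * (2 * L₂ + 2) * ‖w - w'‖ := by positivity
  simp only [satConf, Prod.mk_sub_mk, sub_self, ← map_sub]
  rw [Prod.norm_def, Prod.norm_def]
  simp only [norm_zero]
  refine max_le (by positivity) (max_le ((pi_norm_le_iff_of_nonneg (by positivity)).2 fun j => ?_)
    ((h1 _).trans ?_))
  · refine (norm_projBall_sub_le hk _ _).trans ?_
    have := norm_le_pi_norm (w.1 - w'.1) j
    rw [Pi.sub_apply] at this
    linarith
  · have : ‖((fun i => projBall (C.satRadius ε R i (J 0)) (C.errs w.2 i))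
        - fun i => projBall (C.satRadius ε R i (J 0)) (C.errs w'.2 i),
        (fun i j => projBall R (w.2 i j)) - fun i j => projBall R (w'.2 i j))‖
        ≤ (2 * L₂ + 2) * ‖w - w'‖ := by
      rw [Prod.norm_def]
      refine max_le ((pi_norm_le_iff_of_nonneg (by positivity)).2 fun i => ?_)
        ((pi_norm_le_iff_of_nonneg (by positivity)).2 fun i =>
        (pi_norm_le_iff_of_nonneg (by positivity)).2 fun j => ?_)
      · refine (norm_projBall_sub_le (C.satRadius_pos hε hR i _) _ _).trans ?_
        have e1 := norm_le_pi_norm (C.errs w.2 - C.errs w'.2) i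
        have e2 := h2 (w.2 - w'.2)
        rw [map_sub] at e2
        rw [Pi.sub_apply] at e1
        have : L₂ * ‖w.2 - w'.2‖ ≤ L₂ * ‖w - w'‖ := by gcongr
        linarith
      · refine (norm_projBall_sub_le hR _ _).trans ?_
        have e1 := norm_le_pi_norm ((w.2 - w'.2) i) j
        have e2 := norm_le_pi_norm (w.2 - w'.2) i
        simp only [Pi.sub_apply] at e1 e2
        have : 0 ≤ L₂ * ‖w - w'‖ := by positivity
        linarith
    calc _ ≤ L₁ * ((2 * L₂ + 2) * ‖w - w'‖) := mul_le_mul_of_nonneg_left this h10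
      _ ≤ _ := by linarith

/-- The part of the internal dynamics that is driven by `f(d, T(y,…))`. -/
def inj (v : Vec m) : InnerState m n :=
  Fin.cons (fun j => if (j : ℕ) = n + 1 then v else 0) fun _ _ => 0

/-- The value of f enters additively; the smooth part and the merely measurable part can be
estimated separately. -/
lemma field_eq (θ : Conf m n) (v : Vec m) : C.field θ v = C.field θ 0 + inj v := by
  ext i j : 2
  refine Fin.cases ?_ (fun i => ?_) i
  · simp only [field, inj, Fin.cons_zero, Pi.add_apply, ite_self, add_zero]
  · simp only [field, inj, Fin.cons_succ, Pi.add_apply, add_zero]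

lemma norm_inj_sub_le (v v' : Vec m) : ‖(inj v : InnerState m n) - inj v'‖ ≤ ‖v - v'‖ := by
  refine (pi_norm_le_iff_of_nonneg (norm_nonneg _)).2 fun i =>
    (pi_norm_le_iff_of_nonneg (norm_nonneg _)).2 fun j => ?_
  refine Fin.cases ?_ (fun i => ?_) i
  · simp only [inj, Fin.cons_zero, Pi.sub_apply]
    split_ifs <;> simp
  · simp [inj]

lemma inj_zero : (inj (0 : Vec m) : InnerState m n) = 0 := by
  ext i j : 2
  refine Fin.cases ?_ (fun i => ?_) i <;> simp [inj]

lemma continuous_inj : Continuous (inj : Vec m → InnerState m n) := by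
  refine (LipschitzWith.of_dist_le_mul (K := 1) fun v v' => ?_).continuous
  rw [dist_eq_norm, dist_eq_norm, NNReal.coe_one, one_mul]
  exact norm_inj_sub_le v v'

lemma contDiffOn_field : ContDiffOn ℝ (⊤ : ℕ∞) (fun θ => C.field θ 0) C.confDom := by
  have hX : ∀ (i : Fin (n + 1)) (j : ℕ), ContDiffOn ℝ (⊤ : ℕ∞)
      (fun θ : Conf m n => nth (θ.2.2 i) j) C.confDom := fun i j =>
    (contDiff_nth (contDiff_pi.1 (contDiff_snd.comp contDiff_snd) i) j).contDiffOn
  have hξ : ∀ k : ℕ, ContDiffOn ℝ (⊤ : ℕ∞) (fun θ : Conf m n => nth θ.2.1 k) C.confDom := fun k =>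
    (contDiff_nth (contDiff_fst.comp contDiff_snd) k).contDiffOn
  have hw : ∀ i j, ContDiffOn ℝ (⊤ : ℕ∞) (fun θ => C.w i j (C.jet θ i 0)) C.confDom := fun i j =>
    (C.contDiffOn_w i j).comp ((contDiff_nth_fst 0).contDiffOn.prodMk (C.contDiffOn_err 0 i))
      fun θ hθ => hθ i
  refine contDiffOn_pi.2 fun i => contDiffOn_pi.2 fun j => ?_
  refine Fin.cases ?_ (fun i => ?_) i
  · simp only [field, Fin.cons_zero, ite_self, add_zero]
    refine ContDiffOn.sub (ContDiffOn.sub (ContDiffOn.add (hX _ _) ?_) ?_) ?_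
    · exact (C.R _).contDiff.comp_contDiffOn (C.contDiffOn_out 0)
    · exact C.K.contDiff.comp_contDiffOn (hw _ _)
    · split_ifs
      · exact C.G.contDiff.comp_contDiffOn (hξ _)
      · exact contDiffOn_const
  · simp only [field, Fin.cons_succ]
    exact ((hw _ _).sub (hw _ _)).add (hX _ _)

/-- The values `(y, y', …)`. -/
def outs (C : Coeff m n) (θ : Conf m n) : Sig m n := fun j => C.out θ j

lemma contDiffOn_outs : ContDiffOn ℝ (⊤ : ℕ∞) C.outs C.confDom :=
  contDiffOn_pi.2 fun j => C.contDiffOn_out j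

end Coeff
end

/-! ### The plant with its history, and the saturated internal dynamics -/

noncomputable section

lemma MemLinf.exists_ae_bound {F : Type*} [NormedAddCommGroup F] {g : ℝ → F} (hg : MemLinf g) :
    ∃ D, ∀ᵐ s ∂volume.restrict (Ici (0 : ℝ)), ‖g s‖ ≤ D := by
  have h := hg.2
  rw [eLpNorm_exponent_top] at h
  refine ⟨(eLpNormEssSup g (volume.restrict (Ici 0))).toReal, ?_⟩
  filter_upwards [ae_le_eLpNormEssSup (f := g) (μ := volume.restrict (Ici (0 : ℝ)))] with s hs
  have := ENNReal.toReal_mono h.ne hs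
  simpa using this

lemma ae_restrict_Ico_of_Ici {t b : ℝ} (ht : 0 ≤ t) {p : ℝ → Prop}
    (h : ∀ᵐ s ∂volume.restrict (Ici (0 : ℝ)), p s) : ∀ᵐ s ∂volume.restrict (Ico t b), p s :=
  ae_restrict_of_ae_restrict_of_subset (fun _ hx => ht.trans hx.1) h

/-- The interconnection: its coefficients, the system functions, the derivatives `J` of the funnel
function, the history of `(y, y', …)` and the initial internal state. -/
structure Sys (m n l q : ℕ) extends Coeff m n where
  τ : ℝ
  d : ℝ → Vec l
  f : Vec l × Vec q → Vec m
  T : Op τ (n + 2) m q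
  J : ℝ → Fin (n + 2) → ℝ
  hist : ℝ → Sig m n
  x₀ : InnerState m n

structure Sys.Regular {m n l q : ℕ} (S : Sys m n l q) : Prop where
  op : OpClass S.τ S.T
  first : BoundedByFirst S.τ 1 S.T
  d_bdd : MemLinf S.d
  f_cont : Continuous S.f
  f_lip : LocLipSnd S.f
  J_cont : Continuous S.J
  J_bdd : ∃ b, ∀ t, ‖S.J t‖ ≤ b
  hist_cont : Continuous S.hist
  hist_bdd : ∃ b, ∀ t, ‖S.hist t‖ ≤ b
  init : ∀ ξ, (S.J 0, ξ, S.x₀) ∈ S.confDom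

namespace Sys

variable {m n l q : ℕ} (S : Sys m n l q)

open Classical in
/-- The argument of `T` that continues the history by `g`. -/
def argMap (g : ℝ → Sig m n) : C(Ici (-S.τ), Sig m n) :=
  -- Subtracting g 0 keeps the argument of T continuous even if g does not start where the history
  -- ends, as may happen for saturated trial functions. Along genuine solutions the history ends at
  -- g 0 and the correction cancels.
  if h : Continuous fun t : Ici (-S.τ) => S.hist (min t 0) + g (max (t : ℝ) 0) - g 0 then
    ⟨_, h⟩ else 0

/-- `f(d, T(y, y', …))` for the continuation `g` of the history. -/
def drive (g : ℝ → Sig m n) (s : ℝ) : Vec m := S.f (S.d s, S.T (S.argMap g) s)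

variable {S} (hS : S.Regular)
include hS

lemma argMap_apply {g : ℝ → Sig m n} (hg : Continuous g) (t : Ici (-S.τ)) :
    S.argMap g t = S.hist (min t 0) + g (max (t : ℝ) 0) - g 0 := by
  have : Continuous fun t : Ici (-S.τ) => S.hist (min t 0) + g (max (t : ℝ) 0) - g 0 :=
    ((hS.hist_cont.comp (by fun_prop)).add (hg.comp (by fun_prop))).sub continuous_const
  rw [argMap, dif_pos this]; rfl

lemma argMap_of_nonneg {g : ℝ → Sig m n} (hg : Continuous g) {t : Ici (-S.τ)} (ht : 0 ≤ (t : ℝ)) :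
    S.argMap g t = S.hist 0 + g t - g 0 := by
  rw [argMap_apply hS hg, min_eq_right ht, max_eq_left ht]

lemma aestronglyMeasurable_drive (g : ℝ → Sig m n) (b : ℝ) :
    AEStronglyMeasurable (S.drive g) (volume.restrict (Ico 0 b)) := by
  have h1 : AEStronglyMeasurable S.d (volume.restrict (Ico 0 b)) :=
    hS.d_bdd.1.mono_measure (Measure.restrict_mono (fun _ hx => hx.1) le_rfl)
  have h2 : AEStronglyMeasurable (S.T (S.argMap g)) (volume.restrict (Ico 0 b)) :=
    (hS.op.loc (S.argMap g) b).1.mono_measure (Measure.restrict_mono Ico_subset_Icc_self le_rfl)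
  exact hS.f_cont.comp_aestronglyMeasurable (h1.prodMk h2)

/-- This is where membership in 𝒩_1 enters: bounding the first component, y itself, bounds T. The
higher derivatives of y involve the gains, which are not yet under control when this is needed. -/
lemma exists_bound_op (B : ℝ) : ∃ V, ∀ g : ℝ → Sig m n, Continuous g →
    (∀ s, 0 ≤ s → ‖g s 0‖ ≤ B) →
    ∀ᵐ s ∂volume.restrict (Ici (0 : ℝ)), ‖S.d s‖ ≤ V ∧ ‖S.T (S.argMap g) s‖ ≤ V := by
  obtain ⟨H, hH⟩ := hS.hist_bdd
  obtain ⟨D, hD⟩ := hS.d_bdd.exists_ae_bound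
  obtain ⟨c₂, -, h⟩ := hS.first (max 1 (H + B + B)) (by positivity)
  refine ⟨max D c₂, fun g hg hB => ?_⟩
  have hbd : ∀ t, ∀ i : Fin (n + 2), (i : ℕ) < 1 → ‖S.argMap g t i‖ ≤ max 1 (H + B + B) := by
    intro t i hi
    have hi0 : i = 0 := Fin.ext (by simpa using hi)
    rw [hi0, argMap_apply hS hg]
    refine le_trans ?_ (le_max_right _ _)
    have e1 : ‖S.hist (min t 0) 0‖ ≤ H := (norm_le_pi_norm _ _).trans (hH _)
    have e2 := hB (max (t : ℝ) 0) (le_max_right _ _)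
    have e3 := hB 0 le_rfl
    calc ‖S.hist (min t 0) 0 + g (max (t : ℝ) 0) 0 - g 0 0‖
        ≤ ‖S.hist (min t 0) 0 + g (max (t : ℝ) 0) 0‖ + ‖g 0 0‖ := norm_sub_le _ _
      _ ≤ ‖S.hist (min t 0) 0‖ + ‖g (max (t : ℝ) 0) 0‖ + ‖g 0 0‖ := by gcongr; exact norm_add_le _ _
      _ ≤ _ := by gcongr
  filter_upwards [hD, h (S.argMap g) hbd] with s h1 h2
  exact ⟨h1.trans (le_max_left _ _), h2.trans (le_max_right _ _)⟩

lemma exists_bound_drive (B : ℝ) : ∃ V, 0 ≤ V ∧ ∀ g : ℝ → Sig m n, Continuous g →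
    (∀ s, 0 ≤ s → ‖g s 0‖ ≤ B) →
    ∀ᵐ s ∂volume.restrict (Ici (0 : ℝ)), ‖S.drive g s‖ ≤ V := by
  obtain ⟨V, hV⟩ := exists_bound_op hS B
  obtain ⟨C, hC⟩ := (isCompact_closedBall (0 : Vec l × Vec q) V).exists_bound_of_continuousOn
    hS.f_cont.continuousOn
  refine ⟨max 0 C, le_max_left _ _, fun g hg hB => ?_⟩
  filter_upwards [hV g hg hB] with s hs
  refine (hC _ ?_).trans (le_max_right _ _)
  rw [mem_closedBall_zero_iff, Prod.norm_def]
  exact max_le hs.1 hs.2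

lemma drive_causal {t : ℝ} (ht : 0 ≤ t) {g g' : ℝ → Sig m n} (hg : Continuous g)
    (hg' : Continuous g') (h : ∀ s, 0 ≤ s → s < t → g s = g' s) :
    ∀ᵐ s ∂volume.restrict (Ico 0 t), S.drive g s = S.drive g' s := by
  rcases ht.eq_or_lt with rfl | ht'
  · simp
  have he : ∀ s : Ici (-S.τ), (s : ℝ) < t → S.argMap g s = S.argMap g' s := fun s hs => by
    rw [argMap_apply hS hg, argMap_apply hS hg', h 0 le_rfl ht',
      h _ (le_max_right _ _) (max_lt hs ht')]
  filter_upwards [hS.op.causal t ht (S.argMap g) (S.argMap g') he] with s hs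
  rw [drive, drive, hs]

/-- f is Lipschitz in its second argument on bounded sets only; the common bound B on the first
components places all values of d and T in one ball, after which the local Lipschitz constant of T
is multiplied by that of f. -/
lemma drive_lip (B : ℝ) {t : ℝ} (ht : 0 ≤ t) {g : ℝ → Sig m n} (hg : Continuous g) :
    ∃ Δ > 0, ∃ δ > 0, ∃ L > 0, ∀ g₁ g₂ : ℝ → Sig m n, Continuous g₁ → Continuous g₂ →
      (∀ s, 0 ≤ s → ‖g₁ s 0‖ ≤ B) → (∀ s, 0 ≤ s → ‖g₂ s 0‖ ≤ B) →
      (∀ s, 0 ≤ s → s ≤ t → g₁ s = g s ∧ g₂ s = g s) →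
      (∀ s ∈ Icc t (t + Δ), ‖g₁ s - g t‖ < δ ∧ ‖g₂ s - g t‖ < δ) →
      ∀ M, (∀ s ∈ Icc t (t + Δ), ‖g₁ s - g₂ s‖ ≤ M) →
        ∀ᵐ s ∂volume.restrict (Ico t (t + Δ)), ‖S.drive g₁ s - S.drive g₂ s‖ ≤ L * M := by
  obtain ⟨V, hV⟩ := exists_bound_op hS B
  obtain ⟨Lf, hLf⟩ := hS.f_lip V
  have hτt : -S.τ ≤ t := by linarith [hS.op.pos]
  obtain ⟨Δ, hΔ, δ, hδ, c, hc, H⟩ := hS.op.lip t hτt ht (S.argMap g)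
  refine ⟨Δ, hΔ, δ, hδ, (|Lf| + 1) * c, by positivity,
    fun g₁ g₂ hg₁ hg₂ hB₁ hB₂ heq hcl M hM => ?_⟩
  have hT := H (S.argMap g₁) (S.argMap g₂) (fun s hs => ?_) (fun s hs => ?_) M (fun s hs => ?_)
  · filter_upwards [ae_restrict_Icc_iff_Ico.1 hT, ae_restrict_Ico_of_Ici ht (hV g₁ hg₁ hB₁),
      ae_restrict_Ico_of_Ici ht (hV g₂ hg₂ hB₂)] with s h1 h2 h3
    refine (hLf _ _ _ h2.1 h2.2 h3.2).trans ?_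
    have h4 : Lf ≤ |Lf| + 1 := by linarith [le_abs_self Lf]
    calc Lf * ‖S.T (S.argMap g₁) s - S.T (S.argMap g₂) s‖
        ≤ (|Lf| + 1) * (c * M) := by gcongr
      _ = _ := by ring
  · have e : ∀ s, 0 ≤ s → s ≤ t → g₁ s = g s ∧ g₂ s = g s := heq
    have hm : max (s : ℝ) 0 ≤ t := max_le hs ht
    rw [argMap_apply hS hg₁, argMap_apply hS hg₂, argMap_apply hS hg,
      (e _ (le_max_right _ _) hm).1, (e _ (le_max_right _ _) hm).2, (e 0 le_rfl ht).1,
      (e 0 le_rfl ht).2]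
    exact ⟨rfl, rfl⟩
  · have hs0 : 0 ≤ (s : ℝ) := ht.trans hs.1
    rw [argMap_of_nonneg hS hg₁ hs0, argMap_of_nonneg hS hg₂ hs0,
      argMap_of_nonneg hS hg (t := ⟨t, hτt⟩) ht, (heq 0 le_rfl ht).1, (heq 0 le_rfl ht).2,
      sub_sub_sub_cancel_right, sub_sub_sub_cancel_right, add_sub_add_left_eq_sub,
      add_sub_add_left_eq_sub]
    exact hcl s hs
  · have hs0 : 0 ≤ (s : ℝ) := ht.trans hs.1
    rw [argMap_of_nonneg hS hg₁ hs0, argMap_of_nonneg hS hg₂ hs0, (heq 0 le_rfl ht).1,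
      (heq 0 le_rfl ht).2, sub_sub_sub_cancel_right, add_sub_add_left_eq_sub]
    exact hM s hs

omit hS in
variable (S) in
/-- The right-hand side of the internal dynamics, with saturated arguments. -/
def satOp (ε R k : ℝ) (w : ℝ → Sig m n × InnerState m n) (s : ℝ) : InnerState m n :=
  S.field (S.satConf ε R k (S.J s) (w s))
    (S.drive (fun s => S.outs (S.satConf ε R k (S.J s) (w s))) s)

omit hS in
lemma continuous_satConf_comp (hJ : Continuous S.J) {ε R k : ℝ} (hε : ε < 1) (hR : 0 < R)
    (hk : 0 < k) {w : ℝ → Sig m n × InnerState m n} (hw : Continuous w) :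
    Continuous fun s => S.satConf ε R k (S.J s) (w s) :=
  (Coeff.continuous_satConf hε hR hk).comp (hJ.prodMk hw)

lemma continuous_outs_satConf {ε R k : ℝ} (hε0 : 0 < ε) (hε : ε < 1) (hR : 0 < R)
    (hk : 0 < k) {w : ℝ → Sig m n × InnerState m n} (hw : Continuous w) :
    Continuous fun s => S.outs (S.satConf ε R k (S.J s) (w s)) :=
  S.contDiffOn_outs.continuousOn.comp_continuous (continuous_satConf_comp hS.J_cont hε hR hk hw)
    fun _ => S.core_subset hε0 (Coeff.satConf_mem hε hR hk le_rfl _)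

/-- Saturation confines the configurations to a compact core, where the smooth maps `outs` and
`field` are bounded and Lipschitz. In particular y is bounded, hence so is f(d, T(y,…)). Causality
and the local Lipschitz property are then inherited from T. -/
theorem causalLip_satOp {ε R k : ℝ} (hε0 : 0 < ε) (hε : ε < 1) (hR : 0 < R) (hk : 0 < k) :
    CausalLip (S.satOp ε R k) := by
  obtain ⟨b, hb⟩ := hS.J_bdd
  have hmem : ∀ s w, S.satConf ε R k (S.J s) w ∈ S.core b ε R k := fun s w =>
    Coeff.satConf_mem hε hR hk (hb s) w
  obtain ⟨Lo, hLo0, hLob, hLo⟩ := S.exists_lipschitz_core S.contDiffOn_outs b hε0 R k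
  obtain ⟨LF, hLF0, hLFb, hLF⟩ := S.exists_lipschitz_core S.contDiffOn_field b hε0 R k
  obtain ⟨Ls, hLs0, hLs⟩ := Coeff.exists_lipschitz_satConf (C := S.toCoeff) hε hR hk
  have hgb : ∀ w : ℝ → Sig m n × InnerState m n, ∀ s, 0 ≤ s →
      ‖S.outs (S.satConf ε R k (S.J s) (w s)) 0‖ ≤ Lo := fun w s _ =>
    (norm_le_pi_norm _ _).trans (hLob _ (hmem s _))
  have hgc := fun {w : ℝ → Sig m n × InnerState m n} (hw : Continuous w) =>
    continuous_outs_satConf hS hε0 hε hR hk hw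
  refine ⟨fun w hw b' => ?_, ?_, fun t ht w w' hw hw' h => ?_, fun t ht w hw => ?_⟩
  · have h1 : Continuous fun s => S.field (S.satConf ε R k (S.J s) (w s)) 0 :=
      S.contDiffOn_field.continuousOn.comp_continuous
        (continuous_satConf_comp hS.J_cont hε hR hk hw)
        fun s => S.core_subset hε0 (hmem s _)
    have h2 := Coeff.continuous_inj (n := n) |>.comp_aestronglyMeasurable
      (aestronglyMeasurable_drive hS (fun s => S.outs (S.satConf ε R k (S.J s) (w s))) b')
    refine (h1.aestronglyMeasurable.add h2).congr (Filter.Eventually.of_forall fun s => ?_)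
    exact (Coeff.field_eq _ _).symm
  · obtain ⟨V, hV0, hV⟩ := exists_bound_drive hS Lo
    refine ⟨LF + V + 1, by positivity, fun w hw b' => ?_⟩
    filter_upwards [ae_restrict_Ico_of_Ici le_rfl (hV _ (hgc hw) (hgb w))] with s hs
    rw [satOp, Coeff.field_eq]
    refine (norm_add_le _ _).trans ?_
    have h1 := hLFb _ (hmem s (w s))
    have h2 := Coeff.norm_inj_sub_le (n := n)
      (S.drive (fun s => S.outs (S.satConf ε R k (S.J s) (w s))) s) 0
    rw [Coeff.inj_zero, sub_zero, sub_zero] at h2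
    linarith
  · filter_upwards [drive_causal hS ht (hgc hw) (hgc hw') fun s hs hst => by rw [h s hs hst],
      ae_restrict_mem measurableSet_Ico] with s hs hst
    rw [satOp, satOp, hs, h s hst.1 hst.2]
  · obtain ⟨Δ, hΔ, δ, hδ, L, hL, H⟩ := drive_lip hS Lo ht (hgc hw)
    have hj : Continuous fun v : ℝ × (Sig m n × InnerState m n) =>
        S.outs (S.satConf ε R k (S.J v.1) v.2) :=
      S.contDiffOn_outs.continuousOn.comp_continuous
        ((Coeff.continuous_satConf hε hR hk).comp
          ((hS.J_cont.comp continuous_fst).prodMk continuous_snd))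
        fun v => S.core_subset hε0 (hmem v.1 v.2)
    obtain ⟨η, hη, hcl⟩ := Metric.continuousAt_iff.1 (hj.continuousAt (x := (t, w t))) δ hδ
    have hΔ' : 0 < min Δ (η / 2) := by positivity
    refine ⟨min Δ (η / 2), hΔ', η, hη, (LF * Ls + L * (Lo * Ls) + 1), by positivity,
      fun w₁ w₂ hw₁ hw₂ heq hcl' M hM => ?_⟩
    have hM0 : 0 ≤ M := (norm_nonneg _).trans (hM t ⟨le_rfl, by linarith⟩)
    have hconf : ∀ s ∈ Icc t (t + min Δ (η / 2)),
        ‖S.satConf ε R k (S.J s) (w₁ s) - S.satConf ε R k (S.J s) (w₂ s)‖ ≤ Ls * M :=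
      fun s hs => (hLs _ _ _).trans (mul_le_mul_of_nonneg_left (hM s hs) hLs0)
    set T' := t + min Δ (η / 2) with hT'
    have hT't : t ≤ T' := by linarith
    -- The Lipschitz estimate of `drive` asks for closeness on all of [t, t + Δ], but `outs` varies
    -- with time also through the funnel. Its arguments are therefore frozen after the shorter time
    -- T', and causality undoes this before T'.
    set v : (ℝ → Sig m n × InnerState m n) → ℝ → Sig m n := fun w s =>
      S.outs (S.satConf ε R k (S.J (min s T')) (w (min s T'))) with hv
    have hvc : ∀ {w : ℝ → Sig m n × InnerState m n}, Continuous w → Continuous (v w) := fun hw =>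
      (hgc hw).comp (continuous_id.min continuous_const)
    have hmin : ∀ s ∈ Icc t (t + Δ), min s T' ∈ Icc t T' := fun s hs =>
      ⟨le_min hs.1 hT't, min_le_right _ _⟩
    have hclose : ∀ w' : ℝ → Sig m n × InnerState m n,
        (∀ s ∈ Icc t T', ‖w' s - w t‖ < η) → ∀ s ∈ Icc t (t + Δ),
        ‖v w' s - S.outs (S.satConf ε R k (S.J t) (w t))‖ < δ := by
      intro w' hw' s hs
      have h1 := hmin s hs
      rw [← dist_eq_norm]
      refine @hcl (min s T', w' (min s T')) ?_
      rw [Prod.dist_eq, Real.dist_eq, abs_of_nonneg (by linarith [h1.1]), dist_eq_norm]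
      refine max_lt ?_ (hw' _ h1)
      have := h1.2
      have : T' ≤ t + η / 2 := by rw [hT']; linarith [min_le_right Δ (η / 2)]
      linarith
    have hvb : ∀ w' s, ‖v w' s 0‖ ≤ Lo := fun w' s =>
      (norm_le_pi_norm _ _).trans (hLob _ (hmem _ _))
    have hvl : ∀ s ∈ Icc t (t + Δ), ‖v w₁ s - v w₂ s‖ ≤ Lo * (Ls * M) := fun s hs =>
      (hLo _ (hmem (min s T') (w₁ (min s T'))) _ (hmem (min s T') (w₂ (min s T'))) rfl).trans
        (mul_le_mul_of_nonneg_left (hconf _ (hmin s hs)) hLo0)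
    have key := H (v w₁) (v w₂) (hvc hw₁) (hvc hw₂) (fun s _ => hvb w₁ s) (fun s _ => hvb w₂ s)
      (fun s hs hst => by
        simp only [hv, min_eq_left (hst.trans hT't), (heq s hs hst).1, (heq s hs hst).2, and_self])
      (fun s hs => ⟨hclose w₁ (fun s hs => (hcl' s hs).1) s hs,
        hclose w₂ (fun s hs => (hcl' s hs).2) s hs⟩) (Lo * (Ls * M)) hvl
    have hvd : ∀ w' : ℝ → Sig m n × InnerState m n, Continuous w' →
        ∀ᵐ s ∂volume.restrict (Ico t T'), S.drive (v w') s =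
        S.drive (fun s => S.outs (S.satConf ε R k (S.J s) (w' s))) s := fun w' hw' =>
      ae_restrict_Ico_mono ht le_rfl (drive_causal hS (ht.trans hT't) (hvc hw') (hgc hw')
        fun s _ hs => by simp only [hv, min_eq_left hs.le])
    filter_upwards [ae_restrict_Ico_mono le_rfl (by rw [hT']; linarith [min_le_left Δ (η / 2)]) key,
      hvd w₁ hw₁, hvd w₂ hw₂, ae_restrict_mem measurableSet_Ico] with s h1 h2 h3 h4
    rw [h2, h3] at h1
    rw [satOp, satOp, Coeff.field_eq, Coeff.field_eq (C := S.toCoeff) (S.satConf ε R k (S.J s) (w₂ s)),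
      add_sub_add_comm]
    refine (norm_add_le _ _).trans ?_
    have h5 := (hLF _ (hmem s (w₁ s)) _ (hmem s (w₂ s)) rfl).trans
      (mul_le_mul_of_nonneg_left (hconf s ⟨h4.1, h4.2.le⟩) hLF0)
    have h6 := (Coeff.norm_inj_sub_le (n := n) _ _).trans h1
    calc _ ≤ LF * (Ls * M) + L * (Lo * (Ls * M)) := add_le_add h5 h6
      _ ≤ _ := by nlinarith

end Sys
end

/-! ### Well-posedness of the internal dynamics, and the operator T̃ -/

noncomputable section

namespace Coeff

variable {m n : ℕ} {C : Coeff m n}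

lemma core_mono {b b' ε ε' R R' k k' : ℝ} (hb : b ≤ b') (hε : ε' ≤ ε) (hR : R ≤ R') (hk : k ≤ k') :
    C.core b ε R k ⊆ C.core b' ε' R' k' := fun _ h =>
  ⟨h.1.trans hb, h.2.1.trans hk, fun i => ⟨(h.2.2.1 i).1.trans hR, (h.2.2.1 i).2.trans (by linarith)⟩,
    fun i j => (h.2.2.2 i j).trans hR⟩

lemma exists_core_of_isCompact {A : Set (Conf m n)} (hA : IsCompact A) (hAC : A ⊆ C.confDom) :
    ∃ b ε R k, 0 < ε ∧ ε < 1 ∧ 0 < R ∧ 0 < k ∧ A ⊆ C.core b ε R k := by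
  have he : ∀ i, Continuous fun θ : Conf m n => C.errs θ.2.2 i := fun i =>
    (continuous_apply i).comp (C.continuous_errs.comp (continuous_snd.comp continuous_snd))
  obtain ⟨B, hB⟩ := hA.exists_bound_of_continuousOn (f := fun θ => θ) continuousOn_id
  have hE : ∀ i, ∃ B, ∀ θ ∈ A, ‖C.errs θ.2.2 i‖ ≤ B := fun i =>
    hA.exists_bound_of_continuousOn (he i).continuousOn
  choose B' hB' using hE
  have hε : ∀ i, ∃ ε, 0 < ε ∧ ∀ θ ∈ A, |C.c i * θ.1 0| * ‖C.errs θ.2.2 i‖ ≤ 1 - ε := by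
    intro i
    rcases A.eq_empty_or_nonempty with rfl | hne
    · exact ⟨1, one_pos, by simp⟩
    have hcont : Continuous fun θ : Conf m n => |C.c i * θ.1 0| * ‖C.errs θ.2.2 i‖ :=
      ((continuous_const.mul ((continuous_apply 0).comp continuous_fst)).abs).mul (he i).norm
    obtain ⟨θ, hθ, hmax⟩ := hA.exists_isMaxOn hne hcont.continuousOn
    have h1 := (C.mem_confDom.1 (hAC hθ)) i
    rw [← mul_pow, ← sq_abs, abs_mul, abs_norm, sq_lt_one_iff₀ (by positivity)] at h1
    refine ⟨1 - |C.c i * θ.1 0| * ‖C.errs θ.2.2 i‖, by linarith, fun θ' hθ' => ?_⟩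
    have := hmax hθ'
    simp only [mem_ofPred_eq] at this
    linarith
  choose ε hε0 hε using hε
  obtain ⟨i₀, hi₀⟩ := Finite.exists_min ε
  obtain ⟨i₁, hi₁⟩ := Finite.exists_max B'
  refine ⟨B, min (ε i₀) (1 / 2), max 1 (max B (B' i₁)), max 1 B, lt_min (hε0 _) (by norm_num),
    (min_le_right _ _).trans_lt (by norm_num), by positivity, by positivity, fun θ hθ => ?_⟩
  have hθB := hB θ hθ
  have h1 := (norm_fst_le θ).trans hθB
  have h2 := (norm_snd_le θ).trans hθB
  refine ⟨h1, ((norm_fst_le _).trans h2).trans (le_max_right _ _), fun i =>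
    ⟨((hB' i θ hθ).trans (hi₁ i)).trans ((le_max_right _ _).trans (le_max_right _ _)),
    (hε i θ hθ).trans ?_⟩, fun i j => ?_⟩
  · linarith [min_le_left (ε i₀) (1 / 2), hi₀ i]
  · exact ((norm_le_pi_norm _ _).trans ((norm_le_pi_norm _ _).trans ((norm_snd_le _).trans h2))).trans
      ((le_max_left _ _).trans (le_max_right _ _))

end Coeff

namespace Sys

variable {m n l q : ℕ} (S : Sys m n l q)

/-- `X` solves the internal dynamics on `[0,b]` for the signal `ξ`. -/
structure IsInternal (ξ : ℝ → Sig m n) (b : ℝ) (X : ℝ → InnerState m n) : Prop where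
  cont : Continuous X
  mem : ∀ t ∈ Icc 0 b, (S.J t, ξ t, X t) ∈ S.confDom
  -- T needs a signal on the whole half-line, while `outs` is controlled on [0,b] only. By causality
  -- every continuous continuation gives the same integrals.
  eqn : ∀ g : ℝ → Sig m n, Continuous g → (∀ s ∈ Icc 0 b, g s = S.outs (S.J s, ξ s, X s)) →
    ∀ t ∈ Icc 0 b, X t = S.x₀ + ∫ s in (0 : ℝ)..t, S.field (S.J s, ξ s, X s) (S.drive g s)

/-- Bounded signals lead to internal states in a compact set on which the gains are bounded. -/
def Apriori : Prop := ∀ k, ∃ b ε R k', 0 < ε ∧ ε < 1 ∧ 0 < R ∧ 0 < k' ∧ k ≤ k' ∧ ∀ ξ t X, Continuous ξ →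
  0 ≤ t → (∀ s ∈ Icc 0 t, ‖ξ s‖ ≤ k) → S.IsInternal ξ t X →
  ∀ s ∈ Icc 0 t, (S.J s, ξ s, X s) ∈ S.core b ε R k'

variable {S} (hS : S.Regular)

include hS in
lemma field_drive_ae_eq {ξ : ℝ → Sig m n} {X : ℝ → InnerState m n} {t : ℝ} (ht : 0 ≤ t)
    {g g' : ℝ → Sig m n} (hg : Continuous g) (hg' : Continuous g')
    (h : ∀ s, 0 ≤ s → s < t → g s = g' s) :
    ∫ s in (0 : ℝ)..t, S.field (S.J s, ξ s, X s) (S.drive g s)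
      = ∫ s in (0 : ℝ)..t, S.field (S.J s, ξ s, X s) (S.drive g' s) := by
  refine intervalIntegral_congr_ae_Ico ht ?_
  filter_upwards [drive_causal hS ht hg hg' h] with s hs
  rw [hs]

/-- Freezing the trajectory outside [0,b] creates no new values, so bounds on [0,b] carry over to
the whole line. -/
lemma exists_continuous_outs (hJ : Continuous S.J) {ξ : ℝ → Sig m n} (hξ : Continuous ξ)
    {X : ℝ → InnerState m n} (hX : Continuous X) {b : ℝ} (hb : 0 ≤ b)
    (hmem : ∀ t ∈ Icc 0 b, (S.J t, ξ t, X t) ∈ S.confDom) :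
    ∃ g : ℝ → Sig m n, Continuous g ∧ (∀ s ∈ Icc 0 b, g s = S.outs (S.J s, ξ s, X s)) ∧
      ∀ s, ∃ s' ∈ Icc 0 b, g s = S.outs (S.J s', ξ s', X s') := by
  have hm : ∀ s : ℝ, max 0 (min s b) ∈ Icc 0 b := fun s =>
    ⟨le_max_left _ _, max_le hb (min_le_right _ _)⟩
  refine ⟨fun s => S.outs (S.J (max 0 (min s b)), ξ (max 0 (min s b)), X (max 0 (min s b))),
    S.contDiffOn_outs.continuousOn.comp_continuous ((hJ.comp (by fun_prop)).prodMk
      ((hξ.comp (by fun_prop)).prodMk (hX.comp (by fun_prop)))) fun s => hmem _ (hm s),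
    fun s hs => ?_, fun s => ⟨_, hm s, rfl⟩⟩
  simp only [min_eq_left hs.2, max_eq_right hs.1]

include hS in
lemma isInternal_of_exists {ξ : ℝ → Sig m n} {b : ℝ} {X : ℝ → InnerState m n} (hX : Continuous X)
    (hmem : ∀ t ∈ Icc 0 b, (S.J t, ξ t, X t) ∈ S.confDom) {g : ℝ → Sig m n} (hg : Continuous g)
    (hgs : ∀ s ∈ Icc 0 b, g s = S.outs (S.J s, ξ s, X s))
    (h : ∀ t ∈ Icc 0 b, X t = S.x₀ + ∫ s in (0 : ℝ)..t, S.field (S.J s, ξ s, X s) (S.drive g s)) :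
    S.IsInternal ξ b X := by
  refine ⟨hX, hmem, fun g' hg' hgs' t ht => ?_⟩
  rw [h t ht, field_drive_ae_eq hS ht.1 hg hg' fun s hs hst => ?_]
  rw [hgs s ⟨hs, hst.le.trans ht.2⟩, hgs' s ⟨hs, hst.le.trans ht.2⟩]

include hS in
lemma IsInternal.mono {ξ : ℝ → Sig m n} {b b' : ℝ} {X : ℝ → InnerState m n}
    (hX : S.IsInternal ξ b X) (hξ : Continuous ξ) (hb' : 0 ≤ b') (h : b' ≤ b) :
    S.IsInternal ξ b' X := by
  obtain ⟨g, hg, hgs, -⟩ := exists_continuous_outs hS.J_cont hξ hX.cont (hb'.trans h) hX.mem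
  exact isInternal_of_exists hS hX.cont (fun t ht => hX.mem t ⟨ht.1, ht.2.trans h⟩) hg
    (fun s hs => hgs s ⟨hs.1, hs.2.trans h⟩) fun t ht => hX.eqn g hg hgs t ⟨ht.1, ht.2.trans h⟩

lemma isInternal_congr {ξ ξ' : ℝ → Sig m n} {b : ℝ} {X : ℝ → InnerState m n}
    (hX : S.IsInternal ξ b X) (h : ∀ s ∈ Icc 0 b, ξ s = ξ' s) : S.IsInternal ξ' b X := by
  refine ⟨hX.cont, fun t ht => by rw [← h t ht]; exact hX.mem t ht, fun g hg hgs t ht => ?_⟩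
  rw [hX.eqn g hg (fun s hs => by rw [hgs s hs, h s hs]) t ht]
  congr 1
  refine intervalIntegral.integral_congr fun s hs => ?_
  rw [uIcc_of_le ht.1] at hs
  simp only [h s ⟨hs.1, hs.2.trans ht.2⟩]

lemma satOp_eq {ε R k b : ℝ} (hε : ε < 1) (hR : 0 < R) (hk : 0 < k)
    {ξ : ℝ → Sig m n} {X : ℝ → InnerState m n} {s : ℝ}
    (h : (S.J s, ξ s, X s) ∈ S.core b ε R k) : S.satOp ε R k (fun s => (ξ s, X s)) s =
      S.field (S.J s, ξ s, X s)
        (S.drive (fun s => S.outs (S.satConf ε R k (S.J s) (ξ s, X s))) s) := by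
  rw [satOp, Coeff.satConf_of_mem hε hR hk h]

include hS in
-- The saturation acts as the identity on the core. It transfers the theory of the saturated
-- equation to trajectories that stay there.
lemma isInternal_iff_solOn {ε R k b c : ℝ} (hε0 : 0 < ε) (hε : ε < 1) (hR : 0 < R) (hk : 0 < k)
    {ξ : ℝ → Sig m n} (hξ : Continuous ξ) {X : ℝ → InnerState m n} (hX : Continuous X)
    (hmem : ∀ s ∈ Icc 0 b, (S.J s, ξ s, X s) ∈ S.core c ε R k) :
    S.IsInternal ξ b X ↔ SolOn (fun Y => S.satOp ε R k fun s => (ξ s, Y s)) S.x₀ b X := by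
  have hgc := continuous_outs_satConf hS hε0 hε hR hk (hξ.prodMk hX)
  have hgs : ∀ s ∈ Icc 0 b, S.outs (S.satConf ε R k (S.J s) (ξ s, X s))
      = S.outs (S.J s, ξ s, X s) := fun s hs => by
    rw [Coeff.satConf_of_mem hε hR hk (hmem s hs)]
  have hint : ∀ t ∈ Icc 0 b, ∫ s in (0 : ℝ)..t, S.satOp ε R k (fun s => (ξ s, X s)) s
      = ∫ s in (0 : ℝ)..t, S.field (S.J s, ξ s, X s)
        (S.drive (fun s => S.outs (S.satConf ε R k (S.J s) (ξ s, X s))) s) := fun t ht => by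
    refine intervalIntegral.integral_congr fun s hs => ?_
    rw [uIcc_of_le ht.1] at hs
    exact satOp_eq hε hR hk (hmem s ⟨hs.1, hs.2.trans ht.2⟩)
  constructor
  · intro h
    exact ⟨hX, fun t ht => by rw [hint t ht]; exact h.eqn _ hgc hgs t ht⟩
  · intro h
    exact isInternal_of_exists hS hX (fun t ht => S.core_subset hε0 (hmem t ht)) hgc hgs
      fun t ht => by rw [← hint t ht]; exact h.eqn t ht

include hS in
lemma IsInternal.exists_core {ξ : ℝ → Sig m n} (hξ : Continuous ξ) {b : ℝ} {X : ℝ → InnerState m n}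
    (hX : S.IsInternal ξ b X) : ∃ c ε R k, 0 < ε ∧ ε < 1 ∧ 0 < R ∧ 0 < k ∧
      ∀ s ∈ Icc 0 b, (S.J s, ξ s, X s) ∈ S.core c ε R k := by
  obtain ⟨c, ε, R, k, h0, h1, h2, h3, h4⟩ := Coeff.exists_core_of_isCompact (C := S.toCoeff)
    ((isCompact_Icc (a := 0) (b := b)).image (hS.J_cont.prodMk (hξ.prodMk hX.cont)))
    (by rintro _ ⟨t, ht, rfl⟩; exact hX.mem t ht)
  exact ⟨c, ε, R, k, h0, h1, h2, h3, fun s hs => h4 ⟨s, hs, rfl⟩⟩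

include hS in
-- On a compact interval two internal trajectories lie in a common core, so both solve the same
-- saturated equation.
theorem IsInternal.unique {ξ : ℝ → Sig m n} (hξ : Continuous ξ) {b : ℝ} {X X' : ℝ → InnerState m n}
    (hX : S.IsInternal ξ b X) (hX' : S.IsInternal ξ b X') : ∀ t ∈ Icc 0 b, X t = X' t := by
  obtain ⟨c, ε, R, k, h0, h1, h2, h3, h4⟩ := hX.exists_core hS hξ
  obtain ⟨c', ε', R', k', h0', h1', h2', h3', h4'⟩ := hX'.exists_core hS hξ
  have hε0 : 0 < min ε ε' := lt_min h0 h0'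
  have hε : min ε ε' < 1 := (min_le_left _ _).trans_lt h1
  have hR : 0 < max R R' := lt_max_of_lt_left h2
  have hk : 0 < max k k' := lt_max_of_lt_left h3
  have s1 := (isInternal_iff_solOn hS hε0 hε hR hk hξ hX.cont (c := max c c') fun s hs =>
    Coeff.core_mono (le_max_left _ _) (min_le_left _ _) (le_max_left _ _) (le_max_left _ _)
      (h4 s hs)).1 hX
  have s2 := (isInternal_iff_solOn hS hε0 hε hR hk hξ hX'.cont (c := max c c') fun s hs =>
    Coeff.core_mono (le_max_right _ _) (min_le_right _ _) (le_max_right _ _) (le_max_right _ _)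
      (h4' s hs)).1 hX'
  exact ((causalLip_satOp hS hε0 hε hR hk).fix hξ).unique s1 s2

omit hS in
lemma eventually_mem_core {c ε ε' R R' k : ℝ} (hJ : Continuous S.J) (hc : ∀ t, ‖S.J t‖ ≤ c)
    (hε : ε' < ε) (hR : R < R')
    {ξ : ℝ → Sig m n} {X : ℝ → InnerState m n} (hX : Continuous X)
    {t : ℝ} (h : (S.J t, ξ t, X t) ∈ S.core c ε R k) :
    ∀ᶠ s in nhds t, ‖ξ s‖ ≤ k → (S.J s, ξ s, X s) ∈ S.core c ε' R' k := by
  have he : ∀ i, Continuous fun s => S.errs (X s) i := fun i =>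
    (continuous_apply i).comp (S.continuous_errs.comp hX)
  have h1 : ∀ i, ∀ᶠ s in nhds t, ‖S.errs (X s) i‖ < R' := fun i =>
    (he i).norm.continuousAt.eventually_lt continuousAt_const ((h.2.2.1 i).1.trans_lt hR)
  have h2 : ∀ i, ∀ᶠ s in nhds t, |S.c i * S.J s 0| * ‖S.errs (X s) i‖ < 1 - ε' := fun i =>
    ((continuous_const.mul ((continuous_apply 0).comp hJ)).abs.mul
      (he i).norm).continuousAt.eventually_lt continuousAt_const
      ((h.2.2.1 i).2.trans_lt (by linarith))
  have h3 : ∀ i (j : Fin (n + 1)), ∀ᶠ s in nhds t, ‖X s i j.succ‖ < R' := fun i j =>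
    ((continuous_apply j.succ).comp ((continuous_apply i).comp hX)).norm.continuousAt.eventually_lt
      continuousAt_const ((h.2.2.2 i j).trans_lt hR)
  filter_upwards [Filter.eventually_all.2 h1, Filter.eventually_all.2 h2,
    Filter.eventually_all.2 fun i => Filter.eventually_all.2 (h3 i)] with s h1 h2 h3 hk
  exact ⟨hc s, hk, fun i => ⟨(h1 i).le, (h2 i).le⟩, fun i j => (h3 i j).le⟩

include hS in
-- Continuity argument. The equation is saturated at a core that is slightly larger (ε/2, R + 1)
-- than the one of the a priori estimate. While the solution is in the larger core it is a genuine
-- internal trajectory and hence in the smaller one, which it would have to leave before leaving the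
-- larger.
theorem exists_isInternal (hA : S.Apriori) {ξ : ℝ → Sig m n} (hξ : Continuous ξ) {b : ℝ}
    (hb : 0 ≤ b) : ∃ X, S.IsInternal ξ b X := by
  obtain ⟨k, hk⟩ := (isCompact_Icc (a := (0 : ℝ)) (b := b)).exists_bound_of_continuousOn
    hξ.continuousOn
  obtain ⟨c, ε, R, k', hε0, hε1, hR, hk', hkk', H⟩ := hA k
  obtain ⟨c', hc'⟩ := hS.J_bdd
  have hε0' : 0 < ε / 2 := by linarith
  have hε1' : ε / 2 < 1 := by linarith
  have hR' : 0 < R + 1 := by linarith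
  have hN := (causalLip_satOp hS hε0' hε1' hR' hk').fix hξ
  obtain ⟨X, hX⟩ := hN.exists_sol (x₀ := S.x₀) b
  have hX0 : X 0 = S.x₀ := by rw [hX.eqn 0 ⟨le_rfl, hb⟩]; simp
  have hcore : ∀ t ∈ Icc 0 b, (∀ s ∈ Icc 0 t, (S.J s, ξ s, X s) ∈ S.core c' (ε / 2) (R + 1) k') →
      ∀ s ∈ Icc 0 t, (S.J s, ξ s, X s) ∈ S.core c' ε R k' := by
    intro t ht h s hs
    have := H ξ t X hξ ht.1 (fun s hs => hk s ⟨hs.1, hs.2.trans ht.2⟩)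
      ((isInternal_iff_solOn hS hε0' hε1' hR' hk' hξ hX.cont h).2 (hX.mono ht.2)) s hs
    exact ⟨hc' s, this.2⟩
  have hmain : Icc 0 b ⊆ {t | ∀ s ∈ Icc 0 t, (S.J s, ξ s, X s) ∈ S.core c' ε R k'} := by
    apply IsClosed.Icc_subset_of_forall_exists_gt
    · have : {t | ∀ s ∈ Icc 0 t, (S.J s, ξ s, X s) ∈ S.core c' ε R k'} ∩ Icc 0 b
          = (⋂ x ≥ (0 : ℝ), {t | (S.J (min t x), ξ (min t x), X (min t x)) ∈ S.core c' ε R k'})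
            ∩ Icc 0 b := by
        ext t
        simp only [mem_inter_iff, mem_ofPred_eq, mem_iInter, and_congr_left_iff]
        intro ht
        refine ⟨fun h x hx => h _ ⟨le_min ht.1 hx, min_le_left _ _⟩, fun h s hs => ?_⟩
        simpa [min_eq_right hs.2] using h s hs.1
      rw [this]
      refine IsClosed.inter (isClosed_biInter fun x _ => ?_) isClosed_Icc
      have hm : Continuous fun t : ℝ => min t x := by fun_prop
      exact (S.isCompact_core c' ε R k').isClosed.preimage
        ((hS.J_cont.comp hm).prodMk ((hξ.comp hm).prodMk (hX.cont.comp hm)))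
    · intro s hs
      have hs0 : s = 0 := le_antisymm hs.2 hs.1
      subst hs0
      -- To start the argument, the a priori estimate is applied on the degenerate interval [0,0],
      -- where the constant x₀ is a solution.
      have hi : S.IsInternal ξ 0 (fun _ => S.x₀) := by
        refine ⟨continuous_const, fun t ht => ?_, fun g _ _ t ht => ?_⟩
        · rw [le_antisymm ht.2 ht.1]; exact hS.init _
        · rw [le_antisymm ht.2 ht.1]; simp
      have := H ξ 0 _ hξ le_rfl (fun s hs => hk s ⟨hs.1, hs.2.trans hb⟩) hi 0 ⟨le_rfl, le_rfl⟩
      rw [← hX0] at this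
      exact ⟨hc' 0, this.2⟩
    · rintro t ⟨ht, ht0, htb⟩ y hy
      have hev := eventually_mem_core hS.J_cont hc' (half_lt_self hε0) (lt_add_one R) hX.cont
        (ht t ⟨ht0, le_rfl⟩)
      obtain ⟨η, hη, hball⟩ := Metric.eventually_nhds_iff.1 hev
      have hk'' : ∀ s ∈ Icc 0 b, ‖ξ s‖ ≤ k' := fun s hs => (hk s hs).trans hkk'
      have hyt : t < y := hy
      refine ⟨t + min (η / 2) (min (y - t) (b - t)), ?_, ?_, ?_⟩
      · have hle : t + min (η / 2) (min (y - t) (b - t)) ≤ b := by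
          linarith [min_le_right (η / 2) (min (y - t) (b - t)), min_le_right (y - t) (b - t)]
        have hpos : 0 < min (η / 2) (min (y - t) (b - t)) :=
          lt_min (by linarith) (lt_min (by linarith) (by linarith))
        refine hcore _ ⟨by linarith, hle⟩ fun s hs => ?_
        rcases le_total s t with h | h
        · exact Coeff.core_mono le_rfl (half_le_self hε0.le) (by linarith) le_rfl (ht s ⟨hs.1, h⟩)
        · refine hball ?_ (hk'' s ⟨hs.1, hs.2.trans hle⟩)
          rw [Real.dist_eq, abs_of_nonneg (by linarith)]
          have := min_le_left (η / 2) (min (y - t) (b - t))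
          linarith [hs.2]
      · have : 0 < min (η / 2) (min (y - t) (b - t)) :=
          lt_min (by linarith) (lt_min (by linarith) (by linarith))
        linarith
      · linarith [min_le_right (η / 2) (min (y - t) (b - t)), min_le_left (y - t) (b - t)]
  exact ⟨X, (isInternal_iff_solOn hS hε0' hε1' hR' hk' hξ hX.cont fun s hs =>
    Coeff.core_mono le_rfl (half_le_self hε0.le) (by linarith) le_rfl
      (hmain hs s ⟨hs.1, le_rfl⟩)).2 hX⟩

include hS in
-- The solution on [0,t] is evaluated at its right end; uniqueness makes this diagonal agree with
-- each solution on [0,b].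
theorem exists_isInternal_forall (hA : S.Apriori) {ξ : ℝ → Sig m n} (hξ : Continuous ξ) :
    ∃ X, Continuous X ∧ ∀ b, 0 ≤ b → S.IsInternal ξ b X := by
  have h : ∀ b : ℝ, ∃ X, 0 ≤ b → S.IsInternal ξ b X := fun b => by
    by_cases hb : 0 ≤ b
    · obtain ⟨X, hX⟩ := exists_isInternal hS hA hξ hb
      exact ⟨X, fun _ => hX⟩
    · exact ⟨0, fun h => absurd h hb⟩
  choose Y hY using h
  set X : ℝ → InnerState m n := fun t => Y (max t 0) (max t 0) with hXdef
  have heq : ∀ b, 0 ≤ b → ∀ t ≤ b, X t = Y b (max t 0) := fun b hb t ht => by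
    have hm : (0 : ℝ) ≤ max t 0 := le_max_right _ _
    exact (hY _ hm).unique hS hξ ((hY b hb).mono hS hξ hm (max_le ht hb)) _ ⟨hm, le_rfl⟩
  have hc : Continuous X := by
    refine continuous_iff_continuousAt.2 fun t => ?_
    have h1 : Continuous fun s => Y (max t 0 + 1) (max s 0) :=
      (hY _ (by positivity)).cont.comp (by fun_prop)
    refine h1.continuousAt.congr ?_
    filter_upwards [Iio_mem_nhds (show t < max t 0 + 1 by linarith [le_max_left t 0])] with s hs
    exact (heq _ (by positivity) s (le_of_lt hs)).symm
  refine ⟨X, hc, fun b hb => ?_⟩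
  have hXY : ∀ t ∈ Icc 0 b, X t = Y b t := fun t ht => by
    rw [heq b hb t ht.2, max_eq_left ht.1]
  have hYb := hY b hb
  refine ⟨hc, fun t ht => by rw [hXY t ht]; exact hYb.mem t ht, fun g hg hgs t ht => ?_⟩
  rw [hXY t ht, hYb.eqn g hg (fun s hs => by rw [hgs s hs, hXY s hs]) t ht]
  congr 1
  refine intervalIntegral.integral_congr fun s hs => ?_
  rw [uIcc_of_le ht.1] at hs
  simp only [hXY s ⟨hs.1, hs.2.trans ht.2⟩]

include hS in
/-- The internal states depend locally Lipschitz continuously on the signal. -/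
theorem internal_dependence (hA : S.Apriori) {ξ : ℝ → Sig m n} (hξ : Continuous ξ) {t : ℝ}
    (ht : 0 ≤ t) : ∃ Δ > 0, ∃ δ > 0, ∃ c ε R k, 0 < ε ∧ ∀ ξ₁ ξ₂ X₁ X₂, Continuous ξ₁ →
      Continuous ξ₂ → (∀ s, 0 ≤ s → s ≤ t → ξ₁ s = ξ s ∧ ξ₂ s = ξ s) →
      (∀ s ∈ Icc t (t + Δ), ‖ξ₁ s - ξ t‖ < δ ∧ ‖ξ₂ s - ξ t‖ < δ) →
      S.IsInternal ξ₁ (t + Δ) X₁ → S.IsInternal ξ₂ (t + Δ) X₂ →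
      ∀ M, (∀ s ∈ Icc t (t + Δ), ‖ξ₁ s - ξ₂ s‖ ≤ M) → ∀ s ∈ Icc t (t + Δ),
        ‖X₁ s - X₂ s‖ ≤ M ∧ (S.J s, ξ₁ s, X₁ s) ∈ S.core c ε R k ∧
          (S.J s, ξ₂ s, X₂ s) ∈ S.core c ε R k := by
  obtain ⟨k, hk⟩ := (isCompact_Icc (a := (0 : ℝ)) (b := t)).exists_bound_of_continuousOn
    hξ.continuousOn
  -- The signals to be compared are kept within distance 1 of ξ(t), so they are bounded by k + 1 and
  -- share one core.
  obtain ⟨c, ε, R, k', hε0, hε1, hR, hk', hkk', H⟩ := hA (k + 1)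
  obtain ⟨X, hX⟩ := exists_isInternal hS hA hξ ht
  obtain ⟨Δ, hΔ, δ, hδ, hdep⟩ := (causalLip_satOp hS hε0 hε1 hR hk').dependence ht hξ hX.cont
  refine ⟨Δ, hΔ, min δ 1, by positivity, c, ε, R, k', hε0,
    fun ξ₁ ξ₂ X₁ X₂ hξ₁ hξ₂ heq hcl hX₁ hX₂ M hM s hs => ?_⟩
  have key : ∀ ξ' X', Continuous ξ' → (∀ s, 0 ≤ s → s ≤ t → ξ' s = ξ s) →
      (∀ s ∈ Icc t (t + Δ), ‖ξ' s - ξ t‖ < min δ 1) → S.IsInternal ξ' (t + Δ) X' →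
      (∀ s ∈ Icc 0 (t + Δ), (S.J s, ξ' s, X' s) ∈ S.core c ε R k') ∧
      ∀ s, 0 ≤ s → s ≤ t → X' s = X s := by
    intro ξ' X' hξ' heq hcl hX'
    refine ⟨H ξ' (t + Δ) X' hξ' (by linarith) (fun s hs => ?_) hX', fun s hs hst => ?_⟩
    · rcases le_total s t with h | h
      · rw [heq s hs.1 h]; linarith [hk s ⟨hs.1, h⟩]
      · have h1 := (hcl s ⟨h, hs.2⟩).trans_le (min_le_right _ _)
        have h2 := hk t ⟨ht, le_rfl⟩
        have h3 := norm_sub_norm_le (ξ' s) (ξ t)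
        linarith
    · have h1 := isInternal_congr (hX'.mono hS hξ' ht (by linarith : t ≤ t + Δ))
        fun s hs => heq s hs.1 hs.2
      exact h1.unique hS hξ hX s ⟨hs, hst⟩
  obtain ⟨c1, e1⟩ := key ξ₁ X₁ hξ₁ (fun s h h' => (heq s h h').1) (fun s h => (hcl s h).1) hX₁
  obtain ⟨c2, e2⟩ := key ξ₂ X₂ hξ₂ (fun s h h' => (heq s h h').2) (fun s h => (hcl s h).2) hX₂
  refine ⟨?_, c1 s ⟨ht.trans hs.1, hs.2⟩, c2 s ⟨ht.trans hs.1, hs.2⟩⟩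
  exact hdep Δ hΔ.le le_rfl ξ₁ ξ₂ X₁ X₂ S.x₀ hξ₁ hξ₂ heq (fun s h h' => ⟨e1 s h h', e2 s h h'⟩)
    (fun s h => ⟨(hcl s h).1.trans_le (min_le_left _ _), (hcl s h).2.trans_le (min_le_left _ _)⟩)
    ((isInternal_iff_solOn hS hε0 hε1 hR hk' hξ₁ hX₁.cont c1).1 hX₁)
    ((isInternal_iff_solOn hS hε0 hε1 hR hk' hξ₂ hX₂.cont c2).1 hX₂) M hM s hs

variable (S) in
/-- The signal `ξ`, extended to the real line by a constant. -/
def extend (ξ : C(Ici (-S.τ), Sig m n)) (t : ℝ) : Sig m n := 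
  ξ ⟨max t (-S.τ), mem_Ici.2 (le_max_right _ _)⟩

omit hS in
lemma continuous_extend (ξ : C(Ici (-S.τ), Sig m n)) : Continuous (S.extend ξ) :=
  ξ.continuous.comp (Continuous.subtype_mk (by fun_prop) _)

omit hS in
lemma extend_of_le (ξ : C(Ici (-S.τ), Sig m n)) {t : ℝ} (ht : -S.τ ≤ t) :
    S.extend ξ t = ξ ⟨t, ht⟩ := by
  simp only [extend, max_eq_left ht]

open Classical in
variable (S) in
/-- The internal state for the signal `ξ`. -/
def internal (ξ : ℝ → Sig m n) : ℝ → InnerState m n :=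
  if h : ∃ X, Continuous X ∧ ∀ b, 0 ≤ b → S.IsInternal ξ b X then h.choose else 0

include hS in
lemma isInternal_internal (hA : S.Apriori) {ξ : ℝ → Sig m n} (hξ : Continuous ξ) {b : ℝ}
    (hb : 0 ≤ b) : S.IsInternal ξ b (S.internal ξ) := by
  have h := exists_isInternal_forall hS hA hξ
  rw [internal, dif_pos h]
  exact h.choose_spec.2 b hb

variable (S) in
/-- The operator of the interconnection: `z^(r) = innerOp (z, …, z^(r-1)) + Γ̃ u`. -/
def innerOp {Q : ℕ} (ι : Vec m →L[ℝ] Vec Q) : Op S.τ (n + 2) m Q := fun ξ s =>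
  ι (S.lead (S.J s, S.extend ξ s, S.internal (S.extend ξ) s) (Fin.last n) (n + 2))

include hS in
-- T̃ is pointwise a smooth function of (J, ξ, X), so everything reduces to the map ξ ↦ X: the a
-- priori estimate gives boundedness, uniqueness gives causality, and `internal_dependence` gives
-- the local Lipschitz property.
theorem opClass_innerOp (hA : S.Apriori) {Q : ℕ} (ι : Vec m →L[ℝ] Vec Q) :
    OpClass S.τ (S.innerOp ι) := by
  have hI : ∀ (ξ : C(Ici (-S.τ), Sig m n)) {b : ℝ}, 0 ≤ b →
      S.IsInternal (S.extend ξ) b (S.internal (S.extend ξ)) := fun ξ {b} hb =>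
    isInternal_internal hS hA (continuous_extend ξ) hb
  have hτ := hS.op.pos
  refine ⟨hτ, fun ξ b => ?_, fun c₁ hc₁ => ?_, fun t ht ζ ξ h => ?_, fun t hτt ht ξ => ?_⟩
  · rcases lt_or_ge b 0 with hb | hb
    · rw [Icc_eq_empty (not_le.2 hb)]; simp
    have hc : ContinuousOn (S.innerOp ι ξ) (Icc 0 b) :=
      ι.continuous.comp_continuousOn (((S.contDiffOn_lead (n + 2) (Fin.last n)).continuousOn).comp
        (hS.J_cont.prodMk ((continuous_extend ξ).prodMk (hI ξ hb).cont)).continuousOn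
        fun t ht => (hI ξ hb).mem t ht)
    obtain ⟨B, hB⟩ := isCompact_Icc.exists_bound_of_continuousOn hc
    refine memLp_top_of_bound (hc.aestronglyMeasurable measurableSet_Icc) B ?_
    filter_upwards [ae_restrict_mem measurableSet_Icc] with s hs using hB s hs
  · obtain ⟨c, ε, R, k', hε0, hε1, hR, hk', hkk', H⟩ := hA c₁
    obtain ⟨L, hL0, hL, -⟩ := S.exists_lipschitz_core (S.contDiffOn_lead (n + 2) (Fin.last n)) c
      hε0 R k'
    refine ⟨‖ι‖ * L + 1, by positivity, fun ξ hξ => ?_⟩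
    filter_upwards [ae_restrict_mem measurableSet_Ici] with s hs
    have hs0 : 0 ≤ s := hs
    have hmem := H _ s _ (continuous_extend ξ) hs0 (fun x _ => hξ _) (hI ξ hs0) s ⟨hs0, le_rfl⟩
    refine (ι.le_opNorm _).trans ?_
    have := mul_le_mul_of_nonneg_left (hL _ hmem) (norm_nonneg ι)
    linarith
  · filter_upwards [ae_restrict_mem measurableSet_Ico] with s hs
    have he : ∀ x, 0 ≤ x → x ≤ s → S.extend ζ x = S.extend ξ x := fun x hx hxs =>
      h _ (max_lt (hxs.trans_lt hs.2) (by linarith [hs.1, hs.2]))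
    have hX : S.internal (S.extend ζ) s = S.internal (S.extend ξ) s :=
      (isInternal_congr (hI ζ hs.1) fun x hx => he x hx.1 hx.2).unique hS (continuous_extend ξ)
        (hI ξ hs.1) s ⟨hs.1, le_rfl⟩
    simp only [innerOp, hX, he s hs.1 le_rfl]
  · obtain ⟨Δ, hΔ, δ, hδ, c, ε, R, k, hε0, H⟩ :=
      internal_dependence hS hA (continuous_extend ξ) ht
    obtain ⟨L, hL0, -, hL⟩ := S.exists_lipschitz_core (S.contDiffOn_lead (n + 2) (Fin.last n)) c
      hε0 R k
    refine ⟨Δ, hΔ, δ, hδ, ‖ι‖ * L + 1, by positivity, fun ζ₁ ζ₂ heq hcl M hM => ?_⟩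
    filter_upwards [ae_restrict_mem measurableSet_Icc] with s hs
    have hmax : ∀ x ∈ Icc t (t + Δ), max x (-S.τ) ∈ Icc t (t + Δ) := fun x hx => by
      rw [max_eq_left (hτt.trans hx.1)]; exact hx
    have hb0 : 0 ≤ t + Δ := by linarith
    obtain ⟨h1, h2, h3⟩ := H _ _ _ _ (continuous_extend ζ₁) (continuous_extend ζ₂)
      (fun x _ hx => heq _ (max_le hx hτt))
      (fun x hx => by
        rw [extend_of_le ξ hτt]
        exact hcl _ (hmax x hx)) (hI ζ₁ hb0) (hI ζ₂ hb0) M (fun x hx => hM _ (hmax x hx)) s hs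
    have hM' : ‖S.extend ζ₁ s - S.extend ζ₂ s‖ ≤ M := hM _ (hmax s hs)
    have hM0 : 0 ≤ M := (norm_nonneg _).trans hM'
    rw [innerOp, innerOp, ← map_sub]
    refine (ι.le_opNorm _).trans ?_
    have h4 := hL _ h2 _ h3 rfl
    have h5 : ‖(S.J s, S.extend ζ₁ s, S.internal (S.extend ζ₁) s)
        - (S.J s, S.extend ζ₂ s, S.internal (S.extend ζ₂) s)‖ ≤ M := by
      simp only [Prod.mk_sub_mk, sub_self, Prod.norm_def, norm_zero]
      exact max_le hM0 (max_le hM' h1)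
    calc _ ≤ ‖ι‖ * (L * M) := by
          refine mul_le_mul_of_nonneg_left (h4.trans ?_) (norm_nonneg _)
          exact mul_le_mul_of_nonneg_left h5 hL0
      _ ≤ _ := by nlinarith

end Sys
end

/-! ### Monotonicity from almost everywhere derivatives, and quadratic forms -/

noncomputable section

/-- From the last time before t at which u ≤ M onwards, u stays above M and therefore cannot have
increased. -/
lemma le_of_step {u : ℝ → ℝ} {a b M : ℝ} (hu : ContinuousOn u (Icc a b)) (ha : u a ≤ M)
    (hstep : ∀ s t, a ≤ s → s ≤ t → t ≤ b → (∀ x ∈ Ioc s t, M < u x) → u t ≤ u s) :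
    ∀ t ∈ Icc a b, u t ≤ M := by
  intro t ht
  by_contra! hlt
  have hK : IsCompact {x ∈ Icc a t | u x ≤ M} := by
    have : {x ∈ Icc a t | u x ≤ M} = Icc a t ∩ u ⁻¹' Iic M := rfl
    rw [this]
    exact isCompact_Icc.of_isClosed_subset ((hu.mono (Icc_subset_Icc_right ht.2)).preimage_isClosed_of_isClosed
      isClosed_Icc isClosed_Iic) inter_subset_left
  obtain ⟨s, ⟨hs, hsM⟩, hmax⟩ := hK.exists_isMaxOn ⟨a, ⟨le_rfl, ht.1⟩, ha⟩ continuousOn_id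
  have := hstep s t hs.1 hs.2 ht.2 fun x hx => by
    by_contra! h
    have : x ≤ s := hmax ⟨⟨hs.1.trans hx.1.le, hx.2⟩, h⟩
    linarith [hx.1]
  linarith

/-- The internal states are only absolutely continuous. A bounded velocity makes X Lipschitz, so V ∘
X is Lipschitz on [s,t] and is the integral of its derivative, which exists and is nonpositive
almost everywhere. -/
lemma comp_le_of_ae_deriv_nonpos {E : Type*} [NormedAddCommGroup E] [NormedSpace ℝ E]
    [FiniteDimensional ℝ E] {V : E → ℝ} {V' : E → E → ℝ} (hV : LocallyLipschitz V)
    (hV' : ∀ (Y : ℝ → E) x v, HasDerivAt Y v x → HasDerivAt (fun x => V (Y x)) (V' (Y x) v) x)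
    {X g : ℝ → E} {s t B : ℝ} (hst : s ≤ t) (hX : Continuous X)
    (hg : IntervalIntegrable g volume s t) (hB : ∀ᵐ x ∂volume.restrict (Ico s t), ‖g x‖ ≤ B)
    (hXg : ∀ x ∈ Icc s t, X x = X s + ∫ y in s..x, g y)
    (hdec : ∀ᵐ x ∂volume.restrict (Ico s t), V' (X x) (g x) ≤ 0) : V (X t) ≤ V (X s) := by
  have := FiniteDimensional.complete ℝ E
  set B' := max B 0
  have hlip : LipschitzOnWith (Real.toNNReal B') X (Icc s t) := by
    refine LipschitzOnWith.of_dist_le_mul ?_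
    rw [Real.coe_toNNReal B' (le_max_right _ _)]
    have key : ∀ x ∈ Icc s t, ∀ y ∈ Icc s t, x ≤ y → dist (X x) (X y) ≤ B' * dist x y := by
      intro x hx y hy hxy
      have hi : ∀ z ∈ Icc s t, IntervalIntegrable g volume s z := fun z hz =>
        hg.mono_set (by rw [uIcc_of_le hz.1, uIcc_of_le hst]; exact Icc_subset_Icc_right hz.2)
      rw [dist_comm, dist_eq_norm, hXg x hx, hXg y hy, add_sub_add_left_eq_sub,
        intervalIntegral.integral_interval_sub_left (hi y hy) (hi x hx), dist_comm x y,
        Real.dist_eq, abs_of_nonneg (by linarith)]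
      refine (norm_intervalIntegral_le_of_ae_Ico hxy (ae_restrict_Ico_mono hx.1 hy.2 hB)).trans ?_
      exact mul_le_mul_of_nonneg_right (le_max_left _ _) (by linarith)
    intro x hx y hy
    rcases le_total x y with h | h
    · exact key x hx y hy h
    · rw [dist_comm, dist_comm x y]; exact key y hy x hx h
  obtain ⟨K, hK⟩ := (hV.locallyLipschitzOn (s := X '' Icc s t)).exists_lipschitzOnWith_of_compact
    (isCompact_Icc.image hX)
  have hac : AbsolutelyContinuousOnInterval (fun x => V (X x)) s t := by
    have := hK.comp hlip (mapsTo_image X (Icc s t))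
    rw [← uIcc_of_le hst] at this
    exact this.absolutelyContinuousOnInterval
  have hint := hac.integral_deriv_eq_sub
  have hle : ∫ x in s..t, deriv (fun x => V (X x)) x ≤ 0 := by
    rw [← neg_nonneg, ← intervalIntegral.integral_neg]
    refine intervalIntegral.integral_nonneg_of_ae_restrict hst ?_
    have h1 := (ae_restrict_iff' measurableSet_Ico).1 hdec
    rw [Filter.EventuallyLE, ← Measure.restrict_congr_set (Ioo_ae_eq_Icc (a := s) (b := t)),
      ae_restrict_iff' measurableSet_Ioo]
    filter_upwards [hg.ae_hasDerivAt_integral, h1] with x hx h1 hxs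
    have h2 : HasDerivAt (fun y => X s + ∫ z in s..y, g z) (g x) x :=
      (hx (by rw [uIcc_of_le hst]; exact Ioo_subset_Icc_self hxs) s
        (by rw [uIcc_of_le hst]; exact ⟨le_rfl, hst⟩)).const_add _
    have h3 : HasDerivAt X (g x) x := by
      refine h2.congr_of_eventuallyEq ?_
      filter_upwards [Ioo_mem_nhds hxs.1 hxs.2] with y hy using hXg y (Ioo_subset_Icc_self hy)
    rw [(hV' X x (g x) h3).deriv, Pi.zero_apply, neg_nonneg]
    exact h1 (Ioo_subset_Ico_self hxs)
  linarith

section Bil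

variable {r m : ℕ}

/-- The bilinear form `xᵀ (P ⊗ I) y`. -/
def bil (P : Matrix (Fin r) (Fin r) ℝ) (x y : Fin r → Vec m) : ℝ :=
  ∑ j, ∑ k, P j k * inner ℝ (x j) (y k)

variable (P Q : Matrix (Fin r) (Fin r) ℝ) (x y z : Fin r → Vec m)

lemma bil_add_right : bil P x (y + z) = bil P x y + bil P x z := by
  simp [bil, inner_add_right, mul_add, Finset.sum_add_distrib]

lemma bil_add_left : bil (P + Q) x y = bil P x y + bil Q x y := by
  simp [bil, add_mul, Finset.sum_add_distrib]

lemma bil_neg_left : bil (-P) x y = -bil P x y := by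
  simp [bil]

lemma bil_transpose : bil P.transpose x y = bil P y x := by
  simp only [bil, Matrix.transpose_apply]
  rw [Finset.sum_comm]
  refine Finset.sum_congr rfl fun j _ => Finset.sum_congr rfl fun k _ => ?_
  rw [real_inner_comm]

lemma bil_comm (hP : P.transpose = P) : bil P x y = bil P y x := by
  conv_lhs => rw [← hP, bil_transpose]

lemma bil_mul (A : Matrix (Fin r) (Fin r) ℝ) :
    bil (P * A) x y = bil P x fun k => ∑ l, A k l • y l := by
  simp only [bil, Matrix.mul_apply, inner_sum, inner_smul_right, Finset.mul_sum, Finset.sum_mul]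
  refine Finset.sum_congr rfl fun j _ => ?_
  rw [Finset.sum_comm]
  refine Finset.sum_congr rfl fun j _ => Finset.sum_congr rfl fun k _ => ?_
  ring

/-- This is the purpose of the choice of p in (A.1): since P p is a multiple of the first unit
vector, a gain multiplied by p acts, in the inner product of P, on the first component alone. -/
lemma bil_smul_right (p : Fin r → ℝ) (v : Vec m) {κ : ℝ} {i₀ : Fin r}
    (hp : P.mulVec p = Pi.single i₀ κ) : bil P x (fun k => p k • v) = κ * inner ℝ (x i₀) v := by
  have h : ∀ j, ∑ k, P j k * inner ℝ (x j) (p k • v) = (P.mulVec p) j * inner ℝ (x j) v := by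
    intro j
    simp only [Matrix.mulVec, dotProduct, inner_smul_right, Finset.sum_mul]
    exact Finset.sum_congr rfl fun k _ => by ring
  simp only [bil, h, hp]
  rw [Finset.sum_eq_single i₀]
  · simp
  · intro j _ hj; simp [hj]
  · simp

lemma exists_bil_le : ∃ c, 0 ≤ c ∧ ∀ x y : Fin r → Vec m, |bil P x y| ≤ c * ‖x‖ * ‖y‖ := by
  refine ⟨∑ j, ∑ k, |P j k|, by positivity, fun x y => ?_⟩
  rw [bil, Finset.sum_mul, Finset.sum_mul]
  refine (Finset.abs_sum_le_sum_abs _ _).trans (Finset.sum_le_sum fun j _ => ?_)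
  rw [Finset.sum_mul, Finset.sum_mul]
  refine (Finset.abs_sum_le_sum_abs _ _).trans (Finset.sum_le_sum fun k _ => ?_)
  rw [abs_mul, mul_assoc]
  gcongr
  exact (abs_real_inner_le_norm _ _).trans
    (mul_le_mul (norm_le_pi_norm _ _) (norm_le_pi_norm _ _) (norm_nonneg _) (norm_nonneg _))

/-- In coordinates of ℝᵐ the form is a sum of m copies of the quadratic form of P. -/
lemma bil_self_pos {P : Matrix (Fin r) (Fin r) ℝ} (hP : P.PosDef) {x : Fin r → Vec m} (hx : x ≠ 0) :
    0 < bil P x x := by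
  have e : bil P x x = ∑ c : Fin m, dotProduct (fun j => x j c) (P.mulVec fun k => x k c) := by
    simp only [bil, dotProduct, Matrix.mulVec, Finset.mul_sum, PiLp.inner_apply]
    rw [Finset.sum_comm]
    conv_rhs => rw [Finset.sum_comm]
    rw [Finset.sum_comm]
    refine Finset.sum_congr rfl fun j _ => ?_
    rw [Finset.sum_comm]
    refine Finset.sum_congr rfl fun c _ => Finset.sum_congr rfl fun k _ => ?_
    simp; ring
  rw [e]
  have hnn : ∀ c : Fin m, 0 ≤ dotProduct (fun j => x j c) (P.mulVec fun k => x k c) := fun c => by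
    simpa using hP.posSemidef.dotProduct_mulVec_nonneg fun k => x k c
  obtain ⟨j, hj⟩ := Function.ne_iff.1 hx
  obtain ⟨c, hc⟩ : ∃ c, x j c ≠ 0 := by
    by_contra! h
    exact hj (PiLp.ext h)
  refine Finset.sum_pos' (fun c _ => hnn c) ⟨c, Finset.mem_univ _, ?_⟩
  have : (fun k => x k c) ≠ 0 := fun h => hc (congrFun h j)
  simpa using hP.dotProduct_mulVec_pos this

lemma continuous_bil_self : Continuous fun x : Fin r → Vec m => bil P x x := by
  unfold bil; fun_prop

lemma bil_smul_smul (c : ℝ) : bil P (c • x) (c • x) = c ^ 2 * bil P x x := by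
  simp only [bil, Pi.smul_apply, inner_smul_left, inner_smul_right, Finset.mul_sum]
  refine Finset.sum_congr rfl fun j _ => Finset.sum_congr rfl fun k _ => ?_
  simp; ring

lemma exists_le_bil_self {P : Matrix (Fin r) (Fin r) ℝ} (hP : P.PosDef) :
    ∃ c, 0 < c ∧ ∀ x : Fin r → Vec m, c * ‖x‖ ^ 2 ≤ bil P x x := by
  -- The unit sphere is empty when the space of tuples is trivial; otherwise the constant is the
  -- minimum of the form on the sphere.
  rcases (Metric.sphere (0 : Fin r → Vec m) 1).eq_empty_or_nonempty with h | h
  · refine ⟨1, one_pos, fun x => ?_⟩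
    have hx : x = 0 := by
      by_contra hx
      have : (‖x‖⁻¹ • x) ∈ Metric.sphere (0 : Fin r → Vec m) 1 := by
        simp [norm_smul, inv_mul_cancel₀ (norm_ne_zero_iff.2 hx)]
      rw [h] at this; exact this
    simp [hx, bil]
  obtain ⟨x₀, hx₀, hmin⟩ := (isCompact_sphere (0 : Fin r → Vec m) 1).exists_isMinOn h
    (continuous_bil_self P).continuousOn
  have h0 : x₀ ≠ 0 := by rintro rfl; simp at hx₀
  refine ⟨bil P x₀ x₀, bil_self_pos hP h0, fun x => ?_⟩
  by_cases hx : x = 0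
  · simp [hx, bil]
  have hn : 0 < ‖x‖ := norm_pos_iff.2 hx
  have hm : (‖x‖⁻¹ • x) ∈ Metric.sphere (0 : Fin r → Vec m) 1 := by
    simp [norm_smul, inv_mul_cancel₀ hn.ne']
  have h1 : bil P x₀ x₀ ≤ bil P (‖x‖⁻¹ • x) (‖x‖⁻¹ • x) := hmin hm
  rw [bil_smul_smul, inv_pow, inv_mul_eq_div, le_div_iff₀ (by positivity)] at h1
  exact h1

lemma hasDerivAt_bil_self (hP : P.transpose = P) {Y : ℝ → Fin r → Vec m} {v : Fin r → Vec m} {t : ℝ}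
    (hY : ∀ j, HasDerivAt (fun s => Y s j) (v j) t) :
    HasDerivAt (fun s => bil P (Y s) (Y s)) (2 * bil P (Y t) v) t := by
  have h : HasDerivAt (fun s => bil P (Y s) (Y s))
      (∑ j, ∑ k, P j k * (inner ℝ (Y t j) (v k) + inner ℝ (v j) (Y t k))) t := by
    unfold bil
    exact HasDerivAt.fun_sum fun j _ => HasDerivAt.fun_sum fun k _ =>
      ((hY j).inner ℝ (hY k)).const_mul _
  convert h using 1
  have e : ∑ j, ∑ k, P j k * (inner ℝ (Y t j) (v k) + inner ℝ (v j) (Y t k))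
      = bil P (Y t) v + bil P v (Y t) := by
    simp only [bil, mul_add, Finset.sum_add_distrib]
  rw [e, bil_comm P v (Y t) hP]; ring

/-- The Lyapunov equation `Aᵀ P + P A + Q = 0` in terms of the bilinear forms. -/
lemma bil_lyapunov {A : Matrix (Fin r) (Fin r) ℝ} (hP : P.transpose = P)
    (h : A.transpose * P + P * A + Q = 0) :
    2 * bil P x (fun k => ∑ l, A k l • x l) = -bil Q x x := by
  have h1 : A.transpose * P = (P * A).transpose := by rw [Matrix.transpose_mul, hP]
  have h2 : Q = -((P * A).transpose + P * A) := by
    rw [h1] at h; exact eq_neg_of_add_eq_zero_right h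
  rw [h2, bil_neg_left, bil_add_left, bil_transpose, ← bil_mul]; ring

lemma companion_smul {n : ℕ} (a : ℕ → ℝ) (x : Fin (n + 2) → Vec m) (k : Fin (n + 2)) :
    ∑ l, companion (fun j : Fin (n + 2) => a j) k l • x l = nth x (k + 1) - a k • x 0 := by
  simp only [companion, add_smul, Finset.sum_add_distrib, ite_smul, zero_smul, one_smul]
  have h0 : ∑ l : Fin (n + 2), (if (l : ℕ) = 0 then -a k • x l else 0) = -(a k • x 0) := by
    rw [Finset.sum_eq_single (0 : Fin (n + 2)) (fun l _ hl => if_neg fun h => hl (Fin.ext (by simpa using h)))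
      (by simp)]
    simp
  rw [h0]
  by_cases hk : (k : ℕ) + 1 < n + 2
  · rw [nth_of_lt _ hk, Finset.sum_eq_single ⟨k + 1, hk⟩ (fun l _ hl =>
      if_neg fun h => hl (Fin.ext h)) (by simp), if_pos rfl]
    abel
  · rw [nth_of_ge _ (by omega), Finset.sum_eq_zero fun l _ => if_neg (by have := l.2; omega)]
    abel

end Bil
end

/-! ### The energy of the internal states and its dissipation -/

noncomputable section

/-- The storage function for the internal states. -/
def energy {m n : ℕ} (P : Matrix (Fin (n + 2)) (Fin (n + 2)) ℝ) (M : Vec m →L[ℝ] Vec m)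
    (X : InnerState m n) : ℝ :=
  bil P (fun j => M (X 0 j)) (fun j => M (X 0 j)) + ∑ i : Fin n, bil P (X i.succ) (X i.succ)

/-- The derivative of `energy` in the direction `v`. -/
def power {m n : ℕ} (P : Matrix (Fin (n + 2)) (Fin (n + 2)) ℝ) (M : Vec m →L[ℝ] Vec m)
    (X v : InnerState m n) : ℝ :=
  2 * (bil P (fun j => M (X 0 j)) (fun j => M (v 0 j)) + ∑ i : Fin n, bil P (X i.succ) (v i.succ))

section Energy

variable {m n : ℕ} {P : Matrix (Fin (n + 2)) (Fin (n + 2)) ℝ} {M : Vec m →L[ℝ] Vec m}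

lemma power_add (X v w : InnerState m n) :
    power P M X (v + w) = power P M X v + power P M X w := by
  have h : (fun j => M ((v + w) 0 j)) = (fun j => M (v 0 j)) + fun j => M (w 0 j) := by
    ext1 j; simp
  simp only [power, h, bil_add_right, Pi.add_apply _ _ (Fin.succ _), Finset.sum_add_distrib]
  ring

lemma hasDerivAt_energy (hP : P.transpose = P) {Y : ℝ → InnerState m n} {v : InnerState m n} {t : ℝ}
    (hY : HasDerivAt Y v t) : HasDerivAt (fun s => energy P M (Y s)) (power P M (Y t) v) t := by
  have h : ∀ i j, HasDerivAt (fun s => Y s i j) (v i j) t := fun i j =>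
    hasDerivAt_pi.1 (hasDerivAt_pi.1 hY i) j
  have h1 := (hasDerivAt_bil_self P hP (Y := fun s j => M (Y s 0 j)) (v := fun j => M (v 0 j))
    fun j => M.hasFDerivAt.comp_hasDerivAt t (h 0 j)).add
    (HasDerivAt.fun_sum fun (i : Fin n) (_ : i ∈ Finset.univ) =>
      hasDerivAt_bil_self P hP (Y := fun s => Y s i.succ) (h i.succ))
  refine h1.congr_deriv ?_
  rw [power, mul_add, Finset.mul_sum]

lemma locallyLipschitz_energy : LocallyLipschitz (energy (m := m) P M) := by
  refine ContDiff.locallyLipschitz (𝕂 := ℝ) ?_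
  have h : ∀ i j, ContDiff ℝ 1 fun X : InnerState m n => X i j := fun i j =>
    contDiff_pi.1 (contDiff_pi.1 contDiff_id i) j
  unfold energy bil
  refine ContDiff.add ?_ ?_
  · exact ContDiff.sum fun j _ => ContDiff.sum fun k _ => contDiff_const.mul
      ((M.contDiff.comp (h 0 j)).inner ℝ (M.contDiff.comp (h 0 k)))
  · exact ContDiff.sum fun i _ => ContDiff.sum fun j _ => ContDiff.sum fun k _ =>
      contDiff_const.mul ((h _ j).inner ℝ (h _ k))

lemma sq_norm_le_sum {ι : Type*} [Fintype ι] {F : Type*} [NormedAddCommGroup F] (x : ι → F) :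
    ‖x‖ ^ 2 ≤ ∑ i, ‖x i‖ ^ 2 := by
  have h0 : 0 ≤ ∑ i, ‖x i‖ ^ 2 := by positivity
  rw [← Real.sqrt_le_sqrt_iff h0, Real.sqrt_sq (norm_nonneg _)]
  refine (pi_norm_le_iff_of_nonneg (Real.sqrt_nonneg _)).2 fun i => Real.le_sqrt_of_sq_le ?_
  exact Finset.single_le_sum (f := fun i => ‖x i‖ ^ 2) (fun i _ => by positivity) (Finset.mem_univ i)

lemma norm_map_le {ι : Type*} [Fintype ι] (M : Vec m →L[ℝ] Vec m) (x : ι → Vec m) :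
    ‖fun j => M (x j)‖ ≤ ‖M‖ * ‖x‖ :=
  (pi_norm_le_iff_of_nonneg (by positivity)).2 fun j => (M.le_opNorm _).trans
    (mul_le_mul_of_nonneg_left (norm_le_pi_norm _ _) (norm_nonneg _))

lemma exists_power_le : ∃ c, 0 ≤ c ∧ ∀ X v : InnerState m n, |power P M X v| ≤ c * ‖X‖ * ‖v‖ := by
  obtain ⟨c, hc, h⟩ := exists_bil_le (m := m) P
  refine ⟨2 * (c * ‖M‖ * ‖M‖ + n * c), by positivity, fun X v => ?_⟩
  have h1 : |bil P (fun j => M (X 0 j)) (fun j => M (v 0 j))| ≤ c * ‖M‖ * ‖M‖ * (‖X‖ * ‖v‖) := by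
    refine (h _ _).trans ?_
    have e1 := (norm_map_le M (X 0)).trans (mul_le_mul_of_nonneg_left (norm_le_pi_norm X 0) (norm_nonneg M))
    have e2 := (norm_map_le M (v 0)).trans (mul_le_mul_of_nonneg_left (norm_le_pi_norm v 0) (norm_nonneg M))
    calc _ ≤ c * (‖M‖ * ‖X‖) * (‖M‖ * ‖v‖) := by gcongr
      _ = _ := by ring
  have h2 : |∑ i : Fin n, bil P (X i.succ) (v i.succ)| ≤ n * c * (‖X‖ * ‖v‖) := by
    refine (Finset.abs_sum_le_sum_abs _ _).trans ?_
    calc _ ≤ ∑ i : Fin n, c * ‖X‖ * ‖v‖ := Finset.sum_le_sum fun i _ => (h _ _).trans (by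
          gcongr <;> exact norm_le_pi_norm _ _)
      _ = _ := by simp; ring
  rw [power, abs_mul, abs_two]
  have := abs_add_le (bil P (fun j => M (X 0 j)) (fun j => M (v 0 j))) (∑ i : Fin n, bil P (X i.succ) (v i.succ))
  nlinarith

lemma power_self (X : InnerState m n) : power P M X X = 2 * energy P M X := rfl

lemma exists_le_energy (hP : P.PosDef) {μ : ℝ} (hμ : 0 < μ) (hM : ∀ x, μ * ‖x‖ ≤ ‖M x‖) :
    ∃ c, 0 < c ∧ ∀ X : InnerState m n, c * ‖X‖ ^ 2 ≤ energy P M X := by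
  obtain ⟨c, hc, h⟩ := exists_le_bil_self (m := m) hP
  refine ⟨c * min (μ ^ 2) 1, by positivity, fun X => ?_⟩
  have h0 : μ ^ 2 * ‖X 0‖ ^ 2 ≤ ‖fun j => M (X 0 j)‖ ^ 2 := by
    rw [← mul_pow]
    refine pow_le_pow_left₀ (by positivity) ?_ 2
    rw [mul_comm, ← le_div_iff₀ hμ]
    refine (pi_norm_le_iff_of_nonneg (by positivity)).2 fun j => ?_
    rw [le_div_iff₀ hμ, mul_comm]
    exact (hM _).trans (norm_le_pi_norm (fun j => M (X 0 j)) j)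
  have h1 := sq_norm_le_sum X
  rw [Fin.sum_univ_succ] at h1
  have h2 : ∑ i : Fin n, c * ‖X i.succ‖ ^ 2 ≤ ∑ i : Fin n, bil P (X i.succ) (X i.succ) :=
    Finset.sum_le_sum fun i _ => h _
  rw [← Finset.mul_sum] at h2
  have h3 := h fun j => M (X 0 j)
  rw [energy]
  generalize ∑ i : Fin n, bil P (X i.succ) (X i.succ) = b₁ at h2 ⊢
  generalize bil P (fun j => M (X 0 j)) (fun j => M (X 0 j)) = b₀ at h3 ⊢
  have hs : 0 ≤ ∑ i : Fin n, ‖X i.succ‖ ^ 2 := Finset.sum_nonneg fun _ _ => sq_nonneg _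
  generalize ∑ i : Fin n, ‖X i.succ‖ ^ 2 = s at h1 h2 hs
  have hx : 0 ≤ ‖X 0‖ ^ 2 := sq_nonneg _
  generalize ‖X 0‖ ^ 2 = x at h0 h1 hx
  have e1 := mul_le_mul_of_nonneg_right (min_le_left (μ ^ 2) 1) hx
  have e2 := mul_le_mul_of_nonneg_right (min_le_right (μ ^ 2) 1) hs
  have e3 := mul_le_mul_of_nonneg_left h1 (by positivity : 0 ≤ c * min (μ ^ 2) 1)
  have e4 := mul_le_mul_of_nonneg_left (e1.trans h0) hc.le
  have e5 := mul_le_mul_of_nonneg_left e2 hc.le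
  linarith

end Energy

/-- The conditions on the coefficients under which the internal dynamics are stable. -/
structure Coeff.Stable {m n : ℕ} (C : Coeff m n) (ρ κ ν : ℝ)
    (P Q : Matrix (Fin (n + 2)) (Fin (n + 2)) ℝ) (M : Vec m →L[ℝ] Vec m) : Prop where
  rho : 1 < ρ
  c_zero : C.c 0 = ρ⁻¹
  c_succ : ∀ i : Fin n, C.c i.succ = 1
  P_pos : P.PosDef
  Q_pos : Q.PosDef
  lyapunov : (companion fun j : Fin (n + 2) => C.a j).transpose * P
    + P * (companion fun j : Fin (n + 2) => C.a j) + Q = 0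
  kappa : 0 < κ
  mulVec_p : P.mulVec (fun j => C.p j) = Pi.single 0 κ
  p_zero : 0 < C.p 0
  K_add_G : ∀ x, C.K x + C.G x = x
  inner_M : ∀ x y, inner ℝ (M x) (M (C.K y)) = inner ℝ x y
  nu : 0 < ν
  le_M : ∀ x, ν * ‖x‖ ≤ ‖M x‖
  G_lt : ‖C.G‖ < 1
  G_small : n * ‖C.G‖ + 1 < ρ

namespace Coeff

variable {m n : ℕ} (C : Coeff m n)

/-- The gain `h_i`. -/
def gain (θ : Conf m n) (i : Fin (n + 1)) : ℝ :=
  1 / (1 - (C.c i * θ.1 0) ^ 2 * ‖C.errs θ.2.2 i‖ ^ 2)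

lemma w_jet (θ : Conf m n) (i : Fin (n + 1)) (j : ℕ) :
    C.w i j (C.jet θ i 0) = (C.a j + C.p j * C.gain θ i) • C.errs θ.2.2 i := by
  rw [w, gainTerm, jet, err_eq_errs, nth_of_lt _ (by omega)]; rfl

variable {C}

lemma gain_pos {θ : Conf m n} (hθ : θ ∈ C.confDom) (i : Fin (n + 1)) : 0 < C.gain θ i :=
  one_div_pos.2 (sub_pos.2 (C.mem_confDom.1 hθ i))

variable {ρ κ ν : ℝ} {P Q : Matrix (Fin (n + 2)) (Fin (n + 2)) ℝ} {M : Vec m →L[ℝ] Vec m}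

lemma Stable.c_pos (h : C.Stable ρ κ ν P Q M) (i : Fin (n + 1)) : 0 < C.c i := by
  refine Fin.cases ?_ (fun i => ?_) i
  · rw [h.c_zero]; exact inv_pos.2 (by linarith [h.rho])
  · rw [h.c_succ]; exact one_pos

lemma Stable.inv_c_le (h : C.Stable ρ κ ν P Q M) (i : Fin (n + 1)) : (C.c i)⁻¹ ≤ ρ := by
  refine Fin.cases ?_ (fun i => ?_) i
  · rw [h.c_zero, inv_inv]
  · rw [h.c_succ]; simpa using h.rho.le

lemma Stable.c_le (h : C.Stable ρ κ ν P Q M) (i : Fin (n + 1)) : C.c i ≤ 1 := by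
  refine Fin.cases ?_ (fun i => ?_) i
  · rw [h.c_zero]; exact inv_le_one_of_one_le₀ h.rho.le
  · rw [h.c_succ]

lemma mul_norm_errs_lt {θ : Conf m n} (hc : 0 < C.c i) (hθ : θ ∈ C.confDom) (hφ : 0 < θ.1 0) :
    C.c i * θ.1 0 * ‖C.errs θ.2.2 i‖ < 1 := by
  have := C.mem_confDom.1 hθ i
  rw [← mul_pow] at this
  exact (sq_lt_one_iff₀ (by positivity)).1 this

lemma Stable.norm_errs_le (h : C.Stable ρ κ ν P Q M) {θ : Conf m n} (hθ : θ ∈ C.confDom) {μ : ℝ}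
    (hμ : 0 < μ) (hφ : μ ≤ θ.1 0) (i : Fin (n + 1)) : ‖C.errs θ.2.2 i‖ ≤ ρ / μ := by
  have h1 := mul_norm_errs_lt (h.c_pos i) hθ (hμ.trans_le hφ)
  have h2 := h.inv_c_le i
  have hc := h.c_pos i
  have hr : 1 ≤ ρ * C.c i := by
    have := mul_le_mul_of_nonneg_right h2 hc.le
    rwa [inv_mul_cancel₀ hc.ne'] at this
  rw [le_div_iff₀ hμ]
  have h4 : C.c i * (‖C.errs θ.2.2 i‖ * μ) ≤ 1 := by
    have : C.c i * (‖C.errs θ.2.2 i‖ * μ) ≤ C.c i * (‖C.errs θ.2.2 i‖ * θ.1 0) := by gcongr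
    linarith
  by_contra! hlt
  have : 1 < C.c i * (‖C.errs θ.2.2 i‖ * μ) :=
    hr.trans_lt (by rw [mul_comm ρ]; exact mul_lt_mul_of_pos_left hlt hc)
  linarith

/-- y is z plus the sum of all errors, and the errors are confined by the funnels. So y is bounded
independently of the size of the gains. -/
lemma Stable.norm_out_le (h : C.Stable ρ κ ν P Q M) {θ : Conf m n} (hθ : θ ∈ C.confDom) {μ k : ℝ}
    (hμ : 0 < μ) (hφ : μ ≤ θ.1 0) (hk : ‖θ.2.1‖ ≤ k) : ‖C.out θ 0‖ ≤ k + (n + 1) * (ρ / μ) := by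
  rw [out, nth_of_lt _ (by omega)]
  refine (norm_add_le _ _).trans (add_le_add ((norm_le_pi_norm _ _).trans hk) ?_)
  refine (norm_sum_le_of_le _ fun i _ => (C.err_eq_errs θ i ▸ h.norm_errs_le hθ hμ hφ i :
    ‖C.err θ 0 i‖ ≤ ρ / μ)).trans ?_
  simp

/-- With s = αx < 1 and αy ≤ 1 one has α² x (y − x) ≤ s (1 − s) ≤ 1 − s², and the last expression
cancels against the gain. So a gain of any size contributes only a bounded amount. -/
lemma gain_mul_le {α x y : ℝ} (hα : 0 < α) (hx : 0 ≤ x) (hxα : α * x < 1) (hy : y ≤ 1 / α) :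
    1 / (1 - α ^ 2 * x ^ 2) * (x * (y - x)) ≤ 1 / α ^ 2 := by
  have h1 : 0 < 1 - α ^ 2 * x ^ 2 := by
    have : (α * x) ^ 2 < 1 := (sq_lt_one_iff₀ (by positivity)).2 hxα
    nlinarith
  rw [one_div_mul_eq_div, div_le_div_iff₀ h1 (by positivity)]
  rw [le_div_iff₀ hα] at hy
  have h2 : y * α * (x * α) ≤ 1 * (x * α) := by gcongr
  nlinarith

/-- The contribution of the companion matrices to the internal dynamics. -/
def linPart (C : Coeff m n) (X : InnerState m n) : InnerState m n := fun i k =>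
  ∑ l, companion (fun j : Fin (n + 2) => C.a j) k l • X i l

/-- The contribution of the gains to the internal dynamics. -/
def gainPart (C : Coeff m n) (θ : Conf m n) : InnerState m n :=
  Fin.cons (fun j => C.p j • -(C.gain θ 0 • C.K (C.errs θ.2.2 0)))
    fun i j => C.p j • (C.gain θ i.castSucc • C.errs θ.2.2 i.castSucc
      - C.gain θ i.succ • C.errs θ.2.2 i.succ)

/-- What is bounded as soon as the errors, ξ and v are. The a_j-terms correct `linPart`, in which
the first state of each block stands in for the error terms. -/
def restPart (C : Coeff m n) (θ : Conf m n) (v : Vec m) : InnerState m n :=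
  Fin.cons (fun j => C.a j • (θ.2.2 0 0 - C.K (C.errs θ.2.2 0)) + C.R (n + 1 - j) (C.out θ 0)
      - (if (j : ℕ) = n then C.G (nth θ.2.1 (n + 1)) else 0) + if (j : ℕ) = n + 1 then v else 0)
    fun i j => C.a j • C.errs θ.2.2 i.castSucc

lemma field_eq_parts (θ : Conf m n) (v : Vec m) :
    C.field θ v = C.linPart θ.2.2 + C.gainPart θ + C.restPart θ v := by
  ext i j : 2
  refine Fin.cases ?_ (fun i => ?_) i
  · simp only [field, gainPart, restPart, linPart, Fin.cons_zero, Pi.add_apply, companion_smul,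
      w_jet, smul_neg, map_smul, map_add, add_smul, smul_sub, mul_smul]
    abel
  · simp only [field, gainPart, restPart, linPart, Fin.cons_succ, Pi.add_apply, companion_smul,
      w_jet, add_smul, smul_sub, mul_smul, errs_succ]
    abel

/-- The Lyapunov equation in each block; M acts on ℝᵐ and so commutes with the companion matrix. -/
lemma Stable.power_linPart_le (h : C.Stable ρ κ ν P Q M) :
    ∃ q, 0 < q ∧ ∀ X : InnerState m n, power P M X (C.linPart X) ≤ -q * ‖X‖ ^ 2 := by
  obtain ⟨q, hq, H⟩ := exists_le_energy (m := m) h.Q_pos h.nu h.le_M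
  refine ⟨q, hq, fun X => ?_⟩
  have hP : P.transpose = P := by simpa using h.P_pos.1.eq
  have e1 : (fun j => M (C.linPart X 0 j))
      = fun k => ∑ l, companion (fun j : Fin (n + 2) => C.a j) k l • M (X 0 l) := by
    ext1 k; simp [linPart]
  have : power P M X (C.linPart X) = -energy Q M X := by
    rw [power, e1, mul_add, bil_lyapunov _ _ _ hP h.lyapunov, Finset.mul_sum, energy, neg_add,
      ← Finset.sum_neg_distrib]
    congr 1
    exact Finset.sum_congr rfl fun i _ => bil_lyapunov _ _ _ hP h.lyapunov
  rw [this]; linarith [H X]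

/-- As P p = (κ, 0, …, 0), only first components count, and MᵀM = K⁻¹ removes K from the first
block. Sorted by gains, h_i multiplies ⟨e_{i+1}, e_i⟩ − ‖e_i‖², with the further term −⟨G ∑ e_j,
e_0⟩ for i = 0. Each vector paired with e_i is at most as long as the funnel radius of e_i, so
`gain_mul_le` applies. -/
lemma Stable.power_gainPart_le (h : C.Stable ρ κ ν P Q M) {θ : Conf m n} (hθ : θ ∈ C.confDom) {μ : ℝ}
    (hμ : 0 < μ) (hφ : μ ≤ θ.1 0) :
    power P M θ.2.2 (C.gainPart θ) ≤ 2 * (κ * ((ρ ^ 2 + n) / μ ^ 2)) := by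
  set e := C.errs θ.2.2 with he
  set φ := θ.1 0 with hφdef
  have hφ0 : 0 < φ := hμ.trans_le hφ
  have hρ := h.rho
  have h0 : bil P (fun j => M (θ.2.2 0 j)) (fun j => M (C.gainPart θ 0 j))
      = κ * -(C.gain θ 0 * inner ℝ (θ.2.2 0 0) (e 0)) := by
    have : (fun j => M (C.gainPart θ 0 j))
        = fun j : Fin (n + 2) => C.p j • M (-(C.gain θ 0 • C.K (e 0))) := by
      ext1 j; simp only [gainPart, Fin.cons_zero, map_smul, he]
    rw [this, bil_smul_right _ _ _ _ h.mulVec_p, map_neg, map_smul, inner_neg_right,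
      inner_smul_right, h.inner_M]
  have h1 : ∀ i : Fin n, bil P (θ.2.2 i.succ) (C.gainPart θ i.succ)
      = κ * (C.gain θ i.castSucc * inner ℝ (e i.succ) (e i.castSucc)
        - C.gain θ i.succ * ‖e i.succ‖ ^ 2) := fun i => by
    have : C.gainPart θ i.succ = fun j : Fin (n + 2) => C.p j •
        (C.gain θ i.castSucc • e i.castSucc - C.gain θ i.succ • e i.succ) := by
      ext1 j; simp only [gainPart, Fin.cons_succ, he]
    rw [this, bil_smul_right _ _ _ _ h.mulVec_p, inner_sub_right, inner_smul_right,
      inner_smul_right, he, errs_succ, real_inner_self_eq_norm_sq]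
  have hX : θ.2.2 0 0 = e 0 + C.G (∑ i : Fin n, e i.succ) := by
    rw [he, errs_zero]; simp only [errs_succ]; abel
  -- The sum is reordered by the gain that occurs. The last gain has no successor, which `nth`
  -- expresses by the error 0.
  have hsum : ∑ i : Fin n, C.gain θ i.castSucc * inner ℝ (e i.succ) (e i.castSucc)
      = ∑ i : Fin (n + 1), C.gain θ i * inner ℝ (nth e (i + 1)) (e i) := by
    rw [Fin.sum_univ_castSucc, Fin.val_last, nth_of_ge e le_rfl, inner_zero_left, mul_zero, add_zero]
    refine Finset.sum_congr rfl fun i _ => ?_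
    rw [Fin.val_castSucc, nth_of_lt e (by omega)]; rfl
  have hn : ∀ j : ℕ, ‖nth e (j + 1)‖ ≤ 1 / φ := fun j => by
    by_cases hj : j + 1 < n + 1
    · rw [nth_of_lt e hj, le_div_iff₀ hφ0]
      have := mul_norm_errs_lt (h.c_pos (⟨j, by omega⟩ : Fin n).succ) hθ hφ0
      rw [h.c_succ, one_mul] at this
      have e2 : (⟨j + 1, hj⟩ : Fin (n + 1)) = (⟨j, by omega⟩ : Fin n).succ := rfl
      rw [e2, mul_comm]
      exact this.le
    · rw [nth_of_ge e (by omega), norm_zero]; positivity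
  have hs : ∀ i : Fin n, C.gain θ i.succ * (inner ℝ (nth e (i.succ + 1)) (e i.succ) - ‖e i.succ‖ ^ 2)
      ≤ 1 / μ ^ 2 := fun i => by
    have hg := gain_pos hθ i.succ
    have hx := mul_norm_errs_lt (h.c_pos i.succ) hθ hφ0
    rw [h.c_succ, one_mul] at hx
    have hgm := gain_mul_le hφ0 (norm_nonneg _) hx (hn i.succ)
    have hgain : C.gain θ i.succ = 1 / (1 - φ ^ 2 * ‖e i.succ‖ ^ 2) := by
      rw [gain, h.c_succ, one_mul]
    calc _ ≤ C.gain θ i.succ * (‖e i.succ‖ * (‖nth e (i.succ + 1)‖ - ‖e i.succ‖)) := by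
          refine mul_le_mul_of_nonneg_left ?_ hg.le
          have := real_inner_le_norm (nth e (i.succ + 1)) (e i.succ)
          linarith
      _ ≤ 1 / φ ^ 2 := by rw [hgain]; exact hgm
      _ ≤ _ := by gcongr
  have hz : C.gain θ 0 * (inner ℝ (nth e 1) (e 0) - ‖e 0‖ ^ 2
      - inner ℝ (C.G (∑ i : Fin n, e i.succ)) (e 0)) ≤ ρ ^ 2 / μ ^ 2 := by
    have hg := gain_pos hθ 0
    have hα : 0 < ρ⁻¹ * φ := by positivity
    have hx := mul_norm_errs_lt (h.c_pos 0) hθ hφ0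
    rw [h.c_zero] at hx
    have hS : ‖∑ i : Fin n, e i.succ‖ ≤ n * (1 / φ) := by
      refine (norm_sum_le_of_le _ fun i _ => ?_).trans (by simp : ∑ i : Fin n, 1 / φ ≤ _)
      have := hn i
      rwa [nth_of_lt e (by omega)] at this
    -- The first funnel has radius ρ/φ instead of 1/φ; the condition n‖G‖ + 1 < ρ makes room for the
    -- feedback through G.
    have hb : ‖nth e 1‖ + ‖C.G (∑ i : Fin n, e i.succ)‖ ≤ 1 / (ρ⁻¹ * φ) := by
      have e1 : ‖C.G (∑ i : Fin n, e i.succ)‖ ≤ ‖C.G‖ * (n * (1 / φ)) :=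
        (C.G.le_opNorm _).trans (mul_le_mul_of_nonneg_left hS (norm_nonneg _))
      have e2 := hn 0
      have e3 : 1 / (ρ⁻¹ * φ) = ρ * (1 / φ) := by field_simp
      have e4 : (n * ‖C.G‖ + 1) * (1 / φ) ≤ ρ * (1 / φ) := by gcongr; exact h.G_small.le
      rw [e3]; rw [zero_add] at e2; linarith
    have hgm := gain_mul_le hα (norm_nonneg _) hx hb
    have hgain : C.gain θ 0 = 1 / (1 - (ρ⁻¹ * φ) ^ 2 * ‖e 0‖ ^ 2) := by
      rw [gain, h.c_zero]
    calc _ ≤ C.gain θ 0 * (‖e 0‖ * (‖nth e 1‖ + ‖C.G (∑ i : Fin n, e i.succ)‖ - ‖e 0‖)) := by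
          refine mul_le_mul_of_nonneg_left ?_ hg.le
          have e1 := real_inner_le_norm (nth e 1) (e 0)
          have e2 := abs_real_inner_le_norm (C.G (∑ i : Fin n, e i.succ)) (e 0)
          have e3 := neg_abs_le (inner ℝ (C.G (∑ i : Fin n, e i.succ)) (e 0))
          linarith
      _ ≤ 1 / (ρ⁻¹ * φ) ^ 2 := by rw [hgain]; exact hgm
      _ ≤ 1 / (ρ⁻¹ * μ) ^ 2 := by gcongr
      _ = _ := by field_simp
  have htot : (∑ i : Fin (n + 1), C.gain θ i * inner ℝ (nth e (i + 1)) (e i))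
      - C.gain θ 0 * inner ℝ (θ.2.2 0 0) (e 0) - ∑ i : Fin n, C.gain θ i.succ * ‖e i.succ‖ ^ 2
      ≤ (ρ ^ 2 + n) / μ ^ 2 := by
    have hsum' := Finset.sum_le_sum fun (i : Fin n) (_ : i ∈ Finset.univ) => hs i
    simp only [Finset.sum_const, Finset.card_univ, Fintype.card_fin, nsmul_eq_mul, mul_sub,
      Finset.sum_sub_distrib] at hsum'
    rw [Fin.sum_univ_succ, hX, inner_add_left, real_inner_self_eq_norm_sq, Fin.val_zero, zero_add]
    have : (ρ ^ 2 + n) / μ ^ 2 = ρ ^ 2 / μ ^ 2 + n * (1 / μ ^ 2) := by ring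
    rw [this]
    linarith
  rw [power, h0]
  simp only [h1]
  rw [← Finset.mul_sum, ← mul_add, Finset.sum_sub_distrib, hsum]
  have := mul_le_mul_of_nonneg_left htot h.kappa.le
  linarith

lemma Stable.exists_norm_restPart_le (h : C.Stable ρ κ ν P Q M) {μ k V : ℝ}
    (hμ : 0 < μ) (hk : 0 ≤ k) (hV : 0 ≤ V) : ∃ B, 0 ≤ B ∧ ∀ θ ∈ C.confDom, μ ≤ θ.1 0 →
      ‖θ.2.1‖ ≤ k → ∀ v, ‖v‖ ≤ V → ‖C.restPart θ v‖ ≤ B := by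
  have hρ := h.rho
  set α := ∑ j ∈ Finset.range (n + 2), |C.a j|
  set r := ∑ j ∈ Finset.range (n + 2), ‖C.R j‖
  have hα : 0 ≤ α := by positivity
  have hr : 0 ≤ r := by positivity
  have hαj : ∀ j : Fin (n + 2), |C.a j| ≤ α := fun j =>
    Finset.single_le_sum (f := fun j => |C.a j|) (fun i _ => abs_nonneg _) (by simp)
  have hrj : ∀ j : ℕ, ‖C.R (n + 1 - j)‖ ≤ r := fun j =>
    Finset.single_le_sum (f := fun j => ‖C.R j‖) (fun i _ => norm_nonneg _)
      (by simp only [Finset.mem_range]; omega)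
  refine ⟨α * ((1 + n + ‖C.K‖) * (ρ / μ)) + r * (k + (n + 1) * (ρ / μ)) + k + V, by positivity,
    fun θ hθ hφ hξ v hv => ?_⟩
  have he := h.norm_errs_le hθ hμ hφ
  refine (pi_norm_le_iff_of_nonneg (by positivity)).2 fun i =>
    (pi_norm_le_iff_of_nonneg (by positivity)).2 fun j => ?_
  refine Fin.cases ?_ (fun i => ?_) i
  · have e1 : ‖θ.2.2 0 0 - C.K (C.errs θ.2.2 0)‖ ≤ (1 + n + ‖C.K‖) * (ρ / μ) := by
      have hX : θ.2.2 0 0 = C.errs θ.2.2 0 + C.G (∑ i : Fin n, C.errs θ.2.2 i.succ) := by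
        rw [errs_zero]; simp only [errs_succ]; abel
      have hS : ‖∑ i : Fin n, C.errs θ.2.2 i.succ‖ ≤ n * (ρ / μ) :=
        (norm_sum_le_of_le _ fun i _ => he _).trans (by simp)
      have hG : ‖C.G (∑ i : Fin n, C.errs θ.2.2 i.succ)‖ ≤ 1 * (n * (ρ / μ)) :=
        (C.G.le_opNorm _).trans (by gcongr; exact h.G_lt.le)
      have hK : ‖C.K (C.errs θ.2.2 0)‖ ≤ ‖C.K‖ * (ρ / μ) :=
        (C.K.le_opNorm _).trans (by gcongr; exact he 0)
      rw [hX]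
      refine (norm_sub_le _ _).trans ?_
      have := norm_add_le (C.errs θ.2.2 0) (C.G (∑ i : Fin n, C.errs θ.2.2 i.succ))
      linarith [he 0]
    have e2 : ‖C.a j • (θ.2.2 0 0 - C.K (C.errs θ.2.2 0))‖ ≤ α * ((1 + n + ‖C.K‖) * (ρ / μ)) := by
      rw [norm_smul]
      exact mul_le_mul (hαj j) e1 (norm_nonneg _) hα
    have e3 : ‖C.R (n + 1 - j) (C.out θ 0)‖ ≤ r * (k + (n + 1) * (ρ / μ)) :=
      (ContinuousLinearMap.le_opNorm _ _).trans
        (mul_le_mul (hrj j) (h.norm_out_le hθ hμ hφ hξ) (norm_nonneg _) hr)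
    have e4 : ‖(if (j : ℕ) = n then C.G (nth θ.2.1 (n + 1)) else 0 : Vec m)‖ ≤ k := by
      split_ifs
      · refine (C.G.le_opNorm _).trans ?_
        rw [nth_of_lt _ (by omega)]
        calc _ ≤ 1 * k := mul_le_mul h.G_lt.le ((norm_le_pi_norm _ _).trans hξ) (norm_nonneg _) zero_le_one
          _ = k := one_mul k
      · simpa using hk
    have e5 : ‖(if (j : ℕ) = n + 1 then v else 0 : Vec m)‖ ≤ V := by
      split_ifs
      · exact hv
      · simpa using hV
    simp only [restPart, Fin.cons_zero]
    refine (norm_add_le _ _).trans (add_le_add ((norm_sub_le _ _).trans (add_le_add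
      ((norm_add_le _ _).trans (add_le_add e2 e3)) e4)) e5)
  · simp only [restPart, Fin.cons_succ]
    rw [norm_smul]
    have e1 : |C.a j| * ‖C.errs θ.2.2 i.castSucc‖ ≤ α * (ρ / μ) :=
      mul_le_mul (hαj j) (he _) (norm_nonneg _) hα
    have e2 : α * (ρ / μ) ≤ α * ((1 + n + ‖C.K‖) * (ρ / μ)) := by
      refine mul_le_mul_of_nonneg_left ?_ hα
      refine le_mul_of_one_le_left (by positivity) ?_
      have : 0 ≤ (n : ℝ) + ‖C.K‖ := by positivity
      linarith
    have e3 : 0 ≤ r * (k + (n + 1) * (ρ / μ)) := by positivity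
    rw [Real.norm_eq_abs]
    linarith

/-- At high energy the internal dynamics dissipate. -/
lemma Stable.exists_power_field_nonpos (h : C.Stable ρ κ ν P Q M) {μ k V : ℝ}
    (hμ : 0 < μ) (hk : 0 ≤ k) (hV : 0 ≤ V) : ∃ E, 0 ≤ E ∧ ∀ θ ∈ C.confDom, μ ≤ θ.1 0 →
      ‖θ.2.1‖ ≤ k → ∀ v, ‖v‖ ≤ V → E < energy P M θ.2.2 → power P M θ.2.2 (C.field θ v) ≤ 0 := by
  obtain ⟨q, hq, H1⟩ := h.power_linPart_le
  obtain ⟨c, hc, H2⟩ := exists_power_le (m := m) (P := P) (M := M)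
  obtain ⟨B, hB, H3⟩ := h.exists_norm_restPart_le hμ hk hV
  have hρ := h.rho
  have hκ := h.kappa
  set D := 2 * (κ * ((ρ ^ 2 + n) / μ ^ 2)) with hD
  have hD0 : 0 ≤ D := by positivity
  -- For ‖X‖ ≥ N the loss q‖X‖² outweighs c B ‖X‖ + D, where D ≤ D‖X‖ because ‖X‖ ≥ 1. Since the
  -- energy is at most c‖X‖², an energy above c N² forces ‖X‖ ≥ N.
  set N := max 1 ((c * B + D) / q) with hN
  refine ⟨c * N ^ 2, by positivity, fun θ hθ hφ hξ v hv hE => ?_⟩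
  have h1 : energy P M θ.2.2 ≤ c * ‖θ.2.2‖ ^ 2 := by
    have h1 := H2 θ.2.2 θ.2.2
    have h2 := le_abs_self (power P M θ.2.2 θ.2.2)
    rw [power_self] at h1 h2
    have h3 : 0 ≤ c * ‖θ.2.2‖ * ‖θ.2.2‖ := by positivity
    have : energy P M θ.2.2 ≤ max 0 (2 * energy P M θ.2.2) := by
      rcases le_total 0 (energy P M θ.2.2) with h | h
      · rw [max_eq_right (by linarith)]; linarith
      · exact h.trans (le_max_left _ _)
    refine this.trans (max_le (by positivity) ?_)
    nlinarith
  have hNX : N ≤ ‖θ.2.2‖ := by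
    by_contra! hlt
    have : c * ‖θ.2.2‖ ^ 2 ≤ c * N ^ 2 := by gcongr
    linarith
  have hX1 : 1 ≤ ‖θ.2.2‖ := (le_max_left _ _).trans hNX
  have hX2 : c * B + D ≤ q * ‖θ.2.2‖ := by
    have := (le_max_right 1 ((c * B + D) / q)).trans hNX
    rwa [div_le_iff₀ hq, mul_comm _ q] at this
  rw [field_eq_parts, power_add, power_add]
  have e1 := H1 θ.2.2
  have e2 := h.power_gainPart_le hθ hμ hφ
  have e3 := (le_abs_self _).trans (H2 θ.2.2 (C.restPart θ v))
  have e4 : c * ‖θ.2.2‖ * ‖C.restPart θ v‖ ≤ c * ‖θ.2.2‖ * B := by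
    gcongr; exact H3 θ hθ hφ hξ v hv
  have e5 : D ≤ D * ‖θ.2.2‖ := le_mul_of_one_le_right hD0 hX1
  have e6 := mul_le_mul_of_nonneg_right hX2 (norm_nonneg θ.2.2)
  rw [← hD] at e2
  nlinarith

end Coeff
end

/-! ### Bounds near the initial time, and boundedness of the internal state -/

noncomputable section

/-- At the first time where u reaches η the hypothesis would give u < η. -/
lemma le_of_first_exit {u : ℝ → ℝ} {b η : ℝ} (hu : Continuous u) (h0 : u 0 < η)
    (h : ∀ s ∈ Icc 0 b, (∀ x ∈ Icc 0 s, u x ≤ η) → u s < η) : ∀ s ∈ Icc 0 b, u s ≤ η := by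
  by_contra! hcon
  obtain ⟨s₁, hs₁, hlt⟩ := hcon
  have hK : IsCompact {x ∈ Icc 0 b | η ≤ u x} :=
    isCompact_Icc.inter_right (isClosed_le continuous_const hu)
  obtain ⟨s, ⟨hs, hsη⟩, hmin⟩ := hK.exists_isMinOn ⟨s₁, hs₁, hlt.le⟩ continuousOn_id
  have hs0 : s ≠ 0 := by rintro rfl; linarith
  have hlt : ∀ x ∈ Ico 0 s, u x ≤ η := fun x hx => by
    by_contra! hc
    have : s ≤ x := hmin ⟨⟨hx.1, hx.2.le.trans hs.2⟩, hc.le⟩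
    linarith [hx.2]
  have hle : ∀ x ∈ Icc 0 s, u x ≤ η := by
    have : closure (Ico 0 s) ⊆ {x | u x ≤ η} :=
      closure_minimal hlt (isClosed_le hu continuous_const)
    rwa [closure_Ico (Ne.symm hs0)] at this
  linarith [h s hs hle]

namespace Sys

variable {m n l q : ℕ} {S : Sys m n l q}

/-- The funnel function is differentiable and bounded away from zero after the initial time. -/
structure Funnel (S : Sys m n l q) : Prop where
  lower : ∀ δ > 0, ∃ μ > 0, ∀ t ≥ δ, μ ≤ S.J t 0
  deriv : ∀ t > 0, HasDerivAt (fun s => S.J s 0) (S.J t 1) t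

variable (hS : S.Regular)

include hS

/-- Fixes one continuation g of (y, y′, …) that takes no values beyond those on [0,b]. Hence a bound
of y on [0,b] bounds f(d, T(y,…)) on the whole half-line, and the velocity is bounded almost
everywhere. -/
lemma IsInternal.exists_drive {ξ : ℝ → Sig m n} {X : ℝ → InnerState m n} {b : ℝ}
    (hξ : Continuous ξ) (hb : 0 ≤ b) (h : S.IsInternal ξ b X) :
    ∃ g : ℝ → Sig m n, Continuous g ∧ (∀ s ∈ Icc 0 b, g s = S.outs (S.J s, ξ s, X s)) ∧
      IntervalIntegrable (fun s => S.field (S.J s, ξ s, X s) (S.drive g s)) volume 0 b ∧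
      (∃ B, ∀ᵐ s ∂volume.restrict (Ico 0 b), ‖S.field (S.J s, ξ s, X s) (S.drive g s)‖ ≤ B) ∧
      (∀ s ∈ Icc 0 b, ∀ t ∈ Icc s b,
        X t = X s + ∫ x in s..t, S.field (S.J x, ξ x, X x) (S.drive g x)) ∧
      ∀ Y V, (∀ g : ℝ → Sig m n, Continuous g → (∀ s ≥ 0, ‖g s 0‖ ≤ Y) →
          ∀ᵐ s ∂volume.restrict (Ici (0 : ℝ)), ‖S.drive g s‖ ≤ V) →
        (∀ s ∈ Icc 0 b, ‖S.out (S.J s, ξ s, X s) 0‖ ≤ Y) →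
        ∀ᵐ s ∂volume.restrict (Ici (0 : ℝ)), ‖S.drive g s‖ ≤ V := by
  obtain ⟨g, hg, hgs, hgv⟩ := exists_continuous_outs hS.J_cont hξ h.cont hb h.mem
  have hY : ∀ Y, (∀ s ∈ Icc 0 b, ‖S.out (S.J s, ξ s, X s) 0‖ ≤ Y) → ∀ s, ‖g s 0‖ ≤ Y :=
    fun Y hY s => by
      obtain ⟨s', hs', e⟩ := hgv s
      rw [e]; exact hY s' hs'
  have hθ : ContinuousOn (fun s => S.field (S.J s, ξ s, X s) 0) (Icc 0 b) :=
    S.contDiffOn_field.continuousOn.comp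
      (hS.J_cont.prodMk (hξ.prodMk h.cont)).continuousOn h.mem
  have ho : ContinuousOn (fun s => S.outs (S.J s, ξ s, X s)) (Icc 0 b) :=
    S.contDiffOn_outs.continuousOn.comp
      (hS.J_cont.prodMk (hξ.prodMk h.cont)).continuousOn h.mem
  obtain ⟨B, hB⟩ := isCompact_Icc.exists_bound_of_continuousOn hθ
  obtain ⟨Y, hYb⟩ := isCompact_Icc.exists_bound_of_continuousOn ho
  obtain ⟨V, hV0, hV⟩ := exists_bound_drive hS Y
  have hw := hV g hg fun s _ => hY Y (fun s hs => (norm_le_pi_norm _ (0 : Fin (n + 2))).trans (hYb s hs)) s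
  have hbd : ∀ᵐ s ∂volume.restrict (Ico 0 b), ‖S.field (S.J s, ξ s, X s) (S.drive g s)‖ ≤ B + V := by
    filter_upwards [ae_restrict_Ico_of_Ici le_rfl hw, ae_restrict_mem measurableSet_Ico] with s h1 h2
    rw [Coeff.field_eq]
    refine (norm_add_le _ _).trans (add_le_add (hB s ⟨h2.1, h2.2.le⟩) ?_)
    have := Coeff.norm_inj_sub_le (n := n) (S.drive g s) 0
    rw [Coeff.inj_zero, sub_zero, sub_zero] at this
    exact this.trans h1
  have hint : IntervalIntegrable (fun s => S.field (S.J s, ξ s, X s) (S.drive g s)) volume 0 b := by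
    refine intervalIntegrable_of_ae_bound hb ?_ hbd
    have h1 := (hθ.mono Ico_subset_Icc_self).aestronglyMeasurable (μ := volume) measurableSet_Ico
    have h2 := (Coeff.continuous_inj (m := m) (n := n)).comp_aestronglyMeasurable
      (aestronglyMeasurable_drive hS g b)
    refine (h1.add h2).congr (Filter.Eventually.of_forall fun s => ?_)
    exact (Coeff.field_eq _ _).symm
  refine ⟨g, hg, hgs, hint, ⟨_, hbd⟩, fun s hs t ht => ?_, fun Y V hV hYs =>
    hV g hg fun s _ => hY Y hYs s⟩
  have hi : ∀ z ∈ Icc 0 b, IntervalIntegrable (fun s => S.field (S.J s, ξ s, X s) (S.drive g s))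
      volume 0 z := fun z hz => hint.mono_set
    (by rw [uIcc_of_le hz.1, uIcc_of_le hb]; exact Icc_subset_Icc_right hz.2)
  have ht0 : t ∈ Icc 0 b := ⟨hs.1.trans ht.1, ht.2⟩
  rw [h.eqn g hg hgs t ht0, h.eqn g hg hgs s hs, add_assoc,
    intervalIntegral.integral_add_adjacent_intervals (hi s hs) ((hi s hs).symm.trans (hi t ht0))]

lemma IsInternal.exists_velocity {ξ : ℝ → Sig m n} {X : ℝ → InnerState m n} {b : ℝ}
    (hξ : Continuous ξ) (hb : 0 ≤ b) (h : S.IsInternal ξ b X) :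
    ∃ w : ℝ → Vec m,
      IntervalIntegrable (fun s => S.field (S.J s, ξ s, X s) (w s)) volume 0 b ∧
      (∃ B, ∀ᵐ s ∂volume.restrict (Ico 0 b), ‖S.field (S.J s, ξ s, X s) (w s)‖ ≤ B) ∧
      (∀ s ∈ Icc 0 b, ∀ t ∈ Icc s b,
        X t = X s + ∫ x in s..t, S.field (S.J x, ξ x, X x) (w x)) ∧
      ∀ Y V, (∀ g : ℝ → Sig m n, Continuous g → (∀ s ≥ 0, ‖g s 0‖ ≤ Y) →
          ∀ᵐ s ∂volume.restrict (Ici (0 : ℝ)), ‖S.drive g s‖ ≤ V) →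
        (∀ s ∈ Icc 0 b, ‖S.out (S.J s, ξ s, X s) 0‖ ≤ Y) →
        ∀ᵐ s ∂volume.restrict (Ici (0 : ℝ)), ‖w s‖ ≤ V := by
  obtain ⟨g, -, -, h⟩ := h.exists_drive hS hξ hb
  exact ⟨_, h⟩

lemma exists_initial_core : ∃ η > 0, ∃ ε > 0, ∀ t ∈ Icc 0 η, ∀ X, ‖X - S.x₀‖ ≤ η →
    ∀ i, |S.c i * S.J t 0| * ‖S.errs X i‖ ≤ 1 - ε := by
  obtain ⟨b, ε, R, k, hε, -, -, -, h⟩ := Coeff.exists_core_of_isCompact (C := S.toCoeff)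
    (isCompact_singleton (x := ((S.J 0, 0, S.x₀) : Conf m n))) (by simpa using hS.init 0)
  have h := h rfl
  have hF : ∀ i, Continuous fun v : ℝ × InnerState m n => |S.c i * S.J v.1 0| * ‖S.errs v.2 i‖ :=
    fun i => ((continuous_const.mul ((continuous_apply 0).comp
      (hS.J_cont.comp continuous_fst))).abs).mul
      ((continuous_apply i).comp (S.continuous_errs.comp continuous_snd)).norm
  have hev : ∀ᶠ v in nhds ((0 : ℝ), S.x₀), ∀ i,
      |S.c i * S.J v.1 0| * ‖S.errs v.2 i‖ < 1 - ε / 2 :=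
    Filter.eventually_all.2 fun i => (hF i).continuousAt.eventually_lt continuousAt_const
      (lt_of_le_of_lt (h.2.2.1 i).2 (by linarith))
  obtain ⟨η, hη, hball⟩ := Metric.nhds_basis_closedBall.eventually_iff.1 hev
  refine ⟨η, hη, ε / 2, by linarith, fun t ht X hX i => (hball (x := (t, X)) ?_ i).le⟩
  rw [mem_closedBall_iff_norm, Prod.norm_def]
  refine max_le ?_ hX
  rw [Prod.fst_sub, sub_zero, Real.norm_of_nonneg ht.1]
  exact ht.2

/-- Near the initial time the internal state is close to its initial value. -/
lemma exists_initial_bound {b' : ℝ} (hb' : ∀ t, ‖S.J t‖ ≤ b') (k : ℝ) :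
    ∃ δ > 0, ∃ ε > 0, ∃ R, ∀ ξ b X, Continuous ξ → 0 ≤ b → (∀ s ∈ Icc 0 b, ‖ξ s‖ ≤ k) →
      S.IsInternal ξ b X → ∀ s ∈ Icc 0 b, s ≤ δ →
        (S.J s, ξ s, X s) ∈ S.core b' ε R k ∧ ‖X s‖ ≤ R := by
  obtain ⟨η, hη, ε, hε, hcore⟩ := exists_initial_core hS
  set R := ‖S.x₀‖ + η
  obtain ⟨c, hc0, hc⟩ : ∃ L, 0 ≤ L ∧ ∀ v, ‖S.errs v‖ ≤ L * ‖v‖ :=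
    ⟨‖LinearMap.toContinuousLinearMap S.errs‖, norm_nonneg _, fun v =>
      (LinearMap.toContinuousLinearMap S.errs).le_opNorm v⟩
  have hR0 : 0 ≤ R := by positivity
  have hXR : ∀ X, ‖X - S.x₀‖ ≤ η → ‖X‖ ≤ R := fun X hX => by
    have := norm_sub_norm_le X S.x₀
    simp only [R]; linarith
  have hmem : ∀ t ∈ Icc 0 η, ∀ ξ : Sig m n, ‖ξ‖ ≤ k → ∀ X, ‖X - S.x₀‖ ≤ η →
      (S.J t, ξ, X) ∈ S.core b' ε (max R (c * R)) k := by
    refine fun t ht ξ hξ X hX => ⟨hb' t, hξ, fun i => ⟨?_, hcore t ht X hX i⟩, fun i j => ?_⟩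
    · refine ((norm_le_pi_norm _ i).trans (hc X)).trans (le_trans ?_ (le_max_right _ _))
      exact mul_le_mul_of_nonneg_left (hXR X hX) hc0
    · exact ((norm_le_pi_norm _ j.succ).trans ((norm_le_pi_norm _ i).trans (hXR X hX))).trans
        (le_max_left _ _)
  obtain ⟨Lo, hLo0, hLo, -⟩ := S.exists_lipschitz_core S.contDiffOn_outs b' hε (max R (c * R)) k
  obtain ⟨LF, hLF0, hLF, -⟩ := S.exists_lipschitz_core S.contDiffOn_field b' hε (max R (c * R)) k
  obtain ⟨V, hV0, hV⟩ := exists_bound_drive hS Lo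
  -- As long as X is η-close to x₀ its speed is at most LF + V, so within this time it moves by less
  -- than η and cannot reach the boundary of the ball.
  refine ⟨min η (η / (2 * (LF + V + 1))), by positivity, ε, hε, max R (c * R),
    fun ξ b X hξ hb hk hX => ?_⟩
  have hX0 : X 0 = S.x₀ := by
    obtain ⟨w, -, -, -, -⟩ := hX.exists_velocity hS hξ hb
    obtain ⟨g, hg, hgs, -⟩ := exists_continuous_outs hS.J_cont hξ hX.cont hb hX.mem
    rw [hX.eqn g hg hgs 0 ⟨le_rfl, hb⟩]; simp
  set δ := min η (η / (2 * (LF + V + 1)))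
  have key : ∀ s ∈ Icc 0 (min b δ), ‖X s - S.x₀‖ ≤ η := by
    refine le_of_first_exit (hX.cont.sub continuous_const).norm (by simpa [hX0] using hη)
      fun s hs hle => ?_
    have hsb : s ≤ b := hs.2.trans (min_le_left _ _)
    have hsδ : s ≤ δ := hs.2.trans (min_le_right _ _)
    have hsη : s ≤ η := hsδ.trans (min_le_left _ _)
    obtain ⟨w, hint, -, hXw, hw⟩ := (hX.mono hS hξ hs.1 hsb).exists_velocity hS hξ hs.1
    have hm : ∀ x ∈ Icc 0 s, (S.J x, ξ x, X x) ∈ S.core b' ε (max R (c * R)) k := fun x hx =>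
      hmem x ⟨hx.1, hx.2.trans hsη⟩ _ (hk x ⟨hx.1, hx.2.trans hsb⟩) _ (hle x hx)
    have hwV := hw Lo V hV fun x hx =>
      (norm_le_pi_norm (S.outs (S.J x, ξ x, X x)) (0 : Fin (n + 2))).trans (hLo _ (hm x hx))
    have hb : ∀ᵐ x ∂volume.restrict (Ico 0 s), ‖S.field (S.J x, ξ x, X x) (w x)‖ ≤ LF + V := by
      filter_upwards [ae_restrict_Ico_of_Ici le_rfl hwV, ae_restrict_mem measurableSet_Ico]
        with x h1 h2
      rw [Coeff.field_eq]
      refine (norm_add_le _ _).trans (add_le_add (hLF _ (hm x ⟨h2.1, h2.2.le⟩)) ?_)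
      have := Coeff.norm_inj_sub_le (n := n) (w x) 0
      rw [Coeff.inj_zero, sub_zero, sub_zero] at this
      exact this.trans h1
    rw [hXw 0 ⟨le_rfl, hs.1⟩ s ⟨hs.1, le_rfl⟩, hX0, add_sub_cancel_left]
    refine (norm_intervalIntegral_le_of_ae_Ico hs.1 hb).trans_lt ?_
    have h1 : s ≤ η / (2 * (LF + V + 1)) := hsδ.trans (min_le_right _ _)
    rw [le_div_iff₀ (by positivity)] at h1
    have := hs.1
    nlinarith
  intro s hs hsδ
  have hs' := key s ⟨hs.1, le_min hs.2 hsδ⟩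
  exact ⟨hmem s ⟨hs.1, hsδ.trans (min_le_left _ _)⟩ _ (hk s hs) _ hs',
    (hXR _ hs').trans (le_max_left _ _)⟩

variable {ρ κ ν : ℝ} {P Q : Matrix (Fin (n + 2)) (Fin (n + 2)) ℝ} {M : Vec m →L[ℝ] Vec m}

/-- After the initial time the internal state is bounded. -/
lemma exists_state_bound (h : S.toCoeff.Stable ρ κ ν P Q M) (hF : S.Funnel) {b' k δ ε R : ℝ} (hk0 : 0 ≤ k) (hδ : 0 < δ) (hε : 0 < ε)
    (hinit : ∀ ξ b X, Continuous ξ → 0 ≤ b → (∀ s ∈ Icc 0 b, ‖ξ s‖ ≤ k) →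
      S.IsInternal ξ b X → ∀ s ∈ Icc 0 b, s ≤ δ →
        (S.J s, ξ s, X s) ∈ S.core b' ε R k ∧ ‖X s‖ ≤ R) :
    ∃ R₁, ∀ ξ b X, Continuous ξ → δ ≤ b → (∀ s ∈ Icc 0 b, ‖ξ s‖ ≤ k) →
      S.IsInternal ξ b X → ∀ s ∈ Icc δ b, ‖X s‖ ≤ R₁ := by
  obtain ⟨μ, hμ, hμJ⟩ := hF.lower δ hδ
  obtain ⟨Lo, hLo0, hLo, -⟩ := S.exists_lipschitz_core S.contDiffOn_outs b' hε R k
  obtain ⟨V, hV0, hV⟩ := exists_bound_drive hS (max Lo (k + (n + 1) * (ρ / μ)))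
  obtain ⟨E, hE0, hE⟩ := h.exists_power_field_nonpos hμ hk0 hV0
  obtain ⟨c, hc, hpow⟩ := exists_power_le (m := m) (P := P) (M := M)
  obtain ⟨c', hc', hen⟩ := exists_le_energy (m := m) h.P_pos h.nu h.le_M
  have hP : P.transpose = P := by simpa using h.P_pos.1.eq
  refine ⟨Real.sqrt (max E (c * R * R) / c'), fun ξ b X hξ hδb hk hX s hs => ?_⟩
  have hb : 0 ≤ b := hδ.le.trans hδb
  obtain ⟨w, hint, ⟨B, hB⟩, hXw, hw⟩ := hX.exists_velocity hS hξ hb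
  -- The bound of y before time δ comes from the initial estimate, where φ may be small, and after
  -- time δ from the funnels.
  have hwV := hw _ V hV fun x hx => by
    rcases le_total x δ with hxδ | hxδ
    · exact ((norm_le_pi_norm (S.outs (S.J x, ξ x, X x)) (0 : Fin (n + 2))).trans
        (hLo _ (hinit ξ b X hξ hb hk hX x hx hxδ).1)).trans (le_max_left _ _)
    · exact (h.norm_out_le (hX.mem x hx) hμ (hμJ x hxδ) (hk x hx)).trans (le_max_right _ _)
  -- The energy does not increase above the level E, and at time δ it is bounded by the initial
  -- estimate.
  have hmain : ∀ t ∈ Icc δ b, energy P M (X t) ≤ max E (c * R * R) := by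
    refine le_of_step (locallyLipschitz_energy.continuous.comp hX.cont).continuousOn ?_
      fun s t hs hst ht hgt => ?_
    · have hR := (hinit ξ b X hξ hb hk hX δ ⟨hδ.le, hδb⟩ le_rfl).2
      have h1 := (le_abs_self _).trans (hpow (X δ) (X δ))
      rw [power_self] at h1
      have hR0 : 0 ≤ R := (norm_nonneg _).trans hR
      have h2 : c * ‖X δ‖ * ‖X δ‖ ≤ c * R * R := by gcongr
      have h3 : 0 ≤ c * R * R := le_trans (by positivity) h2
      refine le_trans ?_ (le_max_right _ _)
      show energy P M (X δ) ≤ _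
      linarith
    · have hs0 : 0 ≤ s := hδ.le.trans hs
      refine comp_le_of_ae_deriv_nonpos (V := energy P M) (V' := power P M) locallyLipschitz_energy
        (fun Y x v hY => hasDerivAt_energy hP hY) hst hX.cont
        (hint.mono_set (by
          rw [uIcc_of_le hst, uIcc_of_le hb]; exact Icc_subset_Icc hs0 ht))
        (ae_restrict_Ico_mono hs0 ht hB) (fun x hx => hXw s ⟨hs0, hst.trans ht⟩ x
          ⟨hx.1, hx.2.trans ht⟩) ?_
      have h1 := ae_restrict_Ioc_iff_Ico.2 (ae_restrict_Ico_of_Ici (b := t) hs0 hwV)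
      refine ae_restrict_Ioc_iff_Ico.1 ?_
      filter_upwards [h1, ae_restrict_mem measurableSet_Ioc] with x hx1 hx2
      have hx : x ∈ Icc 0 b := ⟨hs0.trans hx2.1.le, hx2.2.trans ht⟩
      exact hE _ (hX.mem x hx) (hμJ x (hs.trans hx2.1.le)) (hk x hx) _ hx1
        ((le_max_left _ _).trans_lt (hgt x hx2))
  refine Real.le_sqrt_of_sq_le ?_
  rw [le_div_iff₀ hc', mul_comm]
  exact (hen _).trans (hmain s hs)

end Sys
end

/-! ### The loop of errors, boundedness of the gains, and the a priori estimate -/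

noncomputable section

namespace Coeff

variable {m n : ℕ} {C : Coeff m n} {ρ κ ν : ℝ} {P Q : Matrix (Fin (n + 2)) (Fin (n + 2)) ℝ}
  {M : Vec m →L[ℝ] Vec m}

lemma errs_field_succ (θ : Conf m n) (v : Vec m) (i : Fin n) :
    C.errs (C.field θ v) i.succ = C.w i.castSucc 0 (C.jet θ i.castSucc 0)
      - C.w i.succ 0 (C.jet θ i.succ 0) + θ.2.2 i.succ 1 := by
  rw [errs_succ]
  simp only [field, Fin.cons_succ, Fin.val_zero, zero_add]
  rw [nth_of_lt _ (by omega)]; rfl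

/-- Differentiating e_0 = X_{0,0} − G ∑ X_{i,0}, the terms w_{i,0} in the sum telescope, and K + G =
I combines what is left into G w_{n,0} − w_{0,0}. So the last error feeds back into the first one
through G, and the errors form a loop. -/
lemma Stable.errs_field_zero (h : C.Stable ρ κ ν P Q M) (θ : Conf m n) (v : Vec m) :
    C.errs (C.field θ v) 0 = C.G (C.w (Fin.last n) 0 (C.jet θ (Fin.last n) 0))
      - C.w 0 0 (C.jet θ 0 0) + (θ.2.2 0 1 + C.R (n + 1) (C.out θ 0)
      - (if 0 = n then C.G (nth θ.2.1 (n + 1)) else 0) - C.G (∑ i : Fin n, θ.2.2 i.succ 1)) := by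
  have h1 : ∑ i : Fin n, C.field θ v i.succ 0 = C.w 0 0 (C.jet θ 0 0)
      - C.w (Fin.last n) 0 (C.jet θ (Fin.last n) 0) + ∑ i : Fin n, θ.2.2 i.succ 1 := by
    have e1 := Fin.sum_univ_castSucc fun i => C.w i 0 (C.jet θ i 0)
    have e2 := Fin.sum_univ_succ fun i => C.w i 0 (C.jet θ i 0)
    have e3 := fun i : Fin n => C.errs_field_succ θ v i
    simp only [errs_succ] at e3
    simp only [e3, Finset.sum_add_distrib, Finset.sum_sub_distrib]
    rw [e1] at e2
    rw [sub_eq_sub_iff_add_eq_add.2 e2]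
  have hK := h.K_add_G (C.w 0 0 (C.jet θ 0 0))
  rw [errs_zero, h1, map_add, map_sub]
  have e : C.field θ v 0 0 = nth (θ.2.2 0) 1 + C.R (n + 1) (C.out θ 0) - C.K (C.w 0 0 (C.jet θ 0 0))
      - (if 0 = n then C.G (nth θ.2.1 (n + 1)) else 0) + if 0 = n + 1 then v else 0 := rfl
  rw [e, nth_of_lt _ (by omega), if_neg (by omega : ¬ 0 = n + 1), eq_sub_iff_add_eq.2 hK]
  have : (⟨1, by omega⟩ : Fin (n + 2)) = 1 := rfl
  rw [this]
  abel

/-- The preceding compensator in the loop that the errors form. -/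
def prev (i : Fin (n + 1)) : Fin (n + 1) := Fin.cases (Fin.last n) (fun i => i.castSucc) i

def loopGain (C : Coeff m n) (i : Fin (n + 1)) : ℝ := Fin.cases ‖C.G‖ (fun _ => 1) i

lemma loopGain_nonneg (i : Fin (n + 1)) : 0 ≤ C.loopGain i := by
  refine Fin.cases (norm_nonneg _) (fun i => zero_le_one) i

/-- In each w_{i,0} the part with a_0 is bounded by the funnels, so D collects everything but the
gains. The value v of f is absent: it enters the component of order n + 1 only, while the errors
depend on those of order 0. -/
lemma Stable.exists_inner_errs_field_le (h : C.Stable ρ κ ν P Q M) {μ k R : ℝ} (hμ : 0 < μ)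
    (hk : 0 ≤ k) (hR : 0 ≤ R) :
    ∃ D, 0 ≤ D ∧ ∀ θ ∈ C.confDom, μ ≤ θ.1 0 → ‖θ.2.1‖ ≤ k → ‖θ.2.2‖ ≤ R → ∀ v i,
      inner ℝ (C.errs θ.2.2 i) (C.errs (C.field θ v) i) ≤ ‖C.errs θ.2.2 i‖ *
        (D + C.p 0 * (C.loopGain i * (C.gain θ (prev i) * ‖C.errs θ.2.2 (prev i)‖))
          - C.p 0 * (C.gain θ i * ‖C.errs θ.2.2 i‖)) := by
  have hρ := h.rho
  have hp := h.p_zero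
  set e' := ρ / μ
  have he' : 0 ≤ e' := by positivity
  set D := |C.a 0| * (2 * e') + (R + ‖C.R (n + 1)‖ * (k + (n + 1) * e') + k + n * R)
  refine ⟨D, by positivity, fun θ hθ hφ hξ hX v i => ?_⟩
  have he := h.norm_errs_le hθ hμ hφ
  have hXi : ∀ i j, ‖θ.2.2 i j‖ ≤ R := fun i j =>
    (norm_le_pi_norm _ j).trans ((norm_le_pi_norm _ i).trans hX)
  -- an error whose derivative has the form of a loop equation
  have key : ∀ (L : Vec m →L[ℝ] Vec m) (γ : ℝ) (i i' : Fin (n + 1)) (d : Vec m), ‖L‖ ≤ γ → γ ≤ 1 →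
      ‖d‖ ≤ R + ‖C.R (n + 1)‖ * (k + (n + 1) * e') + k + n * R →
      inner ℝ (C.errs θ.2.2 i) (L (C.w i' 0 (C.jet θ i' 0)) - C.w i 0 (C.jet θ i 0) + d)
        ≤ ‖C.errs θ.2.2 i‖ * (D + C.p 0 * (γ * (C.gain θ i' * ‖C.errs θ.2.2 i'‖))
          - C.p 0 * (C.gain θ i * ‖C.errs θ.2.2 i‖)) := by
    intro L γ i i' d hL hγ hd
    have hg' := gain_pos hθ i'
    rw [w_jet, w_jet, map_smul]
    have e0 : (C.a 0 + C.p 0 * C.gain θ i') • L (C.errs θ.2.2 i')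
        - (C.a 0 + C.p 0 * C.gain θ i) • C.errs θ.2.2 i + d
        = (C.a 0 • (L (C.errs θ.2.2 i') - C.errs θ.2.2 i) + d
          + (C.p 0 * C.gain θ i') • L (C.errs θ.2.2 i'))
          - (C.p 0 * C.gain θ i) • C.errs θ.2.2 i := by
      simp only [add_smul, smul_sub]; abel
    rw [e0, inner_sub_right, inner_smul_right, real_inner_self_eq_norm_sq]
    have e1 : ‖L (C.errs θ.2.2 i')‖ ≤ γ * ‖C.errs θ.2.2 i'‖ :=
      (L.le_opNorm _).trans (by gcongr)
    have e2 : ‖C.a 0 • (L (C.errs θ.2.2 i') - C.errs θ.2.2 i)‖ ≤ |C.a 0| * (2 * e') := by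
      rw [norm_smul, Real.norm_eq_abs]
      gcongr
      refine (norm_sub_le _ _).trans ?_
      have : γ * ‖C.errs θ.2.2 i'‖ ≤ 1 * e' := by
        gcongr; exact he i'
      linarith [he i]
    have e3 : ‖(C.p 0 * C.gain θ i') • L (C.errs θ.2.2 i')‖
        ≤ C.p 0 * (γ * (C.gain θ i' * ‖C.errs θ.2.2 i'‖)) := by
      rw [norm_smul, Real.norm_of_nonneg (by positivity)]
      calc _ ≤ C.p 0 * C.gain θ i' * (γ * ‖C.errs θ.2.2 i'‖) := by gcongr
        _ = _ := by ring
    have e4 := real_inner_le_norm (C.errs θ.2.2 i) (C.a 0 • (L (C.errs θ.2.2 i') - C.errs θ.2.2 i)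
      + d + (C.p 0 * C.gain θ i') • L (C.errs θ.2.2 i'))
    have e5 : ‖C.a 0 • (L (C.errs θ.2.2 i') - C.errs θ.2.2 i)
        + d + (C.p 0 * C.gain θ i') • L (C.errs θ.2.2 i')‖
        ≤ D + C.p 0 * (γ * (C.gain θ i' * ‖C.errs θ.2.2 i'‖)) := by
      refine (norm_add_le _ _).trans (add_le_add ((norm_add_le _ _).trans (add_le_add e2 hd)) e3)
    have e6 := mul_le_mul_of_nonneg_left e5 (norm_nonneg (C.errs θ.2.2 i))
    nlinarith
  refine Fin.cases ?_ (fun i => ?_) i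
  · rw [h.errs_field_zero]
    refine key C.G ‖C.G‖ 0 (Fin.last n) _ le_rfl h.G_lt.le ?_
    refine (norm_sub_le _ _).trans (add_le_add ((norm_sub_le _ _).trans (add_le_add
      ((norm_add_le _ _).trans (add_le_add (hXi _ _) ?_)) ?_)) ?_)
    · exact (ContinuousLinearMap.le_opNorm _ _).trans
        (mul_le_mul_of_nonneg_left (h.norm_out_le hθ hμ hφ hξ) (norm_nonneg _))
    · split_ifs
      · refine (C.G.le_opNorm _).trans ?_
        rw [nth_of_lt _ (by omega)]
        calc _ ≤ 1 * k := mul_le_mul h.G_lt.le ((norm_le_pi_norm _ _).trans hξ) (norm_nonneg _) zero_le_one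
          _ = k := one_mul k
      · simpa using hk
    · refine (C.G.le_opNorm _).trans ?_
      have hS : ‖∑ i : Fin n, θ.2.2 i.succ 1‖ ≤ n * R :=
        (norm_sum_le_of_le _ fun i _ => hXi _ _).trans (by simp)
      calc _ ≤ 1 * (n * R) := mul_le_mul h.G_lt.le hS (norm_nonneg _) zero_le_one
        _ = n * R := one_mul _
  · rw [errs_field_succ]
    refine key (ContinuousLinearMap.id ℝ _) 1 i.succ i.castSucc _
      ContinuousLinearMap.norm_id_le le_rfl ((hXi _ _).trans ?_)
    have : 0 ≤ ‖C.R (n + 1)‖ * (k + (n + 1) * e') + k + n * R := by positivity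
    linarith

/-- Bounds on quantities that are linked in a loop with gain less than one. -/
lemma Stable.le_of_loop (h : C.Stable ρ κ ν P Q M) {U : Fin (n + 1) → ℝ} {D : ℝ} (hD : 0 ≤ D)
    (hU : ∀ i, U i ≤ D + C.loopGain i * U (prev i)) (i : Fin (n + 1)) :
    U i ≤ n * D + (n + 1) * D / (1 - ‖C.G‖) := by
  have h1 : ∀ (j : ℕ) (hj : j < n + 1), U ⟨j, hj⟩ ≤ j * D + U 0 := by
    intro j
    induction j with
    | zero => intro hj; simp
    | succ j ih =>
      intro hj
      have e1 : U ⟨j + 1, hj⟩ ≤ D + 1 * U ⟨j, by omega⟩ := hU (⟨j, by omega⟩ : Fin n).succ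
      have e2 := ih (by omega)
      push_cast; linarith
  have h2 : ∀ j : Fin (n + 1), U j ≤ n * D + U 0 := fun j => by
    have : (j : ℝ) * D ≤ n * D := by
      gcongr
      exact_mod_cast (by omega : (j : ℕ) ≤ n)
    linarith [h1 j j.2]
  have h3 : U 0 ≤ D + ‖C.G‖ * U (Fin.last n) := hU 0
  have h4 : ‖C.G‖ * U (Fin.last n) ≤ ‖C.G‖ * (n * D + U 0) :=
    mul_le_mul_of_nonneg_left (h2 _) (norm_nonneg _)
  -- Along the chain each step adds D; on returning to the first error the whole is multiplied by
  -- ‖G‖ < 1, which allows U 0 to be solved for.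
  have h5 : U 0 ≤ (n + 1) * D / (1 - ‖C.G‖) := by
    rw [le_div_iff₀ (by linarith [h.G_lt])]
    have : ‖C.G‖ * (n * D) ≤ 1 * (n * D) := by gcongr; exact h.G_lt.le
    nlinarith
  linarith [h2 i]

/-- `(c_i φ)² ‖e_i‖²` as a function of `φ` and the internal state. -/
def level (C : Coeff m n) (i : Fin (n + 1)) (v : ℝ × InnerState m n) : ℝ :=
  (C.c i * v.1) ^ 2 * ‖C.errs v.2 i‖ ^ 2

def levelDeriv (C : Coeff m n) (i : Fin (n + 1)) (v v' : ℝ × InnerState m n) : ℝ :=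
  2 * C.c i ^ 2 * v.1 * (v'.1 * ‖C.errs v.2 i‖ ^ 2 + v.1 * inner ℝ (C.errs v.2 i) (C.errs v'.2 i))

lemma hasDerivAt_level (i : Fin (n + 1)) {Y : ℝ → ℝ × InnerState m n} {v : ℝ × InnerState m n}
    {t : ℝ} (hY : HasDerivAt Y v t) :
    HasDerivAt (fun s => C.level i (Y s)) (C.levelDeriv i (Y t) v) t := by
  have h1 : HasDerivAt (fun s => (Y s).1) v.1 t := by
    simpa using! (ContinuousLinearMap.fst ℝ ℝ (InnerState m n)).hasFDerivAt.comp_hasDerivAt t hY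
  have h2 : HasDerivAt (fun s => (Y s).2) v.2 t := by
    simpa using! (ContinuousLinearMap.snd ℝ ℝ (InnerState m n)).hasFDerivAt.comp_hasDerivAt t hY
  have h3 : HasDerivAt (fun s => C.errs (Y s).2) (C.errs v.2) t :=
    (LinearMap.toContinuousLinearMap C.errs).hasFDerivAt.comp_hasDerivAt t h2
  have h4 : HasDerivAt (fun s => C.errs (Y s).2 i) (C.errs v.2 i) t := hasDerivAt_pi.1 h3 i
  have h5 := ((h1.const_mul (C.c i)).pow 2).mul h4.norm_sq
  refine h5.congr_deriv ?_
  simp only [levelDeriv, Pi.pow_apply]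
  push_cast
  ring

lemma locallyLipschitz_level (i : Fin (n + 1)) : LocallyLipschitz (C.level i) := by
  refine ContDiff.locallyLipschitz (𝕂 := ℝ) ?_
  have h : ContDiff ℝ 1 fun v : ℝ × InnerState m n => C.errs v.2 i :=
    contDiff_pi.1 ((LinearMap.toContinuousLinearMap C.errs).contDiff.comp contDiff_snd) i
  unfold level
  exact ((contDiff_const.mul contDiff_fst).pow 2).mul (h.norm_sq ℝ)

lemma gain_eq_level (θ : Conf m n) (i : Fin (n + 1)) :
    C.gain θ i = 1 / (1 - C.level i (θ.1 0, θ.2.2)) := rfl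

lemma continuousOn_gain (i : Fin (n + 1)) : ContinuousOn (fun θ => C.gain θ i) C.confDom := by
  refine continuousOn_const.div ?_ fun θ hθ => (sub_pos.2 (C.mem_confDom.1 hθ i)).ne'
  have : Continuous fun θ : Conf m n => C.level i (θ.1 0, θ.2.2) :=
    (locallyLipschitz_level i).continuous.comp (((continuous_apply 0).comp continuous_fst).prodMk
      (continuous_snd.comp continuous_snd))
  exact (continuous_const.sub this).continuousOn

/-- A gain that is large compared to the preceding one decreases. -/
lemma Stable.levelDeriv_nonpos (h : C.Stable ρ κ ν P Q M) {μ b D N φ' : ℝ} (hμ : 0 < μ)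
    {θ : Conf m n} {v : Vec m} (hθ : θ ∈ C.confDom) (hφ : μ ≤ θ.1 0) (hb : θ.1 0 ≤ b) (hD : 0 ≤ D)
    (hφ' : |φ'| ≤ b) {i : Fin (n + 1)}
    (hin : inner ℝ (C.errs θ.2.2 i) (C.errs (C.field θ v) i) ≤ ‖C.errs θ.2.2 i‖ *
        (D + C.p 0 * (C.loopGain i * (C.gain θ (prev i) * ‖C.errs θ.2.2 (prev i)‖))
          - C.p 0 * (C.gain θ i * ‖C.errs θ.2.2 i‖)))
    (hN : C.gain θ (prev i) / C.c (prev i) ≤ N)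
    (hi : ρ + b * (D + b * (ρ / μ) / μ) / C.p 0 + C.loopGain i * N < C.gain θ i / C.c i) :
    C.levelDeriv i (θ.1 0, θ.2.2) (φ', C.field θ v) ≤ 0 := by
  have hp := h.p_zero
  have hφ0 := hμ.trans_le hφ
  have hb0 := hφ0.trans_le hb
  have hρ := h.rho
  have hfac : 0 ≤ 2 * C.c i ^ 2 * θ.1 0 := by positivity
  refine mul_nonpos_of_nonneg_of_nonpos hfac ?_
  have hx : ‖C.errs θ.2.2 i‖ ≤ ρ / μ := h.norm_errs_le hθ hμ hφ i
  have hc := h.c_pos i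
  have hg := gain_pos hθ i
  have hu := mul_norm_errs_lt hc hθ hφ0
  have hgain : C.gain θ i = 1 / (1 - (C.c i * θ.1 0) ^ 2 * ‖C.errs θ.2.2 i‖ ^ 2) := rfl
  have hprev : θ.1 0 * (C.gain θ (prev i) * ‖C.errs θ.2.2 (prev i)‖) ≤ N := by
    refine le_trans ?_ hN
    have h1 := mul_norm_errs_lt (h.c_pos (prev i)) hθ hφ0
    rw [le_div_iff₀ (h.c_pos _)]
    have h2 := mul_le_mul_of_nonneg_left h1.le (gain_pos hθ (prev i)).le
    linarith
  -- With x = c_i φ‖e_i‖ < 1, h_i (1 − x) = 1/(1 + x) ≤ 1. So φ h_i‖e_i‖ is at least (h_i − 1)/c_i,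
  -- and 1/c_i ≤ ρ.
  have hlow : C.gain θ i / C.c i - ρ ≤ θ.1 0 * (C.gain θ i * ‖C.errs θ.2.2 i‖) := by
    have h1 := h.inv_c_le i
    have h2 : C.gain θ i - 1 ≤ C.gain θ i * (C.c i * θ.1 0 * ‖C.errs θ.2.2 i‖) := by
      set x := C.c i * θ.1 0 * ‖C.errs θ.2.2 i‖ with hx
      have hx0 : 0 ≤ x := by positivity
      have h3 : C.gain θ i = 1 / (1 - x ^ 2) := by rw [hgain, hx, mul_pow _ ‖_‖]
      have h4 : 0 < 1 - x ^ 2 := by nlinarith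
      rw [h3, div_sub_one h4.ne', one_div_mul_eq_div]
      gcongr
      nlinarith
    have h3 : C.gain θ i / C.c i - (C.c i)⁻¹ ≤ θ.1 0 * (C.gain θ i * ‖C.errs θ.2.2 i‖) := by
      rw [← one_div, ← sub_div, div_le_iff₀ hc]
      linarith
    linarith
  have hγ : 0 ≤ C.loopGain i := loopGain_nonneg i
  set Z := D + b * (ρ / μ) / μ with hZ
  have hZ0 : 0 ≤ Z := by positivity
  set g := C.gain θ i * ‖C.errs θ.2.2 i‖
  set g' := C.gain θ (prev i) * ‖C.errs θ.2.2 (prev i)‖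
  -- The movement of the funnel is estimated by φ times a constant; it can then be added to the
  -- bounded part D of the velocity.
  have e1 : φ' * ‖C.errs θ.2.2 i‖ ^ 2 ≤ ‖C.errs θ.2.2 i‖ * (θ.1 0 * (b * (ρ / μ) / μ)) := by
    have e2 : φ' * ‖C.errs θ.2.2 i‖ ≤ b * (ρ / μ) :=
      mul_le_mul ((le_abs_self _).trans hφ') hx (norm_nonneg _) hb0.le
    have e3 : b * (ρ / μ) ≤ θ.1 0 * (b * (ρ / μ) / μ) := by
      calc b * (ρ / μ) = μ * (b * (ρ / μ) / μ) := by field_simp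
        _ ≤ _ := by gcongr
    calc _ = ‖C.errs θ.2.2 i‖ * (φ' * ‖C.errs θ.2.2 i‖) := by ring
      _ ≤ _ := mul_le_mul_of_nonneg_left (e2.trans e3) (norm_nonneg _)
  have e2 := mul_le_mul_of_nonneg_left hin hφ0.le
  have e3 : b * Z / C.p 0 + C.loopGain i * (θ.1 0 * g') ≤ θ.1 0 * g := by
    have := mul_le_mul_of_nonneg_left hprev hγ
    linarith
  have e4 : b * Z + C.p 0 * (C.loopGain i * (θ.1 0 * g')) ≤ C.p 0 * (θ.1 0 * g) := by
    have := mul_le_mul_of_nonneg_left e3 hp.le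
    rwa [mul_add, mul_div_cancel₀ _ hp.ne'] at this
  have e5 : θ.1 0 * Z ≤ b * Z := mul_le_mul_of_nonneg_right hb hZ0
  have e6 : θ.1 0 * Z + C.p 0 * (C.loopGain i * (θ.1 0 * g')) - C.p 0 * (θ.1 0 * g) ≤ 0 := by
    linarith
  have e7 := mul_nonpos_of_nonneg_of_nonpos (norm_nonneg (C.errs θ.2.2 i)) e6
  calc _ ≤ ‖C.errs θ.2.2 i‖ * (θ.1 0 * (b * (ρ / μ) / μ)) + θ.1 0 * (‖C.errs θ.2.2 i‖ *
        (D + C.p 0 * (C.loopGain i * g') - C.p 0 * g)) := add_le_add e1 e2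
    _ = ‖C.errs θ.2.2 i‖ * (θ.1 0 * Z + C.p 0 * (C.loopGain i * (θ.1 0 * g'))
        - C.p 0 * (θ.1 0 * g)) := by rw [hZ]; ring
    _ ≤ 0 := e7

end Coeff

namespace Sys

variable {m n l q : ℕ} {S : Sys m n l q} (hS : S.Regular) {ρ κ ν : ℝ}
  {P Q : Matrix (Fin (n + 2)) (Fin (n + 2)) ℝ} {M : Vec m →L[ℝ] Vec m}

include hS

/-- After the initial time the gains are bounded. -/
lemma exists_gain_bound (h : S.toCoeff.Stable ρ κ ν P Q M) (hF : S.Funnel) {b' : ℝ}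
    (hb' : ∀ t, ‖S.J t‖ ≤ b') {k δ ε R : ℝ} (hk0 : 0 ≤ k) (hδ : 0 < δ) (hε : 0 < ε)
    (hinit : ∀ ξ b X, Continuous ξ → 0 ≤ b → (∀ s ∈ Icc 0 b, ‖ξ s‖ ≤ k) →
      S.IsInternal ξ b X → ∀ s ∈ Icc 0 b, s ≤ δ →
        (S.J s, ξ s, X s) ∈ S.core b' ε R k ∧ ‖X s‖ ≤ R) :
    ∃ H, ∀ ξ b X, Continuous ξ → δ ≤ b → (∀ s ∈ Icc 0 b, ‖ξ s‖ ≤ k) →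
      S.IsInternal ξ b X → ∀ s ∈ Icc δ b, ∀ i, S.gain (S.J s, ξ s, X s) i ≤ H := by
  obtain ⟨μ, hμ, hμJ⟩ := hF.lower δ hδ
  obtain ⟨R₁, hR₁⟩ := exists_state_bound hS h hF hk0 hδ hε hinit
  obtain ⟨D, hD0, hD⟩ := h.exists_inner_errs_field_le (R := max 0 R₁) hμ hk0 (le_max_left _ _)
  have hρ := h.rho
  have hp := h.p_zero
  have hb'0 : 0 ≤ b' := (norm_nonneg _).trans (hb' 0)
  -- The excess over the preceding gain that makes a gain decrease. D₂ additionally dominates the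
  -- gains at time δ, for which the initial estimate gives 1/ε, multiplied by 1/c_i ≤ ρ.
  set D₁ := ρ + b' * (D + b' * (ρ / μ) / μ) / S.p 0 with hD₁
  have hD₁0 : 0 ≤ D₁ := by positivity
  set D₂ := max D₁ (ρ * (1 / ε))
  refine ⟨n * D₂ + (n + 1) * D₂ / (1 - ‖S.G‖), fun ξ b X hξ hδb hk hX => ?_⟩
  have hb : 0 ≤ b := hδ.le.trans hδb
  obtain ⟨w, hint, ⟨B, hB⟩, hXw, -⟩ := hX.exists_velocity hS hξ hb
  have hcont : ∀ i, ContinuousOn (fun s => S.gain (S.J s, ξ s, X s) i / S.c i) (Icc δ b) := fun i =>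
    ((Coeff.continuousOn_gain i).comp (hS.J_cont.prodMk (hξ.prodMk hX.cont)).continuousOn
      fun s hs => hX.mem s ⟨hδ.le.trans hs.1, hs.2⟩).div_const _
  -- On a compact interval each gain has some maximum, possibly depending on the trajectory. The
  -- loop inequality between these maxima turns them into a uniform bound.
  have hmax : ∀ i, ∃ t ∈ Icc δ b, ∀ s ∈ Icc δ b,
      S.gain (S.J s, ξ s, X s) i / S.c i ≤ S.gain (S.J t, ξ t, X t) i / S.c i := fun i =>
    isCompact_Icc.exists_isMaxOn ⟨δ, le_rfl, hδb⟩ (hcont i)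
  choose t₀ ht₀ hmax using hmax
  set U : Fin (n + 1) → ℝ := fun i => S.gain (S.J (t₀ i), ξ (t₀ i), X (t₀ i)) i / S.c i with hU
  have hmem : ∀ s ∈ Icc δ b, (S.J s, ξ s, X s) ∈ S.confDom := fun s hs =>
    hX.mem s ⟨hδ.le.trans hs.1, hs.2⟩
  have hU0 : ∀ i, 0 ≤ U i := fun i =>
    div_nonneg (Coeff.gain_pos (hmem _ (ht₀ i)) i).le (h.c_pos i).le
  have hloop : ∀ i, U i ≤ D₂ + S.loopGain i * U (Coeff.prev i) := by
    intro i
    have hγ : 0 ≤ S.loopGain i * U (Coeff.prev i) :=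
      mul_nonneg (Coeff.loopGain_nonneg i) (hU0 _)
    -- While the normalized gain exceeds the threshold, the derivative of its level is nonpositive,
    -- and the gain is an increasing function of the level.
    refine le_of_step (hcont i) ?_ (fun s t hs hst ht hgt => ?_) (t₀ i) (ht₀ i)
    · have h1 := (hinit ξ b X hξ hb hk hX δ ⟨hδ.le, hδb⟩ le_rfl).1
      have h2 := (h1.2.2.1 i).2
      have h3 : S.gain (S.J δ, ξ δ, X δ) i ≤ 1 / ε := by
        rw [Coeff.gain]
        refine one_div_le_one_div_of_le hε ?_
        have h4 : (S.c i * S.J δ 0) ^ 2 * ‖S.errs (X δ) i‖ ^ 2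
            = (|S.c i * S.J δ 0| * ‖S.errs (X δ) i‖) ^ 2 := by
          rw [mul_pow |S.c i * S.J δ 0|, sq_abs]
        have h5 : 0 ≤ |S.c i * S.J δ 0| * ‖S.errs (X δ) i‖ := by positivity
        show ε ≤ 1 - (S.c i * S.J δ 0) ^ 2 * ‖S.errs (X δ) i‖ ^ 2
        rw [h4]
        nlinarith
      have h4 : S.gain (S.J δ, ξ δ, X δ) i / S.c i ≤ ρ * (1 / ε) := by
        rw [div_eq_inv_mul]
        exact mul_le_mul (h.inv_c_le i) h3 (Coeff.gain_pos (hmem δ ⟨le_rfl, hδb⟩) i).le (by linarith)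
      have := le_max_right D₁ (ρ * (1 / ε))
      show S.gain (S.J δ, ξ δ, X δ) i / S.c i ≤ _
      linarith
    · have hs0 : 0 ≤ s := hδ.le.trans hs
      have hs0' : 0 < s := hδ.trans_le hs
      have hJint : ∀ x ∈ Icc s t, S.J x 0 = S.J s 0 + ∫ y in s..x, S.J y 1 := fun x hx => by
        rw [intervalIntegral.integral_eq_sub_of_hasDerivAt (f := fun s => S.J s 0)]
        · ring
        · intro y hy
          rw [uIcc_of_le hx.1] at hy
          exact hF.deriv y (hs0'.trans_le hy.1)
        · exact ((continuous_apply 1).comp hS.J_cont).intervalIntegrable _ _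
      have hsub : Icc s t ⊆ Icc 0 b := Icc_subset_Icc hs0 ht
      have hint' : IntervalIntegrable (fun s => S.field (S.J s, ξ s, X s) (w s)) volume s t :=
        hint.mono_set (by rwa [uIcc_of_le hst, uIcc_of_le hb])
      have hJi : IntervalIntegrable (fun y => S.J y 1) volume s t :=
        ((continuous_apply 1).comp hS.J_cont).intervalIntegrable _ _
      have hlev := comp_le_of_ae_deriv_nonpos (V := S.level i) (V' := S.levelDeriv i)
        (X := fun s => (S.J s 0, X s))
        (g := fun s => (S.J s 1, S.field (S.J s, ξ s, X s) (w s))) (B := max b' B)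
        (Coeff.locallyLipschitz_level i) (fun Y x v hY => Coeff.hasDerivAt_level i hY) hst
        (((continuous_apply 0).comp hS.J_cont).prodMk hX.cont) ?_ ?_ (fun x hx => ?_) ?_
      · have hx : ∀ x ∈ Icc δ b, S.level i (S.J x 0, X x) < 1 := fun x hx =>
          S.mem_confDom.1 (hmem x hx) i
        have h1 := hx s ⟨hs, hst.trans ht⟩
        have h2 := hx t ⟨hs.trans hst, ht⟩
        rw [Coeff.gain_eq_level, Coeff.gain_eq_level]
        have := h.c_pos i
        show 1 / (1 - S.level i (S.J t 0, X t)) / S.c i ≤ 1 / (1 - S.level i (S.J s 0, X s)) / S.c i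
        have h3 : S.level i (S.J t 0, X t) ≤ S.level i (S.J s 0, X s) := hlev
        have h4 : 0 < 1 - S.level i (S.J s 0, X s) := by linarith
        gcongr
      · rw [intervalIntegrable_iff] at hJi hint' ⊢
        exact hJi.prodMk hint'
      · filter_upwards [ae_restrict_Ico_mono hs0 ht hB] with x hx
        rw [Prod.norm_def]
        exact max_le_max ((norm_le_pi_norm (S.J x) 1).trans (hb' x)) hx
      · have e1 : IntervalIntegrable (fun s => S.field (S.J s, ξ s, X s) (w s)) volume s x :=
          hint'.mono_set (by rw [uIcc_of_le hx.1, uIcc_of_le hst]; exact Icc_subset_Icc_right hx.2)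
        have e2 : IntervalIntegrable (fun y => S.J y 1) volume s x :=
          ((continuous_apply 1).comp hS.J_cont).intervalIntegrable _ _
        have : ∫ y in s..x, (S.J y 1, S.field (S.J y, ξ y, X y) (w y))
            = (∫ y in s..x, S.J y 1, ∫ y in s..x, S.field (S.J y, ξ y, X y) (w y)) := by
          rw [intervalIntegral.integral_of_le hx.1, intervalIntegral.integral_of_le hx.1,
            intervalIntegral.integral_of_le hx.1]
          exact integral_pair (e2.1) (e1.1)
        rw [this, Prod.mk_add_mk, ← hJint x hx,
          ← hXw s ⟨hs0, hst.trans ht⟩ x ⟨hx.1, hx.2.trans ht⟩]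
      · refine ae_restrict_Ioc_iff_Ico.1 ?_
        filter_upwards [ae_restrict_mem measurableSet_Ioc] with x hx
        have hxδ : x ∈ Icc δ b := ⟨hs.trans hx.1.le, hx.2.trans ht⟩
        have hx0 : x ∈ Icc 0 b := ⟨hδ.le.trans hxδ.1, hxδ.2⟩
        refine h.levelDeriv_nonpos (N := U (Coeff.prev i)) (θ := (S.J x, ξ x, X x)) hμ (hmem x hxδ) (hμJ x hxδ.1)
          ((le_abs_self _).trans ((norm_le_pi_norm (S.J x) 0).trans (hb' x))) hD0
          ((norm_le_pi_norm (S.J x) 1).trans (hb' x)) (hD _ (hmem x hxδ) (hμJ x hxδ.1) (hk x hx0)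
            ((hR₁ ξ b X hξ hδb hk hX x hxδ).trans (le_max_right _ _)) _ i)
          (hmax _ x hxδ) ?_
        have h1 := hgt x hx
        have h2 := le_max_left D₁ (ρ * (1 / ε))
        rw [← hD₁]
        linarith
  intro s hs i
  have hD₂0 : 0 ≤ D₂ := hD₁0.trans (le_max_left _ _)
  have h1 := (hmax i s hs).trans (h.le_of_loop hD₂0 hloop i)
  rw [div_le_iff₀ (h.c_pos i)] at h1
  refine h1.trans (mul_le_of_le_one_right ?_ (h.c_le i))
  have : 0 < 1 - ‖S.G‖ := by linarith [h.G_lt]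
  positivity

/-- The core is assembled from the estimate near the initial time and, after δ, from the funnels,
the bound on the state and the bound on the gains. All constants depend on the bound of the signal,
not on the signal or the length of the interval. -/
theorem apriori (h : S.toCoeff.Stable ρ κ ν P Q M) (hF : S.Funnel) : S.Apriori := by
  intro k
  obtain ⟨b', hb'⟩ := hS.J_bdd
  obtain ⟨δ, hδ, ε, hε, R, hinit⟩ := exists_initial_bound hS hb' (max k 1)
  have hk0 : (0 : ℝ) ≤ max k 1 := zero_le_one.trans (le_max_right _ _)
  obtain ⟨R₁, hR₁⟩ := exists_state_bound hS h hF hk0 hδ hε hinit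
  obtain ⟨H, hH⟩ := exists_gain_bound hS h hF hb' hk0 hδ hε hinit
  obtain ⟨μ, hμ, hμJ⟩ := hF.lower δ hδ
  refine ⟨b', min (1 / 2) (min ε (1 / (2 * max H 1))), max (max R 1) (max R₁ (ρ / μ)), max k 1,
    by positivity, (min_le_left _ _).trans_lt (by norm_num), by positivity, by positivity,
    le_max_left _ _, fun ξ t X hξ ht hk hX s hs => ?_⟩
  have hk' : ∀ s ∈ Icc 0 t, ‖ξ s‖ ≤ max k 1 := fun s hs => (hk s hs).trans (le_max_left _ _)
  rcases le_total s δ with hsδ | hsδ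
  · exact Coeff.core_mono le_rfl ((min_le_right _ _).trans (min_le_left _ _))
      ((le_max_left _ _).trans (le_max_left _ _)) le_rfl (hinit ξ t X hξ ht hk' hX s hs hsδ).1
  have hs' : s ∈ Icc δ t := ⟨hsδ, hs.2⟩
  have hXs := hR₁ ξ t X hξ (hsδ.trans hs.2) hk' hX s hs'
  refine ⟨hb' s, hk' s hs, fun i => ⟨?_, ?_⟩, fun i j => ?_⟩
  · exact (h.norm_errs_le (hX.mem s hs) hμ (hμJ s hsδ) i).trans
      ((le_max_right _ _).trans (le_max_right _ _))
  · have h1 := (hH ξ t X hξ (hsδ.trans hs.2) hk' hX s hs' i).trans (le_max_left H 1)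
    have h2 : 0 < max H 1 := by positivity
    have hJ : 0 < S.J s 0 := hμ.trans_le (hμJ s hsδ)
    have h3 := Coeff.mul_norm_errs_lt (h.c_pos i) (hX.mem s hs) hJ
    rw [abs_of_pos (mul_pos (h.c_pos i) hJ)]
    set x := S.c i * S.J s 0 * ‖S.errs (X s) i‖ with hx
    have hx0 : 0 ≤ x := mul_nonneg (mul_nonneg (h.c_pos i).le hJ.le) (norm_nonneg _)
    have hx1 : x < 1 := h3
    have h4 : S.gain (S.J s, ξ s, X s) i = 1 / (1 - x ^ 2) := by
      rw [hx, mul_pow _ ‖_‖]; rfl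
    have h5 : 0 < 1 - x ^ 2 := by nlinarith
    rw [h4, div_le_iff₀ h5] at h1
    -- A gain at most H means 1 − x² ≥ 1/H, and 1 − x² ≤ 2(1 − x) for 0 ≤ x < 1.
    have h6 : 1 / (2 * max H 1) ≤ 1 - x := by
      rw [div_le_iff₀ (by positivity)]
      nlinarith
    have h7 : min (1 / 2) (min ε (1 / (2 * max H 1))) ≤ 1 / (2 * max H 1) :=
      (min_le_right _ _).trans (min_le_right _ _)
    linarith
  · exact ((norm_le_pi_norm _ _).trans ((norm_le_pi_norm _ _).trans hXs)).trans
      ((le_max_left _ _).trans (le_max_right _ _))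

end Sys
end

/-! ### Chains of derivatives, gluing at time 0, and weak derivatives -/

noncomputable section

/-- The interval `[0, ω)`. -/
def ray (ω : EReal) : Set ℝ := {t | 0 ≤ t ∧ (t : EReal) < ω}

section Ray

variable {ω : EReal} {τ : ℝ}

lemma ray_mono {t b : ℝ} (hb : b ∈ ray ω) (h0 : 0 ≤ t) (h : t ≤ b) : t ∈ ray ω :=
  ⟨h0, (EReal.coe_le_coe_iff.2 h).trans_lt hb.2⟩

lemma zero_mem_ray (hω : 0 < ω) : (0 : ℝ) ∈ ray ω := ⟨le_rfl, by exact_mod_cast hω⟩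

lemma exists_lt_mem_ray {t : ℝ} (ht : t ∈ ray ω) : ∃ b ∈ ray ω, t < b := by
  obtain ⟨b, h1, h2⟩ := EReal.lt_iff_exists_real_btwn.1 ht.2
  have h1 := EReal.coe_lt_coe_iff.1 h1
  exact ⟨b, ⟨ht.1.trans h1.le, h2⟩, h1⟩

lemma Icc_subset_ray {b : ℝ} (hb : b ∈ ray ω) : Icc 0 b ⊆ ray ω := fun _ ht => ray_mono hb ht.1 ht.2

lemma Icc_subset_dom (hω : 0 < ω) : Icc (-τ) 0 ⊆ dom τ ω := fun t ht =>
  ⟨ht.1, (EReal.coe_le_coe_iff.2 ht.2).trans_lt (by exact_mod_cast hω)⟩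

lemma ray_subset_dom (hτ : 0 < τ) : ray ω ⊆ dom τ ω := fun t ht => ⟨by linarith [ht.1], ht.2⟩

lemma dom_eq (hτ : 0 < τ) (hω : 0 < ω) : dom τ ω = Icc (-τ) 0 ∪ ray ω := by
  refine Subset.antisymm (fun t ht => ?_) (union_subset (Icc_subset_dom hω) (ray_subset_dom hτ))
  rcases le_total t 0 with h | h
  · exact Or.inl ⟨ht.1, h⟩
  · exact Or.inr ⟨h, ht.2⟩

lemma ordConnected_ray : (ray ω).OrdConnected :=
  ⟨fun _ hx _ hy _ hz => ray_mono hy (hx.1.trans hz.1) hz.2⟩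

lemma uniqueDiffOn_dom (hτ : 0 < τ) (hω : 0 < ω) : UniqueDiffOn ℝ (dom τ ω) := by
  have hoc : (dom τ ω).OrdConnected :=
    ⟨fun _ hx _ hy _ hz => ⟨hx.1.trans hz.1, (EReal.coe_le_coe_iff.2 hz.2).trans_lt hy.2⟩⟩
  refine uniqueDiffOn_convex hoc.convex ⟨-τ / 2, mem_interior_iff_mem_nhds.2 ?_⟩
  filter_upwards [Icc_mem_nhds (show -τ < -τ / 2 by linarith) (by linarith : -τ / 2 < 0)] with x hx
  exact Icc_subset_dom hω hx

end Ray

section Chain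

variable {F : Type*} [NormedAddCommGroup F] [NormedSpace ℝ F] {s : Set ℝ} {N : ℕ}

lemma iteratedDerivWithin_of_chain (hs : UniqueDiffOn ℝ s) {f : ℕ → ℝ → F}
    (h : ∀ k < N, ∀ t ∈ s, HasDerivWithinAt (f k) (f (k + 1) t) s t) {k : ℕ} (hk : k ≤ N) :
    EqOn (iteratedDerivWithin k (f 0) s) (f k) s := by
  induction k with
  | zero => intro t _; simp
  | succ k ih =>
    intro t ht
    have ih := ih (by omega)
    rw [iteratedDerivWithin_succ, derivWithin_congr ih (ih ht)]
    exact (h k (by omega) t ht).derivWithin (hs t ht)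

lemma contDiffOn_of_chain (hs : UniqueDiffOn ℝ s) {f : ℕ → ℝ → F}
    (h : ∀ k < N, ∀ t ∈ s, HasDerivWithinAt (f k) (f (k + 1) t) s t) (hN : ContinuousOn (f N) s) :
    ContDiffOn ℝ N (f 0) s := by
  have hc : ∀ k ≤ N, ContinuousOn (f k) s := fun k hk => by
    rcases hk.eq_or_lt with rfl | hk
    · exact hN
    · exact fun t ht => (h k hk t ht).continuousWithinAt
  have he := fun k (hk : k ≤ N) => iteratedDerivWithin_of_chain hs h hk
  refine contDiffOn_of_continuousOn_differentiableOn_deriv (n := (N : ℕ∞)) (fun k hk => ?_) fun k hk => ?_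
  · have hk : k ≤ N := by exact_mod_cast hk
    exact (hc k hk).congr (he k hk)
  · have hk : k < N := by exact_mod_cast hk
    exact fun t ht => ((h k hk t ht).congr (he k hk.le) (he k hk.le ht)).differentiableWithinAt

lemma chain_of_contDiffOn (hs : UniqueDiffOn ℝ s) {g : ℝ → F} (hg : ContDiffOn ℝ N g s) {k : ℕ}
    (hk : k < N) {t : ℝ} (ht : t ∈ s) :
    HasDerivWithinAt (iteratedDerivWithin k g s) (iteratedDerivWithin (k + 1) g s t) s t := by
  rw [iteratedDerivWithin_succ]
  exact (hg.differentiableOn_iteratedDerivWithin (by exact_mod_cast hk) hs t ht).hasDerivWithinAt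

lemma hasDerivWithinAt_of_notMem_closure {f : ℝ → F} {f' : F} {t : ℝ} (h : t ∉ closure s) :
    HasDerivWithinAt f f' s t := HasFDerivWithinAt.of_notMem_closure h

/-- The domain is the union of the history interval and [0, ω). On each piece the derivative is the
given one, and at points outside the closure of a piece the condition there is void; at 0 the
one-sided derivatives agree. -/
lemma hasDerivWithinAt_glue {m : ℕ} {τ : ℝ} {ω : EReal} (hτ : 0 < τ) (hω : 0 < ω)
    {f f' g g' : ℝ → Vec m} (h0 : f 0 = g 0) (h0' : f' 0 = g' 0)
    (hf : ∀ t ∈ Icc (-τ) 0, HasDerivWithinAt f (f' t) (Icc (-τ) 0) t)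
    (hg : ∀ t ∈ ray ω, HasDerivWithinAt g (g' t) (ray ω) t) {t : ℝ} (ht : t ∈ dom τ ω) :
    HasDerivWithinAt (glue f g) (glue f' g' t) (dom τ ω) t := by
  have e1 : ∀ {u v : ℝ → Vec m}, u 0 = v 0 → EqOn (glue u v) u (Icc (-τ) 0) := fun {u v} h s hs => by
    rcases hs.2.lt_or_eq with h' | rfl
    · simp [glue, h']
    · simp [glue, h]
  have e2 : ∀ {u v : ℝ → Vec m}, EqOn (glue u v) v (ray ω) := fun {u v} s hs => by
    simp [glue, not_lt.2 hs.1]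
  rw [dom_eq hτ hω]
  refine HasDerivWithinAt.union ?_ ?_
  · by_cases h : t ∈ Icc (-τ) 0
    · rw [e1 h0' h]
      exact (hf t h).congr (e1 h0) (e1 h0 h)
    · exact hasDerivWithinAt_of_notMem_closure (by rwa [isClosed_Icc.closure_eq])
  · by_cases h : t ∈ ray ω
    · rw [e2 h]
      exact (hg t h).congr e2 (e2 h)
    · have h0 : t < 0 := by
        by_contra! hc
        exact h ⟨hc, ht.2⟩
      refine hasDerivWithinAt_of_notMem_closure fun hc => ?_
      have : closure (ray ω) ⊆ Ici 0 := closure_minimal (fun x hx => hx.1) isClosed_Ici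
      exact absurd (this hc) (not_le.2 h0)

end Chain

namespace HasWeakDerivOn

variable {F G : Type*} [NormedAddCommGroup F] [NormedSpace ℝ F] [NormedAddCommGroup G]
  [NormedSpace ℝ G] {f f' g g' : ℝ → F} {ω : EReal}

lemma add (hf : HasWeakDerivOn f f' ω) (hg : HasWeakDerivOn g g' ω) :
    HasWeakDerivOn (fun t => f t + g t) (fun t => f' t + g' t) ω := fun t h0 ht => by
  obtain ⟨i1, e1⟩ := hf t h0 ht
  obtain ⟨i2, e2⟩ := hg t h0 ht
  refine ⟨i1.add i2, ?_⟩
  show f t + g t = f 0 + g 0 + _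
  rw [intervalIntegral.integral_add i1 i2, e1, e2]; abel

lemma map [CompleteSpace F] [CompleteSpace G] (L : F →L[ℝ] G) (hf : HasWeakDerivOn f f' ω) :
    HasWeakDerivOn (fun t => L (f t)) (fun t => L (f' t)) ω := fun t h0 ht => by
  obtain ⟨i1, e1⟩ := hf t h0 ht
  refine ⟨⟨L.integrable_comp i1.1, L.integrable_comp i1.2⟩, ?_⟩
  show L (f t) = L (f 0) + _
  rw [L.intervalIntegral_comp_comm i1, e1, map_add]

lemma neg (hf : HasWeakDerivOn f f' ω) : HasWeakDerivOn (fun t => -f t) (fun t => -f' t) ω :=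
  fun t h0 ht => by
  obtain ⟨i1, e1⟩ := hf t h0 ht
  refine ⟨i1.neg, ?_⟩
  show -f t = -f 0 + _
  rw [intervalIntegral.integral_neg, e1]; abel

lemma sub (hf : HasWeakDerivOn f f' ω) (hg : HasWeakDerivOn g g' ω) :
    HasWeakDerivOn (fun t => f t - g t) (fun t => f' t - g' t) ω := by
  simpa only [sub_eq_add_neg] using hf.add hg.neg

lemma zero : HasWeakDerivOn (fun _ => (0 : F)) (fun _ => 0) ω := fun t _ _ => by simp

lemma sum {ι : Type*} (s : Finset ι) {f f' : ι → ℝ → F} (h : ∀ i ∈ s, HasWeakDerivOn (f i) (f' i) ω) :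
    HasWeakDerivOn (fun t => ∑ i ∈ s, f i t) (fun t => ∑ i ∈ s, f' i t) ω := by
  classical
  induction s using Finset.induction_on with
  | empty => simpa using zero
  | insert i s hi ih =>
    simp only [Finset.sum_insert hi]
    exact (h i (Finset.mem_insert_self _ _)).add (ih fun j hj => h j (Finset.mem_insert_of_mem hj))

lemma congr (hf : HasWeakDerivOn f f' ω) (h : EqOn g f (ray ω))
    (h' : ∀ b ∈ ray ω, ∀ᵐ s ∂volume.restrict (Ico 0 b), g' s = f' s) : HasWeakDerivOn g g' ω :=
  fun t h0 ht => by
  obtain ⟨i1, e1⟩ := hf t h0 ht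
  have h1 := h' t ⟨h0, ht⟩
  refine ⟨i1.congr_ae ?_, ?_⟩
  · rw [uIoc_of_le h0]
    filter_upwards [ae_restrict_Ioc_iff_Ico.2 h1] with s hs using hs.symm
  · rw [intervalIntegral_congr_ae_Ico h0 h1, h ⟨h0, ht⟩, h ⟨le_rfl, (ray_mono ⟨h0, ht⟩ le_rfl h0).2⟩, e1]

lemma congr_of_eqOn (hf : HasWeakDerivOn f f' ω) (h : EqOn g f (ray ω)) (h' : EqOn g' f' (ray ω)) :
    HasWeakDerivOn g g' ω :=
  hf.congr h fun b hb => by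
    filter_upwards [ae_restrict_mem measurableSet_Ico] with s hs
    exact h' (ray_mono hb hs.1 hs.2.le)

lemma hasDerivWithinAt [CompleteSpace F] (hf : HasWeakDerivOn f f' ω) (h' : ContinuousOn f' (ray ω))
    {t : ℝ} (ht : t ∈ ray ω) : HasDerivWithinAt f (f' t) (ray ω) t := by
  obtain ⟨b, hb, htb⟩ := exists_lt_mem_ray ht
  have hb0 : 0 ≤ b := hb.1
  set G := fun x => f' (projIcc 0 b hb0 x)
  have hG : Continuous G := (h'.mono (Icc_subset_ray hb)).comp_continuous
    (continuous_subtype_val.comp continuous_projIcc) fun x => (projIcc 0 b hb0 x).2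
  have hGe : EqOn G f' (Icc 0 b) := fun x hx => by simp only [G, projIcc_of_mem hb0 hx]
  have h1 : HasDerivAt (fun x => f 0 + ∫ s in (0 : ℝ)..x, G s) (G t) t :=
    (intervalIntegral.integral_hasDerivAt_right (hG.intervalIntegrable _ _)
      hG.stronglyMeasurable.stronglyMeasurableAtFilter hG.continuousAt).const_add _
  have he : ∀ x ∈ Icc 0 b, f x = f 0 + ∫ s in (0 : ℝ)..x, G s := fun x hx => by
    rw [(hf x hx.1 (Icc_subset_ray hb hx).2).2]
    congr 1
    refine intervalIntegral.integral_congr fun s hs => (hGe ?_).symm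
    rw [uIcc_of_le hx.1] at hs
    exact ⟨hs.1, hs.2.trans hx.2⟩
  rw [← hGe ⟨ht.1, htb.le⟩]
  refine h1.hasDerivWithinAt.congr_of_eventuallyEq ?_ (he t ⟨ht.1, htb.le⟩)
  filter_upwards [self_mem_nhdsWithin, mem_nhdsWithin_of_mem_nhds (Iio_mem_nhds htb)] with x hx hxb
  exact he x ⟨hx.1, le_of_lt hxb⟩

lemma continuousOn (hf : HasWeakDerivOn f f' ω) : ContinuousOn f (ray ω) := by
  intro t ht
  obtain ⟨b, hb, htb⟩ := exists_lt_mem_ray ht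
  have hb0 : 0 ≤ b := hb.1
  have h1 : ContinuousOn (fun x => f 0 + ∫ s in (0 : ℝ)..x, f' s) (Icc 0 b) := by
    refine continuousOn_const.add ?_
    have := intervalIntegral.continuousOn_primitive_interval
      ((intervalIntegrable_iff_integrableOn_Icc_of_le hb0).1 (hf b hb0 hb.2).1 |>.mono_set
        (uIcc_of_le hb0).le)
    rwa [uIcc_of_le hb0] at this
  have h2 : ContinuousOn f (Icc 0 b) := h1.congr fun x hx => (hf x hx.1 (Icc_subset_ray hb hx).2).2
  refine (h2 t ⟨ht.1, htb.le⟩).mono_of_mem_nhdsWithin ?_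
  filter_upwards [self_mem_nhdsWithin, mem_nhdsWithin_of_mem_nhds (Iio_mem_nhds htb)] with x hx hxb
  exact ⟨hx.1, le_of_lt hxb⟩

lemma of_hasDerivWithinAt [CompleteSpace F] (hf : ∀ t ∈ ray ω, HasDerivWithinAt f (f' t) (ray ω) t)
    (h' : ContinuousOn f' (ray ω)) : HasWeakDerivOn f f' ω := fun t h0 ht => by
  have hsub : Icc 0 t ⊆ ray ω := Icc_subset_ray ⟨h0, ht⟩
  have hi : IntervalIntegrable f' volume 0 t := by
    refine ContinuousOn.intervalIntegrable ?_
    rw [uIcc_of_le h0]; exact h'.mono hsub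
  refine ⟨hi, ?_⟩
  rw [intervalIntegral.integral_eq_sub_of_hasDeriv_right_of_le h0
    (fun x hx => ((hf x (hsub hx)).mono hsub).continuousWithinAt) (fun x hx => ?_) hi]
  · abel
  · refine ((hf x (hsub (Ioo_subset_Icc_self hx))).mono_of_mem_nhdsWithin ?_)
    filter_upwards [mem_nhdsWithin_of_mem_nhds (Ioo_mem_nhds hx.1 hx.2)] with y hy
    exact hsub (Ioo_subset_Icc_self hy)

/-- A function that is weakly differentiable on each `[0,b]`, `b < ω`, has its classical derivative
as weak derivative. -/
lemma of_forall [CompleteSpace F]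
    (h : ∀ b ∈ ray ω, ∃ v, IntervalIntegrable v volume 0 b ∧
      ∀ t ∈ Icc 0 b, f t = f 0 + ∫ s in (0 : ℝ)..t, v s) :
    HasWeakDerivOn f (deriv f) ω ∧ ∀ b ∈ ray ω, ∀ v, IntervalIntegrable v volume 0 b →
      (∀ t ∈ Icc 0 b, f t = f 0 + ∫ s in (0 : ℝ)..t, v s) →
      ∀ᵐ s ∂volume.restrict (Ico 0 b), deriv f s = v s := by
  have key : ∀ b ∈ ray ω, ∀ v, IntervalIntegrable v volume 0 b →
      (∀ t ∈ Icc 0 b, f t = f 0 + ∫ s in (0 : ℝ)..t, v s) →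
      ∀ᵐ s ∂volume.restrict (Ico 0 b), deriv f s = v s := by
    intro b hb v hv hfv
    rw [← Measure.restrict_congr_set (Ioo_ae_eq_Ico (a := (0 : ℝ)) (b := b)),
      ae_restrict_iff' measurableSet_Ioo]
    filter_upwards [hv.ae_hasDerivAt_integral] with x hx hxs
    have h2 : HasDerivAt (fun y => f 0 + ∫ z in (0 : ℝ)..y, v z) (v x) x :=
      (hx (by rw [uIcc_of_le hb.1]; exact Ioo_subset_Icc_self hxs) 0
        (by rw [uIcc_of_le hb.1]; exact ⟨le_rfl, hb.1⟩)).const_add _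
    refine (h2.congr_of_eventuallyEq ?_).deriv
    filter_upwards [Ioo_mem_nhds hxs.1 hxs.2] with y hy using hfv y (Ioo_subset_Icc_self hy)
  refine ⟨fun t h0 ht => ?_, key⟩
  obtain ⟨v, hv, hfv⟩ := h t ⟨h0, ht⟩
  have hae := key t ⟨h0, ht⟩ v hv hfv
  refine ⟨hv.congr_ae ?_, ?_⟩
  · rw [uIoc_of_le h0]
    filter_upwards [ae_restrict_Ioc_iff_Ico.2 hae] with s hs using hs.symm
  · rw [intervalIntegral_congr_ae_Ico h0 hae]; exact hfv t ⟨h0, le_rfl⟩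

lemma pi {ι : Type*} [Fintype ι] {E : ι → Type*} [∀ i, NormedAddCommGroup (E i)]
    [∀ i, NormedSpace ℝ (E i)] [∀ i, CompleteSpace (E i)] {f f' : ℝ → ∀ i, E i}
    (h : ∀ i, HasWeakDerivOn (fun t => f t i) (fun t => f' t i) ω) : HasWeakDerivOn f f' ω := by
  classical
  have h1 := sum Finset.univ fun i (_ : i ∈ Finset.univ) =>
    (h i).map (ContinuousLinearMap.single ℝ E i)
  refine h1.congr_of_eqOn (fun t _ => ?_) fun t _ => ?_
  · simp [Finset.univ_sum_single]
  · simp [Finset.univ_sum_single]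

end HasWeakDerivOn
end

/-! ### The change of variables between cascade states and configurations -/

noncomputable section

/-- The differences of successive entries of `y, z 0, …, z n`. -/
def diffs {m n : ℕ} (y : Vec m) (z : Fin (n + 1) → Vec m) (i : Fin (n + 1)) : Vec m :=
  (Fin.cons y fun i : Fin n => z i.castSucc : Fin (n + 1) → Vec m) i - z i

lemma diffs_zero {m n : ℕ} (y : Vec m) (z : Fin (n + 1) → Vec m) : diffs y z 0 = y - z 0 := rfl

lemma diffs_succ {m n : ℕ} (y : Vec m) (z : Fin (n + 1) → Vec m) (i : Fin n) :
    diffs y z i.succ = z i.castSucc - z i.succ := rfl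

lemma sum_diffs_succ {m n : ℕ} (y : Vec m) (z : Fin (n + 1) → Vec m) :
    ∑ i : Fin n, diffs y z i.succ = z 0 - z (Fin.last n) := by
  simp only [diffs_succ, Finset.sum_sub_distrib]
  have e1 := Fin.sum_univ_castSucc z
  rw [Fin.sum_univ_succ z] at e1
  exact sub_eq_sub_iff_add_eq_add.2 (by rw [e1.symm, add_comm])

namespace Coeff

variable {m n : ℕ} (C : Coeff m n) (J : Fin (n + 2) → ℝ) (Z : Fin (n + 1) → ℕ → Vec m)
  (Y : ℕ → Vec m)

/-- The derivatives of the errors `z_{i-1,1} - z_{i,1}`, from the states of the cascade and the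
derivatives of `y`. -/
def cascErrs : ℕ → Fin (n + 1) → Vec m := recSeq fun j prev => diffs (Y j) fun i =>
  Z i j + jetSum (C.w i) j fun k => (nth J k, prev k i)

/-- The derivatives of `z_{i,1}`. -/
def cascOut (i : Fin (n + 1)) (j : ℕ) : Vec m :=
  Z i j + jetSum (C.w i) j fun k => (nth J k, C.cascErrs J Z Y k i)

lemma cascErrs_eq (j : ℕ) : C.cascErrs J Z Y j = diffs (Y j) fun i => C.cascOut J Z Y i j := by
  rw [cascErrs, recSeq_eq]; rfl

lemma cascOut_zero (i : Fin (n + 1)) : C.cascOut J Z Y i 0 = Z i 0 := by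
  simp [cascOut, jetSum]

lemma cascErrs_zero : C.cascErrs J Z Y 0 = diffs (Y 0) fun i => Z i 0 := by
  simp only [cascErrs_eq, cascOut_zero]

/-- The configuration that corresponds to the states of the cascade and the derivatives of `y`. -/
def confOf : Conf m n :=
  (J, fun j => C.cascOut J Z Y (Fin.last n) j,
    Fin.cons (fun j => Y j - ∑ k : Fin j, C.R (n + 2 - j + k) (Y k) - C.K (Z 0 j)
        -- The term G z^{(j)} makes the entry of order 0 a function of the errors alone. It is
        -- omitted for j = r − 1, since its derivative G z^{(r)} would bring in the control.
        - if (j : ℕ) < n + 1 then C.G (C.cascOut J Z Y (Fin.last n) j) else 0)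
      fun i j => Z i.castSucc j - Z i.succ j)

lemma nth_confOf_zero {j : ℕ} (hj : j < n + 2) : nth ((C.confOf J Z Y).2.2 0) j
    = Y j - ∑ k : Fin j, C.R (n + 2 - j + k) (Y k) - C.K (Z 0 j)
      - if j < n + 1 then C.G (C.cascOut J Z Y (Fin.last n) j) else 0 := nth_of_lt _ hj

lemma nth_confOf_succ {j : ℕ} (hj : j < n + 2) (i : Fin n) :
    nth ((C.confOf J Z Y).2.2 i.succ) j = Z i.castSucc j - Z i.succ j := nth_of_lt _ hj

lemma nth_confOf_sig {j : ℕ} (hj : j < n + 2) :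
    nth (C.confOf J Z Y).2.1 j = C.cascOut J Z Y (Fin.last n) j := nth_of_lt _ hj

variable {C J Z Y} (hKG : ∀ x, C.K x + C.G x = x)

include hKG

/-- Induction on the order: the recursion behind `err` inverts the definition of the internal
states. For the first error the decomposition I = K + G is applied to z_0^{(j)}. -/
lemma err_confOf {j : ℕ} (hj : j < n + 2) : C.err (C.confOf J Z Y) j = C.cascErrs J Z Y j := by
  induction j using Nat.strong_induction_on with
  | _ j ih =>
  have hlead : ∀ i k, k ≤ j → C.lead (C.confOf J Z Y) i k + Z i k = C.cascOut J Z Y i k := by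
    intro i k hk
    rw [cascOut, add_comm, lead]
    congr 2
    funext l
    rw [jet, ih l (by omega) (by omega)]; rfl
  have hout : ∀ k < j, C.out (C.confOf J Z Y) k = Y k := by
    intro k hk
    rw [out, ih k hk (by omega), nth_confOf_sig _ _ _ _ (by omega), Fin.sum_univ_succ, cascErrs_eq,
      sum_diffs_succ, diffs_zero]
    abel
  have hs : ∀ i : Fin n, C.err (C.confOf J Z Y) j i.succ = C.cascErrs J Z Y j i.succ := by
    intro i
    rw [err_succ, nth_confOf_succ _ _ _ _ hj, cascErrs_eq, diffs_succ, ← hlead _ j le_rfl,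
      ← hlead _ j le_rfl]
    abel
  funext i
  refine Fin.cases ?_ hs i
  have hsum : ∑ k : Fin j, C.R (n + 2 - j + k) (C.out (C.confOf J Z Y) k)
      = ∑ k : Fin j, C.R (n + 2 - j + k) (Y k) :=
    Finset.sum_congr rfl fun k _ => by rw [hout k k.2]
  rw [err_zero, hsum]
  simp only [hs]
  rw [nth_confOf_zero _ _ _ _ hj, cascErrs_eq, sum_diffs_succ, diffs_zero, ← hlead 0 j le_rfl,
    nth_confOf_sig _ _ _ _ hj]
  have e := hKG (C.lead (C.confOf J Z Y) 0 j + Z 0 j)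
  have e2 : Y j - (C.lead (C.confOf J Z Y) 0 j + Z 0 j) = Y j - (C.K (C.lead (C.confOf J Z Y) 0 j + Z 0 j)
    + C.G (C.lead (C.confOf J Z Y) 0 j + Z 0 j)) := by rw [e]
  rw [e2]
  by_cases h : j = n + 1
  · rw [if_neg (by omega), if_pos h]; simp only [map_add, map_sub]; abel
  · rw [if_pos (by omega), if_neg h]; simp only [map_add, map_sub]; abel

lemma lead_confOf {j : ℕ} (hj : j ≤ n + 2) (i : Fin (n + 1)) :
    C.lead (C.confOf J Z Y) i j = C.cascOut J Z Y i j - Z i j := by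
  rw [cascOut, add_sub_cancel_left, lead]
  congr 1
  funext l
  rw [jet, err_confOf hKG (by omega)]; rfl

lemma out_confOf {j : ℕ} (hj : j < n + 2) : C.out (C.confOf J Z Y) j = Y j := by
  rw [out, err_confOf hKG hj, nth_confOf_sig _ _ _ _ hj, Fin.sum_univ_succ, cascErrs_eq,
    sum_diffs_succ, diffs_zero]
  abel

lemma outs_confOf : C.outs (C.confOf J Z Y) = fun j : Fin (n + 2) => Y j :=
  funext fun j => out_confOf hKG j.2

lemma confOf_mem_confDom (h : ∀ i, (nth J 0, C.cascErrs J Z Y 0 i) ∈ gainDom m (C.c i)) :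
    C.confOf J Z Y ∈ C.confDom := fun i => by
  rw [jet, err_confOf hKG (by omega)]
  exact h i

omit hKG in
variable (C) in
/-- The states of the cascade as functions of the configuration. -/
def cascState (θ : Conf m n) (i : Fin (n + 1)) (j : ℕ) : Vec m :=
  nth θ.2.1 j + ∑ i' ∈ Finset.Ioi i, C.err θ j i' - C.lead θ i j

omit hKG in
lemma sum_Ioi_castSucc {n : ℕ} (i : Fin n) (f : Fin (n + 1) → Vec m) :
    ∑ k ∈ Finset.Ioi i.castSucc, f k = f i.succ + ∑ k ∈ Finset.Ioi i.succ, f k := by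
  have : Finset.Ioi i.castSucc = insert i.succ (Finset.Ioi i.succ) := by
    ext k
    simp only [Finset.mem_Ioi, Finset.mem_insert, Fin.lt_def, Fin.ext_iff, Fin.val_castSucc,
      Fin.val_succ]
    omega
  rw [this, Finset.sum_insert (by simp)]

omit hKG in
lemma sum_Ioi_zero {n : ℕ} (f : Fin (n + 1) → Vec m) :
    ∑ k ∈ Finset.Ioi 0, f k = ∑ k : Fin n, f k.succ := by
  have h1 : (Finset.univ : Finset (Fin (n + 1))) = insert 0 (Finset.Ioi 0) := by
    ext k
    simp only [Finset.mem_univ, Finset.mem_insert, Finset.mem_Ioi, true_iff, Fin.lt_def,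
      Fin.ext_iff, Fin.val_zero]
    omega
  have h2 := Fin.sum_univ_succ f
  rw [h1, Finset.sum_insert (by simp)] at h2
  exact add_left_cancel h2

omit hKG in
lemma cascState_last (θ : Conf m n) (j : ℕ) :
    C.cascState θ (Fin.last n) j = nth θ.2.1 j - C.lead θ (Fin.last n) j := by
  have : Finset.Ioi (Fin.last n) = ∅ := by
    ext k; simp [Finset.mem_Ioi, Fin.le_last]
  rw [cascState, this, Finset.sum_empty, add_zero]

omit hKG in
lemma cascState_castSucc (θ : Conf m n) (i : Fin n) (j : ℕ) :
    C.cascState θ i.castSucc j = C.cascState θ i.succ j + nth (θ.2.2 i.succ) j := by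
  rw [cascState, cascState, sum_Ioi_castSucc, err_succ]; abel

lemma cascState_confOf {j : ℕ} (hj : j < n + 2) (i : Fin (n + 1)) :
    C.cascState (C.confOf J Z Y) i j = Z i j := by
  induction i using Fin.reverseInduction with
  | last =>
    rw [cascState_last, nth_confOf_sig _ _ _ _ hj, lead_confOf hKG hj.le]; abel
  | cast i ih => rw [cascState_castSucc, ih, nth_confOf_succ _ _ _ _ hj]; abel

omit hKG in
lemma cascState_zero_sub (θ : Conf m n) :
    (diffs (C.out θ 0) fun i => C.cascState θ i 0) = C.err θ 0 := by
  funext i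
  refine Fin.cases ?_ (fun i => ?_) i
  · rw [diffs_zero, cascState, sum_Ioi_zero, lead_zero, out, Fin.sum_univ_succ]; abel
  · rw [diffs_succ, cascState_castSucc, add_sub_cancel_left, err_succ, lead_zero, lead_zero]; abel

end Coeff
end

/-! ### Differentiation along trajectories, in both directions -/

noncomputable section

namespace HasWeakDerivOn

variable {F : Type*} [NormedAddCommGroup F] [NormedSpace ℝ F] {f f' : ℝ → F} {ω : EReal}

lemma apply {ι : Type*} [Fintype ι] {E : ι → Type*} [∀ i, NormedAddCommGroup (E i)]
    [∀ i, NormedSpace ℝ (E i)] [∀ i, CompleteSpace (E i)] {f f' : ℝ → ∀ i, E i}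
    (h : HasWeakDerivOn f f' ω) (i : ι) : HasWeakDerivOn (fun t => f t i) (fun t => f' t i) ω :=
  h.map (ContinuousLinearMap.proj (R := ℝ) i)

end HasWeakDerivOn

lemma diffs_weakDeriv {m n : ℕ} {ω : EReal} {y y' : ℝ → Vec m} {z z' : ℝ → Fin (n + 1) → Vec m}
    (hy : HasWeakDerivOn y y' ω) (hz : ∀ i, HasWeakDerivOn (fun t => z t i) (fun t => z' t i) ω)
    (i : Fin (n + 1)) :
    HasWeakDerivOn (fun t => diffs (y t) (z t) i) (fun t => diffs (y' t) (z' t) i) ω := by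
  refine Fin.cases ?_ (fun i => ?_) i
  · exact hy.sub (hz 0)
  · exact (hz i.castSucc).sub (hz i.succ)

namespace Coeff

variable {m n : ℕ} {C : Coeff m n} {ω : EReal} {J : ℝ → Fin (n + 2) → ℝ}

lemma continuousOn_jetSum_w {s : Set ℝ} {i : Fin (n + 1)} {j : ℕ} {c : ℕ → ℝ → ℝ × Vec m}
    (hc : ∀ k < j, ContinuousOn (c k) s) (h0 : ∀ t ∈ s, c 0 t ∈ gainDom m (C.c i)) :
    ContinuousOn (fun t => jetSum (C.w i) j fun k => c k t) s := by
  refine (contDiffOn_jetSum (isOpen_gainDom m (C.c i)) (C.contDiffOn_w i) j).continuousOn.comp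
    (continuousOn_pi.2 fun k : Fin j => hc k k.2) fun t ht k hk => ?_
  simpa [hk] using h0 t ht

/-- The chain rule for `jetSum` along weakly differentiable curves. -/
lemma weakDeriv_jetSum {i : Fin (n + 1)} {j : ℕ} (hj : j < n + 2) {e : ℕ → ℝ → Vec m}
    (hJ : ∀ t ∈ ray ω, ∀ k < n + 1,
      HasDerivWithinAt (fun x => nth (J x) k) (nth (J t) (k + 1)) (ray ω) t)
    (hJc : ∀ k, ContinuousOn (fun t => nth (J t) k) (ray ω))
    (he : ∀ k < j, HasWeakDerivOn (e k) (e (k + 1)) ω) (hec : ContinuousOn (e j) (ray ω))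
    (h0 : ∀ t ∈ ray ω, (nth (J t) 0, e 0 t) ∈ gainDom m (C.c i)) :
    HasWeakDerivOn (fun t => jetSum (C.w i) j fun k => (nth (J t) k, e k t))
      (fun t => jetSum (C.w i) (j + 1) (fun k => (nth (J t) k, e k t))
        - C.w i j (nth (J t) 0, e 0 t)) ω := by
  have hc : ∀ k ≤ j, ContinuousOn (e k) (ray ω) := fun k hk => by
    rcases hk.eq_or_lt with rfl | hk
    · exact hec
    · exact (he k hk).continuousOn
  refine HasWeakDerivOn.of_hasDerivWithinAt (fun t ht => ?_) (ContinuousOn.sub ?_ ?_)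
  · exact hasDerivWithinAt_jetSum (isOpen_gainDom m (C.c i)) (C.contDiffOn_w i)
      (c := fun k x => (nth (J x) k, e k x))
      (fun k hk => (hJ t ht k (by omega)).prodMk ((he k hk).hasDerivWithinAt (hc _ hk) ht))
      (h0 t ht)
  · exact continuousOn_jetSum_w (c := fun k x => (nth (J x) k, e k x))
      (fun k hk => (hJc k).prodMk (hc k (by omega))) h0
  · exact (C.contDiffOn_w i j).continuousOn.comp ((hJc 0).prodMk (hc 0 (by omega))) h0

section Forward

variable {Z : ℝ → Fin (n + 1) → ℕ → Vec m} {Y : ℝ → ℕ → Vec m}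
  (hJ : ∀ t ∈ ray ω, ∀ k < n + 1,
      HasDerivWithinAt (fun x => nth (J x) k) (nth (J t) (k + 1)) (ray ω) t)
  (hJc : ∀ k, ContinuousOn (fun t => nth (J t) k) (ray ω))
  (hY : ∀ k < n + 2, HasWeakDerivOn (fun t => Y t k) (fun t => Y t (k + 1)) ω)
  (hZ : ∀ i, ∀ k < n + 2, HasWeakDerivOn (fun t => Z t i k)
    (fun t => C.w i k (nth (J t) 0, C.cascErrs (J t) (Z t) (Y t) 0 i) + Z t i (k + 1)) ω)
  (h0 : ∀ t ∈ ray ω, ∀ i, (nth (J t) 0, C.cascErrs (J t) (Z t) (Y t) 0 i) ∈ gainDom m (C.c i))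

include hJ hJc hY hZ h0

omit hJ in
lemma continuousOn_cascErrs {k : ℕ} (hk : k < n + 2) (i : Fin (n + 1)) :
    ContinuousOn (fun t => C.cascErrs (J t) (Z t) (Y t) k i) (ray ω) := by
  induction k using Nat.strong_induction_on generalizing i with
  | _ k ih =>
  have ho : ∀ i, ContinuousOn (fun t => C.cascOut (J t) (Z t) (Y t) i k) (ray ω) := fun i =>
    (hZ i k hk).continuousOn.add (continuousOn_jetSum_w
      (c := fun l t => (nth (J t) l, C.cascErrs (J t) (Z t) (Y t) l i))
      (fun l hl => (hJc l).prodMk (ih l hl (by omega) i)) fun t ht => h0 t ht i)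
  simp only [cascErrs_eq C _ _ _ k]
  refine Fin.cases ?_ (fun i => ?_) i
  · exact (hY k hk).continuousOn.sub (ho 0)
  · exact (ho i.castSucc).sub (ho i.succ)

/-- z_i^{(k)} is Z_{i,k} plus its lead. The term w_{i,k} from the differential equation of Z_{i,k}
cancels the one subtracted when the lead is differentiated. At k = r − 1 this yields z_i^{(r)},
whose state part is the control. -/
lemma weakDeriv_casc {k : ℕ} (hk : k < n + 2) (i : Fin (n + 1)) :
    HasWeakDerivOn (fun t => C.cascErrs (J t) (Z t) (Y t) k i)
      (fun t => C.cascErrs (J t) (Z t) (Y t) (k + 1) i) ω ∧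
    HasWeakDerivOn (fun t => C.cascOut (J t) (Z t) (Y t) i k)
      (fun t => C.cascOut (J t) (Z t) (Y t) i (k + 1)) ω := by
  induction k using Nat.strong_induction_on generalizing i with
  | _ k ih =>
  have ho : ∀ i, HasWeakDerivOn (fun t => C.cascOut (J t) (Z t) (Y t) i k)
      (fun t => C.cascOut (J t) (Z t) (Y t) i (k + 1)) ω := fun i => by
    have h1 := (hZ i k hk).add (weakDeriv_jetSum (C := C) hk
      (e := fun l t => C.cascErrs (J t) (Z t) (Y t) l i) hJ hJc
      (fun l hl => (ih l hl (by omega) i).1)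
      (continuousOn_cascErrs hJc hY hZ h0 hk i) fun t ht => h0 t ht i)
    refine h1.congr_of_eqOn (fun t _ => rfl) fun t _ => ?_
    simp only [cascOut]; abel
  refine ⟨?_, ho i⟩
  simp only [cascErrs_eq C _ _ _ k, cascErrs_eq C _ _ _ (k + 1)]
  exact diffs_weakDeriv (hY k hk) ho i

variable (hKG : ∀ x, C.K x + C.G x = x) {v fd : ℝ → Vec m}
  (hv : ∀ i, ∀ t ∈ ray ω, Z t i (n + 2) = v t)
  (heq : ∀ b ∈ ray ω, ∀ᵐ t ∂volume.restrict (Ico 0 b),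
    Y t (n + 2) = ∑ k : Fin (n + 2), C.R k (Y t k) + fd t + C.K (v t))

include hKG hv heq

/-- The defining property of the internal states: their dynamics do not contain the control. -/
lemma weakDeriv_confOf : HasWeakDerivOn (fun t => (C.confOf (J t) (Z t) (Y t)).2.2)
    (fun t => C.field (C.confOf (J t) (Z t) (Y t)) (fd t)) ω := by
  have hjet : ∀ t i, C.jet (C.confOf (J t) (Z t) (Y t)) i 0
      = (nth (J t) 0, C.cascErrs (J t) (Z t) (Y t) 0 i) := fun t i => by
    rw [jet, err_confOf hKG (by omega)]; rfl
  refine HasWeakDerivOn.pi fun i => HasWeakDerivOn.pi fun j => ?_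
  have hj2 : (j : ℕ) < n + 2 := j.2
  refine Fin.cases ?_ (fun i => ?_) i
  · have h1 := (((hY j hj2).sub (HasWeakDerivOn.sum Finset.univ
      fun (k : Fin j) _ => (hY k (by omega)).map (C.R (n + 2 - j + k)))).sub
      ((hZ 0 j hj2).map C.K))
    by_cases hjn : (j : ℕ) < n + 1
    · have h2 := h1.sub ((weakDeriv_casc hJ hJc hY hZ h0 hj2 (Fin.last n)).2.map C.G)
      refine h2.congr_of_eqOn (fun t _ => ?_) fun t ht => ?_
      · simp only [confOf, Fin.cons_zero, if_pos hjn]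
      · simp only [field, Fin.cons_zero]
        rw [nth_confOf_zero _ _ _ _ (by omega), hjet, out_confOf hKG (by omega),
          nth_confOf_sig _ _ _ _ (by omega), Fin.sum_univ_succ]
        have e1 : n + 2 - ((j : ℕ) + 1) = n + 1 - j := by omega
        have e2 : ∀ l : Fin j, n + 1 - j + (l + 1 : ℕ) = n + 2 - j + l := fun l => by omega
        simp only [Fin.val_zero, Fin.val_succ, e1, e2, add_zero, map_add, hjn.ne, if_false]
        by_cases hjn' : (j : ℕ) = n
        · rw [if_neg (by omega), if_pos hjn', hjn']; abel
        · rw [if_pos (show (j : ℕ) + 1 < n + 1 by omega), if_neg hjn']; abel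
    -- The only entry of the first block where the control occurs: K v from the equation of
    -- y^{(r−1)} cancels K v from the last state of the first compensator.
    · have hjn' : (j : ℕ) = n + 1 := by omega
      refine h1.congr (fun t _ => ?_) fun b hb => ?_
      · simp only [confOf, Fin.cons_zero, if_neg hjn, sub_zero]
      · filter_upwards [heq b hb, ae_restrict_mem measurableSet_Ico] with t ht htb
        simp only [field, Fin.cons_zero]
        have e2 : ∀ l : Fin (n + 1), n + 2 - (n + 1) + (l : ℕ) = l + 1 := fun l => by omega
        rw [nth_of_ge _ (by omega), hjet, out_confOf hKG (by omega), if_neg (by omega), if_pos hjn']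
        generalize hj' : (j : ℕ) = j' at *
        subst hjn'
        rw [hv 0 t (ray_mono hb htb.1 htb.2.le), ht, Fin.sum_univ_succ]
        simp only [e2, map_add, Fin.val_zero, Fin.val_succ, Nat.sub_self]
        abel
  · refine ((hZ i.castSucc j hj2).sub (hZ i.succ j hj2)).congr_of_eqOn (fun t _ => ?_)
      fun t ht => ?_
    · simp only [confOf, Fin.cons_succ]
    · simp only [field, Fin.cons_succ, hjet]
      by_cases hjn : (j : ℕ) < n + 1
      · rw [nth_confOf_succ _ _ _ _ (by omega)]; abel
      · have hjn' : (j : ℕ) = n + 1 := by omega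
        rw [nth_of_ge ((C.confOf (J t) (Z t) (Y t)).2.2 i.succ) (show n + 2 ≤ (j : ℕ) + 1 by omega),
          hjn', hv _ t ht, hv _ t ht]; abel

end Forward

lemma sum_Ioi_err (θ : Conf m n) (i : Fin (n + 1)) :
    ∑ k ∈ Finset.Ioi i, C.err θ (n + 2) k = C.lead θ i (n + 2) - C.lead θ (Fin.last n) (n + 2) := by
  induction i using Fin.reverseInduction with
  | last =>
    have : Finset.Ioi (Fin.last n) = ∅ := by ext k; simp [Finset.mem_Ioi, Fin.le_last]
    rw [this, Finset.sum_empty, sub_self]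
  | cast i ih =>
    rw [sum_Ioi_castSucc, ih, err_succ, nth_of_ge _ le_rfl]; abel

section Backward

variable {θ : ℝ → Conf m n} {wr fd : ℝ → Vec m}
  (hθ : ∀ t ∈ ray ω, θ t ∈ C.confDom)
  (hJ : ∀ t ∈ ray ω, ∀ k < n + 1,
      HasDerivWithinAt (fun x => nth (θ x).1 k) (nth (θ t).1 (k + 1)) (ray ω) t)
  (hJc : ∀ k, ContinuousOn (fun t => nth (θ t).1 k) (ray ω))
  (hξ : ∀ k < n + 1, HasWeakDerivOn (fun t => nth (θ t).2.1 k) (fun t => nth (θ t).2.1 (k + 1)) ω)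
  (hξr : HasWeakDerivOn (fun t => nth (θ t).2.1 (n + 1)) wr ω)
  (hX : HasWeakDerivOn (fun t => (θ t).2.2) (fun t => C.field (θ t) (fd t)) ω)

include hθ hJ hJc hξ hξr hX

omit hθ hJ in
lemma continuousOn_conf : ContinuousOn θ (ray ω) := by
  have h1 : ContinuousOn (fun t => (θ t).1) (ray ω) := continuousOn_pi.2 fun k => by
    simpa using hJc k
  have h2 : ContinuousOn (fun t => (θ t).2.1) (ray ω) := continuousOn_pi.2 fun k => by
    rcases Nat.lt_or_ge k (n + 1) with h | h
    · simpa using (hξ k h).continuousOn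
    · have := hξr.continuousOn
      have e : (k : ℕ) = n + 1 := by omega
      rw [← e] at this
      simpa using this
  exact h1.prodMk (h2.prodMk hX.continuousOn)

lemma hasDerivWithinAt_err_ray {k : ℕ} (hk : k < n + 1) (i : Fin (n + 1)) {t : ℝ} (ht : t ∈ ray ω) :
    HasDerivWithinAt (fun x => C.err (θ x) k i) (C.err (θ t) (k + 1) i) (ray ω) t := by
  have hθc := continuousOn_conf hJc hξ hξr hX
  have hf : ContinuousOn (fun t => C.field (θ t) 0) (ray ω) :=
    C.contDiffOn_field.continuousOn.comp hθc hθ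
  -- The value of f is only measurable, but it enters the last entry of the first block alone. Below
  -- that order the velocities are continuous and do not depend on v, so the derivatives are
  -- classical.
  refine C.hasDerivWithinAt_err (v := 0) (hθ t ht) (hJ t ht) (fun k hk => ?_) (fun i k hk => ?_) k hk i
  · refine (hξ k hk).hasDerivWithinAt ?_ ht
    rcases Nat.lt_or_ge (k + 1) (n + 1) with h | h
    · exact (hξ _ h).continuousOn
    · rw [show k + 1 = n + 1 by omega]; exact hξr.continuousOn
  · have hk2 : k < n + 2 := by omega
    have h1 := (hX.apply i).apply ⟨k, hk2⟩
    have h2 : HasWeakDerivOn (fun t => (θ t).2.2 i ⟨k, hk2⟩) (fun t => C.field (θ t) 0 i ⟨k, hk2⟩) ω := by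
      refine h1.congr_of_eqOn (fun _ _ => rfl) fun t _ => ?_
      simp only
      rw [field_eq (C := C) (θ t) (fd t)]
      refine Fin.cases ?_ (fun i => ?_) i
      · simp [inj, hk.ne]
      · simp [inj]
    simp only [nth_of_lt _ hk2]
    exact h2.hasDerivWithinAt ((continuousOn_pi.1 ((continuousOn_pi.1 hf) i)) _) ht

omit hJ in
lemma continuousOn_err (k : ℕ) (i : Fin (n + 1)) :
    ContinuousOn (fun t => C.err (θ t) k i) (ray ω) :=
  (C.contDiffOn_err k i).continuousOn.comp (continuousOn_conf hJc hξ hξr hX) hθ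

lemma weakDeriv_err {k : ℕ} (hk : k < n + 1) (i : Fin (n + 1)) :
    HasWeakDerivOn (fun t => C.err (θ t) k i) (fun t => C.err (θ t) (k + 1) i) ω :=
  HasWeakDerivOn.of_hasDerivWithinAt
    (fun _ ht => hasDerivWithinAt_err_ray hθ hJ hJc hξ hξr hX hk i ht)
    (continuousOn_err hθ hJc hξ hξr hX _ i)

lemma weakDeriv_lead {k : ℕ} (hk : k < n + 2) (i : Fin (n + 1)) :
    HasWeakDerivOn (fun t => C.lead (θ t) i k)
      (fun t => C.lead (θ t) i (k + 1) - C.w i k (C.jet (θ t) i 0)) ω :=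
  weakDeriv_jetSum (C := C) hk (J := fun t => (θ t).1) (e := fun l t => C.err (θ t) l i) hJ hJc
    (fun l hl => weakDeriv_err hθ hJ hJc hξ hξr hX (by omega) i)
    (continuousOn_err hθ hJc hξ hξr hX _ i) fun t ht => hθ t ht i

/-- The later errors can be differentiated once more than the first one in this form: their blocks
contain neither f nor a derivative of z beyond those available. -/
lemma weakDeriv_err_succ {k : ℕ} (hk : k < n + 2) (i : Fin n) :
    HasWeakDerivOn (fun t => C.err (θ t) k i.succ) (fun t => C.err (θ t) (k + 1) i.succ) ω := by
  have h1 := (hX.apply i.succ).apply ⟨k, hk⟩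
  have h2 := (h1.add (weakDeriv_lead hθ hJ hJc hξ hξr hX hk i.castSucc)).sub
    (weakDeriv_lead hθ hJ hJc hξ hξr hX hk i.succ)
  refine h2.congr_of_eqOn (fun t _ => ?_) fun t _ => ?_
  · simp only [err_succ, nth_of_lt _ hk]
  · simp only [err_succ, field, Fin.cons_succ]; abel

lemma weakDeriv_out {k : ℕ} (hk : k < n + 1) :
    HasWeakDerivOn (fun t => C.out (θ t) k) (fun t => C.out (θ t) (k + 1)) ω :=
  (hξ k hk).add (HasWeakDerivOn.sum _ fun i _ => weakDeriv_err hθ hJ hJc hξ hξr hX hk i)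

lemma weakDeriv_err_zero_top : HasWeakDerivOn (fun t => C.err (θ t) (n + 1) 0)
    (fun t => C.err (θ t) (n + 2) 0 + fd t - C.G (wr t)) ω := by
  have hX0 := (hX.apply 0).apply ⟨n + 1, by omega⟩
  have h1 := (((hX0.sub (hξr.map C.G)).sub ((HasWeakDerivOn.sum Finset.univ fun (i : Fin n) _ =>
    weakDeriv_err_succ hθ hJ hJc hξ hξr hX (k := n + 1) (by omega) i).map C.G)).add
    (HasWeakDerivOn.sum Finset.univ fun (l : Fin (n + 1)) _ =>
      (weakDeriv_out hθ hJ hJc hξ hξr hX l.2).map (C.R (n + 2 - (n + 1) + l)))).sub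
    ((weakDeriv_lead hθ hJ hJc hξ hξr hX (k := n + 1) (by omega) 0).map C.K)
  refine h1.congr_of_eqOn (fun t _ => ?_) fun t _ => ?_
  · simp only [err_zero (j := n + 1), if_true, nth_of_lt ((θ t).2.2 0) (show n + 1 < n + 2 by omega)]
  · have e2 : ∀ l : Fin (n + 1), n + 2 - (n + 1) + (l : ℕ) = l + 1 := fun l => by omega
    simp only
    rw [err_zero, nth_of_ge _ le_rfl, if_neg (by omega), Fin.sum_univ_succ]
    simp only [field, Fin.cons_zero, e2, Nat.sub_self, Fin.val_zero, Fin.val_succ, zero_add,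
      add_zero, if_true, map_sub, nth_of_ge _ (show n + 2 ≤ n + 1 + 1 by omega),
      if_neg (show ¬ n + 1 = n by omega)]
    abel

/-- y^{(r)} is z^{(r)} plus the derivatives of order r of the errors. Those of the later errors sum
to a difference of leads, and I − G = K collects the rest into K (z^{(r)} − lead), which is Γu once
z^{(r)} − lead = Γ̃u. -/
lemma weakDeriv_out_top (hKG : ∀ x, C.K x + C.G x = x) :
    HasWeakDerivOn (fun t => C.out (θ t) (n + 1))
      (fun t => ∑ k : Fin (n + 2), C.R k (C.out (θ t) k) + fd t
        + C.K (wr t - C.lead (θ t) (Fin.last n) (n + 2))) ω := by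
  have h1 := hξr.add ((weakDeriv_err_zero_top hθ hJ hJc hξ hξr hX).add
    (HasWeakDerivOn.sum Finset.univ fun (i : Fin n) _ =>
      weakDeriv_err_succ hθ hJ hJc hξ hξr hX (k := n + 1) (by omega) i))
  refine h1.congr_of_eqOn (fun t _ => ?_) fun t _ => ?_
  · simp only [out, Fin.sum_univ_succ]
  · have e := sum_Ioi_err (C := C) (θ t) 0
    rw [sum_Ioi_zero] at e
    simp only
    rw [err_zero, nth_of_ge _ le_rfl, if_neg (by omega), e]
    have e1 := hKG (wr t)
    have e2 := hKG (C.lead (θ t) 0 (n + 2) - C.lead (θ t) (Fin.last n) (n + 2))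
    have e3 : ∀ a b c : Vec m, wr t + (a + b - c + (C.lead (θ t) 0 (n + 2) - C.lead (θ t) (Fin.last n) (n + 2)))
      = (C.K (wr t) + C.G (wr t)) + (a + b - c + (C.K (C.lead (θ t) 0 (n + 2) - C.lead (θ t) (Fin.last n) (n + 2)) + C.G (C.lead (θ t) 0 (n + 2) - C.lead (θ t) (Fin.last n) (n + 2)))) := by
      intro a b c; rw [e1, e2]
    rw [e3]
    simp only [map_sub, Nat.sub_self, zero_add]
    abel

lemma weakDeriv_cascState (i : Fin (n + 1)) {j : ℕ} (hj : j < n + 2) :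
    HasWeakDerivOn (fun t => C.cascState (θ t) i j)
      (fun t => C.w i j (C.jet (θ t) i 0) + if j < n + 1 then C.cascState (θ t) i (j + 1)
        else wr t - C.lead (θ t) (Fin.last n) (n + 2)) ω := by
  have hs : ∀ k ∈ Finset.Ioi i, HasWeakDerivOn (fun t => C.err (θ t) j k)
      (fun t => C.err (θ t) (j + 1) k) ω := fun k hk => by
    obtain ⟨k, rfl⟩ := Fin.exists_succ_eq.2 (Fin.ne_zero_of_lt (Finset.mem_Ioi.1 hk))
    exact weakDeriv_err_succ hθ hJ hJc hξ hξr hX hj k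
  have h1 := (HasWeakDerivOn.sum _ hs).sub (weakDeriv_lead hθ hJ hJc hξ hξr hX hj i)
  by_cases hjn : j < n + 1
  · refine ((hξ j hjn).add h1).congr_of_eqOn (fun t _ => ?_) fun t _ => ?_
    · simp only [cascState]; abel
    · simp only [cascState, if_pos hjn]; abel
  · obtain rfl : j = n + 1 := by omega
    refine (hξr.add h1).congr_of_eqOn (fun t _ => ?_) fun t _ => ?_
    · simp only [cascState]; abel
    · simp only [if_neg hjn, sum_Ioi_err]; abel

end Backward

end Coeff
end

/-! ### The internal state along a given trajectory on [0, ω) -/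

noncomputable section

/-- The projection onto `[0,b]`. -/
def clamp (b t : ℝ) : ℝ := max 0 (min t b)

lemma clamp_mem {b : ℝ} (hb : 0 ≤ b) (t : ℝ) : clamp b t ∈ Icc 0 b :=
  ⟨le_max_left _ _, max_le hb (min_le_right _ _)⟩

lemma clamp_of_mem {b t : ℝ} (ht : t ∈ Icc 0 b) : clamp b t = t := by
  rw [clamp, min_eq_left ht.2, max_eq_right ht.1]

lemma continuous_clamp (b : ℝ) : Continuous (clamp b) := by unfold clamp; fun_prop

lemma ContinuousOn.comp_clamp {F : Type*} [TopologicalSpace F] {f : ℝ → F} {ω : EReal}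
    (hf : ContinuousOn f (ray ω)) {b : ℝ} (hb : b ∈ ray ω) : Continuous fun t => f (clamp b t) :=
  hf.comp_continuous (continuous_clamp b) fun t => Icc_subset_ray hb (clamp_mem hb.1 t)

namespace Sys

variable {m n l q : ℕ} {S : Sys m n l q} (hS : S.Regular) {ω : EReal}

include hS

/-- The internal states computed from a solution of the interconnection solve the internal dynamics
for its output, so uniqueness identifies them with the state on which T̃ is built. -/
theorem internal_eq_confOf (hA : S.Apriori) (hKG : ∀ x, S.K x + S.G x = x)
    {Z : ℝ → Fin (n + 1) → ℕ → Vec m} {Y : ℝ → ℕ → Vec m} {v : ℝ → Vec m}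
    (hJ : ∀ t ∈ ray ω, ∀ k < n + 1,
      HasDerivWithinAt (fun x => nth (S.J x) k) (nth (S.J t) (k + 1)) (ray ω) t)
    (hY : ∀ k < n + 2, HasWeakDerivOn (fun t => Y t k) (fun t => Y t (k + 1)) ω)
    (hZ : ∀ i, ∀ k < n + 2, HasWeakDerivOn (fun t => Z t i k)
      (fun t => S.w i k (nth (S.J t) 0, S.cascErrs (S.J t) (Z t) (Y t) 0 i) + Z t i (k + 1)) ω)
    (h0 : ∀ t ∈ ray ω, ∀ i, (nth (S.J t) 0, S.cascErrs (S.J t) (Z t) (Y t) 0 i)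
      ∈ gainDom m (S.c i))
    (hv : ∀ i, ∀ t ∈ ray ω, Z t i (n + 2) = v t)
    (heq : ∀ b ∈ ray ω, ∀ g : ℝ → Sig m n, Continuous g →
      (∀ s ∈ Icc 0 b, g s = fun k : Fin (n + 2) => Y s k) →
      ∀ᵐ t ∂volume.restrict (Ico 0 b),
        Y t (n + 2) = ∑ k : Fin (n + 2), S.R k (Y t k) + S.drive g t + S.K (v t))
    (hinit : (S.confOf (S.J 0) (Z 0) (Y 0)).2.2 = S.x₀) {t : ℝ} (ht : t ∈ ray ω)
    {ξ : ℝ → Sig m n} (hξ : Continuous ξ)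
    (hξ' : ∀ s ∈ Icc 0 t, ξ s = (S.confOf (S.J s) (Z s) (Y s)).2.1) :
    S.internal ξ t = (S.confOf (S.J t) (Z t) (Y t)).2.2 := by
  have hJc : ∀ k, ContinuousOn (fun t => nth (S.J t) k) (ray ω) := fun k => by
    rcases Nat.lt_or_ge k (n + 2) with h | h
    · simp only [nth_of_lt _ h]
      exact ((continuous_apply _).comp hS.J_cont).continuousOn
    · simp only [nth_of_ge _ h]
      exact continuousOn_const
  have hX := Coeff.weakDeriv_confOf hJ hJc hY hZ h0 hKG hv
    -- The residual of the plant equation serves as value of f; it equals f(d, T(y,…)) almost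
    -- everywhere, but which continuation of y is inserted into T is decided only afterwards.
    (fd := fun t => Y t (n + 2) - ∑ k : Fin (n + 2), S.R k (Y t k) - S.K (v t))
    fun b _ => Filter.Eventually.of_forall fun t => by abel
  have hcl : ∀ s ∈ Icc 0 t, clamp t s = s := fun s hs => clamp_of_mem hs
  have hint : S.IsInternal ξ t fun s =>
      (S.confOf (S.J (clamp t s)) (Z (clamp t s)) (Y (clamp t s))).2.2 := by
    refine ⟨hX.continuousOn.comp_clamp ht, fun s hs => ?_, fun g hg hgs s hs => ?_⟩
    · rw [hcl s hs, hξ' s hs]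
      exact Coeff.confOf_mem_confDom hKG (h0 s (Icc_subset_ray ht hs))
    · rw [hcl s hs]
      refine (hX s hs.1 (Icc_subset_ray ht hs).2).2.trans ?_
      simp only [hinit]
      congr 1
      refine intervalIntegral_congr_ae_Ico hs.1 ?_
      have h1 := heq t ht g hg fun s hs => by
        rw [hgs s hs, hcl s hs, hξ' s hs]
        exact Coeff.outs_confOf hKG
      filter_upwards [ae_restrict_Ico_mono le_rfl hs.2 h1, ae_restrict_mem measurableSet_Ico]
        with x hx hxs
      have hxt : x ∈ Icc 0 t := ⟨hxs.1, hxs.2.le.trans hs.2⟩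
      rw [hcl x hxt, hξ' x hxt, hx]
      congr 1
      abel
  rw [← (hint.unique hS hξ (isInternal_internal hS hA hξ ht.1)) t ⟨ht.1, le_rfl⟩,
    hcl t ⟨ht.1, le_rfl⟩]

/-- The signal need not extend continuously to ω. It is frozen at each t < ω, the internal state is
taken at t, and uniqueness makes these values one trajectory. -/
theorem exists_state (hA : S.Apriori) (hω : 0 < ω) {ξ : ℝ → Sig m n}
    (hξ : ContinuousOn ξ (ray ω)) : ∃ (X : ℝ → InnerState m n) (fd : ℝ → Vec m), X 0 = S.x₀ ∧
      (∀ t ∈ ray ω, (S.J t, ξ t, X t) ∈ S.confDom) ∧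
      (∀ t ∈ ray ω, ∀ ξ', Continuous ξ' → (∀ s ∈ Icc 0 t, ξ' s = ξ s) → S.internal ξ' t = X t) ∧
      HasWeakDerivOn X (fun t => S.field (S.J t, ξ t, X t) (fd t)) ω ∧
      ∀ b ∈ ray ω, ∀ g : ℝ → Sig m n, Continuous g →
        (∀ s ∈ Icc 0 b, g s = S.outs (S.J s, ξ s, X s)) →
        ∀ᵐ t ∂volume.restrict (Ico 0 b), fd t = S.drive g t := by
  set Ξ : ℝ → ℝ → Sig m n := fun b t => ξ (clamp b t) with hΞ
  have hΞc : ∀ b ∈ ray ω, Continuous (Ξ b) := fun b hb => hξ.comp_clamp hb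
  have hΞe : ∀ b, ∀ s ∈ Icc 0 b, Ξ b s = ξ s := fun b s hs => by rw [hΞ]; simp only [clamp_of_mem hs]
  set X : ℝ → InnerState m n := fun t => S.internal (Ξ t) t with hXdef
  have key : ∀ t ∈ ray ω, ∀ ξ', Continuous ξ' → (∀ s ∈ Icc 0 t, ξ' s = ξ s) →
      S.internal ξ' t = X t := fun t ht ξ' hc he => by
    have h1 := isInternal_congr (isInternal_internal hS hA hc ht.1) (ξ' := Ξ t)
      fun s hs => (he s hs).trans (hΞe t s hs).symm
    exact h1.unique hS (hΞc t ht) (isInternal_internal hS hA (hΞc t ht) ht.1) t ⟨ht.1, le_rfl⟩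
  have hI : ∀ b ∈ ray ω, S.IsInternal (Ξ b) b (S.internal (Ξ b)) := fun b hb =>
    isInternal_internal hS hA (hΞc b hb) hb.1
  have hXe : ∀ b ∈ ray ω, ∀ t ∈ Icc 0 b, S.internal (Ξ b) t = X t := fun b hb t ht =>
    key t (Icc_subset_ray hb ht) _ (hΞc b hb) fun s hs => hΞe b s ⟨hs.1, hs.2.trans ht.2⟩
  have hX0 : X 0 = S.x₀ := by
    have h0 := zero_mem_ray hω
    obtain ⟨g, hg, hgs, -⟩ := exists_continuous_outs hS.J_cont (hΞc 0 h0) (hI 0 h0).cont le_rfl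
      (hI 0 h0).mem
    have := (hI 0 h0).eqn g hg hgs 0 ⟨le_rfl, le_rfl⟩
    rwa [intervalIntegral.integral_same, add_zero] at this
  have hmem : ∀ t ∈ ray ω, (S.J t, ξ t, X t) ∈ S.confDom := fun t ht => by
    have := (hI t ht).mem t ⟨ht.1, le_rfl⟩
    rwa [hΞe t t ⟨ht.1, le_rfl⟩] at this
  have hvel : ∀ b ∈ ray ω, ∃ g : ℝ → Sig m n, Continuous g ∧
      (∀ s ∈ Icc 0 b, g s = S.outs (S.J s, ξ s, X s)) ∧
      IntervalIntegrable (fun s => S.field (S.J s, Ξ b s, S.internal (Ξ b) s) (S.drive g s))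
        volume 0 b ∧ ∀ t ∈ Icc 0 b, X t = X 0
        + ∫ x in (0 : ℝ)..t, S.field (S.J x, Ξ b x, S.internal (Ξ b) x) (S.drive g x) :=
    fun b hb => by
      obtain ⟨g, hg, hgs, h1, -, h2, -⟩ := (hI b hb).exists_drive hS (hΞc b hb) hb.1
      refine ⟨g, hg, fun s hs => by rw [hgs s hs, hΞe b s hs, hXe b hb s hs], h1, fun t ht => ?_⟩
      rw [← hXe b hb t ht, ← hXe b hb 0 ⟨le_rfl, hb.1⟩]
      exact h2 0 ⟨le_rfl, hb.1⟩ t ht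
  obtain ⟨hw, hd⟩ := HasWeakDerivOn.of_forall (f := X) (ω := ω) fun b hb => by
    obtain ⟨g, -, -, h1, h2⟩ := hvel b hb
    exact ⟨_, h1, h2⟩
  -- The value of f is read off from the last entry of the first block of X′. This gives one
  -- function on all of [0, ω), whereas the continuations g depend on the interval.
  set fd : ℝ → Vec m := fun t => deriv X t 0 (Fin.last _)
    - S.field (S.J t, ξ t, X t) 0 0 (Fin.last _) with hfd
  have hae : ∀ b ∈ ray ω, ∃ g : ℝ → Sig m n, Continuous g ∧
      (∀ s ∈ Icc 0 b, g s = S.outs (S.J s, ξ s, X s)) ∧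
      ∀ᵐ t ∂volume.restrict (Ico 0 b), S.field (S.J t, ξ t, X t) (fd t) = deriv X t
        ∧ fd t = S.drive g t := fun b hb => by
    obtain ⟨g, hg, hgs, h1, h2⟩ := hvel b hb
    refine ⟨g, hg, hgs, ?_⟩
    filter_upwards [hd b hb _ h1 h2, ae_restrict_mem measurableSet_Ico] with t ht htb
    have htb' : t ∈ Icc 0 b := ⟨htb.1, htb.2.le⟩
    rw [hΞe b t htb', hXe b hb t htb'] at ht
    have e : fd t = S.drive g t := by
      rw [hfd]
      simp only
      rw [ht, Coeff.field_eq]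
      simp [Coeff.inj]
    exact ⟨by rw [e, ht], e⟩
  refine ⟨X, fd, hX0, hmem, key, hw.congr (fun _ _ => rfl) fun b hb => ?_, fun b hb g hg hgs => ?_⟩
  · obtain ⟨g, -, -, h⟩ := hae b hb
    filter_upwards [h] with t ht using ht.1
  · obtain ⟨g', hg', hgs', h⟩ := hae b hb
    filter_upwards [h, drive_causal hS hb.1 hg hg' fun s hs hsb => by
      rw [hgs s ⟨hs, hsb.le⟩, hgs' s ⟨hs, hsb.le⟩]] with t ht ht'
    rw [ht.2, ht']

end Sys
end

/-! ### Solutions as chains of derivatives with a history -/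

noncomputable section

section Glue

variable {m : ℕ} {τ : ℝ} {ω : EReal} {f g : ℝ → Vec m}

lemma glue_of_mem_Icc (h : f 0 = g 0) {t : ℝ} (ht : t ∈ Icc (-τ) 0) : glue f g t = f t := by
  rcases ht.2.lt_or_eq with h' | rfl
  · simp [glue, h']
  · simp [glue, h]

lemma glue_of_nonneg {t : ℝ} (ht : 0 ≤ t) : glue f g t = g t := by simp [glue, not_lt.2 ht]

lemma glue_eq (h : f 0 = g 0) (t : ℝ) : glue f g t = f (min t 0) + g (max t 0) - g 0 := by
  rcases lt_or_ge t 0 with ht | ht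
  · simp [glue, ht, min_eq_left ht.le, max_eq_right ht.le]
  · simp [glue, not_lt.2 ht, min_eq_right ht, max_eq_left ht, h]

lemma continuousOn_glue (hτ : 0 < τ) (hω : 0 < ω) (h : f 0 = g 0)
    (hf : ContinuousOn f (Icc (-τ) 0)) (hg : ContinuousOn g (ray ω)) :
    ContinuousOn (glue f g) (dom τ ω) := by
  have h1 : ContinuousOn (fun t => f (min t 0)) (dom τ ω) :=
    hf.comp (by fun_prop) fun t ht => ⟨le_min ht.1 (by linarith), min_le_right _ _⟩
  have h2 : ContinuousOn (fun t => g (max t 0)) (dom τ ω) :=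
    hg.comp (by fun_prop) fun t ht => ⟨le_max_right _ _, by
      rcases max_cases t 0 with ⟨e, -⟩ | ⟨e, -⟩ <;> rw [e]
      · exact ht.2
      · exact (zero_mem_ray hω).2⟩
  exact ((h1.add h2).sub continuousOn_const).congr fun t _ => glue_eq h t

end Glue

lemma uniqueDiffOn_hist {τ : ℝ} (hτ : 0 < τ) : UniqueDiffOn ℝ (Icc (-τ) 0) :=
  uniqueDiffOn_Icc (by linarith)

/-- The functions `g 0, …, g (n+1)` are the derivatives on `[0,ω)` of a solution with initial
trajectory `y₀`, and `g (n+2)` is the weak derivative of the last one. -/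
structure ChainSol {m n l q : ℕ} (τ : ℝ) (R : Fin (n + 2) → Matrix (Fin m) (Fin m) ℝ)
    (d : ℝ → Vec l) (f : Vec l × Vec q → Vec m) (T : Op τ (n + 2) m q)
    (Γ : Matrix (Fin m) (Fin m) ℝ) (y₀ : ℝ → Vec m) (u : ℝ → Vec m) (ω : EReal)
    (g : ℕ → ℝ → Vec m) : Prop where
  contDiff : ContDiffOn ℝ (n + 1 : ℕ) y₀ (Icc (-τ) 0)
  init : ∀ k ≤ n + 1, iteratedDerivWithin k y₀ (Icc (-τ) 0) 0 = g k 0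
  weak : ∀ k < n + 2, HasWeakDerivOn (g k) (g (k + 1)) ω
  eqn : ∀ s ∈ ray ω, ∀ Ξ : C(Ici (-τ), Fin (n + 2) → Vec m),
    (∀ t : Ici (-τ), (t : ℝ) < s → ∀ i : Fin (n + 2),
      Ξ t i = glue (iteratedDerivWithin i y₀ (Icc (-τ) 0)) (g i) t) →
    ∀ᵐ t ∂volume.restrict (Ico 0 s),
      g (n + 2) t = ∑ i : Fin (n + 2), mulV (R i) (g i t) + f (d t, T Ξ t) + mulV Γ (u t)

section ChainSol

variable {m n l q : ℕ} {τ : ℝ} {R : Fin (n + 2) → Matrix (Fin m) (Fin m) ℝ}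
    {d : ℝ → Vec l} {f : Vec l × Vec q → Vec m} {T : Op τ (n + 2) m q}
    {Γ : Matrix (Fin m) (Fin m) ℝ} {y₀ : ℝ → Vec m} {u : ℝ → Vec m} {ω : EReal}
    (hτ : 0 < τ) (hω : 0 < ω)

include hτ hω

lemma IsSolution.exists_chain {y : ℝ → Vec m} (h : IsSolution τ R d f T Γ y₀ u ω y) :
    ∃ g, EqOn y (g 0) (ray ω) ∧ ChainSol τ R d f T Γ y₀ u ω g := by
  obtain ⟨yr, hyr, heq⟩ := h.eqn
  have hcd : ContDiffOn ℝ (n + 1 : ℕ) y (dom τ ω) := h.contDiff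
  have hU := uniqueDiffOn_dom hτ hω
  set D : ℕ → ℝ → Vec m := fun k => iteratedDerivWithin k y (dom τ ω) with hD
  have hDc : ∀ k < n + 1, ∀ t ∈ dom τ ω, HasDerivWithinAt (D k) (D (k + 1) t) (dom τ ω) t :=
    fun k hk t ht => chain_of_contDiffOn hU hcd hk ht
  have hcont : ContinuousOn (D (n + 1)) (dom τ ω) :=
    hcd.continuousOn_iteratedDerivWithin le_rfl hU
  have hDc' : ∀ k < n + 1, ∀ t ∈ Icc (-τ) 0, HasDerivWithinAt (D k) (D (k + 1) t) (Icc (-τ) 0) t :=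
    fun k hk t ht => (hDc k hk t (Icc_subset_dom hω ht)).mono (Icc_subset_dom hω)
  have hD0 : EqOn y₀ (D 0) (Icc (-τ) 0) := fun t ht => by
    simp only [hD, iteratedDerivWithin_zero]; exact (h.init ht).symm
  have hUh := uniqueDiffOn_hist hτ
  have hH : ∀ k ≤ n + 1, EqOn (iteratedDerivWithin k y₀ (Icc (-τ) 0)) (D k) (Icc (-τ) 0) :=
    fun k hk => (iteratedDerivWithin_congr hD0).trans
      (iteratedDerivWithin_of_chain hUh hDc' hk)
  have h0 : (0 : ℝ) ∈ Icc (-τ) 0 := ⟨by linarith, le_rfl⟩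
  refine ⟨fun k => if k < n + 2 then D k else yr, fun t _ => by simp [hD], ?_, fun k hk => ?_,
    fun k hk => ?_, fun s hs Ξ hΞ => ?_⟩
  · exact (contDiffOn_of_chain hUh hDc' (hcont.mono (Icc_subset_dom hω))).congr hD0
  · simp only [show k < n + 2 by omega, if_true]
    exact hH k hk h0
  · simp only [hk, if_true]
    by_cases hk' : k < n + 1
    · simp only [show k + 1 < n + 2 by omega, if_true]
      refine HasWeakDerivOn.of_hasDerivWithinAt (fun t ht =>
        (hDc k hk' t (ray_subset_dom hτ ht)).mono (ray_subset_dom hτ)) ?_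
      refine ContinuousOn.mono ?_ (ray_subset_dom hτ)
      exact hcd.continuousOn_iteratedDerivWithin (by exact_mod_cast hk') hU
    · obtain rfl : k = n + 1 := by omega
      simp only [lt_irrefl, if_false]
      exact hyr
  · rcases hs.1.eq_or_lt with rfl | hs0
    · simp
    have := heq s hs0 hs.2 Ξ fun t ht i => by
      have hti : (i : ℕ) ≤ n + 1 := by omega
      rw [hΞ t ht i]
      rcases lt_or_ge (t : ℝ) 0 with h' | h'
      · rw [glue, if_pos h']; exact hH i hti ⟨t.2, h'.le⟩
      · rw [glue_of_nonneg h', if_pos i.2]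
    filter_upwards [this] with t ht
    simp only [lt_irrefl, if_false, Fin.is_lt, if_true]
    exact ht

lemma ChainSol.isSolution {g : ℕ → ℝ → Vec m} (h : ChainSol τ R d f T Γ y₀ u ω g) {y : ℝ → Vec m}
    (hy₀ : EqOn y y₀ (Icc (-τ) 0)) (hy : EqOn y (g 0) (ray ω)) :
    IsSolution τ R d f T Γ y₀ u ω y := by
  have hU := uniqueDiffOn_dom hτ hω
  have hUh := uniqueDiffOn_hist hτ
  set H : ℕ → ℝ → Vec m := fun k => iteratedDerivWithin k y₀ (Icc (-τ) 0) with hH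
  set E : ℕ → ℝ → Vec m := fun k => glue (H k) (g k) with hE
  have hgc : ∀ k ≤ n + 1, ContinuousOn (g k) (ray ω) := fun k hk => (h.weak k (by omega)).continuousOn
  have hEc : ∀ k < n + 1, ∀ t ∈ dom τ ω, HasDerivWithinAt (E k) (E (k + 1) t) (dom τ ω) t :=
    fun k hk t ht => hasDerivWithinAt_glue hτ hω (h.init k hk.le) (h.init _ (by omega))
      (fun t ht => chain_of_contDiffOn hUh h.contDiff hk ht)
      (fun t ht => (h.weak k (by omega)).hasDerivWithinAt (hgc _ (by omega)) ht) ht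
  have hcont : ContinuousOn (E (n + 1)) (dom τ ω) :=
    continuousOn_glue hτ hω (h.init _ le_rfl)
      (h.contDiff.continuousOn_iteratedDerivWithin le_rfl hUh) (hgc _ le_rfl)
  have hyE : EqOn y (E 0) (dom τ ω) := fun t ht => by
    rcases lt_or_ge t 0 with h' | h'
    · rw [hE]; simp only [glue, if_pos h', hH, iteratedDerivWithin_zero]
      exact hy₀ ⟨ht.1, h'.le⟩
    · simp only [hE, glue_of_nonneg h']; exact hy ⟨h', ht.2⟩
  have hD : ∀ k ≤ n + 1, EqOn (iteratedDerivWithin k y (dom τ ω)) (E k) (dom τ ω) := fun k hk =>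
    (iteratedDerivWithin_congr hyE).trans (iteratedDerivWithin_of_chain hU hEc hk)
  have hDr : ∀ k ≤ n + 1, EqOn (iteratedDerivWithin k y (dom τ ω)) (g k) (ray ω) := fun k hk t ht =>
    (hD k hk (ray_subset_dom hτ ht)).trans (glue_of_nonneg ht.1)
  refine ⟨(contDiffOn_of_chain hU hEc hcont).congr hyE, hy₀, g (n + 2),
    (h.weak (n + 1) (by omega)).congr_of_eqOn (hDr _ le_rfl) fun _ _ => rfl,
    fun s hs0 hs Ξ hΞ => ?_⟩
  have hsr : s ∈ ray ω := ⟨hs0.le, hs⟩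
  filter_upwards [h.eqn s hsr Ξ fun t ht i => (hΞ t ht i).trans (hD i (by omega)
    ⟨t.2, (EReal.coe_le_coe_iff.2 ht.le).trans_lt hs⟩), ae_restrict_mem measurableSet_Ico] with t ht hts
  rw [ht]
  congr 2
  exact Finset.sum_congr rfl fun i _ => by rw [hDr i (by omega) (ray_mono hsr hts.1 hts.2.le)]

end ChainSol

section Cascade

variable {m n : ℕ} {ω : EReal}

/-- The states of the cascade, with `v` after the last ones. -/
def cascSeq (z : Fin (n + 1) → Fin (n + 2) → ℝ → Vec m) (v : ℝ → Vec m) (t : ℝ) (i : Fin (n + 1))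
    (j : ℕ) : Vec m := if h : j < n + 2 then z i ⟨j, h⟩ t else v t

lemma cascErr_eq (y : ℝ → Vec m) (z : Fin (n + 1) → Fin (n + 2) → ℝ → Vec m) (i : Fin (n + 1))
    (t : ℝ) : cascErr (r := n + 2) y z i t = diffs (y t) (fun i => z i 0 t) i := by
  refine Fin.cases ?_ (fun i => ?_) i
  · rw [diffs_zero]; rfl
  · rw [diffs_succ]; rfl

end Cascade
end

/-! ### The two directions of the equivalence -/

noncomputable section

namespace Coeff

variable {m n : ℕ} (C : Coeff m n)

section Congr

variable {J : Fin (n + 2) → ℝ} {Z Z' : Fin (n + 1) → ℕ → Vec m} {Y Y' : ℕ → Vec m}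
  (hZ : ∀ i, ∀ j < n + 2, Z i j = Z' i j) (hY : ∀ j < n + 2, Y j = Y' j)

include hZ hY

lemma cascErrs_congr {j : ℕ} (hj : j < n + 2) : C.cascErrs J Z Y j = C.cascErrs J Z' Y' j := by
  induction j using Nat.strong_induction_on with
  | _ j ih =>
  rw [cascErrs_eq, cascErrs_eq, hY j hj]
  congr 1
  funext i
  rw [cascOut, cascOut, hZ i j hj]
  congr 2
  funext k
  rw [ih k k.2 (by omega)]

lemma confOf_congr : C.confOf J Z Y = C.confOf J Z' Y' := by
  have ho : ∀ i, ∀ j < n + 2, C.cascOut J Z Y i j = C.cascOut J Z' Y' i j := fun i j hj => by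
    rw [cascOut, cascOut, hZ i j hj]
    congr 2
    funext k
    rw [C.cascErrs_congr hZ hY (by omega)]
  refine Prod.ext rfl (Prod.ext (funext fun j => ho _ j j.2) (funext fun i => funext fun j => ?_))
  refine Fin.cases ?_ (fun i => ?_) i
  · simp only [confOf, Fin.cons_zero]
    rw [ho _ j j.2, hZ 0 j j.2, hY j j.2, Finset.sum_congr rfl fun (k : Fin j) _ => by
      rw [hY k (by omega)]]
  · simp only [confOf, Fin.cons_succ]
    rw [hZ _ j j.2, hZ _ j j.2]

end Congr

end Coeff

/-- The sequences of vectors that start with given ones. -/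
def padSeq {m n : ℕ} (z : Fin (n + 1) → Fin (n + 2) → Vec m) (i : Fin (n + 1)) (j : ℕ) : Vec m :=
  nth (z i) j

section Cascade

variable {m n : ℕ} {ω : EReal} {C : Coeff m n} {J : ℝ → Fin (n + 2) → ℝ}
  {a p : Fin (n + 2) → ℝ} {φ φ₁ : ℝ → ℝ} {Γt : Matrix (Fin m) (Fin m) ℝ}
  {z₀ : Fin (n + 1) → Fin (n + 2) → Vec m} {u y : ℝ → Vec m}
  {z : Fin (n + 1) → Fin (n + 2) → ℝ → Vec m}
  (ha : ∀ j : Fin (n + 2), C.a j = a j) (hp : ∀ j : Fin (n + 2), C.p j = p j)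
  (hφ : ∀ i : Fin (n + 1), ∀ t, 0 ≤ t → C.c i * nth (J t) 0 = cascFunnel (r := n + 2) φ φ₁ i t)

include hφ in
lemma cascDenom_eq (i : Fin (n + 1)) {t : ℝ} (ht : 0 ≤ t) : cascDenom (r := n + 2) φ φ₁ y z i t
    = 1 - (C.c i * nth (J t) 0) ^ 2 * ‖diffs (y t) (fun i => z i 0 t) i‖ ^ 2 := by
  rw [cascDenom, ← hφ i t ht, cascErr_eq]

include ha hp hφ in
lemma cascRhs_eq (i : Fin (n + 1)) (j : Fin (n + 2)) {t : ℝ} (ht : 0 ≤ t) :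
    cascRhs (r := n + 2) a p φ φ₁ Γt u y z i j t
      = C.w i j (nth (J t) 0, diffs (y t) (fun i => z i 0 t) i)
        + cascSeq z (fun t => mulV Γt (u t)) t i (j + 1) := by
  rw [cascRhs, cascDenom_eq hφ i ht, cascErr_eq, Coeff.w, gainTerm, ha, hp]; rfl

include ha hp hφ in
/-- The gains of the cascade are positive along its solutions. -/
lemma IsCascade.weak (hω : 0 < ω) (h : IsCascade (r := n + 2) a p φ φ₁ Γt z₀ u y ω z)
    (hy : ContinuousOn y (ray ω)) (hJ : Continuous J)
    (hinit : ∀ i, (nth (J 0) 0, diffs (y 0) (fun i => z₀ i 0) i) ∈ gainDom m (C.c i)) :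
    (∀ t ∈ ray ω, ∀ i, (nth (J t) 0, diffs (y t) (fun i => z i 0 t) i) ∈ gainDom m (C.c i)) ∧
    ∀ i, ∀ k < n + 2, HasWeakDerivOn (fun t => cascSeq z (fun t => mulV Γt (u t)) t i k)
      (fun t => C.w i k (nth (J t) 0, diffs (y t) (fun i => z i 0 t) i)
        + cascSeq z (fun t => mulV Γt (u t)) t i (k + 1)) ω := by
  refine ⟨fun t ht i => ?_, fun i k hk => ?_⟩
  · have hz : ∀ i, ContinuousOn (z i 0) (ray ω) := fun i => (h.eqn i 0).continuousOn
    have hd : ContinuousOn (fun t => diffs (y t) (fun i => z i 0 t) i) (ray ω) := by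
      refine Fin.cases ?_ (fun i => ?_) i
      · exact hy.sub (hz 0)
      · exact (hz i.castSucc).sub (hz i.succ)
    have hJ0 : Continuous fun t => nth (J t) 0 := by
      simp only [nth_of_lt _ (show 0 < n + 2 by omega)]
      exact (continuous_apply _).comp hJ
    set D : ℝ → ℝ := fun t =>
      1 - (C.c i * nth (J t) 0) ^ 2 * ‖diffs (y t) (fun i => z i 0 t) i‖ ^ 2 with hDdef
    have hDc : ContinuousOn D (ray ω) := continuousOn_const.sub
      (((continuous_const.mul hJ0).pow 2).continuousOn.mul (hd.norm.pow 2))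
    have h0 := zero_mem_ray hω
    have hD0 : 0 < D 0 := by
      have := hinit i
      have e : (fun i => z i 0 0) = fun i => z₀ i 0 := funext fun i => h.init i 0
      rw [gainDom, mem_ofPred_eq] at this
      simp only [hDdef, e]
      exact sub_pos.2 this
    have hne : ∀ s ∈ ray ω, D s ≠ 0 := fun s hs => by
      have := h.defined i s hs.1 hs.2
      rwa [cascDenom_eq hφ i hs.1] at this
    have hpos : 0 < D t := by
      -- The denominator is continuous, positive at 0 and nowhere zero, so by the intermediate value
      -- theorem it stays positive.
      by_contra! hle
      obtain ⟨s, hs, hs0⟩ := ordConnected_ray.isPreconnected.intermediate_value ht h0 hDc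
        (show (0 : ℝ) ∈ Icc (D t) (D 0) from ⟨hle, hD0.le⟩)
      exact hne s hs hs0
    exact sub_pos.1 hpos
  · refine (h.eqn i ⟨k, hk⟩).congr_of_eqOn (fun t _ => ?_) fun t ht => ?_
    · simp only [cascSeq, dif_pos hk]
    · exact (cascRhs_eq ha hp hφ i ⟨k, hk⟩ ht.1).symm

end Cascade

namespace Sys

variable {m n l q Q : ℕ} {S : Sys m n l q} {ω : EReal}
  {R : Fin (n + 2) → Matrix (Fin m) (Fin m) ℝ} {Γ Γt : Matrix (Fin m) (Fin m) ℝ}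
  {a p : Fin (n + 2) → ℝ} {φ φ₁ : ℝ → ℝ} {y₀ ζ₀ : ℝ → Vec m}
  {z₀ : Fin (n + 1) → Fin (n + 2) → Vec m}

/-- The initial configuration of the interconnection. -/
def initConf (S : Sys m n l q) (z₀ : Fin (n + 1) → Fin (n + 2) → Vec m) : Conf m n :=
  S.confOf (S.J 0) (padSeq z₀) (nth (S.hist 0))

/-- The data of the interconnection are those of the model `S`. -/
structure Models (S : Sys m n l q) (R : Fin (n + 2) → Matrix (Fin m) (Fin m) ℝ)
    (Γ Γt : Matrix (Fin m) (Fin m) ℝ) (a p : Fin (n + 2) → ℝ) (φ φ₁ : ℝ → ℝ)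
    (y₀ ζ₀ : ℝ → Vec m) (z₀ : Fin (n + 1) → Fin (n + 2) → Vec m) : Prop where
  R_eq : ∀ k : Fin (n + 2), S.R k = mulV (R k)
  K_eq : ∀ x, S.K (mulV Γt x) = mulV Γ x
  K_add_G : ∀ x, S.K x + S.G x = x
  a_eq : ∀ j : Fin (n + 2), S.a j = a j
  p_eq : ∀ j : Fin (n + 2), S.p j = p j
  funnel_eq : ∀ i : Fin (n + 1), ∀ t, 0 ≤ t →
    S.c i * nth (S.J t) 0 = cascFunnel (r := n + 2) φ φ₁ i t
  deriv : ∀ t, 0 ≤ t → ∀ k < n + 1,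
    HasDerivWithinAt (fun x => nth (S.J x) k) (nth (S.J t) (k + 1)) (Ici 0) t
  contDiff : ContDiffOn ℝ (n + 1 : ℕ) y₀ (Icc (-S.τ) 0)
  hist_eq : ∀ t ∈ Icc (-S.τ) 0, ∀ i : Fin (n + 2),
    S.hist t i = iteratedDerivWithin i y₀ (Icc (-S.τ) 0) t
  x₀_eq : S.x₀ = (S.initConf z₀).2.2
  contDiff' : ContDiffOn ℝ (n + 1 : ℕ) ζ₀ (Icc (-S.τ) 0)
  init_eq : ∀ i : Fin (n + 2), iteratedDerivWithin i ζ₀ (Icc (-S.τ) 0) 0 = (S.initConf z₀).2.1 i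

variable (hS : S.Regular) (hA : S.Apriori) (hM : S.Models R Γ Γt a p φ φ₁ y₀ ζ₀ z₀)
  {dt : ℝ → Vec (n + 2)} {Ft : Vec (n + 2) × Vec Q → Vec m} {ι : Vec m →L[ℝ] Vec Q}
  (hF : ∀ δ x, Ft (δ, ι x) = x) {u z : ℝ → Vec m} (hω : 0 < ω)

include hS hM in
lemma argMap_eq_glue {g : ℝ → Sig m n} (hg : Continuous g) {gy : ℕ → ℝ → Vec m}
    (h0 : ∀ i : Fin (n + 2), S.hist 0 i = gy i 0) {b : ℝ} (hb : 0 < b)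
    (hgs : ∀ s ∈ Icc 0 b, ∀ i : Fin (n + 2), g s i = gy i s) {t : Ici (-S.τ)} (ht : (t : ℝ) < b)
    (i : Fin (n + 2)) :
    S.argMap g t i = glue (iteratedDerivWithin i y₀ (Icc (-S.τ) 0)) (gy i) t := by
  have hτ := hS.op.pos
  have h00 : (0 : ℝ) ∈ Icc (-S.τ) 0 := ⟨by linarith, le_rfl⟩
  rw [glue_eq (by rw [← hM.hist_eq 0 h00 i, h0]), argMap_apply hS hg, Pi.sub_apply, Pi.add_apply,
    hgs 0 ⟨le_rfl, hb.le⟩, hgs _ ⟨le_max_right _ _, max_le ht.le hb.le⟩,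
    hM.hist_eq _ ⟨le_min t.2 (by linarith), min_le_right _ _⟩]

include hS hA hM hF hω in
-- The derivatives of z are `cascOut` of the last compensator. At order r this is the lead plus Γ̃u,
-- and by `internal_eq_confOf` the operator evaluates exactly to this lead.
lemma isSolution_of_interconnection {y : ℝ → Vec m} {zc : Fin (n + 1) → Fin (n + 2) → ℝ → Vec m}
    (hy : IsSolution S.τ R S.d S.f S.T Γ y₀ u ω y)
    (hz : IsCascade (r := n + 2) a p φ φ₁ Γt z₀ u y ω zc)
    (hzz : ∀ t ∈ ray ω, z t = zc (Fin.last n) 0 t) :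
    IsSolution S.τ 0 dt Ft (S.innerOp ι) Γt ζ₀ u ω (glue ζ₀ z) := by
  have hτ := hS.op.pos
  have h0r := zero_mem_ray hω
  have h00 : (0 : ℝ) ∈ Icc (-S.τ) 0 := ⟨by linarith, le_rfl⟩
  obtain ⟨g, hyg, hg⟩ := hy.exists_chain hτ hω
  set v : ℝ → Vec m := fun t => mulV Γt (u t) with hv
  set Z : ℝ → Fin (n + 1) → ℕ → Vec m := cascSeq zc v with hZdef
  set Y : ℝ → ℕ → Vec m := fun t k => g k t with hYdef
  have hZ0 : ∀ t i, Z t i 0 = zc i 0 t := fun t i => dif_pos (by omega)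
  have hZinit : ∀ i, ∀ j < n + 2, Z 0 i j = padSeq z₀ i j := fun i j hj => by
    rw [padSeq, nth_of_lt _ hj, hZdef, cascSeq, dif_pos hj, hz.init]
  have hh0 : ∀ i : Fin (n + 2), S.hist 0 i = g i 0 := fun i => by
    rw [hM.hist_eq 0 h00, hg.init i (by omega)]
  have hYinit : ∀ j < n + 2, Y 0 j = nth (S.hist 0) j := fun j hj => by
    rw [nth_of_lt _ hj, hh0]
  have hconf0 : S.confOf (S.J 0) (Z 0) (Y 0) = S.initConf z₀ := S.confOf_congr hZinit hYinit
  have hderiv : ∀ t ∈ ray ω, ∀ k < n + 1,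
      HasDerivWithinAt (fun x => nth (S.J x) k) (nth (S.J t) (k + 1)) (ray ω) t :=
    fun t ht k hk => (hM.deriv t ht.1 k hk).mono fun s hs => hs.1
  have herr0 : ∀ t ∈ ray ω, S.cascErrs (S.J t) (Z t) (Y t) 0 = diffs (y t) fun i => zc i 0 t :=
    fun t ht => by
      rw [Coeff.cascErrs_zero]
      simp only [hZ0, hYdef, hyg ht]
  have hyc : ContinuousOn y (ray ω) := (hg.weak 0 (by omega)).continuousOn.congr hyg
  obtain ⟨hdom, hweak⟩ := hz.weak hM.a_eq hM.p_eq hM.funnel_eq hω hyc hS.J_cont fun i => by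
    have h1 := hS.init 0 i
    rw [Coeff.jet, Coeff.err_eq_errs] at h1
    simp only [hM.x₀_eq] at h1
    rw [← Coeff.err_eq_errs, initConf, Coeff.err_confOf hM.K_add_G (by omega),
      Coeff.cascErrs_zero] at h1
    have e : y 0 = nth (S.hist 0) 0 := by rw [hyg h0r, ← hYinit 0 (by omega)]
    rw [e]
    convert! h1 using 3
  have hZw : ∀ i, ∀ k < n + 2, HasWeakDerivOn (fun t => Z t i k)
      (fun t => S.w i k (nth (S.J t) 0, S.cascErrs (S.J t) (Z t) (Y t) 0 i) + Z t i (k + 1)) ω :=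
    fun i k hk => (hweak i k hk).congr_of_eqOn (fun _ _ => rfl) fun t ht => by
      simp only [herr0 t ht]; rfl
  have h0 : ∀ t ∈ ray ω, ∀ i, (nth (S.J t) 0, S.cascErrs (S.J t) (Z t) (Y t) 0 i)
      ∈ gainDom m (S.c i) := fun t ht i => by rw [herr0 t ht]; exact hdom t ht i
  have hvn : ∀ i, ∀ t ∈ ray ω, Z t i (n + 2) = v t := fun i t _ => dif_neg (by omega)
  have hKv : ∀ t, S.K (v t) = mulV Γ (u t) := fun t => hM.K_eq _
  have heq : ∀ b ∈ ray ω, ∀ g' : ℝ → Sig m n, Continuous g' →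
      (∀ s ∈ Icc 0 b, g' s = fun k : Fin (n + 2) => Y s k) →
      ∀ᵐ t ∂volume.restrict (Ico 0 b),
        Y t (n + 2) = ∑ k : Fin (n + 2), S.R k (Y t k) + S.drive g' t + S.K (v t) := by
    intro b hb g' hg' hgs
    rcases hb.1.eq_or_lt with rfl | hb0
    · simp
    filter_upwards [hg.eqn b hb (S.argMap g') fun t ht i => argMap_eq_glue hS hM hg' hh0 hb0
      (fun s hs i => by rw [hgs s hs]) ht i] with t ht
    simp only [hYdef, ht, hKv, hM.R_eq]; rfl
  have hJc : ∀ k, ContinuousOn (fun t => nth (S.J t) k) (ray ω) := fun k => by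
    rcases Nat.lt_or_ge k (n + 2) with h | h
    · simp only [nth_of_lt _ h]
      exact ((continuous_apply _).comp hS.J_cont).continuousOn
    · simp only [nth_of_ge _ h]
      exact continuousOn_const
  have hchain : ChainSol S.τ 0 dt Ft (S.innerOp ι) Γt ζ₀ u ω
      fun k t => S.cascOut (S.J t) (Z t) (Y t) (Fin.last n) k := by
    refine ⟨hM.contDiff', fun k hk => ?_, fun k hk =>
      (Coeff.weakDeriv_casc hderiv hJc hg.weak hZw h0 hk _).2, fun s hs Ξ hΞ => ?_⟩
    · rw [hM.init_eq ⟨k, by omega⟩, ← hconf0]; rfl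
    · refine (ae_restrict_iff' measurableSet_Ico).2 (Filter.Eventually.of_forall fun t ht => ?_)
      have htr : t ∈ ray ω := ray_mono hs ht.1 ht.2.le
      have hΞ' : ∀ x ∈ Icc 0 t, S.extend Ξ x = (S.confOf (S.J x) (Z x) (Y x)).2.1 := by
        intro x hx
        have hxτ : -S.τ ≤ x := by linarith [hx.1]
        rw [extend_of_le _ hxτ]
        funext i
        exact (hΞ ⟨x, hxτ⟩ (hx.2.trans_lt ht.2) i).trans (glue_of_nonneg hx.1)
      have hint := internal_eq_confOf hS hA hM.K_add_G hderiv hg.weak hZw h0 hvn heq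
        (by rw [hconf0, hM.x₀_eq]) htr (continuous_extend Ξ) hΞ'
      rw [innerOp, hint, hΞ' t ⟨ht.1, le_rfl⟩, hF]
      have := Coeff.lead_confOf (C := S.toCoeff) (J := S.J t) (Z := Z t) (Y := Y t) hM.K_add_G
        (le_refl (n + 2)) (Fin.last n)
      rw [show (S.J t, (S.confOf (S.J t) (Z t) (Y t)).2.1, (S.confOf (S.J t) (Z t) (Y t)).2.2)
        = S.confOf (S.J t) (Z t) (Y t) from rfl, this, hvn _ t htr]
      simp [hv]
  have hz0 : ∀ t ∈ ray ω, z t = S.cascOut (S.J t) (Z t) (Y t) (Fin.last n) 0 := fun t ht => by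
    rw [hzz t ht, Coeff.cascOut_zero, hZ0]
  refine hchain.isSolution hτ hω (fun t ht => glue_of_mem_Icc ?_ ht) fun t ht => ?_
  · rw [hz0 0 h0r, ← hchain.init 0 (by omega), iteratedDerivWithin_zero]
  · rw [glue_of_nonneg ht.1, hz0 t ht]

include hS hA hM hF hω in
-- From z the internal state is generated by its own dynamics; y and the cascade are then
-- reconstructed from the configuration by `out` and `cascState`. At time 0 the reconstruction
-- returns the prescribed data.
lemma interconnection_of_isSolution
    (hz : IsSolution S.τ 0 dt Ft (S.innerOp ι) Γt ζ₀ u ω (glue ζ₀ z)) :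
    ∃ (y : ℝ → Vec m) (zc : Fin (n + 1) → Fin (n + 2) → ℝ → Vec m),
      IsSolution S.τ R S.d S.f S.T Γ y₀ u ω y ∧
      IsCascade (r := n + 2) a p φ φ₁ Γt z₀ u y ω zc ∧ ∀ t ∈ ray ω, z t = zc (Fin.last n) 0 t := by
  have hτ := hS.op.pos
  have h0r := zero_mem_ray hω
  have h00 : (0 : ℝ) ∈ Icc (-S.τ) 0 := ⟨by linarith, le_rfl⟩
  obtain ⟨g, hzg, hg⟩ := hz.exists_chain hτ hω
  have hzg' : ∀ t ∈ ray ω, z t = g 0 t := fun t ht => by rw [← hzg ht, glue_of_nonneg ht.1]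
  set ξ : ℝ → Sig m n := fun t i => g i t with hξdef
  have hξc : ContinuousOn ξ (ray ω) := continuousOn_pi.2 fun i => (hg.weak i i.2).continuousOn
  obtain ⟨X, fd, hX0, hdom, hint, hXw, hfd⟩ := exists_state hS hA hω hξc
  set θ : ℝ → Conf m n := fun t => (S.J t, ξ t, X t) with hθdef
  have hθ0 : θ 0 = S.initConf z₀ := by
    refine Prod.ext rfl (Prod.ext (funext fun i => ?_) ?_)
    · rw [← hM.init_eq i, hg.init i (by omega)]
    · rw [← hM.x₀_eq]; exact hX0
  have hderiv : ∀ t ∈ ray ω, ∀ k < n + 1,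
      HasDerivWithinAt (fun x => nth (θ x).1 k) (nth (θ t).1 (k + 1)) (ray ω) t :=
    fun t ht k hk => (hM.deriv t ht.1 k hk).mono fun s hs => hs.1
  have hJc : ∀ k, ContinuousOn (fun t => nth (θ t).1 k) (ray ω) := fun k => by
    rcases Nat.lt_or_ge k (n + 2) with h | h
    · simp only [nth_of_lt _ h]
      exact ((continuous_apply _).comp hS.J_cont).continuousOn
    · simp only [nth_of_ge _ h]
      exact continuousOn_const
  have hnth : ∀ k < n + 2, (fun t => nth (θ t).2.1 k) = g k := fun k hk => by
    funext t; rw [nth_of_lt _ hk]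
  have hξ : ∀ k < n + 1,
      HasWeakDerivOn (fun t => nth (θ t).2.1 k) (fun t => nth (θ t).2.1 (k + 1)) ω :=
    fun k hk => by
      rw [hnth k (by omega), hnth (k + 1) (by omega)]; exact hg.weak k (by omega)
  have hξr : HasWeakDerivOn (fun t => nth (θ t).2.1 (n + 1)) (g (n + 2)) ω := by
    rw [hnth (n + 1) (by omega)]; exact hg.weak (n + 1) (by omega)
  -- The new system equation, solved for the control: this quantity takes the place of Γ̃u in the
  -- reconstructed equations.
  have hctrl : ∀ b ∈ ray ω, ∀ᵐ t ∂volume.restrict (Ico 0 b),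
      g (n + 2) t - S.lead (θ t) (Fin.last n) (n + 2) = mulV Γt (u t) := by
    intro b hb
    have hG : ∀ i : Fin (n + 2), ContinuousOn
        (glue (iteratedDerivWithin i ζ₀ (Icc (-S.τ) 0)) (g i)) (dom S.τ ω) := fun i =>
      continuousOn_glue hτ hω (hg.init i (by omega))
        (hg.contDiff.continuousOn_iteratedDerivWithin (by exact_mod_cast Nat.lt_succ_iff.1 i.2)
          (uniqueDiffOn_hist hτ))
        (hg.weak i i.2).continuousOn
    have hcont : Continuous fun (t : Ici (-S.τ)) (i : Fin (n + 2)) =>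
        glue (iteratedDerivWithin i ζ₀ (Icc (-S.τ) 0)) (g i) (min (t : ℝ) b) :=
      continuous_pi fun i => (hG i).comp_continuous (by fun_prop) fun t =>
        ⟨le_min t.2 (by linarith [hb.1]),
          (EReal.coe_le_coe_iff.2 (min_le_right _ _)).trans_lt hb.2⟩
    have h1 := hg.eqn b hb ⟨_, hcont⟩ fun t ht i => by
      show glue _ (g i) (min (t : ℝ) b) = _
      rw [min_eq_left ht.le]
    filter_upwards [h1, ae_restrict_mem measurableSet_Ico] with t ht htb
    have htr : t ∈ ray ω := ray_mono hb htb.1 htb.2.le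
    have hΞ' : ∀ x ∈ Icc 0 t, S.extend ⟨_, hcont⟩ x = ξ x := by
      intro x hx
      have hxτ : -S.τ ≤ x := by linarith [hx.1]
      rw [extend_of_le _ hxτ]
      funext i
      show glue _ (g i) (min x b) = _
      rw [min_eq_left (hx.2.trans htb.2.le), glue_of_nonneg hx.1]
    rw [ht, innerOp, hint t htr _ (continuous_extend _) hΞ', hΞ' t ⟨htb.1, le_rfl⟩, hF]
    simp [hθdef]
  set yr : ℝ → Vec m := fun t => ∑ k : Fin (n + 2), S.R k (S.out (θ t) k) + fd t
    + S.K (g (n + 2) t - S.lead (θ t) (Fin.last n) (n + 2)) with hyr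
  have hpad : ∀ i, ∀ j < n + 2, S.cascState (S.initConf z₀) i j = padSeq z₀ i j :=
    fun i j hj => Coeff.cascState_confOf hM.K_add_G hj i
  have hout0 : ∀ k < n + 2, S.out (θ 0) k = nth (S.hist 0) k := fun k hk => by
    rw [hθ0]; exact Coeff.out_confOf hM.K_add_G hk
  set gy : ℕ → ℝ → Vec m := fun k t => if k < n + 2 then S.out (θ t) k else yr t with hgy
  have hgy' : ∀ i : Fin (n + 2), ∀ t, gy i t = S.out (θ t) i := fun i t => if_pos i.2
  have hh0 : ∀ i : Fin (n + 2), S.hist 0 i = gy i 0 := fun i => by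
    rw [hgy', hout0 i i.2, nth_val]
  have hchain : ChainSol S.τ R S.d S.f S.T Γ y₀ u ω gy := by
    refine ⟨hM.contDiff, fun k hk => ?_, fun k hk => ?_, fun s hs Ξ hΞ => ?_⟩
    · rw [← hM.hist_eq 0 h00 ⟨k, by omega⟩]; exact hh0 ⟨k, by omega⟩
    · by_cases hk' : k < n + 1
      · simp only [hgy, hk, show k + 1 < n + 2 by omega, if_true]
        exact Coeff.weakDeriv_out hdom hderiv hJc hξ hξr hXw hk'
      · obtain rfl : k = n + 1 := by omega
        simp only [hgy, hk, lt_irrefl, if_true, if_false]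
        exact Coeff.weakDeriv_out_top hdom hderiv hJc hξ hξr hXw hM.K_add_G
    · rcases hs.1.eq_or_lt with rfl | hs0
      · simp
      have hθc : ContinuousOn θ (ray ω) := Coeff.continuousOn_conf hJc hξ hξr hXw
      have hoc : ContinuousOn (fun t => S.outs (θ t)) (ray ω) :=
        S.contDiffOn_outs.continuousOn.comp hθc hdom
      set G : ℝ → Sig m n := fun t => S.outs (θ (clamp s t)) with hG
      have hGc : Continuous G := hoc.comp_clamp hs
      have hGe : ∀ t ∈ Icc 0 s, G t = S.outs (θ t) := fun t ht => by
        simp only [hG, clamp_of_mem ht]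
      have hTe := hS.op.causal s hs.1 Ξ (S.argMap G) fun t ht => by
        funext i
        rw [hΞ t ht i, argMap_eq_glue hS hM hGc hh0 hs0
          (fun x hx i => by rw [hGe x hx, hgy']; rfl) ht i]
      filter_upwards [hTe, hctrl s hs, hfd s hs G hGc hGe] with t h1 h2 h3
      have e : gy (n + 2) t = yr t := if_neg (lt_irrefl _)
      rw [e, h1, hyr]
      simp only [h2, h3, hM.K_eq, hgy', hM.R_eq]; rfl
  have hzw : ∀ i : Fin (n + 1), ∀ j : Fin (n + 2), HasWeakDerivOn (fun t => S.cascState (θ t) i j)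
      (fun t => S.w i j (S.jet (θ t) i 0) + cascSeq (fun i j t => S.cascState (θ t) i j)
        (fun t => mulV Γt (u t)) t i (j + 1)) ω := fun i j => by
    refine (Coeff.weakDeriv_cascState hdom hderiv hJc hξ hξr hXw i j.2).congr (fun _ _ => rfl)
      fun b hb => ?_
    filter_upwards [hctrl b hb] with t ht
    congr 1
    by_cases hj : (j : ℕ) < n + 1
    · rw [if_pos hj, cascSeq, dif_pos (by omega)]
    · rw [if_neg hj, cascSeq, dif_neg (by omega), ht]
  have hy0 : ∀ t ∈ ray ω, glue y₀ (gy 0) t = S.out (θ t) 0 := fun t ht => by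
    rw [glue_of_nonneg ht.1]; exact hgy' 0 t
  have hdiff : ∀ t ∈ ray ω, (diffs (glue y₀ (gy 0) t) fun i =>
      S.cascState (θ t) i (0 : Fin (n + 2))) = S.err (θ t) 0 := fun t ht => by
    rw [hy0 t ht]; exact S.cascState_zero_sub (θ t)
  refine ⟨glue y₀ (gy 0), fun i j t => S.cascState (θ t) i j,
    hchain.isSolution hτ hω (fun t ht => glue_of_mem_Icc ?_ ht) fun t ht => glue_of_nonneg ht.1,
    ⟨fun i t ht0 htω => ?_, fun i j => ?_, fun i j => ?_⟩, fun t ht => ?_⟩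
  · rw [← hchain.init 0 (by omega), iteratedDerivWithin_zero]
  · have ht : t ∈ ray ω := ⟨ht0, htω⟩
    rw [cascDenom_eq hM.funnel_eq i ht0, hdiff t ht]
    exact (sub_pos.2 (hdom t ht i)).ne'
  · rw [hθ0, hpad i j j.2, padSeq, nth_val]
  · refine (hzw i j).congr_of_eqOn (fun _ _ => rfl) fun t ht => ?_
    rw [cascRhs_eq hM.a_eq hM.p_eq hM.funnel_eq i j ht.1, hdiff t ht]; rfl
  · rw [hzg' t ht]
    show g 0 t = S.cascState (θ t) (Fin.last n) 0
    rw [Coeff.cascState_last, Coeff.lead_zero, sub_zero, ← hnth 0 (by omega)]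

end Sys
end

/-! ### Matrix facts, Taylor polynomials and funnel functions -/

noncomputable section

section Matrices

open scoped MatrixOrder

variable {m : ℕ}

lemma mulV_mul (A B : Matrix (Fin m) (Fin m) ℝ) (x : Vec m) : mulV (A * B) x = mulV A (mulV B x) := by
  rw [mulV, map_mul]; rfl

lemma mulV_one (x : Vec m) : mulV (1 : Matrix (Fin m) (Fin m) ℝ) x = x := by
  rw [mulV, map_one]; rfl

lemma inner_mulV_transpose (A : Matrix (Fin m) (Fin m) ℝ) (x y : Vec m) :
    inner ℝ (mulV A x) y = inner ℝ x (mulV A.transpose y) := by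
  have h : ContinuousLinearMap.adjoint (mulV A) = mulV A.transpose := by
    rw [← ContinuousLinearMap.star_eq_adjoint, mulV, ← map_star, Matrix.star_eq_conjTranspose,
      Matrix.conjTranspose_eq_transpose_of_trivial]
  rw [← h, ContinuousLinearMap.adjoint_inner_right]

lemma SignDefinite.isUnit_det {Γ : Matrix (Fin m) (Fin m) ℝ} (h : SignDefinite Γ) :
    IsUnit Γ.det := by
  rw [← Matrix.isUnit_iff_isUnit_det]
  rcases h with h | h
  · exact h.isUnit
  · simpa using h.isUnit

/-- A factorization of the inverse of a positive definite matrix. -/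
lemma exists_factor {K : Matrix (Fin m) (Fin m) ℝ} (hK : K.PosDef) :
    ∃ (M : Vec m →L[ℝ] Vec m) (ν : ℝ), 0 < ν ∧ (∀ x, ν * ‖x‖ ≤ ‖M x‖) ∧
      ∀ x y, inner ℝ (M x) (M (mulV K y)) = inner ℝ x y := by
  obtain ⟨B, hB⟩ := CStarAlgebra.nonneg_iff_eq_star_mul_self.mp hK.inv.posSemidef.nonneg
  rw [Matrix.star_eq_conjTranspose, Matrix.conjTranspose_eq_transpose_of_trivial] at hB
  have hdet : IsUnit K.det := (Matrix.isUnit_iff_isUnit_det _).1 hK.isUnit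
  have h1 : ∀ x, mulV (K * B.transpose) (mulV B x) = x := fun x => by
    rw [← mulV_mul, Matrix.mul_assoc, ← hB, Matrix.mul_nonsing_inv _ hdet, mulV_one]
  refine ⟨mulV B, (‖mulV (K * B.transpose)‖ + 1)⁻¹, by positivity, fun x => ?_, fun x y => ?_⟩
  · rw [inv_mul_le_iff₀ (by positivity)]
    have h2 := (mulV (K * B.transpose)).le_opNorm (mulV B x)
    rw [h1] at h2
    have := norm_nonneg (mulV B x)
    linarith
  · rw [inner_mulV_transpose, ← mulV_mul, ← mulV_mul, Matrix.mul_assoc, ← Matrix.mul_assoc,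
      ← hB, Matrix.nonsing_inv_mul _ hdet, mulV_one]

/-- The gain vector solves `P p = (κ, 0, …, 0)` with the positive Schur complement `κ`. -/
lemma exists_mulVec_schurGain {r : ℕ} {P : Matrix (Fin r) (Fin r) ℝ} (hP : P.PosDef) (i₀ : Fin r) :
    ∃ κ, 0 < κ ∧ P.mulVec (schurGain P i₀) = Pi.single i₀ κ ∧ 0 < schurGain P i₀ i₀ := by
  set P₂ : {i : Fin r // i ≠ i₀} → ℝ := fun j => P i₀ j with hP₂
  set P₄ : Matrix {i : Fin r // i ≠ i₀} {i : Fin r // i ≠ i₀} ℝ := fun i j => P i j with hP₄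
  set κ := P i₀ i₀ - dotProduct P₂ (P₄⁻¹.mulVec P₂) with hκ
  have hdet : IsUnit P.det := (Matrix.isUnit_iff_isUnit_det _).1 hP.isUnit
  have hP₄p : P₄.PosDef := hP.submatrix Subtype.val_injective
  have hdet₄ : IsUnit P₄.det := (Matrix.isUnit_iff_isUnit_det _).1 hP₄p.isUnit
  have hsymm : ∀ i j, P i j = P j i := fun i j => by simpa using hP.1.apply j i
  have hp : P.mulVec (schurGain P i₀) = Pi.single i₀ κ := by
    rw [schurGain, Matrix.mulVec_mulVec, Matrix.mul_nonsing_inv _ hdet, Matrix.one_mulVec]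
  -- The vector (1, −P₄⁻¹P₂) also solves P x = (κ, 0, …, 0), so xᵀP x = κ, which shows that the
  -- Schur complement κ is positive.
  set x : Fin r → ℝ := fun i => if h : i ≠ i₀ then -(P₄⁻¹.mulVec P₂) ⟨i, h⟩ else 1 with hx
  have hx0 : x i₀ = 1 := dif_neg (by simp)
  have hxs : ∀ i : {i : Fin r // i ≠ i₀}, x i = -(P₄⁻¹.mulVec P₂) i := fun i => dif_pos i.2
  have hPx : P.mulVec x = Pi.single i₀ κ := by
    funext i
    rw [Matrix.mulVec, dotProduct, Fintype.sum_eq_add_sum_subtype_ne _ i₀, hx0]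
    simp only [hxs, mul_one, mul_neg, Finset.sum_neg_distrib]
    by_cases hi : i = i₀
    · subst hi
      rw [Pi.single_eq_same, hκ, sub_eq_add_neg]; rfl
    · rw [Pi.single_eq_of_ne hi]
      have h1 : P₄.mulVec (P₄⁻¹.mulVec P₂) = P₂ := by
        rw [Matrix.mulVec_mulVec, Matrix.mul_nonsing_inv _ hdet₄, Matrix.one_mulVec]
      have h2 := congrFun h1 ⟨i, hi⟩
      rw [Matrix.mulVec, dotProduct] at h2
      rw [show ∑ j : {i : Fin r // i ≠ i₀}, P i j * P₄⁻¹.mulVec P₂ j = P i₀ i from h2, hsymm i i₀]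
      ring
  have hdot : ∀ y : Fin r → ℝ, P.mulVec y = Pi.single i₀ κ → y ≠ 0 → 0 < y i₀ * κ := fun y hy hy0 => by
    have := hP.dotProduct_mulVec_pos hy0
    rw [hy] at this
    simpa using this
  have hκ0 : 0 < κ := by
    have := hdot x hPx fun h => by simp [h] at hx0
    rwa [hx0, one_mul] at this
  refine ⟨κ, hκ0, hp, ?_⟩
  -- pᵀP p equals κ times the first entry of p, so that entry is positive as well.
  have := hdot _ hp fun h => by
    rw [h, Matrix.mulVec_zero] at hp
    have := congrFun hp i₀
    rw [Pi.single_eq_same] at this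
    exact hκ0.ne this
  exact pos_of_mul_pos_left this hκ0.le

end Matrices

section Taylor

variable {V : Type*} [NormedAddCommGroup V] [NormedSpace ℝ V]

/-- The polynomial with the derivatives `x 0, …, x (N-1)` at `0`. -/
def taylorPoly (N : ℕ) (x : ℕ → V) (t : ℝ) : V :=
  ∑ j ∈ Finset.range N, (t ^ j / (j.factorial : ℝ)) • x j

lemma taylorPoly_zero (N : ℕ) (x : ℕ → V) : taylorPoly (N + 1) x 0 = x 0 := by
  rw [taylorPoly, Finset.sum_range_succ']
  simp

lemma hasDerivAt_taylorPoly (N : ℕ) (x : ℕ → V) (t : ℝ) :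
    HasDerivAt (taylorPoly (N + 1) x) (taylorPoly N (fun j => x (j + 1)) t) t := by
  have h : ∀ j ∈ Finset.range N, HasDerivAt (fun t : ℝ => (t ^ (j + 1) / ((j + 1).factorial : ℝ)) • x (j + 1))
      ((t ^ j / (j.factorial : ℝ)) • x (j + 1)) t := fun j _ => by
    have h1 := ((hasDerivAt_pow (j + 1) t).div_const ((j + 1).factorial : ℝ)).smul_const (x (j + 1))
    refine h1.congr_deriv ?_
    congr 1
    rw [Nat.factorial_succ]
    push_cast
    have : (j.factorial : ℝ) ≠ 0 := by positivity
    have : (j : ℝ) + 1 ≠ 0 := by positivity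
    field_simp
  have h2 := (HasDerivAt.fun_sum h).add_const ((t ^ 0 / ((0 : ℕ).factorial : ℝ)) • x 0)
  refine h2.congr_of_eventuallyEq (Filter.Eventually.of_forall fun s => ?_)
  simp only [taylorPoly, Finset.sum_range_succ', pow_zero]

lemma continuous_taylorPoly (N : ℕ) (x : ℕ → V) : Continuous (taylorPoly N x) := by
  unfold taylorPoly; fun_prop

/-- The derivatives of `taylorPoly`. -/
lemma exists_taylor_chain (N : ℕ) (x : ℕ → V) : ∃ f : ℕ → ℝ → V, (∀ k, Continuous (f k)) ∧
    (∀ k < N + 1, ∀ t, HasDerivAt (f k) (f (k + 1) t) t) ∧ ∀ k < N + 1, f k 0 = x k := by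
  refine ⟨fun k => taylorPoly (N + 1 - k) fun j => x (j + k), fun k => continuous_taylorPoly _ _,
    fun k hk t => ?_, fun k hk => ?_⟩
  · have h := hasDerivAt_taylorPoly (N - k) (fun j => x (j + k)) t
    simp only [show N + 1 - k = N - k + 1 by omega, show N + 1 - (k + 1) = N - k by omega]
    have e : (fun j => x (j + (k + 1))) = fun j => x (j + 1 + k) := by
      funext j; congr 1; omega
    rw [e]
    exact h
  · simp only [show N + 1 - k = N - k + 1 by omega, taylorPoly_zero, zero_add]

lemma memWInf_of_chain [CompleteSpace V] {f : ℕ → ℝ → V} (hf : ∀ k, Continuous (f k)) {N : ℕ}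
    (h : ∀ k < N, ∀ t, HasDerivAt (f k) (f (k + 1) t) t) (a b : ℝ) : MemWInf N a b (f 0) := by
  refine ⟨f, fun _ _ => rfl, fun j hj t _ => ?_, fun j _ => ?_⟩
  · rw [intervalIntegral.integral_eq_sub_of_hasDerivAt (fun x _ => h j hj x)
      ((hf (j + 1)).intervalIntegrable _ _)]
    abel
  · obtain ⟨C, hC⟩ := (isCompact_Icc (a := a) (b := b)).exists_bound_of_continuousOn
      (hf j).continuousOn
    refine memLp_top_of_bound (hf j).aestronglyMeasurable C ?_
    filter_upwards [ae_restrict_mem measurableSet_Icc] with t ht using hC t ht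

end Taylor

namespace IsFunnel

variable {r : ℕ} {φ : ℝ → ℝ}

lemma continuousOn (h : IsFunnel r φ) : ContinuousOn φ (Ici 0) := h.contDiff.continuousOn

lemma nonneg (h : IsFunnel r φ) : 0 ≤ φ 0 := by
  have h1 : Filter.Tendsto φ (nhdsWithin 0 (Ioi 0)) (nhds (φ 0)) :=
    ((h.continuousOn 0 self_mem_Ici).mono Ioi_subset_Ici_self).tendsto
  refine ge_of_tendsto h1 ?_
  filter_upwards [self_mem_nhdsWithin] with s hs using (h.pos s hs).le

/-- The limes inferior takes care of large times and compactness of the remaining ones; only the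
time 0, where φ may vanish, is excluded. -/
lemma exists_lower (h : IsFunnel r φ) {δ : ℝ} (hδ : 0 < δ) : ∃ μ > 0, ∀ t ≥ δ, μ ≤ φ t := by
  obtain ⟨ε, hε, hev⟩ := h.liminf_pos
  obtain ⟨N, hN⟩ := Filter.eventually_atTop.1 hev
  obtain ⟨x, hx, hmin⟩ := (isCompact_Icc (a := δ) (b := max δ N)).exists_isMinOn
    ⟨δ, le_rfl, le_max_left _ _⟩ (h.continuousOn.mono fun t ht => hδ.le.trans ht.1)
  refine ⟨min ε (φ x), lt_min hε (h.pos x (hδ.trans_le hx.1)), fun t ht => ?_⟩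
  rcases le_total t N with htN | htN
  · exact (min_le_right _ _).trans (hmin ⟨ht, htN.trans (le_max_right _ _)⟩)
  · exact (min_le_left _ _).trans (hN t htN)

end IsFunnel

/-- The derivatives of a function on `[0,∞)`, continued to `ℝ`. -/
def funnelJet (n : ℕ) (φ : ℝ → ℝ) (t : ℝ) (k : Fin (n + 2)) : ℝ :=
  iteratedDerivWithin k φ (Ici 0) (max t 0)

section FunnelJet

variable {n : ℕ} {φ : ℝ → ℝ} (h : IsFunnel (n + 2) φ)

lemma funnelJet_zero {t : ℝ} (ht : 0 ≤ t) : funnelJet n φ t 0 = φ t := by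
  simp [funnelJet, max_eq_left ht]

include h

lemma continuous_funnelJet : Continuous (funnelJet n φ) := continuous_pi fun k =>
  (h.contDiff.continuousOn_iteratedDerivWithin (by exact_mod_cast k.2.le)
    (uniqueDiffOn_Ici 0)).comp_continuous (by fun_prop) fun _ => mem_Ici.2 (le_max_right _ _)

lemma funnelJet_bdd : ∃ b, ∀ t, ‖funnelJet n φ t‖ ≤ b := by
  choose C hC using fun k : Fin (n + 2) => h.bdd k k.2.le
  refine ⟨∑ k, |C k|, fun t => (pi_norm_le_iff_of_nonneg
    (Finset.sum_nonneg fun _ _ => abs_nonneg _)).2 fun k => ?_⟩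
  refine ((hC k _ (le_max_right t 0)).trans (le_abs_self _)).trans ?_
  exact Finset.single_le_sum (f := fun k => |C k|) (fun _ _ => abs_nonneg _) (Finset.mem_univ k)

lemma hasDerivWithinAt_funnelJet {t : ℝ} (ht : 0 ≤ t) {k : ℕ} (hk : k < n + 1) :
    HasDerivWithinAt (fun x => nth (funnelJet n φ x) k) (nth (funnelJet n φ t) (k + 1)) (Ici 0) t := by
  have h1 := chain_of_contDiffOn (uniqueDiffOn_Ici 0) h.contDiff (show k < n + 2 by omega) ht
  simp only [nth_of_lt _ (show k < n + 2 by omega), nth_of_lt _ (show k + 1 < n + 2 by omega),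
    funnelJet, max_eq_left ht]
  refine h1.congr (fun x hx => ?_) ?_
  · rw [max_eq_left hx]
  · rw [max_eq_left ht]

end FunnelJet
end

/-! ### The interconnection as an instance, and the theorem -/

noncomputable section

/-- The coefficients of the interconnection. -/
def interCoeff {m n : ℕ} (R : Fin (n + 2) → Matrix (Fin m) (Fin m) ℝ)
    (Γ Γt : Matrix (Fin m) (Fin m) ℝ) (a p : Fin (n + 2) → ℝ) (ρ : ℝ) : Coeff m n where
  a := nth a
  p := nth p
  -- φ serves as reference, so the first funnel function is φ₁ = φ/ρ.
  c := Fin.cons ρ⁻¹ fun _ => 1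
  G := mulV (1 - Γ * Γt⁻¹)
  K := mulV (Γ * Γt⁻¹)
  R := nth fun k => mulV (R k)

/-- The derivatives of a function on `[-τ,0]`, continued to `ℝ`. -/
def histJet {m : ℕ} (n : ℕ) (τ : ℝ) (y₀ : ℝ → Vec m) (t : ℝ) : Sig m n := fun i =>
  iteratedDerivWithin i y₀ (Icc (-τ) 0) (max (-τ) (min t 0))

/-- The interconnection of the system with the cascade. -/
def interSys {m n l q : ℕ} (τ : ℝ) (R : Fin (n + 2) → Matrix (Fin m) (Fin m) ℝ)
    (d : ℝ → Vec l) (f : Vec l × Vec q → Vec m) (T : Op τ (n + 2) m q)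
    (Γ : Matrix (Fin m) (Fin m) ℝ) (y₀ : ℝ → Vec m) (a p : Fin (n + 2) → ℝ) (φ : ℝ → ℝ) (ρ : ℝ)
    (Γt : Matrix (Fin m) (Fin m) ℝ) (z₀ : Fin (n + 1) → Fin (n + 2) → Vec m) : Sys m n l q where
  toCoeff := interCoeff R Γ Γt a p ρ
  τ := τ
  d := d
  f := f
  T := T
  J := funnelJet n φ
  hist := histJet n τ y₀
  x₀ := ((interCoeff R Γ Γt a p ρ).confOf (funnelJet n φ 0) (padSeq z₀)
    (nth (histJet n τ y₀ 0))).2.2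

section Hist

variable {m n : ℕ} {τ : ℝ} {y₀ : ℝ → Vec m}

lemma histJet_of_mem {t : ℝ} (ht : t ∈ Icc (-τ) 0) (i : Fin (n + 2)) :
    histJet n τ y₀ t i = iteratedDerivWithin i y₀ (Icc (-τ) 0) t := by
  rw [histJet, min_eq_left ht.2, max_eq_right ht.1]

variable (hτ : 0 < τ) (h : ContDiffOn ℝ (n + 1 : ℕ) y₀ (Icc (-τ) 0))

include hτ

lemma histJet_arg_mem (t : ℝ) : max (-τ) (min t 0) ∈ Icc (-τ) 0 :=
  ⟨le_max_left _ _, max_le (by linarith) (min_le_right _ _)⟩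

include h

lemma continuousOn_hist (i : Fin (n + 2)) :
    ContinuousOn (iteratedDerivWithin i y₀ (Icc (-τ) 0)) (Icc (-τ) 0) :=
  h.continuousOn_iteratedDerivWithin (by exact_mod_cast Nat.lt_succ_iff.1 i.2) (uniqueDiffOn_hist hτ)

lemma continuous_histJet : Continuous (histJet n τ y₀) := continuous_pi fun i =>
  (continuousOn_hist hτ h i).comp_continuous (by fun_prop) fun t => histJet_arg_mem hτ t

lemma histJet_bdd : ∃ b, ∀ t, ‖histJet n τ y₀ t‖ ≤ b := by
  choose C hC using fun i : Fin (n + 2) =>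
    (isCompact_Icc (a := -τ) (b := 0)).exists_bound_of_continuousOn (continuousOn_hist hτ h i)
  refine ⟨∑ k, |C k|, fun t => (pi_norm_le_iff_of_nonneg
    (Finset.sum_nonneg fun _ _ => abs_nonneg _)).2 fun k => ?_⟩
  refine ((hC k _ (histJet_arg_mem hτ t)).trans (le_abs_self _)).trans ?_
  exact Finset.single_le_sum (f := fun k => |C k|) (fun _ _ => abs_nonneg _) (Finset.mem_univ k)

end Hist

section Interconnection

variable {m n l q : ℕ} {τ : ℝ} {R : Fin (n + 2) → Matrix (Fin m) (Fin m) ℝ}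
    {d : ℝ → Vec l} {f : Vec l × Vec q → Vec m} {T : Op τ (n + 2) m q}
    {Γ : Matrix (Fin m) (Fin m) ℝ} {y₀ : ℝ → Vec m} {a p : Fin (n + 2) → ℝ} {φ φ₁ : ℝ → ℝ} {ρ : ℝ}
    {Γt : Matrix (Fin m) (Fin m) ℝ} {z₀ : Fin (n + 1) → Fin (n + 2) → Vec m} {hr : 2 ≤ n + 2}
    (hS : MemSigma hr Γ a p φ φ₁ ρ Γt)

include hS

/-- P and Q come from (A.1), and M from a factorization of K⁻¹. The first bound of (A.4) is n‖G‖ + 1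
< ρ; the right-hand side of the second is at most 1, whence ‖G‖ < 1. -/
lemma MemSigma.stable : ∃ κ ν P Q M, (interCoeff R Γ Γt a p ρ).Stable ρ κ ν P Q M := by
  obtain ⟨P, Q, hP, hQ, hlyap, hp⟩ := hS.lyapunov
  obtain ⟨κ, hκ, hPp, hp0⟩ := exists_mulVec_schurGain hP (0 : Fin (n + 2))
  have hp' : p = schurGain P 0 := hp
  rw [← hp'] at hPp hp0
  obtain ⟨M, ν, hν, hM, hMK⟩ := exists_factor hS.product
  have ha : (fun j : Fin (n + 2) => (interCoeff R Γ Γt a p ρ).a j) = a := funext fun j => nth_val a j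
  have hpp : (fun j : Fin (n + 2) => (interCoeff R Γ Γt a p ρ).p j) = p := funext fun j => nth_val p j
  have hρ := hS.rho
  refine ⟨κ, ν, P, Q, M, hρ, rfl, fun _ => rfl, hP, hQ, by rw [ha]; exact hlyap, hκ,
    by rw [hpp]; exact hPp, ?_, fun x => ?_, hMK, hν, hM, ?_, ?_⟩
  · show 0 < nth p 0
    rwa [nth_of_lt _ (show 0 < n + 2 by omega)]
  · show mulV (Γ * Γt⁻¹) x + mulV (1 - Γ * Γt⁻¹) x = x
    rw [show mulV (1 - Γ * Γt⁻¹) = mulV 1 - mulV (Γ * Γt⁻¹) from map_sub _ _ _,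
      _root_.sub_apply, mulV_one]
    abel
  · refine hS.small₂.trans_le ?_
    have h1 : (1 : ℝ) ≤ (ρ + 1) ^ (n + 2 - 2) := one_le_pow₀ (by linarith)
    have h2 : 4 * ρ ^ 2 ≤ 4 * ρ ^ 2 * (ρ + 1) ^ (n + 2 - 2) := le_mul_of_one_le_right (by positivity) h1
    have h3 : ρ ≤ 4 * ρ ^ 2 * (ρ + 1) ^ (n + 2 - 2) - 1 := by nlinarith
    exact (div_le_one (by linarith)).2 h3
  · have h := hS.small₁
    push_cast at h
    show (n : ℝ) * ‖mulV (1 - Γ * Γt⁻¹)‖ + 1 < ρ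
    rw [add_sub_cancel_right] at h
    linarith

lemma MemSigma.cascFunnel_eq (i : Fin (n + 1)) {t : ℝ} (ht : 0 ≤ t) :
    (interCoeff R Γ Γt a p ρ).c i * φ t = cascFunnel (r := n + 2) φ φ₁ i t := by
  refine Fin.cases ?_ (fun i => ?_) i
  · show ρ⁻¹ * φ t = φ₁ t
    rw [hS.funnel_eq t ht, inv_mul_cancel_left₀ (by linarith [hS.rho])]
  · exact one_mul _

lemma MemSigma.funnel_interSys :
    (interSys τ R d f T Γ y₀ a p φ ρ Γt z₀).Funnel := by
  refine ⟨fun δ hδ => ?_, fun t ht => ?_⟩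
  · obtain ⟨μ, hμ, h⟩ := hS.funnel.exists_lower hδ
    refine ⟨μ, hμ, fun t ht => ?_⟩
    show μ ≤ funnelJet n φ t 0
    rw [funnelJet_zero (hδ.le.trans ht)]
    exact h t ht
  · have := (hasDerivWithinAt_funnelJet hS.funnel ht.le (show 0 < n + 1 by omega)).hasDerivAt
      (Ici_mem_nhds ht)
    simpa only [nth_of_lt _ (show 0 < n + 2 by omega), nth_of_lt _ (show 0 + 1 < n + 2 by omega)]
      using! this

variable (hN : MemNk 1 τ d f T Γ) (hf : LocLipSnd f)
  (hinit₁ : φ₁ 0 * ‖y₀ 0 - z₀ 0 0‖ < 1)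
  (hinit : ∀ i : Fin n, φ 0 * ‖z₀ i.castSucc 0 - z₀ i.succ 0‖ < 1)
  (hy₀ : ContDiffOn ℝ (n + 1 : ℕ) y₀ (Icc (-τ) 0))

include hN hf hinit₁ hinit hy₀

lemma MemSigma.regular : (interSys τ R d f T Γ y₀ a p φ ρ Γt z₀).Regular := by
  have hτ := hN.op.pos
  obtain ⟨κ, ν, P, Q, M, hst⟩ := hS.stable (R := R)
  refine ⟨hN.op, hN.first, hN.d_bdd, hN.f_cont, hf, continuous_funnelJet hS.funnel,
    funnelJet_bdd hS.funnel, continuous_histJet hτ hy₀, histJet_bdd hτ hy₀, fun ξ i => ?_⟩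
  have h1 : (interCoeff R Γ Γt a p ρ).jet ((interSys τ R d f T Γ y₀ a p φ ρ Γt z₀).initConf z₀) i 0
      ∈ gainDom m ((interCoeff R Γ Γt a p ρ).c i) := by
    have e : (interCoeff R Γ Γt a p ρ).jet ((interSys τ R d f T Γ y₀ a p φ ρ Γt z₀).initConf z₀) i 0
        = (φ 0, diffs (y₀ 0) (fun i => z₀ i 0) i) := by
      rw [Coeff.jet]
      refine Prod.ext ?_ ?_
      · show nth (funnelJet n φ 0) 0 = φ 0
        rw [nth_of_lt _ (show 0 < n + 2 by omega)]
        exact funnelJet_zero le_rfl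
      · show (interCoeff R Γ Γt a p ρ).err ((interCoeff R Γ Γt a p ρ).confOf (funnelJet n φ 0)
          (padSeq z₀) (nth (histJet n τ y₀ 0))) 0 i = _
        rw [Coeff.err_confOf hst.K_add_G (by omega), Coeff.cascErrs_zero,
          nth_of_lt _ (show 0 < n + 2 by omega), histJet_of_mem ⟨by linarith, le_rfl⟩]
        simp only [iteratedDerivWithin_zero, padSeq, nth_of_lt _ (show 0 < n + 2 by omega)]
        rfl
    have hsq : ∀ {x : ℝ} {v : Vec m}, 0 ≤ x → x * ‖v‖ < 1 → x ^ 2 * ‖v‖ ^ 2 < 1 := fun hx hv => by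
      rw [← mul_pow]
      exact pow_lt_one₀ (mul_nonneg hx (norm_nonneg _)) hv two_ne_zero
    rw [e, gainDom, mem_ofPred_eq]
    simp only [hS.cascFunnel_eq i le_rfl]
    refine Fin.cases ?_ (fun i => ?_) i
    · exact hsq hS.funnel₁.nonneg hinit₁
    · exact hsq hS.funnel.nonneg (hinit i)
  rw [Coeff.jet, Coeff.err_eq_errs] at h1 ⊢
  exact h1

omit hf hinit₁ hinit in
-- T̃ looks at its argument on [0, ∞) only. So any smooth ζ⁰ with the right derivatives at 0 serves,
-- and a Taylor polynomial is chosen.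
lemma MemSigma.exists_model : ∃ ζ₀, MemWInf (n + 1) (-τ) 0 ζ₀ ∧
    (interSys τ R d f T Γ y₀ a p φ ρ Γt z₀).Models R Γ Γt a p φ φ₁ y₀ ζ₀ z₀ := by
  have hτ := hN.op.pos
  set S := interSys τ R d f T Γ y₀ a p φ ρ Γt z₀ with hSdef
  obtain ⟨κ, ν, P, Q, M, hst⟩ := hS.stable (R := R)
  obtain ⟨g, hgc, hgd, hg0⟩ := exists_taylor_chain (n + 1) (nth (S.initConf z₀).2.1)
  have hgw : ∀ k < n + 1, ∀ t ∈ Icc (-τ) 0, HasDerivWithinAt (g k) (g (k + 1) t) (Icc (-τ) 0) t :=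
    fun k hk t _ => (hgd k (by omega) t).hasDerivWithinAt
  have hU := uniqueDiffOn_hist hτ
  refine ⟨g 0, memWInf_of_chain hgc (fun k hk => hgd k (by omega)) _ _, ?_⟩
  exact
    { R_eq := fun k => nth_val (fun k => mulV (R k)) k
      K_eq := fun x => by
        show mulV (Γ * Γt⁻¹) (mulV Γt x) = mulV Γ x
        rw [← mulV_mul, Matrix.mul_assoc, Matrix.nonsing_inv_mul _ hS.gain.isUnit_det,
          Matrix.mul_one]
      K_add_G := hst.K_add_G
      a_eq := fun j => nth_val a j
      p_eq := fun j => nth_val p j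
      funnel_eq := fun i t ht => by
        rw [nth_of_lt _ (show 0 < n + 2 by omega)]
        show (interCoeff R Γ Γt a p ρ).c i * funnelJet n φ t 0 = _
        rw [funnelJet_zero ht, hS.cascFunnel_eq i ht]
      deriv := fun t ht k hk => hasDerivWithinAt_funnelJet hS.funnel ht hk
      contDiff := hy₀
      hist_eq := fun t ht i => histJet_of_mem ht i
      x₀_eq := rfl
      contDiff' := contDiffOn_of_chain hU hgw (hgc _).continuousOn
      init_eq := fun i => by
        rw [show S.τ = τ from rfl, iteratedDerivWithin_of_chain hU hgw (by omega)
          ⟨by linarith, le_rfl⟩, hg0 i (by omega), nth_val] }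

/-- The lead takes values in ℝᵐ; padding by zeros embeds it into any ℝ^Q with Q ≥ m, and F̃ is the
projection onto the first m coordinates. -/
theorem MemSigma.exists_equivalent {Q : ℕ} (hQ : m ≤ Q) :
    ∃ (dt : ℝ → Vec (n + 2)) (Ft : Vec (n + 2) × Vec Q → Vec m) (Tt : Op τ (n + 2) m Q)
      (ζ₀ : ℝ → Vec m), MemN τ dt Ft Tt Γt ∧ MemWInf (n + 1) (-τ) 0 ζ₀ ∧
      ∀ (u : ℝ → Vec m) (ω : EReal), 0 < ω → ∀ z : ℝ → Vec m,
        (∃ (y : ℝ → Vec m) (Z : Fin (n + 1) → Fin (n + 2) → ℝ → Vec m),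
          IsSolution τ R d f T Γ y₀ u ω y ∧ IsCascade (r := n + 2) a p φ φ₁ Γt z₀ u y ω Z ∧
          ∀ t ∈ ray ω, z t = Z (Fin.last n) 0 t) ↔
        IsSolution τ 0 dt Ft Tt Γt ζ₀ u ω (glue ζ₀ z) := by
  have hreg := hS.regular (R := R) hN hf hinit₁ hinit hy₀
  obtain ⟨ζ₀, hζ, hmod⟩ := hS.exists_model (R := R) hN hy₀
  obtain ⟨κ, ν, P, Q', M, hst⟩ := hS.stable (R := R)
  have hA := Sys.apriori hreg hst hS.funnel_interSys
  set ι : Vec m →L[ℝ] Vec Q := LinearMap.toContinuousLinearMap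
    { toFun := fun x => WithLp.toLp 2 fun k : Fin Q => nth x k
      map_add' := fun x y => by
        ext k
        by_cases hk : (k : ℕ) < m <;> simp [nth, hk]
      map_smul' := fun c x => by
        ext k
        by_cases hk : (k : ℕ) < m <;> simp [nth, hk] } with hι
  set Ft : Vec (n + 2) × Vec Q → Vec m := fun v => WithLp.toLp 2 fun k : Fin m =>
    v.2 ⟨k, k.2.trans_le hQ⟩ with hFt
  have hF : ∀ δ x, Ft (δ, ι x) = x := fun δ x => by
    ext k
    exact nth_val x k
  have hFc : Continuous Ft := by
    refine (PiLp.continuous_toLp 2 _).comp (continuous_pi fun k => ?_)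
    fun_prop
  refine ⟨0, Ft, _, ζ₀, ⟨MemLp.zero, hFc, Sys.opClass_innerOp hreg hA ι, hS.gain⟩, hζ,
    fun u ω hω z => ⟨fun ⟨y, Z, h1, h2, h3⟩ => ?_, fun h => ?_⟩⟩
  · exact Sys.isSolution_of_interconnection hreg hA hmod hF hω h1 h2 h3
  · exact Sys.interconnection_of_isSolution hreg hA hmod hF hω h

end Interconnection

lemma opClass_zero {r m q : ℕ} {σ : ℝ} (hσ : 0 < σ) : OpClass σ (0 : Op σ r m q) := by
  refine ⟨hσ, fun ξ b => MemLp.zero, fun c hc => ⟨c, hc, fun ξ _ => ?_⟩, fun t _ ζ ξ _ => ?_,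
    fun t hσt _ ξ => ⟨1, one_pos, 1, one_pos, 1, one_pos, fun ζ₁ ζ₂ _ _ M hM => ?_⟩⟩
  · exact Filter.Eventually.of_forall fun t => by simpa using hc.le
  · exact Filter.Eventually.of_forall fun t => rfl
  · have hM0 : 0 ≤ M := (norm_nonneg _).trans (hM ⟨t, hσt⟩ ⟨le_rfl, by simp⟩)
    exact Filter.Eventually.of_forall fun t => by simpa using hM0
end
theorem theorem1 {m r l q : ℕ} (hm : 0 < m) (hr : 2 ≤ r) (τ : ℝ)
    -- the system, of class `𝒩^{m,r}_1`, and its initial trajectory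
    (R : Fin r → Matrix (Fin m) (Fin m) ℝ) (d : ℝ → Vec l) (f : Vec l × Vec q → Vec m)
    (T : Op τ r m q) (Γ : Matrix (Fin m) (Fin m) ℝ)
    (hN : MemNk 1 τ d f T Γ) (hf : LocLipSnd f)
    (y₀ : ℝ → Vec m) (hy₀ : MemWInf (r - 1) (-τ) 0 y₀)
    -- the cascade, its parameters and its initial values
    (a p : Fin r → ℝ) (φ φ₁ : ℝ → ℝ) (ρ : ℝ) (Γt : Matrix (Fin m) (Fin m) ℝ)
    (hS : MemSigma hr Γ a p φ φ₁ ρ Γt)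
    (z₀ : Fin (r - 1) → Fin r → Vec m)
    (hinit₁ : φ₁ 0 * ‖y₀ 0 - z₀ ⟨0, by omega⟩ ⟨0, by omega⟩‖ < 1)
    (hinit : ∀ (i : ℕ) (hi : i + 1 < r - 1),
      φ 0 * ‖z₀ ⟨i, by omega⟩ ⟨0, by omega⟩ - z₀ ⟨i + 1, hi⟩ ⟨0, by omega⟩‖ < 1) :
    ∃ (dt : ℝ → Vec r) (Ft : Vec r × Vec (r * m * (r - 1) + r) → Vec m)
      (Tt : Op τ r m (r * m * (r - 1) + r)) (ζ₀ : ℝ → Vec m),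
      MemN τ dt Ft Tt Γt ∧ MemWInf (r - 1) (-τ) 0 ζ₀ ∧
      ∀ u : ℝ → Vec m, MemLinfLoc u → ∀ ω : EReal, 0 < ω → ∀ z : ℝ → Vec m,
        -- `z` is the output `z_{r-1,1}` on `[0,ω)` of the interconnection with input `u`
        (∃ (y : ℝ → Vec m) (Z : Fin (r - 1) → Fin r → ℝ → Vec m),
          IsSolution τ R d f T Γ y₀ u ω y ∧ IsCascade a p φ φ₁ Γt z₀ u y ω Z ∧
          ∀ t : ℝ, 0 ≤ t → (t : EReal) < ω → z t = Z ⟨r - 2, by omega⟩ ⟨0, by omega⟩ t)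
        ↔ -- `z` solves the new system with input `u` and initial trajectory `ζ₀`
        IsSolution τ 0 dt Ft Tt Γt ζ₀ u ω (glue ζ₀ z) := by
  obtain ⟨n, rfl⟩ : ∃ n, r = n + 2 := ⟨r - 2, by omega⟩
  have hτ := hN.op.pos
  -- W^{r−1,∞} leaves the derivative of order r − 1 merely essentially bounded, while a solution is
  -- C^{r−1} on its whole interval. If y⁰ is not that smooth, ζ⁰ = y⁰ makes both sides of the
  -- equivalence false.
  by_cases hcd : ContDiffOn ℝ (n + 1 : ℕ) y₀ (Icc (-τ) 0)
  · have hQ : m ≤ (n + 2) * m * (n + 2 - 1) + (n + 2) := by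
      rw [show n + 2 - 1 = n + 1 from rfl]
      nlinarith [Nat.zero_le (n * m), Nat.zero_le (n * n * m)]
    obtain ⟨dt, Ft, Tt, ζ₀, h1, h2, h3⟩ := hS.exists_equivalent (R := R) hN hf hinit₁
      (fun i => hinit i (Nat.succ_lt_succ i.2)) hcd hQ
    refine ⟨dt, Ft, Tt, ζ₀, h1, h2, fun u _ ω hω z => Iff.trans ?_ (h3 u ω hω z)⟩
    exact ⟨fun ⟨y, Z, hy, hZ, hz⟩ => ⟨y, Z, hy, hZ, fun t ht => hz t ht.1 ht.2⟩,
      fun ⟨y, Z, hy, hZ, hz⟩ => ⟨y, Z, hy, hZ, fun t h0 ht => hz t ⟨h0, ht⟩⟩⟩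
  · -- There are no solutions with this initial trajectory.
    refine ⟨0, 0, 0, y₀, ⟨MemLp.zero, continuous_const, opClass_zero hτ, hS.gain⟩, hy₀,
      fun u _ ω hω z => ⟨fun ⟨y, Z, hy, _, _⟩ => ?_, fun h => ?_⟩⟩
    · obtain ⟨g, -, hg⟩ := hy.exists_chain hτ hω
      exact absurd hg.contDiff hcd
    · obtain ⟨g, -, hg⟩ := h.exists_chain hτ hω
      exact absurd hg.contDiff hcd
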